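/- **Setting.** Let $c,q>0$. Put $\theta(z)=i\ln\frac{ic+z}{ic-z}$, $K(z)=\theta'(z)=\frac{2c}{z^2+c^2}$, and for functions $u$ write $\frac{K}{2\pi}u(\lambda)=\int_{-q}^{q}K(\lambda-\tau)u(\tau)\frac{d\tau}{2\pi}$. Let $Z$, $\phi(\cdot,\mu)$, $R(\cdot,\mu)$ be the solutions of $(I-\frac{K}{2\pi})Z=1$, $(I-\frac{K}{2\pi})\phi(\cdot,\mu)=\frac{1}{2\pi}\theta(\cdot-\mu)$, $(I-\frac{K}{2\pi})R(\cdot,\mu)=K(\cdot-\mu)$ (so $(I-\frac{K}{2\pi})(I+\frac{R}{2\pi})=I$), and let $p$ solve $p(\lambda)-\int_{-q}^{q}\theta(\lambda-\mu)p'(\mu)\frac{d\mu}{2\pi}=\lambda$. Set $D=p(q)/\pi$ and $\xi=\frac{p}{2\pi}+\frac D2$. Let $0<\delta<c/8$ and $U_\delta=\{|\Im z|<2\delta\}$ be such that $p$ is injective on $U_\delta$ and $\inf_{U_\delta}\Re Z>0$. "Holomorphic on $S$" means holomorphic in a neighbourhood of $S$; $\|f\|_S=\sup_S|f|$; $\overline{\mathcal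 D}_{0,r}=\{|\gamma|\le r\}$. Let $M\subset U_\delta$ be a compact set without holes whose boundary is a $C^1$ Jordan curve $\mathfrak z:[0,1]\to\partial M$, counterclockwise, let $K_0$ be compact with $[-q,q]\subset\mathrm{Int}\,K_0$ and $K_0\subset\mathrm{Int}\,M$, and let $\mathscr C_q\subset\mathrm{Int}\,K_0$ be a counterclockwise $C^1$ Jordan curve enclosing $[-q,q]$. Let $h$ be holomorphic on $M$, and $W_z\subset\mathbb C^{\ell}$ compact. Let $\mathcal F[\cdot](\boldsymbol z)$, $\boldsymbol z\in W_z$, be a regular functional acting on functions holomorphic in $\mathrm{Int}\,M$: there are $C_{\mathcal F},C'>0$ such that * $\|f\|_{K_0}+\|g\|_{K_0}<C_{\mathcal F}$ implies $\|\mathcal F[f]-\mathcal F[g]\|_{W_z}\le C'\|f-g\|_{K_0}$; * for every open $W_y\ni0$ in some $\mathbb C^m$ and every $\nu(\lambda,\boldsymbol y)$ holomorphic on $\mathrm{Int}\,M\times W_y$ with $\|\nu\|_{K_0\times W_y}<C_{\mathcal F}$, the function $(\boldsymbol y,\boldsymbol z)\mapsto\mathcal F[\nu(*,\boldsymbol y)](\boldsymbol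 z)$ is holomorphic on $W_y\times W_z$. Given $L>0$, $N\in\mathbb N$, and $J=\{1,\dots,N\}\setminus I$ with $|I|\le n$, put $\xi_\nu=\xi+\nu/L$ and $$\Gamma^{(L)}[\nu](\mu)=\sum_{j\in J}\big(\phi(\mu,\mu_j)-\phi(\mu,\lambda_j)\big),$$ where $\mu_j$, $\lambda_j$ are the roots of $\xi(\mu_j)=j/L$, $\xi_\nu(\lambda_j)=j/L$ enclosed by $\mathscr C_q$. For $s\ge1$ let $t_p=\mathfrak z(x_p)$, where $0=x_0\le x_1<\dots<x_s\le x_{s+1}=1$ and $|x_{j+1}-x_j|\le 2/s$ (the points may depend on $s$), let $$f_s(\lambda\mid\{\varsigma_p\})=\sum_{p=1}^{s}\frac{t_{p+1}-t_p}{2i\pi(t_p-\lambda)}\big(\varsigma_p+h(t_p)\big),$$ and let $\mathcal L_{\Gamma^{(L)}}(\gamma,\boldsymbol z)$ be the $s\to\infty$ limit of the Lagrange series $$\sum_{n_1,\dots,n_s\ge0}\ \prod_{r=1}^s\frac{1}{n_r!}\frac{\partial^{n_r}}{\partial\varsigma_r^{n_r}}\Big\{\prod_{r=1}^s\big(\Gamma^{(L)}[\gamma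 f_s](t_r)\big)^{n_r}\,\mathcal F[\gamma f_s](\boldsymbol z)\Big\}\Big|_{\varsigma=0}.$$ A functional derivative of $\Gamma^{(L)}$ at $\nu=\tau$ is a kernel $\frac{\delta\Gamma^{(L)}}{\delta\nu(\zeta)}[\nu](\mu)\big|_{\nu=\tau}$, holomorphic in $(\mu,\zeta)\in M\times\mathcal V$ for some neighbourhood $\mathcal V$ of $\mathscr C_q$, such that, uniformly in $\mu\in M$, for $\rho$ holomorphic in $\mathrm{Int}\,M$, $$\Gamma^{(L)}[\rho](\mu)-\Gamma^{(L)}[\tau](\mu)=\oint_{\mathscr C_q}(\rho-\tau)(\zeta)\,\frac{\delta\Gamma^{(L)}}{\delta\nu(\zeta)}[\nu](\mu)\Big|_{\nu=\tau}d\zeta+o(\|\rho-\tau\|_{K_0}).$$ Determinants are Fredholm determinants, $\det_{\mathscr C}[I+k]=\sum_{m\ge0}\frac1{m!}\int_{\mathscr C^m}\det[k(\zeta_a,\zeta_b)]\,d^m\zeta$. **Proposition.** Fix $n\in\mathbb N$ and $B>0$. There exist $\gamma_0,\eta,L_0>0$ and $C\in\mathbb R$, independent of $L,N,I$, such that for every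 $\gamma\in\overline{\mathcal D}_{0,\gamma_0}$ the equation $(I+\frac{\gamma R}{2\pi})\rho=h$ (with $R$ acting on $[-q,q]$) has a unique continuous solution $\rho$ on $M$, it is holomorphic in $(\gamma,\lambda)\in\overline{\mathcal D}_{0,\gamma_0}\times M$, and, for all real $L\ge L_0$, all $N$ with $|N/L-D|\le\eta$ and all $I\subset\{1,\dots,N\}$ with $|I|\le n$, setting $\epsilon_L=\frac1L+\big|\frac NL-D\big|$: 1. For every $\nu$ holomorphic in $\mathrm{Int}\,M$ with $\|\nu\|_{K_0}\le B$, the root $\lambda_j$ exists and is unique for each $1\le j\le N$ (in particular $\mu_j$, the case $\nu=0$), and the functional derivative of $\Gamma^{(L)}$ at $\nu$ is $$\frac{\delta\Gamma^{(L)}}{\delta\nu(\zeta)}[\nu](\mu)=\frac{(\partial_\zeta\phi)(\mu,\zeta)}{2i\pi L}\sum_{j\in J}\frac{1}{\xi_\nu(\zeta)-j/L}.$$ 2. For $|\gamma|\le\gamma_0$ the equation $\rho^{(L)}(\lambda)=h(\lambda)+\Gamma^{(L)}[\gamma\rho^{(L)}](\lambda)$, $\lambda\in M$, has a unique solution $\rho^{(L)}$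 holomorphic on $M$ with $\|\gamma\rho^{(L)}\|_{K_0}\le B$; it is holomorphic in $(\gamma,\lambda)\in\overline{\mathcal D}_{0,\gamma_0}\times M$. 3. $\rho^{(L)}=\rho+E$ on $\overline{\mathcal D}_{0,\gamma_0}\times M$, where $E(\gamma,\lambda)$ is holomorphic on $\overline{\mathcal D}_{0,\gamma_0}\times U_\delta$ and $|E|\le C\epsilon_L$ there. 4. For $|\gamma|\le\gamma_0$ the determinant below does not vanish, and $$\det{}_{\mathscr C_q}\Big[I-\gamma\frac{\delta\Gamma^{(L)}[\nu]}{\delta\nu(\zeta)}(\mu)\Big]_{\nu=\gamma\rho^{(L)}}=\det{}_{[-q,q]}\Big[I+\frac{\gamma R}{2\pi}\Big]\,(1+e),\qquad|e|\le C\epsilon_L .$$ 5. For any choice of the discretization points, the Lagrange series converges absolutely for $s$ large, uniformly chosen in $(\gamma,\boldsymbol z)\in\overline{\mathcal D}_{0,\gamma_0}\times W_z$, its $s\to\infty$ limit exists uniformly on this set, and $$\mathcal L_{\Gamma^{(L)}}(\gamma,\boldsymbol z)=\frac{\mathcal F[\gamma\rho^{(L)}](\boldsymbol z)}{\det_{\mathscr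 C_q}\Big[I-\gamma\frac{\delta\Gamma^{(L)}[\nu]}{\delta\nu(\zeta)}(\mu)\Big]_{\nu=\gamma\rho^{(L)}}}.$$ In particular, when $N/L=D+O(1/L)$ one has $\epsilon_L=O(1/L)$, so the errors in 3 and 4 are $O(1/L)$. -/

import Mathlib

open Set Filter Topology MeasureTheory

noncomputable section

namespace LiebLiniger

/-- The bare phase `θ(z) = i log ((ic + z) / (ic - z))`. -/
def barePhase (c : ℝ) (z : ℂ) : ℂ :=
  Complex.I * Complex.log ((Complex.I * c + z) / (Complex.I * c - z))

/-- The Lieb kernel `K = θ'`, that is `K(z) = 2c / (z ^ 2 + c ^ 2)`. -/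
def liebKernel (c : ℝ) (z : ℂ) : ℂ := 2 * c / (z ^ 2 + c ^ 2)

/-- The integral operator `K / 2π` on `[-q, q]`. -/
def liebOp (c q : ℝ) (g : ℂ → ℂ) (z : ℂ) : ℂ :=
  (∫ t in (-q)..q, liebKernel c (z - t) * g t) / (2 * Real.pi)

/-- The solution `u` of `u - (K / 2π) u = g` on `[-q, q]`, as the Neumann series of `g`
(which converges for all `c, q > 0`; the equation is `dress_eq` below). -/
def dress (c q : ℝ) (g : ℂ → ℂ) (z : ℂ) : ℂ := ∑' n : ℕ, ((liebOp c q)^[n] g) z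

/-- The dressed charge: `Z - (K / 2π) Z = 1`. -/
def dressedCharge (c q : ℝ) (z : ℂ) : ℂ := dress c q (fun _ => 1) z

/-- The dressed phase: `φ(·, w) - (K / 2π) φ(·, w) = θ(· - w) / 2π`. -/
def dressedPhase (c q : ℝ) (z w : ℂ) : ℂ :=
  dress c q (fun v => barePhase c (v - w) / (2 * Real.pi)) z

/-- The resolvent `R` of the Lieb kernel, `(I - K / 2π) (I + R / 2π) = I`, that is
`R(·, w) - (K / 2π) R(·, w) = K(· - w)`. -/
def resolventKernel (c q : ℝ) (z w : ℂ) : ℂ := dress c q (fun v => liebKernel c (v - w)) z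

/-- The dressed momentum: the solution of `p(z) - ∫ θ(z - t) p'(t) dt / 2π = z` (integral over
`[-q, q]`), whose derivative is the dressed charge; see `dressedMomentum_eq`. -/
def dressedMomentum (c q : ℝ) (z : ℂ) : ℂ :=
  z + (∫ t in (-q)..q, barePhase c (z - t) * dressedCharge c q t) / (2 * Real.pi)

lemma factor_ne {c : ℝ} {z : ℂ} (hz : |z.im| < c) :
    Complex.I * c + z ≠ 0 ∧ Complex.I * c - z ≠ 0 := by
  have h := abs_lt.1 hz
  constructor <;> intro h0 <;> have := congrArg Complex.im h0 <;> simp at this <;> linarith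

lemma sq_add_sq_ne {c : ℝ} {z : ℂ} (hz : |z.im| < c) : z ^ 2 + (c : ℂ) ^ 2 ≠ 0 := by
  have h := factor_ne hz
  have : z ^ 2 + (c : ℂ) ^ 2 = -((Complex.I * c + z) * (Complex.I * c - z)) := by
    ring_nf; simp
  rw [this]
  exact neg_ne_zero.2 (mul_ne_zero h.1 h.2)

lemma barePhase_slit {c : ℝ} {z : ℂ} (hz : |z.im| < c) :
    (Complex.I * c + z) / (Complex.I * c - z) ∈ Complex.slitPlane := by
  have hf := factor_ne hz
  have h := abs_lt.1 hz
  rw [Complex.mem_slitPlane_iff]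
  by_contra hcon
  push Not at hcon
  obtain ⟨h1, h2⟩ := hcon
  set w := (Complex.I * c + z) / (Complex.I * c - z) with hw
  have hwr : w = (w.re : ℂ) := by apply Complex.ext <;> simp [h2]
  have e : Complex.I * c + z = w.re * (Complex.I * c - z) := by
    rw [← hwr, hw, div_mul_cancel₀ _ hf.2]
  have e2 := congrArg Complex.im e
  simp at e2
  nlinarith

/-- On the strip `|Im z| < c` the bare phase is a primitive of the Lieb kernel. -/
theorem hasDerivAt_barePhase {c : ℝ} {z : ℂ} (hz : |z.im| < c) :
    HasDerivAt (barePhase c) (liebKernel c z) z := by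
  have hf := factor_ne hz
  have h1 : HasDerivAt (fun z : ℂ => (Complex.I * c + z) / (Complex.I * c - z))
      ((1 * (Complex.I * c - z) - (Complex.I * c + z) * (-1)) / (Complex.I * c - z) ^ 2) z :=
    ((hasDerivAt_id z).const_add _).div ((hasDerivAt_id z).const_sub _) hf.2
  have h2 := (h1.clog (barePhase_slit hz)).const_mul Complex.I
  refine h2.congr_deriv ?_
  unfold liebKernel
  have := sq_add_sq_ne hz
  have a := hf.1
  have b := hf.2
  field_simp
  ring_nf
  simp
  ring

lemma norm_liebKernel_le {c : ℝ} (hc : 0 < c) (x : ℝ) : ‖liebKernel c x‖ ≤ 2 / c := by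
  have : liebKernel c x = ((2 * c / (x ^ 2 + c ^ 2) : ℝ) : ℂ) := by
    unfold liebKernel; push_cast; ring
  rw [this, Complex.norm_real, Real.norm_of_nonneg (by positivity), div_le_div_iff₀ (by positivity) hc]
  nlinarith [sq_nonneg x]

lemma continuous_liebKernel_sub {c : ℝ} {z : ℂ} (hz : |z.im| < c) :
    Continuous fun t : ℝ => liebKernel c (z - t) := by
  unfold liebKernel
  refine Continuous.div (by fun_prop) (by fun_prop) fun t => sq_add_sq_ne (by simpa using hz)

lemma continuous_liebKernel_sub' {c : ℝ} {z : ℂ} (hz : |z.im| < c) :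
    Continuous fun t : ℝ => liebKernel c (t - z) := by
  unfold liebKernel
  refine Continuous.div (by fun_prop) (by fun_prop) fun t => sq_add_sq_ne (by simpa using hz)

lemma continuous_barePhase_sub' {c : ℝ} {z : ℂ} (hz : |z.im| < c) :
    Continuous fun t : ℝ => barePhase c (t - z) := by
  refine continuous_iff_continuousAt.2 fun t => ?_
  have h : ContinuousAt (barePhase c) ((t : ℂ) - z) :=
    (hasDerivAt_barePhase (c := c) (z := t - z) (by simpa using hz)).continuousAt
  exact ContinuousAt.comp (f := fun t : ℝ => (t : ℂ) - z) h (by fun_prop)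

lemma continuous_barePhase_sub {c : ℝ} {z : ℂ} (hz : |z.im| < c) :
    Continuous fun t : ℝ => barePhase c (z - t) := by
  refine continuous_iff_continuousAt.2 fun t => ?_
  have h : ContinuousAt (barePhase c) (z - (t : ℂ)) :=
    (hasDerivAt_barePhase (c := c) (z := z - t) (by simpa using hz)).continuousAt
  exact ContinuousAt.comp (f := fun t : ℝ => z - (t : ℂ)) h (by fun_prop)

/-- The norm of the operator `K / 2π` on continuous functions on `[-q, q]` is below one. -/
lemma exists_contraction {c q : ℝ} (hc : 0 < c) (hq : 0 < q) :
    ∃ k : ℝ, 0 ≤ k ∧ k < 1 ∧ ∀ x ∈ Icc (-q) q,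
      (∫ t in (-q)..q, ‖liebKernel c ((x : ℂ) - t)‖) / (2 * Real.pi) ≤ k := by
  refine ⟨2 / Real.pi * Real.arctan (2 * q / c), ?_, ?_, fun x hx => ?_⟩
  · have : 0 ≤ Real.arctan (2 * q / c) := Real.arctan_nonneg.2 (by positivity)
    have := Real.pi_pos
    positivity
  · have := Real.arctan_lt_pi_div_two (2 * q / c)
    have hp := Real.pi_pos
    rw [div_mul_eq_mul_div, div_lt_one hp]
    linarith
  · have e : ∀ t : ℝ, ‖liebKernel c ((x : ℂ) - t)‖ = 2 * c / ((x - t) ^ 2 + c ^ 2) := by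
      intro t
      have : liebKernel c ((x : ℂ) - t) = ((2 * c / ((x - t) ^ 2 + c ^ 2) : ℝ) : ℂ) := by
        unfold liebKernel; push_cast; ring
      rw [this, Complex.norm_real, Real.norm_of_nonneg (by positivity)]
    simp_rw [e]
    have hd : ∀ t ∈ uIcc (-q) q, HasDerivAt (fun t : ℝ => 2 * Real.arctan ((t - x) / c))
        (2 * c / ((x - t) ^ 2 + c ^ 2)) t := by
      intro t _
      have h := ((((hasDerivAt_id t).sub_const x).div_const c).arctan).const_mul 2
      refine h.congr_deriv ?_
      simp only [id]
      field_simp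
      ring
    rw [intervalIntegral.integral_eq_sub_of_hasDerivAt hd]
    · have m1 : Real.arctan ((q - x) / c) ≤ Real.arctan (2 * q / c) :=
        Real.arctan_mono (by gcongr; linarith [hx.1])
      have m2 : -Real.arctan (2 * q / c) ≤ Real.arctan ((-q - x) / c) := by
        rw [← Real.arctan_neg]
        refine Real.arctan_mono ?_
        rw [← neg_div]
        gcongr
        linarith [hx.2]
      have hp := Real.pi_pos
      rw [div_le_iff₀ (by positivity)]
      field_simp
      linarith
    · refine Continuous.intervalIntegrable ?_ _ _
      exact Continuous.div (by fun_prop) (by fun_prop) fun t => by positivity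

lemma continuous_liebOp {c q : ℝ} (hc : 0 < c) {g : ℂ → ℂ} (hg : Continuous fun t : ℝ => g t) :
    Continuous fun t : ℝ => liebOp c q g t := by
  unfold liebOp
  refine Continuous.div_const ?_ _
  have h0 : ∀ x : ℝ, |(x : ℂ).im| < c := fun x => by simpa using hc
  refine intervalIntegral.continuous_of_dominated_interval (bound := fun t => 2 / c * ‖g t‖)
    (fun x => ?_) (fun x => ?_) ?_ ?_
  · exact ((continuous_liebKernel_sub (h0 x)).mul hg).aestronglyMeasurable
  · refine Eventually.of_forall fun t _ => ?_
    rw [norm_mul]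
    gcongr
    have := norm_liebKernel_le hc (x - t)
    simpa using this
  · exact (continuous_const.mul hg.norm).intervalIntegrable _ _
  · exact Eventually.of_forall fun t _ => (continuous_liebKernel_sub' (h0 t)).mul continuous_const

lemma continuous_iterate {c q : ℝ} (hc : 0 < c) {g : ℂ → ℂ} (hg : Continuous fun t : ℝ => g t)
    (n : ℕ) : Continuous fun t : ℝ => ((liebOp c q)^[n] g) t := by
  induction n with
  | zero => exact hg
  | succ n ih => rw [Function.iterate_succ_apply']; exact continuous_liebOp hc ih

lemma norm_liebOp_le {c q : ℝ} (hq : 0 < q) {g : ℂ → ℂ}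
    {B : ℝ} (hB : ∀ t ∈ Icc (-q) q, ‖g (t : ℝ)‖ ≤ B) {z : ℂ} (hz : |z.im| < c) :
    ‖liebOp c q g z‖ ≤ (∫ t in (-q)..q, ‖liebKernel c (z - t)‖) / (2 * Real.pi) * B := by
  have hp := Real.pi_pos
  unfold liebOp
  rw [norm_div]
  have : ‖(2 * Real.pi : ℂ)‖ = 2 * Real.pi := by
    simp [abs_of_pos hp]
  rw [this, div_mul_eq_mul_div]
  gcongr
  rw [← intervalIntegral.integral_mul_const]
  refine intervalIntegral.norm_integral_le_of_norm_le (by linarith) ?_ ?_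
  · refine Eventually.of_forall fun t ht => ?_
    rw [norm_mul]
    gcongr
    exact hB t (Ioc_subset_Icc_self ht)
  · exact ((continuous_liebKernel_sub hz).norm.mul continuous_const).intervalIntegrable _ _

lemma exists_iterate_bound {c q : ℝ} (hc : 0 < c) (hq : 0 < q) {g : ℂ → ℂ}
    (hg : Continuous fun t : ℝ => g t) :
    ∃ k B : ℝ, 0 ≤ k ∧ k < 1 ∧ ∀ n : ℕ, ∀ t ∈ Icc (-q) q,
      ‖((liebOp c q)^[n] g) (t : ℝ)‖ ≤ k ^ n * B := by
  obtain ⟨k, hk0, hk1, hk⟩ := exists_contraction hc hq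
  obtain ⟨B, hB⟩ := isCompact_Icc.exists_bound_of_continuousOn (s := Icc (-q) q) hg.continuousOn
  have hB0 : 0 ≤ B := (norm_nonneg _).trans (hB 0 (by constructor <;> linarith))
  refine ⟨k, B, hk0, hk1, fun n => ?_⟩
  induction n with
  | zero => intro t ht; simpa using hB t ht
  | succ n ih =>
    intro t ht
    rw [Function.iterate_succ_apply']
    refine (norm_liebOp_le hq ih (by simpa using hc)).trans ?_
    rw [pow_succ', mul_assoc]
    gcongr
    exact hk t ht

lemma summable_iterate {c q : ℝ} (hc : 0 < c) (hq : 0 < q) {g : ℂ → ℂ}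
    (hg : Continuous fun t : ℝ => g t) {z : ℂ} (hz : |z.im| < c) :
    Summable fun n : ℕ => ((liebOp c q)^[n] g) z := by
  obtain ⟨k, B, hk0, hk1, hb⟩ := exists_iterate_bound hc hq hg
  rw [← summable_nat_add_iff 1]
  refine Summable.of_norm_bounded
    (g := fun n => (∫ t in (-q)..q, ‖liebKernel c (z - t)‖) / (2 * Real.pi) * (k ^ n * B)) ?_ ?_
  · exact ((summable_geometric_of_lt_one hk0 hk1).mul_right B).mul_left _
  · intro n
    rw [Function.iterate_succ_apply']
    exact norm_liebOp_le hq (hb n) hz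

/-- The dressed function solves `(I - K / 2π) u = g` on the strip `|Im z| < c`. -/
theorem dress_eq {c q : ℝ} (hc : 0 < c) (hq : 0 < q) {g : ℂ → ℂ}
    (hg : Continuous fun t : ℝ => g t) {z : ℂ} (hz : |z.im| < c) :
    dress c q g z - (∫ t in (-q)..q, liebKernel c (z - t) * dress c q g t) / (2 * Real.pi) = g z := by
  obtain ⟨k, B, hk0, hk1, hb⟩ := exists_iterate_bound hc hq hg
  have hs := summable_iterate hc hq hg hz
  have hB0 : 0 ≤ B := by
    simpa using (norm_nonneg _).trans (hb 0 0 (by constructor <;> linarith))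
  have hsum : HasSum (fun n : ℕ => ∫ t in (-q)..q, liebKernel c (z - t) * ((liebOp c q)^[n] g) t)
      (∫ t in (-q)..q, liebKernel c (z - t) * dress c q g t) := by
    refine intervalIntegral.hasSum_integral_of_dominated_convergence
      (fun n t => ‖liebKernel c (z - t)‖ * (k ^ n * B)) (fun n => ?_) (fun n => ?_) ?_ ?_ ?_
    · exact ((continuous_liebKernel_sub hz).mul (continuous_iterate hc hg n)).aestronglyMeasurable
    · refine Eventually.of_forall fun t ht => ?_
      rw [norm_mul]
      gcongr
      rw [uIoc_of_le (by linarith)] at ht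
      exact hb n t (Ioc_subset_Icc_self ht)
    · exact Eventually.of_forall fun t _ =>
        ((summable_geometric_of_lt_one hk0 hk1).mul_right B).mul_left _
    · simp_rw [tsum_mul_left, tsum_mul_right]
      exact ((continuous_liebKernel_sub hz).norm.mul continuous_const).intervalIntegrable _ _
    · refine Eventually.of_forall fun t _ => ?_
      exact (summable_iterate hc hq hg (z := (t : ℂ)) (by simpa using hc)).hasSum.mul_left _
  have h2 := (hsum.div_const (2 * Real.pi : ℂ)).tsum_eq
  have h3 : dress c q g z = g z + ∑' n : ℕ, ((liebOp c q)^[n + 1] g) z := by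
    unfold dress
    rw [hs.tsum_eq_zero_add]
    rfl
  rw [h3, ← h2]
  simp_rw [Function.iterate_succ_apply']
  unfold liebOp
  simp

theorem dressedCharge_eq {c q : ℝ} (hc : 0 < c) (hq : 0 < q) {z : ℂ} (hz : |z.im| < c) :
    dressedCharge c q z
      - (∫ t in (-q)..q, liebKernel c (z - t) * dressedCharge c q t) / (2 * Real.pi) = 1 :=
  dress_eq hc hq continuous_const hz

theorem dressedPhase_eq {c q : ℝ} (hc : 0 < c) (hq : 0 < q) {z w : ℂ} (hz : |z.im| < c)
    (hw : |w.im| < c) :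
    dressedPhase c q z w
      - (∫ t in (-q)..q, liebKernel c (z - t) * dressedPhase c q t w) / (2 * Real.pi)
      = barePhase c (z - w) / (2 * Real.pi) :=
  dress_eq hc hq (g := fun v => barePhase c (v - w) / (2 * Real.pi))
    ((continuous_barePhase_sub' hw).div_const _) hz

theorem resolventKernel_eq {c q : ℝ} (hc : 0 < c) (hq : 0 < q) {z w : ℂ} (hz : |z.im| < c)
    (hw : |w.im| < c) :
    resolventKernel c q z w
      - (∫ t in (-q)..q, liebKernel c (z - t) * resolventKernel c q t w) / (2 * Real.pi)
      = liebKernel c (z - w) :=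
  dress_eq hc hq (g := fun v => liebKernel c (v - w)) (continuous_liebKernel_sub' hw) hz

lemma continuousOn_dressedCharge {c q : ℝ} (hc : 0 < c) (hq : 0 < q) :
    ContinuousOn (fun t : ℝ => dressedCharge c q t) (Icc (-q) q) := by
  obtain ⟨k, B, hk0, hk1, hb⟩ := exists_iterate_bound (g := fun _ => 1) hc hq continuous_const
  exact continuousOn_tsum (fun n => (continuous_iterate hc continuous_const n).continuousOn)
    ((summable_geometric_of_lt_one hk0 hk1).mul_right B) hb

theorem hasDerivAt_dressedMomentum {c q : ℝ} (hc : 0 < c) (hq : 0 < q) {z : ℂ}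
    (hz : |z.im| < c) : HasDerivAt (dressedMomentum c q) (dressedCharge c q z) z := by
  have hZ := continuousOn_dressedCharge hc hq
  have hle : -q ≤ q := by linarith
  have hmeas : AEStronglyMeasurable (fun t : ℝ => dressedCharge c q t)
      (volume.restrict (uIoc (-q) q)) := by
    rw [uIoc_of_le hle]
    exact (hZ.mono Ioc_subset_Icc_self).aestronglyMeasurable measurableSet_Ioc
  obtain ⟨B, hB⟩ := isCompact_Icc.exists_bound_of_continuousOn hZ
  obtain ⟨r, hr, hrz⟩ : ∃ r > 0, ∀ w ∈ Metric.closedBall z r, |w.im| < c := by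
    refine ⟨(c - |z.im|) / 2, by linarith, fun w hw => ?_⟩
    have h1 : |(w - z).im| ≤ ‖w - z‖ := Complex.abs_im_le_norm _
    rw [Metric.mem_closedBall, dist_eq_norm] at hw
    have h2 : |w.im| ≤ |z.im| + |(w - z).im| := by
      have := abs_add_le z.im (w - z).im
      simpa using this
    linarith
  have hcont : ContinuousOn (fun p : ℂ × ℝ => liebKernel c (p.1 - p.2))
      (Metric.closedBall z r ×ˢ Icc (-q) q) := by
    unfold liebKernel
    refine ContinuousOn.div (by fun_prop) (by fun_prop) fun p hp => sq_add_sq_ne ?_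
    simpa using hrz p.1 hp.1
  obtain ⟨A, hA⟩ := ((isCompact_closedBall z r).prod isCompact_Icc).exists_bound_of_continuousOn hcont
  have hz0 : z ∈ Metric.closedBall z r := Metric.mem_closedBall_self hr.le
  have key := (intervalIntegral.hasDerivAt_integral_of_dominated_loc_of_deriv_le
    (μ := volume) (a := -q) (b := q) (x₀ := z) (s := Metric.closedBall z r)
    (F := fun w t => barePhase c (w - t) * dressedCharge c q t)
    (F' := fun w t => liebKernel c (w - t) * dressedCharge c q t)
    (bound := fun _ => A * B) (Metric.closedBall_mem_nhds z hr) ?_ ?_ ?_ ?_ ?_ ?_).2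
  · have hd := (hasDerivAt_id z).add (key.div_const (2 * Real.pi : ℂ))
    have e := dressedCharge_eq hc hq hz
    refine hd.congr_deriv ?_
    linear_combination -e
  · filter_upwards [Metric.closedBall_mem_nhds z hr] with w hw
    exact (continuous_barePhase_sub (hrz w hw)).aestronglyMeasurable.mul hmeas
  · refine ContinuousOn.intervalIntegrable ?_
    rw [uIcc_of_le hle]
    exact (continuous_barePhase_sub hz).continuousOn.mul hZ
  · exact (continuous_liebKernel_sub hz).aestronglyMeasurable.mul hmeas
  · refine Eventually.of_forall fun t ht w hw => ?_
    rw [uIoc_of_le hle] at ht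
    have ht' := Ioc_subset_Icc_self ht
    rw [norm_mul]
    have a1 := hA (w, t) ⟨hw, ht'⟩
    exact mul_le_mul a1 (hB t ht') (norm_nonneg _) ((norm_nonneg _).trans a1)
  · exact intervalIntegrable_const
  · refine Eventually.of_forall fun t ht w hw => ?_
    have h1 : HasDerivAt (barePhase c) (liebKernel c (w - t)) (w - t) :=
      hasDerivAt_barePhase (by simpa using hrz w hw)
    have h2 : HasDerivAt (fun w : ℂ => barePhase c (w - t)) (liebKernel c (w - t)) w :=
      h1.comp_sub_const w (t : ℂ)
    exact h2.mul_const _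

theorem dressedMomentum_eq {c q : ℝ} (hc : 0 < c) (hq : 0 < q) (z : ℂ) :
    dressedMomentum c q z
      - (∫ t in (-q)..q, barePhase c (z - t) * deriv (dressedMomentum c q) t) / (2 * Real.pi)
      = z := by
  have h : ∀ t : ℝ, deriv (dressedMomentum c q) t = dressedCharge c q t := fun t =>
    (hasDerivAt_dressedMomentum hc hq (by simpa using hc)).deriv
  simp_rw [h]
  unfold dressedMomentum
  ring

/-- The strip around the real axis. -/
def strip (δ : ℝ) : Set ℂ := {z | |z.im| < 2 * δ}

/-- The Fermi zone `[-q, q]`, as a subset of the complex plane. -/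
def fermiZone (q : ℝ) : Set ℂ := (fun t : ℝ => (t : ℂ)) '' Icc (-q) q

/-- The density `D = p(q) / π`. -/
def density (c q : ℝ) : ℝ := (dressedMomentum c q q).re / Real.pi

/-- The thermodynamic limit of the counting function, `ξ = p / 2π + D / 2`. -/
def countingFunction (c q : ℝ) (z : ℂ) : ℂ :=
  dressedMomentum c q z / (2 * Real.pi) + density c q / 2

/-- The sup norm of `f` on the set `S`. -/
def supNorm (S : Set ℂ) (f : ℂ → ℂ) : ℝ := sSup ((fun z => ‖f z‖) '' S)

/-- A continuously differentiable Jordan curve parametrized by `[0, 1]`. -/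
structure IsJordanLoop (z : ℝ → ℂ) : Prop where
  contDiffOn : ContDiffOn ℝ 1 z (Icc 0 1)
  closed : z 0 = z 1
  injOn : InjOn z (Ico 0 1)

/-- The image of a curve. -/
def trace (z : ℝ → ℂ) : Set ℂ := z '' Icc 0 1

/-- The contour integral of `f` along the curve `z`. -/
def contourIntegral (z : ℝ → ℂ) (f : ℂ → ℂ) : ℂ := ∫ t in (0 : ℝ)..1, f (z t) * deriv z t

def windingNumber (z : ℝ → ℂ) (w : ℂ) : ℂ :=
  contourIntegral z (fun u => 1 / (u - w)) / (2 * Real.pi * Complex.I)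

/-- The domain enclosed by a counterclockwise Jordan curve. -/
def inside (z : ℝ → ℂ) : Set ℂ := {w | w ∉ trace z ∧ windingNumber z w = 1}

/-- `M` is a compact set without holes, whose boundary is the Jordan curve `z`, oriented
counterclockwise. -/
structure IsJordanDomain (M : Set ℂ) (z : ℝ → ℂ) : Prop where
  isCompact : IsCompact M
  no_holes : IsConnected Mᶜ
  loop : IsJordanLoop z
  frontier_eq : frontier M = trace z
  winding : ∀ w ∈ interior M, windingNumber z w = 1

/-- The points `z (x j)`, `0 ≤ j ≤ s + 1`, are a discretization of order `s` of the curve `z`. -/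
structure IsDiscretization (s : ℕ) (x : ℕ → ℝ) : Prop where
  zero : x 0 = 0
  one_nonneg : 0 ≤ x 1
  strictMono : StrictMonoOn x (Icc 1 s)
  le_one : x s ≤ 1
  last : x (s + 1) = 1
  mesh : ∀ j ≤ s, |x (j + 1) - x j| ≤ 2 / s

/-- The Fredholm determinant of `I + k`, where `k` acts by `f ↦ ∫ k(·, w) f(w) dw` along the curve
`z` parametrized by `[a, b]`. -/
def fredholmDet (z : ℝ → ℂ) (a b : ℝ) (k : ℂ → ℂ → ℂ) : ℂ :=
  ∑' n : ℕ, ((n.factorial : ℂ))⁻¹ *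
    ∫ t in Set.pi univ (fun _ : Fin n => Icc a b),
      (Matrix.of fun i j : Fin n => k (z (t i)) (z (t j))).det * ∏ i, deriv z (t i)

/-- A regular functional with respect to `(M, K)`, depending on auxiliary variables in `W`.
It acts on functions holomorphic in the interior of `M`. Holomorphy on a set `S` that is not open
is holomorphy in a neighbourhood of `S`. -/
def IsRegularFunctional {l : ℕ} (M K : Set ℂ) (W : Set (Fin l → ℂ))
    (F : (ℂ → ℂ) → (Fin l → ℂ) → ℂ) : Prop :=
  ∃ CF > 0,
    (∃ C' > 0, ∀ f g : ℂ → ℂ, AnalyticOnNhd ℂ f (interior M) → AnalyticOnNhd ℂ g (interior M) →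
      supNorm K f + supNorm K g < CF →
      ∀ z ∈ W, ‖F f z - F g z‖ ≤ C' * supNorm K (fun u => f u - g u)) ∧
    (∀ (m : ℕ) (Wy : Set (Fin m → ℂ)), IsOpen Wy → 0 ∈ Wy →
      ∀ ν : ℂ → (Fin m → ℂ) → ℂ,
        AnalyticOnNhd ℂ (fun p : ℂ × (Fin m → ℂ) => ν p.1 p.2) (interior M ×ˢ Wy) →
        (∃ b < CF, ∀ u ∈ K, ∀ y ∈ Wy, ‖ν u y‖ ≤ b) →
        ∃ G : (Fin m → ℂ) × (Fin l → ℂ) → ℂ, AnalyticOnNhd ℂ G (Wy ×ˢ W) ∧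
          ∀ y ∈ Wy, ∀ z ∈ W, G (y, z) = F (fun u => ν u y) z)

/-- `V(μ, ζ)` is a functional derivative `δΓ[ν] / δν(ζ) (μ)` at `ν = τ`, relative to the
contour `z`. -/
def IsFunctionalDerivative (M K : Set ℂ) (z : ℝ → ℂ) (Γ : (ℂ → ℂ) → ℂ → ℂ) (τ : ℂ → ℂ)
    (V : ℂ → ℂ → ℂ) : Prop :=
  (∃ U : Set ℂ, IsOpen U ∧ trace z ⊆ U ∧
    AnalyticOnNhd ℂ (fun p : ℂ × ℂ => V p.1 p.2) (M ×ˢ U)) ∧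
  ∀ ε > 0, ∃ d > 0, ∀ ρ : ℂ → ℂ, AnalyticOnNhd ℂ ρ (interior M) →
    supNorm K (fun u => ρ u - τ u) < d →
    ∀ μ ∈ M, ‖Γ ρ μ - Γ τ μ - contourIntegral z (fun ζ => (ρ ζ - τ ζ) * V μ ζ)‖
      ≤ ε * supNorm K (fun u => ρ u - τ u)

/-- `w` is a root of `ξ_ν(w) = j / L`, `ξ_ν = ξ + ν / L`, enclosed by the contour `z`. -/
def IsBetheRoot (c q : ℝ) (z : ℝ → ℂ) (L : ℝ) (ν : ℂ → ℂ) (j : ℕ) (w : ℂ) : Prop :=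
  w ∈ inside z ∧ countingFunction c q w + ν w / L = j / L

/-- The root of `ξ_ν(w) = j / L` enclosed by the contour `z`; it is `μ_j` for `ν = 0`. -/
def betheRoot (c q : ℝ) (z : ℝ → ℂ) (L : ℝ) (ν : ℂ → ℂ) (j : ℕ) : ℂ :=
  Classical.epsilon (IsBetheRoot c q z L ν j)

/-- The functional `Γ[ν](μ) = ∑_{j ∈ J} φ(μ, μ_j) - φ(μ, λ_j)`. -/
def gammaL (c q : ℝ) (z : ℝ → ℂ) (L : ℝ) (J : Finset ℕ) (ν : ℂ → ℂ) (μ : ℂ) : ℂ :=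
  ∑ j ∈ J, (dressedPhase c q μ (betheRoot c q z L (fun _ => 0) j)
    - dressedPhase c q μ (betheRoot c q z L ν j))

/-- The kernel `(∂_ζ φ)(μ, ζ) / (2πiL) ∑_{j ∈ J} 1 / (ξ_ν(ζ) - j / L)`. -/
def gammaLDeriv (c q L : ℝ) (J : Finset ℕ) (ν : ℂ → ℂ) (μ ζ : ℂ) : ℂ :=
  deriv (fun w => dressedPhase c q μ w) ζ / (2 * Real.pi * Complex.I * L)
    * ∑ j ∈ J, 1 / (countingFunction c q ζ + ν ζ / L - j / L)

/-- `f_s(u | ς) = ∑_{p = 1}^s (t_{p+1} - t_p) / (2πi (t_p - u)) (ς_p + h(t_p))` with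
`t_p = z (x p)`. -/
def interpolant (z : ℝ → ℂ) (x : ℕ → ℝ) (h : ℂ → ℂ) (s : ℕ) (ς : Fin s → ℂ) (u : ℂ) : ℂ :=
  ∑ p : Fin s, (z (x (p + 2)) - z (x (p + 1)))
    / (2 * Real.pi * Complex.I * (z (x (p + 1)) - u)) * (ς p + h (z (x (p + 1))))

/-- The partial derivative with respect to the coordinate `r`. -/
def partialDeriv {s : ℕ} (r : Fin s) (Φ : (Fin s → ℂ) → ℂ) (ς : Fin s → ℂ) : ℂ :=
  deriv (fun w => Φ (Function.update ς r w)) (ς r)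

/-- The mixed partial derivative `∏_r (∂ / ∂ς_r) ^ (n_r)`. -/
def mixedPartial {s : ℕ} (n : Fin s → ℕ) (Φ : (Fin s → ℂ) → ℂ) : (Fin s → ℂ) → ℂ :=
  (List.finRange s).foldr (fun r G => (partialDeriv r)^[n r] G) Φ

/-- The term of multi-index `n` of the multidimensional Lagrange series
`∑_n ∏_r (1 / n_r!) (∂ / ∂ς_r) ^ (n_r) [∏_r Γ[γ f_s](t_r) ^ (n_r) F[γ f_s](y)]` at `ς = 0`, which
is the expansion of `: ∏_r exp (Γ[γ f_s](t_r) ∂ / ∂ς_r) F[γ f_s](y) :`. -/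
def lagrangeTerm {l : ℕ} (z : ℝ → ℂ) (x : ℕ → ℝ) (h : ℂ → ℂ) (Γ : (ℂ → ℂ) → ℂ → ℂ)
    (F : (ℂ → ℂ) → (Fin l → ℂ) → ℂ) (γ : ℂ) (y : Fin l → ℂ) (s : ℕ) (n : Fin s → ℕ) : ℂ :=
  (∏ r, ((n r).factorial : ℂ))⁻¹ * mixedPartial n (fun ς =>
    (∏ r : Fin s, Γ (fun u => γ * interpolant z x h s ς u) (z (x (r + 1))) ^ n r)
      * F (fun u => γ * interpolant z x h s ς u) y) 0

end LiebLiniger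

end

open LiebLiniger

namespace LiebLiniger

/-! ### Quantitative estimates for holomorphic functions -/

/-! The functional `Γ` sees the shift ν only through the roots of ξ_ν = j/L, and a sum over these
roots is a contour integral: by residues, the integral over the loop of g times the density `psiL`
is ∑ g(λ_j) / (L ξ_ν'(λ_j)). All five assertions reduce to properties of the roots and of this
density.

Roots. On the strip ξ is injective and ξ' = Z/2π does not vanish, so by compactness its divided
differences are bounded below near the region enclosed by the loop (`exists_antilipschitz`). Adding
ν/L with L large costs at most half of this bound (`RootData.shifted_anti`). This gives uniqueness
of the roots, existence by a quantitative open mapping argument (`RootData.exists_root`),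
displacements of order 1/L under a change of ν, and holomorphic dependence on parameters. Since J
has O(L) elements, `Γ` is Lipschitz with a constant that does not depend on L
(`RootData.norm_gammaL_sub_le`). Its second order expansion, rewritten by residues, is the
functional derivative. For small γ the nonlinear equation is solved by a contraction on the finite
vector of roots; the solution is holomorphic in γ as a uniform limit of iterates
(`exists_differentiableOn_fixedPoint`).

Limit L → ∞. The density `psiL` is essentially a Riemann sum and tends to `psiLim` at the rate ε_L
(`RootData.exists_psiL_bound`). Integrating against `psiLim` along the loop amounts to integrating
over [-q, q] (`RootData.contourIntegral_mul_psiLim`). As ∂_ζ φ(μ, ζ) = -R(μ, ζ)/2π, integrating the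
derivative of s ↦ Γ[sν] over [0, 1] shows that `Γ` is -R/2π up to O(ε_L)
(`RootData.exists_gammaL_limit_bound`). The error E = ρ^(L) - ρ then solves the resolvent equation
with a right side of size O(ε_L), hence is itself of that size.

Determinants. Each term of a Fredholm series is a multiple integral of a holomorphic function, so
the series depends on the weighted points only through the integrals of holomorphic functions of one
variable (`fredholmSeries_congr`). Thus the determinant on the loop with density `psiL` is a finite
determinant over the roots, and with `psiLim` it is the determinant on [-q, q]. A Lipschitz estimate
for small kernels compares the two.

Lagrange series. At order s the series is an instance of the multidimensional Lagrange inversion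
formula (`IsLagrangeMap.hasSum`): its sum is H(v) / det(1 - DG(v)) at the fixed point v of G_r(ς) =
Γ[γ f_s](t_r). At v the interpolant f_s is a discretized Cauchy formula for h + Γ[γ f_s], so it
tends to ρ^(L). The Jacobian factors through the roots, so det(1 - A A') = det(1 - A' A) turns it
into a determinant of fixed size, whose entries are again discretized Cauchy integrals and converge
to those of the finite determinant above.

Cauchy's formula for a C¹ closed curve is obtained from winding numbers by Dixon's argument; the
Jordan curve theorem is not used. -/

lemma norm_sub_le_of_bound_ball {f : ℂ → ℂ} {x y : ℂ} {r b : ℝ} (hr : 0 < r)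
    (hf : DifferentiableOn ℂ f (Metric.ball x r)) (hb : ∀ u ∈ Metric.ball x r, ‖f u‖ ≤ b)
    (hy : ‖f y‖ ≤ b) : ‖f y - f x‖ ≤ 2 * b / r * ‖y - x‖ := by
  have hx := hb x (Metric.mem_ball_self hr)
  have hb0 : 0 ≤ b := (norm_nonneg _).trans hx
  by_cases h : ‖y - x‖ < r
  · have hmaps : MapsTo f (Metric.ball x r) (Metric.closedBall (f x) (2 * b)) := by
      intro u hu
      rw [mem_closedBall_iff_norm]
      calc ‖f u - f x‖ ≤ ‖f u‖ + ‖f x‖ := norm_sub_le _ _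
        _ ≤ 2 * b := by linarith [hb u hu]
    have := Complex.dist_le_div_mul_dist_of_mapsTo_ball hf hmaps
      (z := y) (by rwa [mem_ball_iff_norm])
    simpa [dist_eq_norm] using this
  · push Not at h
    calc ‖f y - f x‖ ≤ ‖f y‖ + ‖f x‖ := norm_sub_le _ _
      _ ≤ 2 * b / r * r := by rw [div_mul_cancel₀ _ hr.ne']; linarith
      _ ≤ _ := by gcongr

/-- Schwarz's lemma in divided form. As in the preceding estimate, y may lie outside the ball, where
the trivial bound 2b is already at most (2b/r)‖y - x‖. -/
lemma norm_dslope_le {f : ℂ → ℂ} {x y : ℂ} {r b : ℝ} (hr : 0 < r)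
    (hf : DifferentiableOn ℂ f (Metric.ball x r)) (hb : ∀ u ∈ Metric.ball x r, ‖f u‖ ≤ b)
    (hy : ‖f y‖ ≤ b) : ‖dslope f x y‖ ≤ 2 * b / r := by
  have hb0 : 0 ≤ b := (norm_nonneg _).trans (hb x (Metric.mem_ball_self hr))
  rcases eq_or_ne y x with rfl | hne
  · have hd : DifferentiableAt ℂ f y := hf.differentiableAt (Metric.ball_mem_nhds _ hr)
    rw [dslope_same]
    refine hd.hasDerivAt.le_of_lip' (by positivity) ?_
    filter_upwards [Metric.ball_mem_nhds y hr] with u hu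
    exact norm_sub_le_of_bound_ball hr hf hb (hb u hu)
  · rw [dslope_of_ne _ hne, slope_def_field, norm_div, div_le_iff₀ (norm_pos_iff.2 (sub_ne_zero.2 hne))]
    exact norm_sub_le_of_bound_ball hr hf hb hy

lemma norm_deriv_le_of_bound_ball {f : ℂ → ℂ} {x : ℂ} {r b : ℝ} (hr : 0 < r)
    (hf : DifferentiableOn ℂ f (Metric.ball x r)) (hb : ∀ u ∈ Metric.ball x r, ‖f u‖ ≤ b) :
    ‖deriv f x‖ ≤ 2 * b / r := by
  rw [← dslope_same]
  exact norm_dslope_le hr hf hb (hb x (Metric.mem_ball_self hr))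

/-- Schwarz's lemma applied twice: the divided difference of f at x is holomorphic and bounded by
2b/r, and its own increment from x to y is the remainder divided by y - x. -/
lemma norm_taylor_two_le {f : ℂ → ℂ} {x y : ℂ} {r b : ℝ} (hr : 0 < r)
    (hf : DifferentiableOn ℂ f (Metric.ball x r)) (hb : ∀ u ∈ Metric.ball x r, ‖f u‖ ≤ b)
    (hy : y ∈ Metric.ball x r) :
    ‖f y - f x - deriv f x * (y - x)‖ ≤ 4 * b / r ^ 2 * ‖y - x‖ ^ 2 := by
  have hg : DifferentiableOn ℂ (dslope f x) (Metric.ball x r) :=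
    (Complex.differentiableOn_dslope (Metric.ball_mem_nhds x hr)).2 hf
  have hgb : ∀ u ∈ Metric.ball x r, ‖dslope f x u‖ ≤ 2 * b / r :=
    fun u hu => norm_dslope_le hr hf hb (hb u hu)
  have h1 := norm_sub_le_of_bound_ball hr hg hgb (hgb y hy)
  have h2 : f y - f x - deriv f x * (y - x) = (dslope f x y - dslope f x x) * (y - x) := by
    have := sub_smul_dslope f x y
    rw [smul_eq_mul] at this
    rw [dslope_same, sub_mul, ← this]; ring
  rw [h2, norm_mul]
  calc _ ≤ 2 * (2 * b / r) / r * ‖y - x‖ * ‖y - x‖ := by gcongr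
    _ = _ := by field_simp; ring

/-- The divided difference of a holomorphic function is jointly continuous. -/
lemma continuousOn_dslope_prod {f : ℂ → ℂ} {Ω : Set ℂ} (hΩ : IsOpen Ω)
    (hf : DifferentiableOn ℂ f Ω) :
    ContinuousOn (fun p : ℂ × ℂ => dslope f p.1 p.2) (Ω ×ˢ Ω) := by
  have han : AnalyticOnNhd ℂ f Ω := hf.analyticOnNhd hΩ
  rintro ⟨a, b⟩ ⟨ha, hb⟩
  refine ContinuousAt.continuousWithinAt ?_
  rcases eq_or_ne a b with rfl | hne
  · have hs : HasStrictDerivAt f (deriv f a) a := (han a ha).hasStrictDerivAt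
    have hdc : ContinuousAt (deriv f) a := (han a ha).deriv.continuousAt
    rw [Metric.continuousAt_iff']
    intro ε hε
    have h1 := hs.hasStrictFDerivAt.isLittleO.def (half_pos hε)
    have h2 := (Metric.continuousAt_iff'.1 hdc) ε hε
    have h3 : ∀ᶠ p : ℂ × ℂ in 𝓝 (a, a), dist (deriv f p.1) (deriv f a) < ε :=
      (continuous_fst.tendsto (a, a)).eventually h2
    filter_upwards [h1, h3] with p hp1 hp3
    simp only [dslope_same]
    rcases eq_or_ne p.2 p.1 with he | he
    · rw [he, dslope_same]; exact hp3
    · rw [dslope_of_ne _ he, slope_def_field, dist_eq_norm]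
      have hpos : 0 < ‖p.1 - p.2‖ := norm_pos_iff.2 (sub_ne_zero.2 he.symm)
      have e : (f p.2 - f p.1) / (p.2 - p.1) - deriv f a
          = (f p.1 - f p.2 - (p.1 - p.2) • deriv f a) / (p.1 - p.2) := by
        have := sub_ne_zero.2 he
        have := sub_ne_zero.2 he.symm
        simp only [smul_eq_mul]
        field_simp
        ring
      rw [e, norm_div, div_lt_iff₀ hpos]
      simp only [ContinuousLinearMap.toSpanSingleton_apply] at hp1
      refine lt_of_le_of_lt hp1 ?_
      nlinarith
  · have h1 : ContinuousAt (fun p : ℂ × ℂ => (f p.2 - f p.1) / (p.2 - p.1)) (a, b) := by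
      have c1 : ContinuousAt f a := (han a ha).continuousAt
      have c2 : ContinuousAt f b := (han b hb).continuousAt
      have c3 : ContinuousAt (fun p : ℂ × ℂ => f p.1) (a, b) :=
        ContinuousAt.comp (f := Prod.fst) c1 continuousAt_fst
      have c4 : ContinuousAt (fun p : ℂ × ℂ => f p.2) (a, b) :=
        ContinuousAt.comp (f := Prod.snd) c2 continuousAt_snd
      exact (c4.sub c3).div (by fun_prop) (sub_ne_zero.2 hne.symm)
    refine h1.congr ?_
    have hopen : IsOpen {p : ℂ × ℂ | p.1 ≠ p.2} := isOpen_ne_fun continuous_fst continuous_snd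
    filter_upwards [hopen.mem_nhds hne] with p hp
    rw [dslope_of_ne _ (Ne.symm hp), slope_def_field]

lemma dslope_comm (f : ℂ → ℂ) (a b : ℂ) : dslope f a b = dslope f b a := by
  rcases eq_or_ne a b with rfl | h
  · rfl
  · rw [dslope_of_ne _ h.symm, dslope_of_ne _ h, slope_comm]

/-- An injective holomorphic function expands distances on compact sets. -/
lemma exists_antilipschitz {f : ℂ → ℂ} {Ω S : Set ℂ} (hΩ : IsOpen Ω)
    (hf : DifferentiableOn ℂ f Ω) (hinj : InjOn f Ω) (hd : ∀ z ∈ Ω, deriv f z ≠ 0)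
    (hS : IsCompact S) (hSΩ : S ⊆ Ω) :
    ∃ κ > 0, ∀ z ∈ S, ∀ w ∈ S, κ ≤ ‖dslope f z w‖ := by
  rcases S.eq_empty_or_nonempty with rfl | hne
  · exact ⟨1, one_pos, by simp⟩
  have hc := ((continuousOn_dslope_prod hΩ hf).mono (prod_mono hSΩ hSΩ)).norm
  -- The minimum over S × S is positive: off the diagonal by injectivity, on it because the
  -- derivative does not vanish.
  obtain ⟨p, hp, hmin⟩ := (hS.prod hS).exists_isMinOn (hne.prod hne) hc
  refine ⟨‖dslope f p.1 p.2‖, ?_, fun z hz w hw => hmin (a := (z, w)) ⟨hz, hw⟩⟩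
  refine norm_pos_iff.2 ?_
  rcases eq_or_ne p.2 p.1 with he | he
  · rw [he, dslope_same]; exact hd _ (hSΩ hp.1)
  · rw [dslope_of_ne _ he, slope_def_field]
    refine div_ne_zero (sub_ne_zero.2 fun h => he ?_) (sub_ne_zero.2 he)
    exact hinj (hSΩ hp.2) (hSΩ hp.1) h

/-! ### Holomorphic parametric integrals -/

/-- An integral depending holomorphically on a parameter. -/
lemma differentiableOn_integral_param {X : Type*} [MeasurableSpace X] {m : Measure X}
    {U : Set ℂ} (hU : IsOpen U) {f : ℂ → X → ℂ}
    (hmeas : ∀ w ∈ U, AEStronglyMeasurable (f w) m)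
    (hf : ∀ᵐ t ∂m, DifferentiableOn ℂ (fun w => f w t) U)
    (hb : ∀ w ∈ U, ∃ r > 0, Metric.ball w r ⊆ U ∧ ∃ g : X → ℝ, Integrable g m ∧
      ∀ᵐ t ∂m, ∀ v ∈ Metric.ball w r, ‖f v t‖ ≤ g t) :
    DifferentiableOn ℂ (fun w => ∫ t, f w t ∂m) U := by
  intro w hw
  obtain ⟨r, hr, hrU, g, hg, hgb⟩ := hb w hw
  have hr2 : 0 < r / 2 := by positivity
  -- No measurability of the derivative is assumed; it is the limit of difference quotients along
  -- the increments r / (2(n + 1)).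
  have hderivmeas : AEStronglyMeasurable (fun t => deriv (fun v => f v t) w) m := by
    have hn : ∀ n : ℕ, w + (r / 2 / (n + 1) : ℝ) ∈ Metric.ball w r := by
      intro n
      rw [mem_ball_iff_norm, add_sub_cancel_left, Complex.norm_real, Real.norm_of_nonneg (by positivity)]
      have : r / 2 / (n + 1) ≤ r / 2 := div_le_self hr2.le (by linarith [n.cast_nonneg (α := ℝ)])
      linarith
    refine aestronglyMeasurable_of_tendsto_ae atTop
      (f := fun (n : ℕ) t => (f (w + (r / 2 / (n + 1) : ℝ)) t - f w t) / ((r / 2 / (n + 1) : ℝ) : ℂ))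
      (fun n => (((hmeas _ (hrU (hn n))).sub (hmeas w hw)).mul_const _)) ?_
    filter_upwards [hf] with t ht
    have hd : HasDerivAt (fun v => f v t) (deriv (fun v => f v t) w) w :=
      (ht.differentiableAt (hU.mem_nhds hw)).hasDerivAt
    have h1 := hd.tendsto_slope_zero
    have h2 : Tendsto (fun n : ℕ => ((r / 2 / (n + 1) : ℝ) : ℂ)) atTop (𝓝[≠] 0) := by
      refine tendsto_nhdsWithin_iff.2 ⟨?_, Eventually.of_forall fun n => ?_⟩
      · have : Tendsto (fun n : ℕ => (r / 2 / (n + 1) : ℝ)) atTop (𝓝 0) :=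
          tendsto_const_nhds.div_atTop (tendsto_natCast_atTop_atTop.atTop_add tendsto_const_nhds)
        have := (Complex.continuous_ofReal.tendsto 0).comp this
        rw [Complex.ofReal_zero] at this; exact this
      · have : (r / 2 / (n + 1) : ℝ) ≠ 0 := by positivity
        exact Complex.ofReal_ne_zero.2 this
    refine (h1.comp h2).congr fun n => ?_
    simp only [Function.comp, smul_eq_mul]
    exact (div_eq_inv_mul _ _).symm
  have key := hasDerivAt_integral_of_dominated_loc_of_deriv_le (μ := m) (𝕜 := ℂ) (x₀ := w)
    (F := f) (F' := fun v t => deriv (fun v => f v t) v) (bound := fun t => 2 * g t / (r / 2))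
    (s := Metric.ball w (r / 2)) (Metric.ball_mem_nhds w hr2) ?_ ?_ hderivmeas ?_ ?_ ?_
  · exact key.2.differentiableAt.differentiableWithinAt
  · filter_upwards [hU.mem_nhds hw] with v hv using hmeas v hv
  · refine hg.mono' (hmeas w hw) ?_
    filter_upwards [hgb] with t ht using ht w (Metric.mem_ball_self hr)
  · filter_upwards [hgb, hf] with t ht hft v hv
    have hsub : Metric.ball v (r / 2) ⊆ Metric.ball w r := by
      refine Metric.ball_subset_ball' ?_
      rw [Metric.mem_ball] at hv
      linarith
    exact norm_deriv_le_of_bound_ball hr2 (hft.mono (hsub.trans hrU)) fun u hu => ht u (hsub hu)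
  · exact (hg.const_mul 2).div_const _
  · filter_upwards [hf] with t ht v hv
    have hv' : v ∈ U := hrU (Metric.ball_subset_ball (by linarith) hv)
    exact (ht.differentiableAt (hU.mem_nhds hv')).hasDerivAt

/-! ### Fixed points depending on one complex parameter -/

/-- A contraction of a bounded closed set of `ι → ℂ` depending holomorphically on one complex
parameter has a holomorphic fixed point. -/
lemma exists_differentiableOn_fixedPoint {ι : Type*} [Fintype ι] {U : Set ℂ} (hU : IsOpen U)
    {Q : Set (ι → ℂ)} (hQc : IsClosed Q) (hQb : Bornology.IsBounded Q) {w₀ : ι → ℂ} (hw₀ : w₀ ∈ Q)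
    {T : ℂ → (ι → ℂ) → ι → ℂ} (hT : ∀ γ ∈ U, MapsTo (T γ) Q Q)
    (hTc : ∀ γ ∈ U, ∀ v ∈ Q, ∀ w ∈ Q, ‖T γ v - T γ w‖ ≤ 1 / 2 * ‖v - w‖)
    (hTd : ∀ Λ : ℂ → ι → ℂ, DifferentiableOn ℂ Λ U → MapsTo Λ U Q →
      DifferentiableOn ℂ (fun γ => T γ (Λ γ)) U) :
    ∃ Λ : ℂ → ι → ℂ, DifferentiableOn ℂ Λ U ∧ MapsTo Λ U Q ∧ ∀ γ ∈ U, T γ (Λ γ) = Λ γ := by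
  have hfix : ∀ γ ∈ U, ∃ v ∈ Q, T γ v = v := by
    intro γ hγ
    have hcw : ContractingWith (1 / 2 : NNReal) ((hT γ hγ).restrict (T γ) Q Q) := by
      refine ⟨?_, ?_⟩
      · rw [← NNReal.coe_lt_coe]; norm_num
      · refine LipschitzWith.of_dist_le_mul fun v w => ?_
        have := hTc γ hγ v v.2 w w.2
        rw [Subtype.dist_eq, Subtype.dist_eq, dist_eq_norm, dist_eq_norm]
        simpa using this
    obtain ⟨y, hy, hfy, -⟩ := hcw.exists_fixedPoint' hQc.isComplete (hT γ hγ) hw₀ (edist_ne_top _ _)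
    exact ⟨y, hy, hfy⟩
  classical
  set Λ : ℂ → ι → ℂ := fun γ => if hγ : γ ∈ U then (hfix γ hγ).choose else w₀ with hΛ
  have hΛQ : MapsTo Λ U Q := fun γ hγ => by
    simp only [hΛ, dif_pos hγ]; exact (hfix γ hγ).choose_spec.1
  have hΛT : ∀ γ ∈ U, T γ (Λ γ) = Λ γ := fun γ hγ => by
    simp only [hΛ, dif_pos hγ]; exact (hfix γ hγ).choose_spec.2
  refine ⟨Λ, ?_, hΛQ, hΛT⟩
  -- The fixed points were chosen separately for each γ. Holomorphy comes from the iterates of the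
  -- constant w₀, which are holomorphic and converge to them geometrically, uniformly in γ.
  set it : ℕ → ℂ → ι → ℂ := fun k γ => (T γ)^[k] w₀ with hit
  have hitQ : ∀ k, MapsTo (it k) U Q := fun k γ hγ => (hT γ hγ).iterate k hw₀
  have hitd : ∀ k, DifferentiableOn ℂ (it k) U := by
    intro k
    induction k with
    | zero => simp only [hit, Function.iterate_zero, id]; exact differentiableOn_const _
    | succ k ih =>
      have := hTd _ ih (hitQ k)
      simpa only [hit, Function.iterate_succ_apply'] using this
  obtain ⟨R, hR⟩ := hQb.exists_norm_le
  have hrate : ∀ k, ∀ γ ∈ U, ‖it k γ - Λ γ‖ ≤ (1 / 2) ^ k * (2 * R) := by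
    intro k γ hγ
    induction k with
    | zero =>
      simp only [hit, Function.iterate_zero, id, pow_zero, one_mul]
      calc _ ≤ ‖w₀‖ + ‖Λ γ‖ := norm_sub_le _ _
        _ ≤ 2 * R := by linarith [hR _ hw₀, hR _ (hΛQ hγ)]
    | succ k ih =>
      have h1 := hTc γ hγ _ (hitQ k hγ) _ (hΛQ hγ)
      rw [hΛT γ hγ] at h1
      have e : it (k + 1) γ = T γ (it k γ) := by simp only [hit, Function.iterate_succ_apply']
      rw [e, pow_succ]
      linarith
  have hu : TendstoUniformlyOn it Λ atTop U := by
    rw [Metric.tendstoUniformlyOn_iff]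
    intro ε hε
    have h0 : Tendsto (fun k : ℕ => (1 / 2 : ℝ) ^ k * (2 * R)) atTop (𝓝 0) := by
      simpa using (tendsto_pow_atTop_nhds_zero_of_lt_one (by norm_num : (0 : ℝ) ≤ 1 / 2)
        (by norm_num)).mul_const (2 * R)
    filter_upwards [h0.eventually (gt_mem_nhds hε)] with k hk γ hγ
    rw [dist_comm, dist_eq_norm]
    exact (hrate k γ hγ).trans_lt hk
  exact hu.tendstoLocallyUniformlyOn.differentiableOn (Eventually.of_forall hitd) hU


/-! ### Contour integrals along closed curves -/

namespace IsJordanLoop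

variable {z : ℝ → ℂ}

lemma continuousOn (hz : IsJordanLoop z) : ContinuousOn z (Icc 0 1) := hz.contDiffOn.continuousOn

lemma isCompact_trace (hz : IsJordanLoop z) : IsCompact (trace z) :=
  isCompact_Icc.image_of_continuousOn hz.continuousOn

lemma mem_trace {t : ℝ} (ht : t ∈ Icc (0 : ℝ) 1) : z t ∈ trace z := mem_image_of_mem z ht

lemma hasDerivAt (hz : IsJordanLoop z) {t : ℝ} (ht : t ∈ Ioo (0 : ℝ) 1) :
    HasDerivAt z (deriv z t) t :=
  ((hz.contDiffOn.differentiableOn one_ne_zero).differentiableAt (Icc_mem_nhds ht.1 ht.2)).hasDerivAt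

/-- The curve is C¹ on the closed interval only, so `deriv z` agrees with the continuous
`derivWithin` inside and carries no information at the endpoints; hence the open interval in the
first bound. -/
lemma exists_deriv_bound (hz : IsJordanLoop z) :
    ∃ D > 0, (∀ t ∈ Ioo (0 : ℝ) 1, ‖deriv z t‖ ≤ D) ∧
      ∀ a ∈ Icc (0 : ℝ) 1, ∀ b ∈ Icc (0 : ℝ) 1, ‖z b - z a‖ ≤ D * |b - a| := by
  have hc : ContinuousOn (derivWithin z (Icc 0 1)) (Icc 0 1) :=
    hz.contDiffOn.continuousOn_derivWithin (uniqueDiffOn_Icc zero_lt_one) le_rfl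
  obtain ⟨D, hD⟩ := isCompact_Icc.exists_bound_of_continuousOn hc
  refine ⟨max D 1, by positivity, fun t ht => ?_, fun a ha b hb => ?_⟩
  · rw [← derivWithin_of_mem_nhds (Icc_mem_nhds ht.1 ht.2)]
    exact (hD t (Ioo_subset_Icc_self ht)).trans (le_max_left _ _)
  · have := (convex_Icc (0 : ℝ) 1).norm_image_sub_le_of_norm_derivWithin_le
      (hz.contDiffOn.differentiableOn one_ne_zero) (C := max D 1)
      (fun x hx => (hD x hx).trans (le_max_left _ _)) ha hb
    simpa using this

lemma ae_deriv_bound {D : ℝ} (hD : ∀ t ∈ Ioo (0 : ℝ) 1, ‖deriv z t‖ ≤ D) :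
    ∀ᵐ t ∂(volume.restrict (Ioc (0 : ℝ) 1)), ‖deriv z t‖ ≤ D := by
  rw [← restrict_Ioo_eq_restrict_Ioc]
  exact (ae_restrict_iff' measurableSet_Ioo).2 (Eventually.of_forall hD)

lemma integrable_deriv (hz : IsJordanLoop z) :
    Integrable (deriv z) (volume.restrict (Ioc (0 : ℝ) 1)) := by
  obtain ⟨D, -, hD, -⟩ := hz.exists_deriv_bound
  exact Integrable.mono' (integrable_const D) (measurable_deriv z).aestronglyMeasurable
    (ae_deriv_bound hD)

lemma aestronglyMeasurable_comp (hz : IsJordanLoop z) {f : ℂ → ℂ} (hf : ContinuousOn f (trace z)) :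
    AEStronglyMeasurable (fun t => f (z t)) (volume.restrict (Ioc (0 : ℝ) 1)) := by
  refine ContinuousOn.aestronglyMeasurable ?_ measurableSet_Ioc
  exact (hf.comp hz.continuousOn fun t ht => mem_trace ht).mono Ioc_subset_Icc_self

lemma integrable_mul_deriv (hz : IsJordanLoop z) {f : ℂ → ℂ} (hf : ContinuousOn f (trace z)) :
    Integrable (fun t => f (z t) * deriv z t) (volume.restrict (Ioc (0 : ℝ) 1)) := by
  obtain ⟨C, hC⟩ := hz.isCompact_trace.exists_bound_of_continuousOn hf
  refine hz.integrable_deriv.bdd_mul (c := C) (hz.aestronglyMeasurable_comp hf) ?_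
  exact (ae_restrict_iff' measurableSet_Ioc).2
    (Eventually.of_forall fun t ht => hC _ (mem_trace (Ioc_subset_Icc_self ht)))

lemma contourIntegral_eq (z : ℝ → ℂ) (f : ℂ → ℂ) :
    contourIntegral z f = ∫ t in Ioc (0 : ℝ) 1, f (z t) * deriv z t := by
  rw [contourIntegral, intervalIntegral.integral_of_le zero_le_one]

lemma contourIntegral_congr {f g : ℂ → ℂ} (h : EqOn f g (trace z)) :
    contourIntegral z f = contourIntegral z g := by
  rw [contourIntegral_eq, contourIntegral_eq]
  exact setIntegral_congr_fun measurableSet_Ioc fun t ht => by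
    simp only [h (mem_trace (Ioc_subset_Icc_self ht))]

lemma contourIntegral_sub (hz : IsJordanLoop z) {f g : ℂ → ℂ} (hf : ContinuousOn f (trace z))
    (hg : ContinuousOn g (trace z)) :
    contourIntegral z (fun u => f u - g u) = contourIntegral z f - contourIntegral z g := by
  simp only [contourIntegral_eq, sub_mul]
  exact integral_sub (hz.integrable_mul_deriv hf) (hz.integrable_mul_deriv hg)

lemma contourIntegral_const_mul (f : ℂ → ℂ) (a : ℂ) :
    contourIntegral z (fun u => a * f u) = a * contourIntegral z f := by
  simp only [contourIntegral_eq, mul_assoc]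
  exact integral_const_mul _ _

lemma contourIntegral_sum (hz : IsJordanLoop z) {ι : Type*} (s : Finset ι) {f : ι → ℂ → ℂ}
    (hf : ∀ i ∈ s, ContinuousOn (f i) (trace z)) :
    contourIntegral z (fun u => ∑ i ∈ s, f i u) = ∑ i ∈ s, contourIntegral z (f i) := by
  simp only [contourIntegral_eq, Finset.sum_mul]
  exact integral_finsetSum _ fun i hi => hz.integrable_mul_deriv (hf i hi)

lemma norm_contourIntegral_le {D C : ℝ} (hD : ∀ t ∈ Ioo (0 : ℝ) 1, ‖deriv z t‖ ≤ D)
    {f : ℂ → ℂ} (hf : ∀ u ∈ trace z, ‖f u‖ ≤ C) : ‖contourIntegral z f‖ ≤ C * D := by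
  rw [contourIntegral_eq]
  have hC : 0 ≤ C := (norm_nonneg _).trans (hf _ (mem_trace (t := 0) (by simp)))
  have : ∀ᵐ t ∂(volume.restrict (Ioc (0 : ℝ) 1)), ‖f (z t) * deriv z t‖ ≤ C * D := by
    filter_upwards [ae_deriv_bound hD, ae_restrict_mem measurableSet_Ioc] with t h1 h2
    rw [norm_mul]
    exact mul_le_mul (hf _ (mem_trace (Ioc_subset_Icc_self h2))) h1 (norm_nonneg _) hC
  simpa using norm_integral_le_of_norm_le_const this

lemma contourIntegral_of_primitive (hz : IsJordanLoop z) {g G : ℂ → ℂ}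
    (hg : ContinuousOn g (trace z)) (hG : ∀ u ∈ trace z, HasDerivAt G (g u) u) :
    contourIntegral z g = 0 := by
  have hGc : ContinuousOn (fun t => G (z t)) (Icc 0 1) := by
    have : ContinuousOn G (trace z) := fun u hu => (hG u hu).continuousAt.continuousWithinAt
    exact this.comp hz.continuousOn fun t ht => mem_trace ht
  unfold contourIntegral
  rw [intervalIntegral.integral_eq_sub_of_hasDerivAt_of_le zero_le_one hGc, hz.closed, sub_self]
  · intro t ht
    have h1 := hG _ (mem_trace (z := z) (Ioo_subset_Icc_self ht))
    exact h1.comp t (hz.hasDerivAt ht)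
  · rw [intervalIntegrable_iff_integrableOn_Ioc_of_le zero_le_one]
    exact hz.integrable_mul_deriv hg

/-- A contour integral depending holomorphically on a parameter. -/
lemma differentiableOn_contourIntegral (hz : IsJordanLoop z) {U : Set ℂ} (hU : IsOpen U)
    {f : ℂ → ℂ → ℂ} (hc : ∀ w ∈ U, ContinuousOn (f w) (trace z))
    (hd : ∀ u ∈ trace z, DifferentiableOn ℂ (fun w => f w u) U)
    (hb : ∀ w ∈ U, ∃ r > 0, Metric.ball w r ⊆ U ∧ ∃ C, ∀ v ∈ Metric.ball w r, ∀ u ∈ trace z,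
      ‖f v u‖ ≤ C) :
    DifferentiableOn ℂ (fun w => contourIntegral z (f w)) U := by
  simp only [contourIntegral_eq]
  obtain ⟨D, hD0, hD, -⟩ := hz.exists_deriv_bound
  refine differentiableOn_integral_param hU (fun w hw => ?_) ?_ fun w hw => ?_
  · exact (hz.aestronglyMeasurable_comp (hc w hw)).mul (measurable_deriv z).aestronglyMeasurable
  · filter_upwards [ae_restrict_mem measurableSet_Ioc] with t ht
    exact (hd _ (mem_trace (Ioc_subset_Icc_self ht))).mul_const _
  · obtain ⟨r, hr, hrU, C, hC⟩ := hb w hw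
    refine ⟨r, hr, hrU, fun _ => C * D, integrable_const _, ?_⟩
    filter_upwards [ae_deriv_bound hD, ae_restrict_mem measurableSet_Ioc] with t h1 h2 v hv
    have h3 := hC v hv _ (mem_trace (Ioc_subset_Icc_self h2))
    rw [norm_mul]
    exact mul_le_mul h3 h1 (norm_nonneg _) ((norm_nonneg _).trans h3)

/-! ### Winding numbers -/

lemma continuousOn_inv_sub {w : ℂ} (hw : w ∉ trace z) :
    ContinuousOn (fun u => 1 / (u - w)) (trace z) := by
  refine ContinuousOn.div continuousOn_const (by fun_prop) fun u hu h => hw ?_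
  rwa [← sub_eq_zero.1 h]

/-- For v near w the difference 1/(u - v) - 1/(u - w) has the primitive log((u - v)/(u - w)) along
the curve, because the quotient stays within distance 1 of 1 there. -/
lemma eventually_windingNumber_eq (hz : IsJordanLoop z) {w : ℂ} (hw : w ∉ trace z) :
    ∀ᶠ v in 𝓝 w, v ∉ trace z ∧ windingNumber z v = windingNumber z w := by
  have hopen : IsOpen (trace z)ᶜ := hz.isCompact_trace.isClosed.isOpen_compl
  obtain ⟨r, hr, hrs⟩ := Metric.isOpen_iff.1 hopen w hw
  filter_upwards [Metric.ball_mem_nhds w hr] with v hv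
  have hv' : v ∉ trace z := hrs hv
  refine ⟨hv', ?_⟩
  unfold windingNumber
  congr 1
  rw [← sub_eq_zero, ← hz.contourIntegral_sub (continuousOn_inv_sub hv') (continuousOn_inv_sub hw)]
  refine hz.contourIntegral_of_primitive (G := fun u => Complex.log ((u - v) / (u - w)))
    ((continuousOn_inv_sub hv').sub (continuousOn_inv_sub hw)) fun u hu => ?_
  have huw : u - w ≠ 0 := fun h => hw (by rwa [← sub_eq_zero.1 h])
  have huv : u - v ≠ 0 := fun h => hv' (by rwa [← sub_eq_zero.1 h])
  have hlt : ‖v - w‖ < ‖u - w‖ := by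
    rw [mem_ball_iff_norm] at hv
    refine hv.trans_le ?_
    by_contra hcon
    push Not at hcon
    exact hrs (mem_ball_iff_norm.2 hcon) hu
  have hslit : (u - v) / (u - w) ∈ Complex.slitPlane := by
    have e : (u - v) / (u - w) = 1 + -((v - w) / (u - w)) := by field_simp; ring
    rw [e]
    refine Complex.mem_slitPlane_of_norm_lt_one ?_
    rw [norm_neg, norm_div, div_lt_one (norm_pos_iff.2 huw)]
    exact hlt
  have hd : HasDerivAt (fun u : ℂ => (u - v) / (u - w))
      ((1 * (u - w) - (u - v) * 1) / (u - w) ^ 2) u :=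
    ((hasDerivAt_id u).sub_const v).div ((hasDerivAt_id u).sub_const w) huw
  refine (hd.clog hslit).congr_deriv ?_
  field_simp

/-- The winding number is locally constant, hence constant on V, and its defining integral tends to
0 along points of V that go to infinity. -/
lemma windingNumber_eq_zero (hz : IsJordanLoop z) {V : Set ℂ} (hV : IsOpen V)
    (hVc : IsPreconnected V) (hVz : Disjoint V (trace z)) (hVb : ¬ Bornology.IsBounded V) {w : ℂ}
    (hw : w ∈ V) : windingNumber z w = 0 := by
  have hnot : ∀ v ∈ V, v ∉ trace z := fun v hv => hVz.notMem_of_mem_left hv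
  have hdv : ∀ v ∈ V, HasDerivAt (windingNumber z) 0 v := fun v hv =>
    (hasDerivAt_const v (windingNumber z v)).congr_of_eventuallyEq
      ((hz.eventually_windingNumber_eq (hnot v hv)).mono fun u hu => hu.2)
  have hconst : ∀ v ∈ V, windingNumber z v = windingNumber z w := fun v hv =>
    hV.is_const_of_deriv_eq_zero hVc (fun u hu => (hdv u hu).differentiableAt.differentiableWithinAt)
      (fun u hu => (hdv u hu).deriv) hv hw
  obtain ⟨D, hD0, hD, -⟩ := hz.exists_deriv_bound
  obtain ⟨R, hR⟩ := hz.isCompact_trace.isBounded.exists_norm_le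
  have hbound : ∀ ε > 0, ‖windingNumber z w‖ ≤ ε * D := by
    intro ε hε
    obtain ⟨v, hv, hvR⟩ : ∃ v ∈ V, R + 1 / ε ≤ ‖v‖ := by
      by_contra hcon
      push Not at hcon
      exact hVb (isBounded_iff_forall_norm_le.2 ⟨_, fun v hv => (hcon v hv).le⟩)
    rw [← hconst v hv, windingNumber, norm_div]
    have h1 : ‖contourIntegral z fun u => 1 / (u - v)‖ ≤ ε * D := by
      refine norm_contourIntegral_le hD fun u hu => ?_
      have h2 : 1 / ε ≤ ‖u - v‖ := by
        have := norm_sub_norm_le v u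
        rw [norm_sub_rev] at this
        linarith [hR u hu]
      rw [norm_div, norm_one, div_le_iff₀ (lt_of_lt_of_le (by positivity) h2)]
      have := mul_le_mul_of_nonneg_left h2 hε.le
      rwa [mul_one_div_cancel hε.ne'] at this
    have h3 : (1 : ℝ) ≤ ‖(2 * Real.pi * Complex.I : ℂ)‖ := by
      have := Real.pi_gt_three
      simp [abs_of_pos Real.pi_pos]
      linarith
    exact (div_le_self (norm_nonneg _) h3).trans h1
  have : ‖windingNumber z w‖ ≤ 0 := by
    refine le_of_forall_pos_le_add fun ε hε => ?_
    have := hbound (ε / D) (by positivity)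
    rwa [div_mul_cancel₀ _ hD0.ne', ← zero_add ε] at this
  exact norm_le_zero_iff.1 this

/-! ### Cauchy's theorem -/

/-- Cauchy's theorem for a closed curve whose winding numbers vanish off a bounded open set. -/
theorem contourIntegral_dslope_eq_zero (hz : IsJordanLoop z) {Ω : Set ℂ} (hΩ : IsOpen Ω)
    (hΩb : Bornology.IsBounded Ω) (hzΩ : trace z ⊆ Ω) (hw : ∀ w, w ∉ Ω → windingNumber z w = 0)
    {f : ℂ → ℂ} (hf : DifferentiableOn ℂ f Ω) {w : ℂ} (hwΩ : w ∈ Ω) :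
    contourIntegral z (dslope f w) = 0 := by
  classical
  have hcont := continuousOn_dslope_prod hΩ hf
  have hfz : ContinuousOn f (trace z) := hf.continuousOn.mono hzΩ
  set V : Set ℂ := {w | w ∉ trace z ∧ windingNumber z w = 0} with hVdef
  have hV : IsOpen V := by
    rw [isOpen_iff_mem_nhds]
    rintro v ⟨hv1, hv2⟩
    filter_upwards [hz.eventually_windingNumber_eq hv1] with u hu
    exact ⟨hu.1, hu.2.trans hv2⟩
  have hVcompl : ∀ v, v ∉ Ω → v ∈ V := fun v hv => ⟨fun h => hv (hzΩ h), hw v hv⟩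
  -- Dixon's argument: `H1` is holomorphic on Ω and `H2` on the open set V where the winding number
  -- vanishes. They agree on Ω ∩ V because there the integral of 1/(u - v) is 0, and Ω ∪ V is the
  -- plane. The glued function is entire and tends to 0 at infinity, so it vanishes.
  set H1 : ℂ → ℂ := fun w => contourIntegral z (dslope f w) with hH1
  set H2 : ℂ → ℂ := fun w => contourIntegral z (fun u => f u / (u - w)) with hH2
  have hfdiv : ∀ v, v ∉ trace z → ContinuousOn (fun u => f u / (u - v)) (trace z) := fun v hv =>
    hfz.div (by fun_prop) fun u hu h => hv (by rwa [← sub_eq_zero.1 h])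
  have h1d : DifferentiableOn ℂ H1 Ω := by
    refine hz.differentiableOn_contourIntegral hΩ (fun w hw => ?_) (fun u hu => ?_) fun w hw => ?_
    · exact (((Complex.differentiableOn_dslope (hΩ.mem_nhds hw)).2 hf).continuousOn).mono hzΩ
    · have := (Complex.differentiableOn_dslope (hΩ.mem_nhds (hzΩ hu))).2 hf
      refine this.congr fun v _ => dslope_comm f v u
    · obtain ⟨r, hr, hrΩ⟩ := Metric.nhds_basis_closedBall.mem_iff.1 (hΩ.mem_nhds hw)
      obtain ⟨C, hC⟩ := ((isCompact_closedBall w r).prod hz.isCompact_trace).exists_bound_of_continuousOn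
        (hcont.mono (prod_mono hrΩ hzΩ))
      exact ⟨r, hr, Metric.ball_subset_closedBall.trans hrΩ, C, fun v hv u hu =>
        hC (v, u) ⟨Metric.ball_subset_closedBall hv, hu⟩⟩
  have h2d : DifferentiableOn ℂ H2 V := by
    refine hz.differentiableOn_contourIntegral hV (fun v hv => hfdiv v hv.1) (fun u hu => ?_)
      fun v hv => ?_
    · refine DifferentiableOn.div (differentiableOn_const _) (by fun_prop) fun v hv h => hv.1 ?_
      rwa [← sub_eq_zero.1 h]
    · obtain ⟨r, hr, hrV⟩ := Metric.nhds_basis_closedBall.mem_iff.1 (hV.mem_nhds hv)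
      have : ContinuousOn (fun p : ℂ × ℂ => f p.2 / (p.2 - p.1)) (Metric.closedBall v r ×ˢ trace z) := by
        refine ContinuousOn.div (hfz.comp continuousOn_snd fun p hp => hp.2) (by fun_prop) ?_
        rintro p ⟨hp1, hp2⟩ h
        exact (hrV hp1).1 (by rwa [← sub_eq_zero.1 h])
      obtain ⟨C, hC⟩ := ((isCompact_closedBall v r).prod hz.isCompact_trace).exists_bound_of_continuousOn
        this
      exact ⟨r, hr, Metric.ball_subset_closedBall.trans hrV, C, fun v hv u hu =>
        hC (v, u) ⟨Metric.ball_subset_closedBall hv, hu⟩⟩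
  have h12 : ∀ v ∈ Ω ∩ V, H1 v = H2 v := by
    rintro v ⟨hvΩ, hv1, hv2⟩
    have e1 : H1 v = contourIntegral z (fun u => f u / (u - v) - f v * (1 / (u - v))) := by
      refine contourIntegral_congr fun u hu => ?_
      have hne : u ≠ v := fun h => hv1 (h ▸ hu)
      have : u - v ≠ 0 := sub_ne_zero.2 hne
      rw [dslope_of_ne _ hne, slope_def_field]
      field_simp
    have hpi : (2 * Real.pi * Complex.I : ℂ) ≠ 0 := Complex.two_pi_I_ne_zero
    have e2 : contourIntegral z (fun u => 1 / (u - v)) = 0 := by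
      rw [windingNumber, div_eq_zero_iff] at hv2
      exact hv2.resolve_right hpi
    rw [e1, hz.contourIntegral_sub (g := fun u => f v * (1 / (u - v))) (hfdiv v hv1)
      (continuousOn_const.mul (continuousOn_inv_sub hv1)),
      contourIntegral_const_mul, e2, mul_zero, sub_zero]
  set H : ℂ → ℂ := fun v => if v ∈ Ω then H1 v else H2 v with hH
  have hHV : EqOn H H2 V := fun v hv => by
    by_cases h : v ∈ Ω
    · simp only [hH, if_pos h]; exact h12 v ⟨h, hv⟩
    · simp only [hH, if_neg h]
  have hHΩ : EqOn H H1 Ω := fun v hv => by simp only [hH, if_pos hv]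
  have hHd : Differentiable ℂ H := by
    intro v
    by_cases h : v ∈ Ω
    · exact (h1d.differentiableAt (hΩ.mem_nhds h)).congr_of_eventuallyEq
        (hHΩ.eventuallyEq_of_mem (hΩ.mem_nhds h))
    · have h' := hVcompl v h
      exact (h2d.differentiableAt (hV.mem_nhds h')).congr_of_eventuallyEq
        (hHV.eventuallyEq_of_mem (hV.mem_nhds h'))
  have hlim : Tendsto H (cocompact ℂ) (𝓝 0) := by
    obtain ⟨R, hR⟩ := hΩb.exists_norm_le
    obtain ⟨C, hC⟩ := hz.isCompact_trace.exists_bound_of_continuousOn hfz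
    obtain ⟨D, hD0, hD, -⟩ := hz.exists_deriv_bound
    have hbd : Tendsto (fun v : ℂ => C / (‖v‖ - R) * D) (cocompact ℂ) (𝓝 0) := by
      have h1 : Tendsto (fun v : ℂ => ‖v‖ - R) (cocompact ℂ) atTop :=
        tendsto_atTop_add_const_right _ _ (tendsto_norm_cocompact_atTop (E := ℂ))
      simpa using ((tendsto_const_nhds (x := C)).div_atTop h1).mul_const D
    refine squeeze_zero_norm' ?_ hbd
    filter_upwards [(tendsto_norm_cocompact_atTop (E := ℂ)).eventually_gt_atTop R] with v hv
    have hvΩ : v ∉ Ω := fun h => absurd (hR v h) (not_le.2 hv)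
    simp only [hH, if_neg hvΩ]
    refine norm_contourIntegral_le hD fun u hu => ?_
    have h2 : ‖v‖ - R ≤ ‖u - v‖ := by
      have := norm_sub_norm_le v u
      rw [norm_sub_rev] at this
      linarith [hR u (hzΩ hu)]
    rw [norm_div]
    exact div_le_div₀ ((norm_nonneg _).trans (hC u hu)) (hC u hu) (by linarith) h2
  have := hHd.apply_eq_of_tendsto_cocompact w hlim
  rwa [hHΩ hwΩ] at this

/-- Cauchy's integral formula. -/
theorem contourIntegral_div_sub (hz : IsJordanLoop z) {Ω : Set ℂ} (hΩ : IsOpen Ω)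
    (hΩb : Bornology.IsBounded Ω) (hzΩ : trace z ⊆ Ω) (hw : ∀ w, w ∉ Ω → windingNumber z w = 0)
    {f : ℂ → ℂ} (hf : DifferentiableOn ℂ f Ω) {w : ℂ} (hwΩ : w ∈ Ω) (hwz : w ∉ trace z) :
    contourIntegral z (fun u => f u / (u - w))
      = 2 * Real.pi * Complex.I * windingNumber z w * f w := by
  have h0 := hz.contourIntegral_dslope_eq_zero hΩ hΩb hzΩ hw hf hwΩ
  have e1 : contourIntegral z (dslope f w)
      = contourIntegral z (fun u => f u / (u - w) - f w * (1 / (u - w))) := by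
    refine contourIntegral_congr fun u hu => ?_
    have hne : u ≠ w := fun h => hwz (h ▸ hu)
    have : u - w ≠ 0 := sub_ne_zero.2 hne
    rw [dslope_of_ne _ hne, slope_def_field]
    field_simp
  have hfdiv : ContinuousOn (fun u => f u / (u - w)) (trace z) :=
    (hf.continuousOn.mono hzΩ).div (by fun_prop) fun u hu h => hwz (by rwa [← sub_eq_zero.1 h])
  rw [e1, hz.contourIntegral_sub (g := fun u => f w * (1 / (u - w))) hfdiv
      (continuousOn_const.mul (continuousOn_inv_sub hwz)),
    contourIntegral_const_mul, sub_eq_zero] at h0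
  have hpi : (2 * Real.pi * Complex.I : ℂ) ≠ 0 := Complex.two_pi_I_ne_zero
  rw [h0, windingNumber, mul_div_cancel₀ _ hpi]
  ring

end IsJordanLoop

/-- The points that a closed curve passes through or winds around. -/
def hull (z : ℝ → ℂ) : Set ℂ := {w | w ∈ trace z ∨ windingNumber z w ≠ 0}

namespace IsJordanLoop

variable {z : ℝ → ℂ}

lemma isOpen_compl_hull (hz : IsJordanLoop z) : IsOpen (hull z)ᶜ := by
  rw [isOpen_iff_mem_nhds]
  intro v hv
  simp only [hull, mem_compl_iff, mem_ofPred_eq, not_or, not_not] at hv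
  filter_upwards [hz.eventually_windingNumber_eq hv.1] with u hu
  simp only [hull, mem_compl_iff, mem_ofPred_eq, not_or, not_not]
  exact ⟨hu.1, hu.2.trans hv.2⟩

lemma isOpen_hull_diff (hz : IsJordanLoop z) : IsOpen (hull z \ trace z) := by
  rw [isOpen_iff_mem_nhds]
  rintro v ⟨hv, hv'⟩
  filter_upwards [hz.eventually_windingNumber_eq hv'] with u hu
  exact ⟨Or.inr (by rw [hu.2]; exact hv.resolve_left hv'), hu.1⟩

lemma isOpen_inside (hz : IsJordanLoop z) : IsOpen (inside z) := by
  rw [isOpen_iff_mem_nhds]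
  rintro v ⟨hv, hv'⟩
  filter_upwards [hz.eventually_windingNumber_eq hv] with u hu
  exact ⟨hu.1, hu.2.trans hv'⟩

lemma trace_subset_hull : trace z ⊆ hull z := fun _ h => Or.inl h

lemma inside_subset_hull : inside z ⊆ hull z := fun _ h => Or.inr (by rw [h.2]; exact one_ne_zero)

lemma windingNumber_eq_zero_of_notMem_hull {w : ℂ} (hw : w ∉ hull z) : windingNumber z w = 0 := by
  by_contra h
  exact hw (Or.inr h)

/-- A closed curve in the interior of a set without holes winds only around interior points. -/
lemma hull_subset_interior (hz : IsJordanLoop z) {M : Set ℂ} (hM : IsCompact M)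
    (hMc : IsConnected Mᶜ) (hzM : trace z ⊆ interior M) : hull z ⊆ interior M := by
  have hext : ∀ w ∈ Mᶜ, windingNumber z w = 0 := fun w hw =>
    hz.windingNumber_eq_zero hM.isClosed.isOpen_compl hMc.isPreconnected
      (disjoint_left.2 fun u hu hu' => hu (interior_subset (hzM hu')))
      (fun hb => by
        have := hM.isBounded.union hb
        rw [union_compl_self] at this
        exact NormedSpace.unbounded_univ ℝ ℂ this) hw
  intro w hw
  by_contra hcon
  rcases hw with hw | hw
  · exact hcon (hzM hw)
  have hwz : w ∉ trace z := fun h => hcon (hzM h)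
  -- A point outside the interior is a limit of points of the complement, where the winding number
  -- is 0; local constancy carries this value over.
  have hcl : w ∈ closure Mᶜ := by rwa [closure_compl]
  obtain ⟨u, hu1, hu2⟩ := mem_closure_iff_nhds.1 hcl _ (hz.eventually_windingNumber_eq hwz)
  exact hw (hu1.2.symm.trans (hext u hu2))

lemma isCompact_hull (hz : IsJordanLoop z) {M : Set ℂ} (hM : IsCompact M)
    (hMc : IsConnected Mᶜ) (hzM : trace z ⊆ interior M) : IsCompact (hull z) :=
  Metric.isCompact_of_isClosed_isBounded
    ⟨hz.isOpen_compl_hull⟩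
    (hM.isBounded.subset ((hz.hull_subset_interior hM hMc hzM).trans interior_subset))

/-- A bound near the curve extends to a neighbourhood of the hull. -/
lemma exists_thickening (hz : IsJordanLoop z) {M K : Set ℂ} (hM : IsCompact M)
    (hMc : IsConnected Mᶜ) (hKM : K ⊆ interior M) (hzK : trace z ⊆ interior K) :
    ∃ r > 0, Metric.cthickening r (hull z) ⊆ interior M ∧
      ∀ ν : ℂ → ℂ, DifferentiableOn ℂ ν (interior M) → ∀ b, (∀ u ∈ K, ‖ν u‖ ≤ b) →
        ∀ u ∈ Metric.cthickening r (hull z), ‖ν u‖ ≤ b := by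
  have hzM : trace z ⊆ interior M := hzK.trans (interior_subset.trans hKM)
  have hHc := hz.isCompact_hull hM hMc hzM
  have hHM := hz.hull_subset_interior hM hMc hzM
  obtain ⟨r1, hr1, h1⟩ := hHc.exists_cthickening_subset_open isOpen_interior hHM
  obtain ⟨r2, hr2, h2⟩ := hz.isCompact_trace.exists_cthickening_subset_open isOpen_interior hzK
  refine ⟨min r1 r2, lt_min hr1 hr2, (Metric.cthickening_mono (min_le_left _ _) _).trans h1, ?_⟩
  intro ν hν b hb u hu
  have hbz : ∀ v ∈ Metric.cthickening r2 (trace z), ‖ν v‖ ≤ b := fun v hv =>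
    hb v (interior_subset (h2 hv))
  by_cases huH : u ∈ hull z
  · by_cases huz : u ∈ trace z
    · exact hb u (interior_subset (hzK huz))
    -- Maximum principle: V is open and its frontier lies on the curve, which is contained in K.
    set V := hull z \ trace z with hV
    have hclV : closure V ⊆ hull z := closure_minimal sdiff_subset ⟨hz.isOpen_compl_hull⟩
    refine Complex.norm_le_of_forall_mem_frontier_norm_le (U := V)
      (hHc.isBounded.subset sdiff_subset) ?_ (fun v hv => ?_) (subset_closure ⟨huH, huz⟩)
    · exact DifferentiableOn.diffContOnCl (hν.mono (hclV.trans hHM))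
    · rw [frontier, hz.isOpen_hull_diff.interior_eq] at hv
      have : v ∈ trace z := by
        by_contra hcon
        exact hv.2 ⟨hclV hv.1, hcon⟩
      exact hb v (interior_subset (hzK this))
  · rw [hHc.cthickening_eq_biUnion_closedBall (lt_min hr1 hr2).le, mem_iUnion₂] at hu
    obtain ⟨y, hy, hyu⟩ := hu
    obtain ⟨p, hp, hpd⟩ := hHc.exists_infDist_eq_dist ⟨y, hy⟩ u
    -- Off the hull, the nearest hull point p must lie on the curve: otherwise a whole neighbourhood
    -- of p is in the hull, and moving from p towards u would come closer to u. So u is within r2 of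
    -- the curve, hence in K.
    have hpz : p ∈ trace z := by
      by_contra hcon
      obtain ⟨ε, hε, hball⟩ := Metric.isOpen_iff.1 hz.isOpen_hull_diff p ⟨hp, hcon⟩
      have hne : 0 < dist u p := dist_pos.2 fun h => huH (h ▸ hp)
      set s : ℝ := min (1 / 2) (ε / (2 * dist u p)) with hs
      have hs0 : 0 < s := by positivity
      have hs1 : s ≤ 1 / 2 := min_le_left _ _
      have hs2 : s * dist u p < ε := by
        have : s * dist u p ≤ ε / (2 * dist u p) * dist u p := by gcongr; exact min_le_right _ _
        have e : ε / (2 * dist u p) * dist u p = ε / 2 := by field_simp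
        linarith
      have hv : p + (s : ℂ) * (u - p) ∈ hull z := by
        refine (hball ?_).1
        rw [mem_ball_iff_norm, add_sub_cancel_left, norm_mul, Complex.norm_real,
          Real.norm_of_nonneg hs0.le, ← dist_eq_norm]
        exact hs2
      have h3 : dist u p ≤ dist u (p + (s : ℂ) * (u - p)) := by
        rw [← hpd]; exact Metric.infDist_le_dist_of_mem hv
      have h4 : dist u (p + (s : ℂ) * (u - p)) = (1 - s) * dist u p := by
        rw [dist_eq_norm, dist_eq_norm]
        have : u - (p + (s : ℂ) * (u - p)) = ((1 - s : ℝ) : ℂ) * (u - p) := by push_cast; ring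
        rw [this, norm_mul, Complex.norm_real, Real.norm_of_nonneg (by linarith)]
      nlinarith
    refine hbz u (Metric.mem_cthickening_of_dist_le u p _ _ hpz ?_)
    rw [← hpd]
    refine (Metric.infDist_le_dist_of_mem hy).trans ((Metric.mem_closedBall.1 hyu).trans ?_)
    exact min_le_right _ _

end IsJordanLoop


/-! ### Taylor coefficients as circle integrals -/

lemma hasSum_circleIntegral {ι : Type*} [Countable ι] {F : ι → ℂ → ℂ} {f : ℂ → ℂ} {u : ι → ℝ}
    {c : ℂ} {R : ℝ} (hR : 0 ≤ R) (hF : ∀ i, ContinuousOn (F i) (Metric.sphere c R))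
    (hu : Summable u) (hFu : ∀ i, ∀ w ∈ Metric.sphere c R, ‖F i w‖ ≤ u i)
    (hf : ∀ w ∈ Metric.sphere c R, HasSum (fun i => F i w) (f w)) :
    HasSum (fun i => ∮ w in C(c, R), F i w) (∮ w in C(c, R), f w) := by
  unfold circleIntegral
  have hm : ∀ θ, circleMap c R θ ∈ Metric.sphere c R := fun θ => circleMap_mem_sphere c hR θ
  refine intervalIntegral.hasSum_integral_of_dominated_convergence (fun i _ => R * u i)
    (fun i => ?_) (fun i => ?_) ?_ ?_ ?_
  · refine Continuous.aestronglyMeasurable ?_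
    have h1 : Continuous fun θ => F i (circleMap c R θ) :=
      (hF i).comp_continuous (continuous_circleMap c R) hm
    simp only [deriv_circleMap]
    exact ((continuous_circleMap 0 R).mul continuous_const).smul h1
  · refine Eventually.of_forall fun θ _ => ?_
    rw [norm_smul]
    have : ‖deriv (circleMap c R) θ‖ = R := by simp [abs_of_nonneg hR]
    rw [this]
    exact mul_le_mul_of_nonneg_left (hFu i _ (hm θ)) hR
  · exact Eventually.of_forall fun θ _ => hu.mul_left R
  · exact intervalIntegrable_const
  · exact Eventually.of_forall fun θ _ => (hf _ (hm θ)).const_smul _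

lemma iteratedDeriv_zero_eq_circleIntegral {f : ℂ → ℂ}
    (hf : DifferentiableOn ℂ f (Metric.ball 0 1)) (n : ℕ) :
    ((n.factorial : ℂ))⁻¹ * iteratedDeriv n f 0
      = (2 * Real.pi * Complex.I)⁻¹ * ∮ w in C(0, 1 / 2), (1 / w ^ (n + 1)) * f w := by
  have hd : DiffContOnCl ℂ f (Metric.ball 0 (1 / 2)) := by
    refine DifferentiableOn.diffContOnCl (hf.mono ?_)
    rw [closure_ball _ (by norm_num)]
    exact Metric.closedBall_subset_ball (by norm_num)
  have h := hd.circleIntegral_one_div_sub_center_pow_smul (by norm_num) n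
  simp only [sub_zero, smul_eq_mul] at h
  rw [h]
  have := Complex.two_pi_I_ne_zero
  have := Nat.cast_ne_zero (R := ℂ).2 n.factorial_ne_zero
  field_simp

lemma continuousOn_inv_pow_mul {f : ℂ → ℂ} (hf : DifferentiableOn ℂ f (Metric.ball 0 1)) (n : ℕ) :
    ContinuousOn (fun w => (1 / w ^ (n + 1)) * f w) (Metric.sphere 0 (1 / 2)) := by
  refine ContinuousOn.mul ?_ (hf.continuousOn.mono fun w hw => ?_)
  · refine ContinuousOn.div continuousOn_const (by fun_prop) fun w hw => pow_ne_zero _ ?_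
    rw [← norm_pos_iff, mem_sphere_zero_iff_norm.1 hw]; norm_num
  · rw [mem_ball_zero_iff, mem_sphere_zero_iff_norm.1 hw]; norm_num

/-- Taylor coefficients at 0 are integrals over the circle of radius 1/2, and a normally convergent
series may be integrated term by term. -/
lemma hasSum_iteratedDeriv {ι : Type*} [Countable ι] {F : ι → ℂ → ℂ} {f : ℂ → ℂ} {u : ι → ℝ}
    (hF : ∀ i, DifferentiableOn ℂ (F i) (Metric.ball 0 1)) (hu : Summable u)
    (hFu : ∀ i, ∀ w ∈ Metric.ball (0 : ℂ) 1, ‖F i w‖ ≤ u i)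
    (hf : ∀ w ∈ Metric.ball (0 : ℂ) 1, HasSum (fun i => F i w) (f w)) (n : ℕ) :
    HasSum (fun i => ((n.factorial : ℂ))⁻¹ * iteratedDeriv n (F i) 0)
      (((n.factorial : ℂ))⁻¹ * iteratedDeriv n f 0) := by
  have hfd : DifferentiableOn ℂ f (Metric.ball 0 1) := by
    refine (Complex.differentiableOn_tsum_of_summable_norm hu hF Metric.isOpen_ball hFu).congr ?_
    exact fun w hw => (hf w hw).tsum_eq.symm
  rw [iteratedDeriv_zero_eq_circleIntegral hfd]
  simp only [iteratedDeriv_zero_eq_circleIntegral (hF _)]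
  refine HasSum.mul_left _ ?_
  have hsub : Metric.sphere (0 : ℂ) (1 / 2) ⊆ Metric.ball 0 1 := fun w hw => by
    rw [mem_ball_zero_iff, mem_sphere_zero_iff_norm.1 hw]; norm_num
  refine hasSum_circleIntegral (u := fun i => 2 ^ (n + 1) * u i) (by norm_num)
    (fun i => continuousOn_inv_pow_mul (hF i) n) (hu.mul_left _) (fun i w hw => ?_)
    fun w hw => (hf w (hsub hw)).mul_left _
  rw [norm_mul, norm_div, norm_pow, mem_sphere_zero_iff_norm.1 hw, norm_one]
  have := hFu i w (hsub hw)
  have e : 1 / (1 / 2 : ℝ) ^ (n + 1) = 2 ^ (n + 1) := by rw [one_div_pow, one_div_one_div]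
  rw [e]
  gcongr

/-- The Lagrange inversion formula in one variable. -/
theorem hasSum_lagrange_one {g k : ℂ → ℂ} (hg : DifferentiableOn ℂ g (Metric.ball 0 1))
    (hk : DifferentiableOn ℂ k (Metric.ball 0 1))
    (hg8 : ∀ w ∈ Metric.ball (0 : ℂ) 1, ‖g w‖ ≤ 1 / 8)
    (hgl : ∀ v ∈ Metric.ball (0 : ℂ) 1, ∀ w ∈ Metric.ball (0 : ℂ) 1,
      ‖g v - g w‖ ≤ 1 / 2 * ‖v - w‖)
    {a : ℂ} (ha : a ∈ Metric.ball (0 : ℂ) 1) (hga : g a = a) :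
    HasSum (fun n : ℕ => ((n.factorial : ℂ))⁻¹ * iteratedDeriv n (fun w => g w ^ n * k w) 0)
      (k a / (1 - deriv g a)) := by
  have hsub : Metric.sphere (0 : ℂ) (1 / 2) ⊆ Metric.ball 0 1 := fun w hw => by
    rw [mem_ball_zero_iff, mem_sphere_zero_iff_norm.1 hw]; norm_num
  have hd : ∀ n : ℕ, DifferentiableOn ℂ (fun w => g w ^ n * k w) (Metric.ball 0 1) :=
    fun n => (hg.pow n).mul hk
  simp only [iteratedDeriv_zero_eq_circleIntegral (hd _)]
  -- Since g(a) = a, one has w - g(w) = (w - a) D(w). The divided differences of g are at most 1/2,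
  -- so D has no zero: k/(w - g) has a single simple pole in the disc, with residue k(a)/(1 -
  -- g'(a)).
  set D : ℂ → ℂ := fun w => 1 - dslope g a w with hD
  have hDd : DifferentiableOn ℂ D (Metric.ball 0 1) :=
    (differentiableOn_const _).sub
      ((Complex.differentiableOn_dslope (Metric.isOpen_ball.mem_nhds ha)).2 hg)
  have hsl : ∀ w ∈ Metric.ball (0 : ℂ) 1, ‖dslope g a w‖ ≤ 1 / 2 := by
    intro w hw
    rcases eq_or_ne w a with rfl | hne
    · rw [dslope_same]
      refine (hg.differentiableAt (Metric.isOpen_ball.mem_nhds hw)).hasDerivAt.le_of_lip'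
        (by norm_num) ?_
      filter_upwards [Metric.isOpen_ball.mem_nhds hw] with v hv using hgl v hv w hw
    · rw [dslope_of_ne _ hne, slope_def_field, norm_div,
        div_le_iff₀ (norm_pos_iff.2 (sub_ne_zero.2 hne))]
      exact hgl w hw a ha
  have hD0 : ∀ w ∈ Metric.ball (0 : ℂ) 1, D w ≠ 0 := by
    intro w hw h
    have h1 : dslope g a w = 1 := (sub_eq_zero.1 h).symm
    have := hsl w hw
    rw [h1] at this
    norm_num at this
  have hDe : ∀ w, w - g w = (w - a) * D w := by
    intro w
    have := sub_smul_dslope g a w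
    rw [smul_eq_mul, hga] at this
    simp only [hD]
    linear_combination this
  have haball : a ∈ Metric.ball (0 : ℂ) (1 / 2) := by
    rw [mem_ball_zero_iff, ← hga]
    exact (hg8 a ha).trans_lt (by norm_num)
  have hval : k a / (1 - deriv g a)
      = (2 * Real.pi * Complex.I)⁻¹ * ∮ w in C(0, 1 / 2), k w / (w - g w) := by
    have hdiff : DifferentiableOn ℂ (fun w => k w / D w) (Metric.closedBall 0 (1 / 2)) :=
      (hk.div hDd hD0).mono (Metric.closedBall_subset_ball (by norm_num))
    have h := hdiff.circleIntegral_sub_inv_smul haball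
    simp only [smul_eq_mul] at h
    have e : (∮ w in C(0, 1 / 2), k w / (w - g w))
        = ∮ w in C(0, 1 / 2), (w - a)⁻¹ * (k w / D w) := by
      refine circleIntegral.integral_congr (by norm_num) fun w hw => ?_
      rw [hDe, inv_mul_eq_div, div_div, mul_comm]
    rw [e, h, hD]
    have := Complex.two_pi_I_ne_zero
    simp only [dslope_same]
    field_simp
  rw [hval]
  refine HasSum.mul_left _ ?_
  obtain ⟨Ck, hCk⟩ := (isCompact_sphere (0 : ℂ) (1 / 2)).exists_bound_of_continuousOn
    (hk.continuousOn.mono hsub)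
  -- On the circle of radius 1/2 the ratio |g(w)/w| is at most 2 · 1/8 = 1/4, so k/(w - g) expands
  -- in a geometric series whose terms integrate to the coefficients wanted.
  refine hasSum_circleIntegral (u := fun n => (1 / 4 : ℝ) ^ n * (2 * Ck)) (by norm_num)
    (fun n => continuousOn_inv_pow_mul (hd n) n) ?_ (fun n w hw => ?_) fun w hw => ?_
  · exact (summable_geometric_of_lt_one (by norm_num) (by norm_num)).mul_right _
  · have h1 := hg8 w (hsub hw)
    have h2 := hCk w hw
    rw [norm_mul, norm_mul, norm_div, norm_pow, norm_pow, mem_sphere_zero_iff_norm.1 hw, norm_one]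
    have e : 1 / (1 / 2 : ℝ) ^ (n + 1) = 2 ^ n * 2 := by rw [one_div_pow, one_div_one_div, pow_succ]
    rw [e]
    calc (2 ^ n * 2 : ℝ) * (‖g w‖ ^ n * ‖k w‖) ≤ 2 ^ n * 2 * ((1 / 8) ^ n * Ck) := by gcongr
      _ = (2 * (1 / 8)) ^ n * (2 * Ck) := by rw [mul_pow]; ring
      _ = _ := by norm_num
  · have hw0 : w ≠ 0 := by rw [← norm_pos_iff, mem_sphere_zero_iff_norm.1 hw]; norm_num
    have hlt : ‖g w / w‖ < 1 := by
      rw [norm_div, mem_sphere_zero_iff_norm.1 hw]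
      have := hg8 w (hsub hw)
      rw [div_lt_one (by norm_num)]
      linarith
    have h := (hasSum_geometric_of_norm_lt_one hlt).mul_left (k w / w)
    have hne : w - g w ≠ 0 := by
      intro h0
      have : g w / w = 1 := by rw [← sub_eq_zero.1 h0, div_self hw0]
      rw [this] at hlt
      simp at hlt
    have e2 : k w / w * (1 - g w / w)⁻¹ = k w / (w - g w) := by
      have : 1 - g w / w = (w - g w) / w := by field_simp
      rw [this]
      field_simp
    rw [e2] at h
    have e3 : (fun n : ℕ => (1 / w ^ (n + 1)) * (g w ^ n * k w))
        = fun n => k w / w * (g w / w) ^ n := by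
      funext n
      rw [div_pow, pow_succ]
      field_simp
    rw [e3]
    exact h

/-! ### Iterated partial derivatives -/

lemma partialDeriv_eq_fderiv {s : ℕ} {Φ : (Fin s → ℂ) → ℂ} {ς : Fin s → ℂ}
    (h : DifferentiableAt ℂ Φ ς) (r : Fin s) :
    partialDeriv r Φ ς = fderiv ℂ Φ ς (Pi.single r 1) := by
  unfold partialDeriv
  have h1 : HasDerivAt (fun w => Function.update ς r w) (Pi.single r 1) (ς r) := by
    exact hasDerivAt_update ς r (ς r)
  have h2 : HasFDerivAt Φ (fderiv ℂ Φ ς) (Function.update ς r (ς r)) := by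
    rw [Function.update_eq_self]; exact h.hasFDerivAt
  exact (h2.comp_hasDerivAt (ς r) h1).deriv

lemma analyticOnNhd_partialDeriv {s : ℕ} {Φ : (Fin s → ℂ) → ℂ} {U : Set (Fin s → ℂ)}
    (hU : IsOpen U) (h : AnalyticOnNhd ℂ Φ U) (r : Fin s) :
    AnalyticOnNhd ℂ (partialDeriv r Φ) U := by
  have h1 : AnalyticOnNhd ℂ (fun ς => fderiv ℂ Φ ς (Pi.single r 1)) U := fun ς hς =>
    ((ContinuousLinearMap.apply ℂ ℂ (Pi.single r (1 : ℂ) : Fin s → ℂ)).analyticAt _).comp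
      (h.fderiv ς hς)
  exact h1.congr hU fun ς hς => (partialDeriv_eq_fderiv (h ς hς).differentiableAt r).symm

lemma analyticOnNhd_mixedPartial {s : ℕ} {Φ : (Fin s → ℂ) → ℂ} {U : Set (Fin s → ℂ)}
    (hU : IsOpen U) (h : AnalyticOnNhd ℂ Φ U) (n : Fin s → ℕ) :
    AnalyticOnNhd ℂ (mixedPartial n Φ) U := by
  unfold mixedPartial
  induction List.finRange s with
  | nil => exact h
  | cons r l ih =>
    simp only [List.foldr_cons]
    generalize n r = k
    induction k with
    | zero => exact ih
    | succ k ihk =>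
      rw [Function.iterate_succ_apply']
      exact analyticOnNhd_partialDeriv hU ihk r

lemma partialDeriv_succ_cons {s : ℕ} (r : Fin s) (Ψ : (Fin (s + 1) → ℂ) → ℂ) (a : ℂ) :
    (fun v : Fin s → ℂ => partialDeriv r.succ Ψ (Fin.cons a v))
      = partialDeriv r (fun v => Ψ (Fin.cons a v)) := by
  funext v
  unfold partialDeriv
  simp only [Fin.cons_succ, Fin.cons_update]

/-- `foldr` over `List.finRange` differentiates in coordinate 0 last, so the other derivatives may
be taken with the first coordinate frozen. This is the induction step on the dimension. -/
lemma mixedPartial_succ {s : ℕ} (n : Fin (s + 1) → ℕ) (Φ : (Fin (s + 1) → ℂ) → ℂ) (a : ℂ)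
    (v : Fin s → ℂ) : mixedPartial n Φ (Fin.cons a v)
      = iteratedDeriv (n 0) (fun w => mixedPartial (fun r => n r.succ)
          (fun u => Φ (Fin.cons w u)) v) a := by
  have key : ∀ (l : List (Fin s)) (w : ℂ),
      (fun u : Fin s → ℂ => (l.foldr (fun r G => (partialDeriv r.succ)^[n r.succ] G) Φ) (Fin.cons w u))
        = l.foldr (fun r G => (partialDeriv r)^[n r.succ] G) (fun u => Φ (Fin.cons w u)) := by
    intro l w
    induction l with
    | nil => rfl
    | cons r l ih =>
      simp only [List.foldr_cons]
      generalize n r.succ = k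
      induction k with
      | zero => exact ih
      | succ k ihk =>
        rw [Function.iterate_succ_apply', Function.iterate_succ_apply', partialDeriv_succ_cons, ihk]
  have key0 : ∀ (k : ℕ) (Ψ : (Fin (s + 1) → ℂ) → ℂ) (a : ℂ),
      ((partialDeriv 0)^[k] Ψ) (Fin.cons a v) = iteratedDeriv k (fun w => Ψ (Fin.cons w v)) a := by
    intro k Ψ
    induction k with
    | zero => intro a; simp
    | succ k ih =>
      intro a
      rw [Function.iterate_succ_apply', iteratedDeriv_succ]
      conv_lhs => unfold partialDeriv
      simp only [Fin.update_cons_zero, Fin.cons_zero]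
      congr 1
      funext w
      exact ih w
  unfold mixedPartial
  rw [List.finRange_succ, List.foldr_cons, key0]
  congr 1
  funext w
  rw [List.foldr_map]
  exact congrFun (key _ w) v

lemma cons_mem_ball {s : ℕ} {a : ℂ} {v : Fin s → ℂ} {R : ℝ} (hR : 0 < R) :
    (Fin.cons a v : Fin (s + 1) → ℂ) ∈ Metric.ball (0 : Fin (s + 1) → ℂ) R
      ↔ a ∈ Metric.ball (0 : ℂ) R ∧ v ∈ Metric.ball (0 : Fin s → ℂ) R := by
  simp only [mem_ball_zero_iff, pi_norm_lt_iff hR, Fin.forall_fin_succ, Fin.cons_zero, Fin.cons_succ]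

lemma cons_zero_zero' {s : ℕ} : (Fin.cons (0 : ℂ) (0 : Fin s → ℂ) : Fin (s + 1) → ℂ) = 0 := by
  funext i
  refine Fin.cases ?_ (fun j => ?_) i <;> simp

lemma analyticAt_cons {s : ℕ} (p : ℂ × (Fin s → ℂ)) :
    AnalyticAt ℂ (fun p : ℂ × (Fin s → ℂ) => (Fin.cons p.1 p.2 : Fin (s + 1) → ℂ)) p := by
  refine AnalyticAt.pi fun i => ?_
  refine Fin.cases ?_ (fun j => ?_) i
  · simpa using analyticAt_fst
  · simp only [Fin.cons_succ]
    exact ((ContinuousLinearMap.proj (R := ℂ) (φ := fun _ : Fin s => ℂ) j).analyticAt _).comp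
      analyticAt_snd

lemma analyticOnNhd_cons_right {s : ℕ} {Φ : (Fin (s + 1) → ℂ) → ℂ} {R : ℝ} (hR : 0 < R)
    (h : AnalyticOnNhd ℂ Φ (Metric.ball 0 R)) {a : ℂ} (ha : a ∈ Metric.ball (0 : ℂ) R) :
    AnalyticOnNhd ℂ (fun u : Fin s → ℂ => Φ (Fin.cons a u)) (Metric.ball 0 R) := fun u hu =>
  AnalyticAt.comp (f := fun u : Fin s → ℂ => (Fin.cons a u : Fin (s + 1) → ℂ))
    (h _ ((cons_mem_ball hR).2 ⟨ha, hu⟩))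
    (AnalyticAt.comp (f := fun u : Fin s → ℂ => (a, u)) (analyticAt_cons (a, u))
      (analyticAt_const.prod analyticAt_id))

lemma differentiableOn_mixedPartial_cons {s : ℕ} {Φ : (Fin (s + 1) → ℂ) → ℂ}
    (h : AnalyticOnNhd ℂ Φ (Metric.ball 0 1)) (n : Fin s → ℕ) :
    DifferentiableOn ℂ (fun w => mixedPartial n (fun u => Φ (Fin.cons w u)) 0)
      (Metric.ball 0 1) := by
  -- The multi-index (0, n) does not differentiate in the first coordinate, so the function of w is
  -- the restriction to a line of a mixed partial derivative of Φ, already known to be analytic.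
  have e : ∀ w, mixedPartial n (fun u => Φ (Fin.cons w u)) 0
      = mixedPartial (Fin.cons 0 n) Φ (Fin.cons w 0) := by
    intro w
    rw [mixedPartial_succ]
    simp
  simp only [e]
  intro w hw
  have h1 := analyticOnNhd_mixedPartial Metric.isOpen_ball h (Fin.cons 0 n) (Fin.cons w 0)
    ((cons_mem_ball one_pos).2 ⟨hw, Metric.mem_ball_self one_pos⟩)
  have h2 : AnalyticAt ℂ (fun w : ℂ => (Fin.cons w (0 : Fin s → ℂ) : Fin (s + 1) → ℂ)) w :=
    AnalyticAt.comp (f := fun w : ℂ => (w, (0 : Fin s → ℂ))) (analyticAt_cons (w, 0))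
      (analyticAt_id.prod analyticAt_const)
  exact (AnalyticAt.comp (f := fun w : ℂ => (Fin.cons w (0 : Fin s → ℂ) : Fin (s + 1) → ℂ))
    h1 h2).differentiableAt.differentiableWithinAt

/-- Cauchy's estimates on a polydisc. -/
lemma norm_mixedPartial_le {s : ℕ} {Φ : (Fin s → ℂ) → ℂ} {C : ℝ}
    (h : AnalyticOnNhd ℂ Φ (Metric.ball 0 1)) (hC : ∀ ς ∈ Metric.ball (0 : Fin s → ℂ) 1, ‖Φ ς‖ ≤ C)
    (n : Fin s → ℕ) :
    ‖(∏ r, ((n r).factorial : ℂ))⁻¹ * mixedPartial n Φ 0‖ ≤ C * ∏ r, (2 : ℝ) ^ n r := by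
  induction s with
  | zero => simpa [mixedPartial] using hC 0 (Metric.mem_ball_self one_pos)
  | succ s ih =>
    set f : ℂ → ℂ := fun w => (∏ r : Fin s, ((n r.succ).factorial : ℂ))⁻¹ *
      mixedPartial (fun r => n r.succ) (fun u => Φ (Fin.cons w u)) 0 with hf
    have hfd : DifferentiableOn ℂ f (Metric.ball 0 1) :=
      (differentiableOn_mixedPartial_cons h _).const_mul _
    have hfb : ∀ w ∈ Metric.ball (0 : ℂ) 1, ‖f w‖ ≤ C * ∏ r : Fin s, (2 : ℝ) ^ n r.succ :=
      fun w hw => ih (analyticOnNhd_cons_right one_pos h hw)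
        (fun u hu => hC _ ((cons_mem_ball one_pos).2 ⟨hw, hu⟩)) _
    have e : (∏ r, ((n r).factorial : ℂ))⁻¹ * mixedPartial n Φ 0
        = (((n 0).factorial : ℂ))⁻¹ * iteratedDeriv (n 0) f 0 := by
      rw [← cons_zero_zero', mixedPartial_succ, Fin.prod_univ_succ, mul_inv, hf]
      rw [iteratedDeriv_const_mul_field]
      ring
    rw [e, norm_mul, norm_inv, Complex.norm_natCast]
    have hd : DiffContOnCl ℂ f (Metric.ball 0 (1 / 2)) := by
      refine DifferentiableOn.diffContOnCl (hfd.mono ?_)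
      rw [closure_ball _ (by norm_num)]
      exact Metric.closedBall_subset_ball (by norm_num)
    have h1 := Complex.norm_iteratedDeriv_le_of_forall_mem_sphere_norm_le (n 0)
      (by norm_num : (0 : ℝ) < 1 / 2) hd fun w hw => hfb w (by
        rw [mem_ball_zero_iff, mem_sphere_zero_iff_norm.1 hw]; norm_num)
    have hfac : (0 : ℝ) < (n 0).factorial := by exact_mod_cast (n 0).factorial_pos
    rw [Fin.prod_univ_succ]
    calc _ ≤ (((n 0).factorial : ℝ))⁻¹ * ((n 0).factorial * (C * ∏ r : Fin s, (2 : ℝ) ^ n r.succ)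
          / (1 / 2) ^ n 0) := by gcongr
      _ = _ := by rw [one_div_pow]; field_simp

lemma summable_prod_geometric (s : ℕ) {a : ℝ} (ha0 : 0 ≤ a) (ha : a < 1) :
    Summable fun n : Fin s → ℕ => ∏ r, a ^ n r := by
  induction s with
  | zero => exact Summable.of_finite
  | succ s ih =>
    rw [← (Fin.consEquiv fun _ : Fin (s + 1) => ℕ).summable_iff]
    have := (summable_geometric_of_lt_one ha0 ha).mul_of_nonneg ih (fun n => by positivity)
      (fun n => Finset.prod_nonneg fun r _ => by positivity)
    refine this.congr fun p => ?_
    simp [Fin.prod_univ_succ, Fin.consEquiv]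


/-! ### The multidimensional Lagrange inversion formula -/

/-- The Jacobian matrix of a map given by its coordinates. -/
noncomputable def jacobian {s : ℕ} (G : Fin s → (Fin s → ℂ) → ℂ) (v : Fin s → ℂ) :
    Matrix (Fin s) (Fin s) ℂ :=
  Matrix.of fun r p => partialDeriv p (G r) v

/-- The hypotheses of the Lagrange inversion formula. -/
structure IsLagrangeMap {s : ℕ} (G : Fin s → (Fin s → ℂ) → ℂ) : Prop where
  analytic : ∀ r, AnalyticOnNhd ℂ (G r) (Metric.ball 0 1)
  small : ∀ r, ∀ ς ∈ Metric.ball (0 : Fin s → ℂ) 1, ‖G r ς‖ ≤ 1 / 8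
  lipschitz : ∀ r, ∀ ς ∈ Metric.ball (0 : Fin s → ℂ) 1, ∀ ς' ∈ Metric.ball (0 : Fin s → ℂ) 1,
    ‖G r ς - G r ς'‖ ≤ 1 / 2 * ‖ς - ς'‖

/-- Cramer's rule: adj(A) A c = det(A) c. In the component 0, where c equals 1, only the (0, 0)
cofactor survives. -/
lemma det_eq_of_mulVec {s : ℕ} (A : Matrix (Fin (s + 1)) (Fin (s + 1)) ℂ) (c : Fin (s + 1) → ℂ)
    (hc0 : c 0 = 1) (x : ℂ) (h0 : A.mulVec c 0 = x) (hs : ∀ r : Fin s, A.mulVec c r.succ = 0) :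
    A.det = x * (A.submatrix Fin.succ Fin.succ).det := by
  have h1 : A.adjugate.mulVec (A.mulVec c) 0 = A.det := by
    rw [Matrix.mulVec_mulVec, Matrix.adjugate_mul, Matrix.smul_mulVec, Matrix.one_mulVec]
    simp [hc0]
  rw [← h1, Matrix.mulVec, dotProduct, Fin.sum_univ_succ]
  simp only [hs, mul_zero, Finset.sum_const_zero, add_zero, h0]
  rw [Matrix.adjugate_fin_succ_eq_det_submatrix]
  simp [mul_comm]

lemma fderiv_eq_sum_partialDeriv {s : ℕ} {Φ : (Fin s → ℂ) → ℂ} {ς : Fin s → ℂ}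
    (h : DifferentiableAt ℂ Φ ς) (c : Fin s → ℂ) :
    fderiv ℂ Φ ς c = ∑ p, partialDeriv p Φ ς * c p := by
  have := (fderiv ℂ Φ ς).toLinearMap.pi_apply_eq_sum_univ c
  simp only [ContinuousLinearMap.coe_coe, smul_eq_mul] at this
  rw [this]
  refine Finset.sum_congr rfl fun p _ => ?_
  rw [partialDeriv_eq_fderiv h, mul_comm]
  congr 3
  funext j
  simp [Pi.single_apply, eq_comm]

lemma norm_cons_sub {s : ℕ} (a a' : ℂ) (v v' : Fin s → ℂ) :
    ‖(Fin.cons a v : Fin (s + 1) → ℂ) - Fin.cons a' v'‖ ≤ max ‖a - a'‖ ‖v - v'‖ := by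
  rw [pi_norm_le_iff_of_nonneg (by positivity)]
  intro i
  refine Fin.cases ?_ (fun j => ?_) i
  · simp
  · simp only [Pi.sub_apply, Fin.cons_succ]
    exact (norm_le_pi_norm (v - v') j).trans (le_max_right _ _)

namespace IsLagrangeMap

variable {s : ℕ}

/-- A kernel vector c would satisfy c_r = DG_r(v) c for all r, whereas each DG_r(v) has norm at most
1/2 for the sup norm. -/
lemma det_ne_zero {G : Fin s → (Fin s → ℂ) → ℂ} (hG : IsLagrangeMap G) {v : Fin s → ℂ}
    (hv : v ∈ Metric.ball (0 : Fin s → ℂ) 1) : (1 - jacobian G v).det ≠ 0 := by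
  intro h
  obtain ⟨c, hc0, hc⟩ := Matrix.exists_mulVec_eq_zero_iff.2 h
  have hle : ∀ r, ‖c r‖ ≤ 1 / 2 * ‖c‖ := by
    intro r
    have hd : DifferentiableAt ℂ (G r) v := (hG.analytic r v hv).differentiableAt
    have h1 : c r = fderiv ℂ (G r) v c := by
      have := congrFun hc r
      rw [Matrix.sub_mulVec, Matrix.one_mulVec, Pi.sub_apply, Pi.zero_apply, sub_eq_zero] at this
      rw [this, fderiv_eq_sum_partialDeriv hd]
      rfl
    rw [h1]
    refine (ContinuousLinearMap.le_opNorm _ _).trans ?_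
    gcongr
    refine hd.hasFDerivAt.le_of_lip' (by norm_num) ?_
    filter_upwards [Metric.isOpen_ball.mem_nhds hv] with u hu using hG.lipschitz r u hu v hv
  have h2 : ‖c‖ ≤ 1 / 2 * ‖c‖ := (pi_norm_le_iff_of_nonneg (by positivity)).2 hle
  have h3 : 0 < ‖c‖ := norm_pos_iff.2 hc0
  linarith

lemma cons {G : Fin (s + 1) → (Fin (s + 1) → ℂ) → ℂ} (hG : IsLagrangeMap G) {a : ℂ}
    (ha : a ∈ Metric.ball (0 : ℂ) 1) :
    IsLagrangeMap (fun (r : Fin s) u => G r.succ (Fin.cons a u)) where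
  analytic r := analyticOnNhd_cons_right one_pos (hG.analytic r.succ) ha
  small r u hu := hG.small r.succ _ ((cons_mem_ball one_pos).2 ⟨ha, hu⟩)
  lipschitz r u hu u' hu' := by
    refine (hG.lipschitz r.succ _ ((cons_mem_ball one_pos).2 ⟨ha, hu⟩) _
      ((cons_mem_ball one_pos).2 ⟨ha, hu'⟩)).trans ?_
    have := norm_cons_sub a a u u'
    simp only [sub_self, norm_zero, norm_nonneg, sup_of_le_right] at this
    gcongr

/-- The open unit ball is not complete; the contraction is run on the closed ball of radius 1/8,
into which T maps the unit ball. -/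
lemma exists_fixedPoint_family {ι : Type*} [Fintype ι] {U : Set ℂ} (hU : IsOpen U)
    {T : ℂ → (ι → ℂ) → ι → ℂ}
    (hT : ∀ a ∈ U, ∀ v ∈ Metric.ball (0 : ι → ℂ) 1, ‖T a v‖ ≤ 1 / 8)
    (hTc : ∀ a ∈ U, ∀ v ∈ Metric.ball (0 : ι → ℂ) 1, ∀ w ∈ Metric.ball (0 : ι → ℂ) 1,
      ‖T a v - T a w‖ ≤ 1 / 2 * ‖v - w‖)
    (hTd : ∀ Λ : ℂ → ι → ℂ, DifferentiableOn ℂ Λ U → MapsTo Λ U (Metric.ball 0 1) →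
      DifferentiableOn ℂ (fun a => T a (Λ a)) U) :
    ∃ Λ : ℂ → ι → ℂ, DifferentiableOn ℂ Λ U ∧ MapsTo Λ U (Metric.ball 0 1) ∧
      ∀ a ∈ U, T a (Λ a) = Λ a := by
  have hsub : Metric.closedBall (0 : ι → ℂ) (1 / 8) ⊆ Metric.ball 0 1 :=
    Metric.closedBall_subset_ball (by norm_num)
  obtain ⟨Λ, h1, h2, h3⟩ := exists_differentiableOn_fixedPoint hU
    (Q := Metric.closedBall (0 : ι → ℂ) (1 / 8)) Metric.isClosed_closedBall
    Metric.isBounded_closedBall (w₀ := 0) (Metric.mem_closedBall_self (by norm_num)) (T := T)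
    (fun a ha v hv => mem_closedBall_zero_iff.2 (hT a ha v (hsub hv)))
    (fun a ha v hv w hw => hTc a ha v (hsub hv) w (hsub hw))
    (fun Λ hΛ hm => hTd Λ hΛ fun a ha => hsub (hm ha))
  exact ⟨Λ, h1, fun a ha => hsub (h2 ha), h3⟩

lemma exists_fixedPoint {G : Fin s → (Fin s → ℂ) → ℂ} (hG : IsLagrangeMap G) :
    ∃ v ∈ Metric.ball (0 : Fin s → ℂ) 1, ∀ r, G r v = v r := by
  obtain ⟨Λ, h1, h2, h3⟩ := exists_fixedPoint_family (U := univ) isOpen_univ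
    (T := fun _ v r => G r v)
    (fun a _ v hv => (pi_norm_le_iff_of_nonneg (by norm_num)).2 fun r => hG.small r v hv)
    (fun a _ v hv w hw => (pi_norm_le_iff_of_nonneg (by positivity)).2
      fun r => hG.lipschitz r v hv w hw)
    (fun Λ hΛ hm => differentiableOn_pi.2 fun r a ha =>
      ((hG.analytic r _ (hm ha)).differentiableAt.comp a
        (hΛ.differentiableAt (isOpen_univ.mem_nhds ha))).differentiableWithinAt)
  exact ⟨Λ 0, h2 (mem_univ 0), fun r => congrFun (h3 0 (mem_univ 0)) r⟩

lemma fixedPoint_unique {G : Fin s → (Fin s → ℂ) → ℂ} (hG : IsLagrangeMap G) {v w : Fin s → ℂ}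
    (hv : v ∈ Metric.ball (0 : Fin s → ℂ) 1) (hw : w ∈ Metric.ball (0 : Fin s → ℂ) 1)
    (hv' : ∀ r, G r v = v r) (hw' : ∀ r, G r w = w r) : v = w := by
  have h : ‖v - w‖ ≤ 1 / 2 * ‖v - w‖ := (pi_norm_le_iff_of_nonneg (by positivity)).2 fun r => by
    rw [Pi.sub_apply, ← hv', ← hw']; exact hG.lipschitz r v hv w hw
  have : ‖v - w‖ ≤ 0 := by linarith [norm_nonneg (v - w)]
  exact sub_eq_zero.1 (norm_le_zero_iff.1 this)

lemma analyticOnNhd_term {G : Fin s → (Fin s → ℂ) → ℂ} (hG : IsLagrangeMap G)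
    {H : (Fin s → ℂ) → ℂ} (hH : AnalyticOnNhd ℂ H (Metric.ball 0 1)) (n : Fin s → ℕ) :
    AnalyticOnNhd ℂ (fun ς => (∏ r, G r ς ^ n r) * H ς) (Metric.ball 0 1) := fun ς hς =>
  (Finset.univ.analyticAt_fun_prod fun r _ => (hG.analytic r ς hς).pow _).mul (hH ς hς)

lemma norm_term_le {G : Fin s → (Fin s → ℂ) → ℂ} (hG : IsLagrangeMap G)
    {H : (Fin s → ℂ) → ℂ} {C : ℝ} (hHC : ∀ ς ∈ Metric.ball (0 : Fin s → ℂ) 1, ‖H ς‖ ≤ C)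
    (n : Fin s → ℕ) {ς : Fin s → ℂ} (hς : ς ∈ Metric.ball (0 : Fin s → ℂ) 1) :
    ‖(∏ r, G r ς ^ n r) * H ς‖ ≤ (∏ r, (1 / 8 : ℝ) ^ n r) * C := by
  rw [norm_mul, norm_prod]
  refine mul_le_mul (Finset.prod_le_prod (fun r _ => norm_nonneg _) fun r _ => ?_) (hHC ς hς)
    (norm_nonneg _) (Finset.prod_nonneg fun r _ => by positivity)
  rw [norm_pow]
  exact pow_le_pow_left₀ (norm_nonneg _) (hG.small r ς hς) _

/-- Cauchy's estimates at radius 1/2 cost 2 ^ n_r in each variable, and the factors G_r bring 8⁻¹ to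
the same power; the product 1/4 is summable. -/
lemma norm_coeff_le {G : Fin s → (Fin s → ℂ) → ℂ} (hG : IsLagrangeMap G)
    {H : (Fin s → ℂ) → ℂ} (hH : AnalyticOnNhd ℂ H (Metric.ball 0 1)) {C : ℝ}
    (hHC : ∀ ς ∈ Metric.ball (0 : Fin s → ℂ) 1, ‖H ς‖ ≤ C) (n : Fin s → ℕ) :
    ‖(∏ r, ((n r).factorial : ℂ))⁻¹ * mixedPartial n (fun ς => (∏ r, G r ς ^ n r) * H ς) 0‖
      ≤ C * ∏ r, (1 / 4 : ℝ) ^ n r := by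
  refine (norm_mixedPartial_le (hG.analyticOnNhd_term hH n)
    (fun ς hς => hG.norm_term_le hHC n hς) n).trans (le_of_eq ?_)
  rw [mul_comm _ C, mul_assoc, ← Finset.prod_mul_distrib]
  congr 1
  refine Finset.prod_congr rfl fun r _ => ?_
  rw [← mul_pow]; norm_num

/-- Elimination: with the first coordinate a as a parameter, the last s equations have a fixed point
w(a), holomorphic in a. The curve a ↦ (a, w(a)) is 1-Lipschitz, so the remaining equation in one
variable keeps the contraction constant 1/2. -/
lemma exists_reduction {G : Fin (s + 1) → (Fin (s + 1) → ℂ) → ℂ} (hG : IsLagrangeMap G) :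
    ∃ w : ℂ → Fin s → ℂ, DifferentiableOn ℂ w (Metric.ball 0 1) ∧
      MapsTo w (Metric.ball 0 1) (Metric.ball 0 1) ∧
      (∀ a ∈ Metric.ball (0 : ℂ) 1, ∀ r : Fin s, G r.succ (Fin.cons a (w a)) = w a r) ∧
      ∀ a ∈ Metric.ball (0 : ℂ) 1, ∀ a' ∈ Metric.ball (0 : ℂ) 1,
        ‖(Fin.cons a (w a) : Fin (s + 1) → ℂ) - Fin.cons a' (w a')‖ ≤ ‖a - a'‖ := by
  obtain ⟨w, h1, h2, h3⟩ := exists_fixedPoint_family (U := Metric.ball (0 : ℂ) 1) Metric.isOpen_ball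
    (T := fun a (v : Fin s → ℂ) r => G r.succ (Fin.cons a v))
    (fun a ha v hv => (pi_norm_le_iff_of_nonneg (by norm_num)).2 fun r => (hG.cons ha).small r v hv)
    (fun a ha v hv w hw => (pi_norm_le_iff_of_nonneg (by positivity)).2
      fun r => (hG.cons ha).lipschitz r v hv w hw)
    (fun Λ hΛ hm => differentiableOn_pi.2 fun r a ha => by
      have hd : DifferentiableAt ℂ (fun a => (Fin.cons a (Λ a) : Fin (s + 1) → ℂ)) a :=
        DifferentiableAt.comp (f := fun a => (a, Λ a)) a (analyticAt_cons (a, Λ a)).differentiableAt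
          (differentiableAt_id.prodMk (hΛ.differentiableAt (Metric.isOpen_ball.mem_nhds ha)))
      exact (DifferentiableAt.comp (f := fun a => (Fin.cons a (Λ a) : Fin (s + 1) → ℂ)) a
        (hG.analytic r.succ _ ((cons_mem_ball one_pos).2 ⟨ha, hm ha⟩)).differentiableAt
        hd).differentiableWithinAt)
  refine ⟨w, h1, h2, fun a ha r => congrFun (h3 a ha) r, fun a ha a' ha' => ?_⟩
  have hw : ‖w a - w a'‖ ≤ 1 / 2 * max ‖a - a'‖ ‖w a - w a'‖ := by
    refine (pi_norm_le_iff_of_nonneg (by positivity)).2 fun r => ?_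
    rw [Pi.sub_apply, ← congrFun (h3 a ha) r, ← congrFun (h3 a' ha') r]
    refine (hG.lipschitz r.succ _ ((cons_mem_ball one_pos).2 ⟨ha, h2 ha⟩) _
      ((cons_mem_ball one_pos).2 ⟨ha', h2 ha'⟩)).trans ?_
    have := norm_cons_sub a a' (w a) (w a')
    gcongr
  refine (norm_cons_sub _ _ _ _).trans (max_le le_rfl ?_)
  rcases le_total ‖a - a'‖ ‖w a - w a'‖ with h | h
  · rw [max_eq_right h] at hw
    linarith [norm_nonneg (w a - w a'), norm_nonneg (a - a')]
  · exact h

/-- The multidimensional Lagrange inversion formula. -/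
theorem hasSum {G : Fin s → (Fin s → ℂ) → ℂ} (hG : IsLagrangeMap G)
    {H : (Fin s → ℂ) → ℂ} (hH : AnalyticOnNhd ℂ H (Metric.ball 0 1)) {C : ℝ}
    (hHC : ∀ ς ∈ Metric.ball (0 : Fin s → ℂ) 1, ‖H ς‖ ≤ C) {v : Fin s → ℂ}
    (hv : v ∈ Metric.ball (0 : Fin s → ℂ) 1) (hGv : ∀ r, G r v = v r) :
    HasSum (fun n : Fin s → ℕ => (∏ r, ((n r).factorial : ℂ))⁻¹ *
        mixedPartial n (fun ς => (∏ r, G r ς ^ n r) * H ς) 0)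
      (H v / (1 - jacobian G v).det) := by
  induction s generalizing C with
  | zero =>
    have hv0 : v = 0 := Subsingleton.elim _ _
    subst hv0
    simp [mixedPartial]
  | succ s ih =>
    have hball1 : IsOpen (Metric.ball (0 : ℂ) 1) := Metric.isOpen_ball
    obtain ⟨w, hwd, hwm, hwf, hwl⟩ := hG.exists_reduction
    have hmem : ∀ a ∈ Metric.ball (0 : ℂ) 1,
        (Fin.cons a (w a) : Fin (s + 1) → ℂ) ∈ Metric.ball (0 : Fin (s + 1) → ℂ) 1 :=
      fun a ha => (cons_mem_ball one_pos).2 ⟨ha, hwm ha⟩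
    have hcd : ∀ a ∈ Metric.ball (0 : ℂ) 1,
        HasDerivAt (fun a => (Fin.cons a (w a) : Fin (s + 1) → ℂ)) (Fin.cons 1 (deriv w a)) a := by
      intro a ha
      have hwa := (hwd.differentiableAt (hball1.mem_nhds ha)).hasDerivAt
      rw [hasDerivAt_pi] at hwa ⊢
      intro i
      refine Fin.cases ?_ (fun j => ?_) i
      · simp only [Fin.cons_zero]; exact hasDerivAt_id a
      · simp only [Fin.cons_succ]; exact hwa j
    have hcomp : ∀ Ψ : (Fin (s + 1) → ℂ) → ℂ, AnalyticOnNhd ℂ Ψ (Metric.ball 0 1) →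
        DifferentiableOn ℂ (fun a => Ψ (Fin.cons a (w a))) (Metric.ball 0 1) := fun Ψ hΨ a ha =>
      ((hΨ _ (hmem a ha)).differentiableAt.hasFDerivAt.comp_hasDerivAt a
        (hcd a ha)).differentiableAt.differentiableWithinAt
    set J' : ℂ → Matrix (Fin s) (Fin s) ℂ := fun a =>
      jacobian (fun (r : Fin s) u => G r.succ (Fin.cons a u)) (w a) with hJ'
    have hJ'e : ∀ a r p, J' a r p = partialDeriv p.succ (G r.succ) (Fin.cons a (w a)) := by
      intro a r p
      simp only [hJ', jacobian, Matrix.of_apply]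
      exact (congrFun (partialDeriv_succ_cons p (G r.succ) a) (w a)).symm
    -- The induction hypothesis sums the series over the last s indices for fixed a, which produces
    -- k(a); the one-variable formula for g and k then sums over the first index.
    set g : ℂ → ℂ := fun a => G 0 (Fin.cons a (w a)) with hg
    set k : ℂ → ℂ := fun a => H (Fin.cons a (w a)) / (1 - J' a).det with hk
    have hdet0 : ∀ a ∈ Metric.ball (0 : ℂ) 1, (1 - J' a).det ≠ 0 := fun a ha =>
      (hG.cons ha).det_ne_zero (hwm ha)
    have hgd : DifferentiableOn ℂ g (Metric.ball 0 1) := hcomp _ (hG.analytic 0)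
    have hkd : DifferentiableOn ℂ k (Metric.ball 0 1) := by
      refine DifferentiableOn.div (hcomp _ hH) ?_ hdet0
      simp only [Matrix.det_apply, Matrix.sub_apply, hJ'e]
      refine DifferentiableOn.fun_sum fun σ _ => DifferentiableOn.const_smul ?_ _
      refine DifferentiableOn.fun_finsetProd fun r _ => ?_
      exact (differentiableOn_const _).sub
        (hcomp _ (analyticOnNhd_partialDeriv Metric.isOpen_ball (hG.analytic _) _))
    -- the fixed point
    have hv0 : v 0 ∈ Metric.ball (0 : ℂ) 1 := by
      rw [mem_ball_zero_iff] at hv ⊢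
      exact (norm_le_pi_norm v 0).trans_lt hv
    have hvt : Fin.tail v ∈ Metric.ball (0 : Fin s → ℂ) 1 := by
      rw [← Fin.cons_self_tail v] at hv
      exact ((cons_mem_ball one_pos).1 hv).2
    have hwv : w (v 0) = Fin.tail v := by
      refine (hG.cons hv0).fixedPoint_unique (hwm hv0) hvt (hwf _ hv0) fun r => ?_
      rw [Fin.cons_self_tail, hGv]; rfl
    have hcv : (Fin.cons (v 0) (w (v 0)) : Fin (s + 1) → ℂ) = v := by
      rw [hwv, Fin.cons_self_tail]
    have hgv : g (v 0) = v 0 := by simp only [hg, hcv, hGv]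
    have hone := hasSum_lagrange_one hgd hkd (fun a ha => hG.small 0 _ (hmem a ha))
      (fun a ha b hb => (hG.lipschitz 0 _ (hmem a ha) _ (hmem b hb)).trans
        (by gcongr; exact hwl a ha b hb)) hv0 hgv
    -- the determinant
    have hdet : (1 - jacobian G v).det = (1 - deriv g (v 0)) * (1 - J' (v 0)).det := by
      have hder : ∀ r, HasDerivAt (fun a => G r (Fin.cons a (w a)))
          (∑ p, partialDeriv p (G r) v * (Fin.cons 1 (deriv w (v 0)) : Fin (s + 1) → ℂ) p) (v 0) := by
        intro r
        have hd : DifferentiableAt ℂ (G r) v := (hG.analytic r v hv).differentiableAt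
        have h1 := hcd (v 0) hv0
        rw [← fderiv_eq_sum_partialDeriv hd]
        have h2 : HasFDerivAt (G r) (fderiv ℂ (G r) v) (Fin.cons (v 0) (w (v 0))) := by
          rw [hcv]; exact hd.hasFDerivAt
        exact h2.comp_hasDerivAt (v 0) h1
      -- The tangent vector (1, w') of the solution curve: 1 - DG kills it in the last s rows, as w
      -- solves these equations along the curve, and gives 1 - g' in row 0.
      have hmv : ∀ r, (1 - jacobian G v).mulVec (Fin.cons 1 (deriv w (v 0))) r
          = (Fin.cons 1 (deriv w (v 0)) : Fin (s + 1) → ℂ) r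
            - deriv (fun a => G r (Fin.cons a (w a))) (v 0) := by
        intro r
        rw [Matrix.sub_mulVec, Matrix.one_mulVec, Pi.sub_apply, (hder r).deriv]
        rfl
      rw [det_eq_of_mulVec _ (Fin.cons 1 (deriv w (v 0))) (by simp) (1 - deriv g (v 0))]
      · congr 2
        ext r p
        rw [Matrix.submatrix_apply, Matrix.sub_apply, Matrix.sub_apply, hJ'e, hcv]
        simp [jacobian, Matrix.one_apply]
      · rw [hmv]; simp [hg]
      · intro r
        rw [hmv, Fin.cons_succ, sub_eq_zero]
        have e : (fun a => G r.succ (Fin.cons a (w a))) =ᶠ[𝓝 (v 0)] fun a => w a r := by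
          filter_upwards [hball1.mem_nhds hv0] with a ha using hwf a ha r
        rw [e.deriv_eq]
        have hwa := (hwd.differentiableAt (hball1.mem_nhds hv0)).hasDerivAt
        exact ((hasDerivAt_pi.1 hwa) r).deriv.symm
    have hval : H v / (1 - jacobian G v).det = k (v 0) / (1 - deriv g (v 0)) := by
      rw [hdet, hk]
      simp only [hcv]
      rw [div_div, mul_comm (1 - deriv g (v 0))]
    rw [hval]
    -- the double series
    set F : (Fin (s + 1) → ℕ) → ℂ := fun n => (∏ r, ((n r).factorial : ℂ))⁻¹ *
        mixedPartial n (fun ς => (∏ r, G r ς ^ n r) * H ς) 0 with hF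
    have hsum : Summable F := Summable.of_norm_bounded
      ((summable_prod_geometric (s + 1) (by norm_num) (by norm_num)).mul_left C)
      fun n => hG.norm_coeff_le hH hHC n
    have hC0 : 0 ≤ C := (norm_nonneg _).trans (hHC 0 (Metric.mem_ball_self one_pos))
    -- For fixed n0 the factor G_0 ^ n0 is absorbed into H, the induction hypothesis applies for
    -- every a, and the resulting series of functions of a is differentiated n0 times term by term.
    have hfib : ∀ n0 : ℕ, HasSum (fun m : Fin s → ℕ => F (Fin.cons n0 m))
        (((n0.factorial : ℂ))⁻¹ * iteratedDeriv n0 (fun a => g a ^ n0 * k a) 0) := by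
      intro n0
      have hH0 : AnalyticOnNhd ℂ (fun ς => G 0 ς ^ n0 * H ς) (Metric.ball 0 1) := fun ς hς =>
        ((hG.analytic 0 ς hς).pow n0).mul (hH ς hς)
      have hH0C : ∀ ς ∈ Metric.ball (0 : Fin (s + 1) → ℂ) 1, ‖G 0 ς ^ n0 * H ς‖ ≤ C := by
        intro ς hς
        rw [norm_mul, norm_pow]
        have h1 : ‖G 0 ς‖ ^ n0 ≤ 1 :=
          pow_le_one₀ (norm_nonneg _) ((hG.small 0 ς hς).trans (by norm_num))
        calc _ ≤ 1 * C := mul_le_mul h1 (hHC ς hς) (norm_nonneg _) zero_le_one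
          _ = C := one_mul C
      set f : (Fin s → ℕ) → ℂ → ℂ := fun m a => (∏ r, ((m r).factorial : ℂ))⁻¹ *
        mixedPartial m (fun u => (∏ r : Fin s, G r.succ (Fin.cons a u) ^ m r)
          * (G 0 (Fin.cons a u) ^ n0 * H (Fin.cons a u))) 0 with hf
      have hfd : ∀ m, DifferentiableOn ℂ (f m) (Metric.ball 0 1) := by
        intro m
        refine DifferentiableOn.const_mul ?_ _
        have hΦ : AnalyticOnNhd ℂ (fun ς => (∏ r : Fin s, G r.succ ς ^ m r)
            * (G 0 ς ^ n0 * H ς)) (Metric.ball 0 1) := fun ς hς =>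
          (Finset.univ.analyticAt_fun_prod fun r _ => (hG.analytic r.succ ς hς).pow _).mul
            (hH0 ς hς)
        exact differentiableOn_mixedPartial_cons hΦ m
      have hkey := hasSum_iteratedDeriv (F := f) (f := fun a => g a ^ n0 * k a)
        (u := fun m => C * ∏ r, (1 / 4 : ℝ) ^ m r) hfd
        ((summable_prod_geometric s (by norm_num) (by norm_num)).mul_left C)
        (fun m a ha => (hG.cons ha).norm_coeff_le (analyticOnNhd_cons_right one_pos hH0 ha)
          (fun u hu => hH0C _ ((cons_mem_ball one_pos).2 ⟨ha, hu⟩)) m)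
        (fun a ha => by
          have := ih (hG.cons ha) (analyticOnNhd_cons_right one_pos hH0 ha)
            (fun u hu => hH0C _ ((cons_mem_ball one_pos).2 ⟨ha, hu⟩)) (hwm ha) (hwf a ha)
          simpa only [hg, hk, mul_div_assoc] using this) n0
      have e : (fun m : Fin s → ℕ => F (Fin.cons n0 m))
          = fun m => ((n0.factorial : ℂ))⁻¹ * iteratedDeriv n0 (f m) 0 := by
        funext m
        simp only [hF, hf]
        rw [← cons_zero_zero', mixedPartial_succ, Fin.prod_univ_succ, mul_inv,
          iteratedDeriv_const_mul_field]
        simp only [Fin.cons_zero, Fin.cons_succ]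
        rw [mul_assoc]
        congr 4
        funext a
        congr 1
        funext u
        rw [Fin.prod_univ_succ]
        simp only [Fin.cons_zero, Fin.cons_succ]
        ring
      rw [e]
      exact hkey
    have hpair : HasSum (fun p : ℕ × (Fin s → ℕ) => F (Fin.cons p.1 p.2)) (∑' n, F n) :=
      ((Fin.consEquiv fun _ : Fin (s + 1) => ℕ).hasSum_iff (f := F)).2 hsum.hasSum
    have := hpair.prod_fiberwise hfib
    rw [← this.unique hone]
    exact hsum.hasSum

end IsLagrangeMap


/-! ### Expansion of a finite determinant in principal minors. -/

section VonKoch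

variable {ι : Type*} [Fintype ι] [DecidableEq ι]

/-- The maps with image s are its m! enumerations, and permuting rows and columns simultaneously
does not change a determinant. -/
lemma sum_det_submatrix_image_eq {m : ℕ} (A : Matrix ι ι ℂ) (s : Finset ι) (hs : s.card = m) :
    ∑ f : Fin m → ι with Finset.univ.image f = s, (A.submatrix f f).det
      = m.factorial * (A.submatrix (Subtype.val : s → ι) (Subtype.val : s → ι)).det := by
  have hcard : Fintype.card (Fin m ≃ s) = m.factorial := by
    have e : Fin m ≃ s := Fintype.equivOfCardEq (by simp [hs])
    rw [Fintype.card_equiv e, Fintype.card_fin]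
  rw [← hcard, ← nsmul_eq_mul, ← Finset.card_univ, ← Finset.sum_const]
  symm
  refine Finset.sum_bij (fun (e : Fin m ≃ s) _ => fun i => (e i : ι)) ?_ ?_ ?_ ?_
  · intro e _
    simp only [Finset.mem_filter, Finset.mem_univ, true_and]
    ext a
    simp only [Finset.mem_image, Finset.mem_univ, true_and]
    constructor
    · rintro ⟨i, rfl⟩; exact (e i).2
    · intro ha; exact ⟨e.symm ⟨a, ha⟩, by simp⟩
  · intro e _ e' _ h
    ext i
    exact congrFun h i
  · intro f hf
    simp only [Finset.mem_filter, Finset.mem_univ, true_and] at hf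
    have hmem : ∀ i, f i ∈ s := fun i => by
      rw [← hf]; exact Finset.mem_image_of_mem f (Finset.mem_univ i)
    let g : Fin m → s := fun i => ⟨f i, hmem i⟩
    have hg : Function.Surjective g := by
      rintro ⟨a, ha⟩
      rw [← hf] at ha
      obtain ⟨i, -, hi⟩ := Finset.mem_image.1 ha
      exact ⟨i, Subtype.ext hi⟩
    have hb : Function.Bijective g :=
      (Fintype.bijective_iff_surjective_and_card g).2 ⟨hg, by simp [hs]⟩
    exact ⟨Equiv.ofBijective g hb, Finset.mem_univ _, rfl⟩
  · intro e _
    have := Matrix.det_submatrix_equiv_self e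
      (A.submatrix (Subtype.val : s → ι) (Subtype.val : s → ι))
    rw [← this, Matrix.submatrix_submatrix]
    rfl

/-- A map that is not injective repeats a row, so only enumerations of sets with m elements
contribute. -/
lemma sum_det_submatrix (A : Matrix ι ι ℂ) (m : ℕ) :
    ∑ f : Fin m → ι, (A.submatrix f f).det
      = m.factorial * ∑ s ∈ (Finset.univ : Finset ι).powersetCard m,
          (A.submatrix (Subtype.val : s → ι) (Subtype.val : s → ι)).det := by
  rw [← Finset.sum_fiberwise (Finset.univ : Finset (Fin m → ι)) (fun f => Finset.univ.image f),
    Finset.mul_sum]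
  have h0 : ∀ s : Finset ι, s ∉ (Finset.univ : Finset ι).powersetCard m →
      ∑ f : Fin m → ι with Finset.univ.image f = s, (A.submatrix f f).det = 0 := by
    intro s hs
    refine Finset.sum_eq_zero fun f hf => ?_
    simp only [Finset.mem_filter, Finset.mem_univ, true_and] at hf
    have hni : ¬ Function.Injective f := by
      intro hi
      refine hs (Finset.mem_powersetCard.2 ⟨Finset.subset_univ _, ?_⟩)
      rw [← hf, Finset.card_image_of_injective _ hi, Finset.card_univ, Fintype.card_fin]
    simp only [Function.Injective, not_forall] at hni
    obtain ⟨i, j, hij, hne⟩ := hni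
    exact Matrix.det_zero_of_row_eq hne (by ext k; simp [Matrix.submatrix_apply, hij])
  rw [← Finset.sum_subset (Finset.subset_univ ((Finset.univ : Finset ι).powersetCard m))
    fun s _ hs => h0 s hs]
  exact Finset.sum_congr rfl fun s hs =>
    sum_det_submatrix_image_eq A s (Finset.mem_powersetCard.1 hs).2

/-- The expansion of `det (1 + A)` in principal minors. -/
theorem det_one_add_eq_sum (A : Matrix ι ι ℂ) :
    ∑' m : ℕ, ((m.factorial : ℂ))⁻¹ * ∑ f : Fin m → ι, (A.submatrix f f).det = (1 + A).det := by
  have hcoeff := Matrix.coeff_det_one_add_X_smul_eq_sum_minors A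
  -- The sums of principal minors are the coefficients of det(1 + X A), which is then evaluated at X
  -- = 1.
  set P := (1 + (Polynomial.X : Polynomial ℂ) • A.map Polynomial.C).det with hP
  have hterm : ∀ m : ℕ, ((m.factorial : ℂ))⁻¹ * ∑ f : Fin m → ι, (A.submatrix f f).det
      = P.coeff m := by
    intro m
    rw [sum_det_submatrix, hcoeff, inv_mul_cancel_left₀ (by exact_mod_cast m.factorial_ne_zero)]
  simp_rw [hterm]
  rw [tsum_eq_sum (s := Finset.range (P.natDegree + 1))]
  · have h1 : P.eval 1 = (1 + A).det := by
      rw [hP, ← Polynomial.coe_evalRingHom, RingHom.map_det]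
      congr 1
      ext i j
      simp [Matrix.one_apply, apply_ite]
    rw [← h1, Polynomial.eval_eq_sum_range]
    simp
  · intro m hm
    refine Polynomial.coeff_eq_zero_of_natDegree_lt ?_
    simpa using hm

end VonKoch

/-! ### Weighted points with equal integrals of holomorphic functions, and Fredholm series. -/

section MultiIntegral

variable {X Y : Type*} [MeasurableSpace X] [MeasurableSpace Y]

lemma integral_pi_succ {E : Type*} [NormedAddCommGroup E] [NormedSpace ℝ E] {m : ℕ}
    (μ : Measure X) [SigmaFinite μ] (F : (Fin (m + 1) → X) → E) :
    ∫ x, F x ∂(Measure.pi fun _ => μ)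
      = ∫ p : X × (Fin m → X), F (Fin.cons p.1 p.2) ∂(μ.prod (Measure.pi fun _ => μ)) := by
  rw [← ((measurePreserving_piFinSuccAbove (fun _ : Fin (m + 1) => μ) 0).symm).integral_comp']
  refine integral_congr_ae (Eventually.of_forall fun p => ?_)
  simp only [MeasurableEquiv.piFinSuccAbove_symm_apply, Fin.insertNthEquiv, Equiv.coe_fn_mk,
    Fin.insertNth_zero]
  rfl

variable [TopologicalSpace X] [SecondCountableTopology X] [BorelSpace X]
  [TopologicalSpace Y] [SecondCountableTopology Y] [BorelSpace Y]

lemma differentiableOn_cons {m : ℕ} {S : Set ℂ} {G : (Fin (m + 1) → ℂ) → ℂ}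
    (hG : DifferentiableOn ℂ G (Set.pi univ fun _ => S)) {a : ℂ} (ha : a ∈ S) :
    DifferentiableOn ℂ (fun v : Fin m → ℂ => G (Fin.cons a v)) (Set.pi univ fun _ => S) := by
  have hd : Differentiable ℂ fun v : Fin m → ℂ => (Fin.cons a v : Fin (m + 1) → ℂ) := by
    refine differentiable_pi.2 fun i => ?_
    refine Fin.cases ?_ (fun j => ?_) i
    · simp
    · simp only [Fin.cons_succ]; fun_prop
  refine hG.comp hd.differentiableOn fun v hv i _ => ?_
  refine Fin.cases ?_ (fun j => ?_) i
  · simpa using ha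
  · simpa using hv j (mem_univ j)

lemma differentiableOn_cons_left {m : ℕ} {S : Set ℂ} {G : (Fin (m + 1) → ℂ) → ℂ}
    (hG : DifferentiableOn ℂ G (Set.pi univ fun _ => S)) {v : Fin m → ℂ} (hv : ∀ i, v i ∈ S) :
    DifferentiableOn ℂ (fun a : ℂ => G (Fin.cons a v)) S := by
  have hd : Differentiable ℂ fun a : ℂ => (Fin.cons a v : Fin (m + 1) → ℂ) := by
    refine differentiable_pi.2 fun i => ?_
    refine Fin.cases ?_ (fun j => ?_) i
    · simp only [Fin.cons_zero]; fun_prop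
    · simp
  refine hG.comp hd.differentiableOn fun a ha i _ => ?_
  refine Fin.cases ?_ (fun j => ?_) i
  · simpa using ha
  · simpa using hv j

lemma cons_mem_univ_pi {m : ℕ} {Q : Set ℂ} {a : ℂ} (ha : a ∈ Q) {v : Fin m → ℂ}
    (hv : ∀ i, v i ∈ Q) : (Fin.cons a v : Fin (m + 1) → ℂ) ∈ Set.pi univ fun _ => Q := by
  intro i _
  refine Fin.cases ?_ (fun j => ?_) i
  · simpa using ha
  · simpa using hv j

lemma continuous_comp_cons {T : Type*} [TopologicalSpace T] {m : ℕ} {Q : Set ℂ}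
    {G : (Fin (m + 1) → ℂ) → ℂ} (hG : ContinuousOn G (Set.pi univ fun _ => Q)) {a : T → ℂ}
    {v : T → Fin m → ℂ} (ha : Continuous a) (hv : Continuous v) (haQ : ∀ t, a t ∈ Q)
    (hvQ : ∀ t i, v t i ∈ Q) : Continuous fun t => G (Fin.cons (a t) (v t)) := by
  refine hG.comp_continuous ?_ fun t => cons_mem_univ_pi (haQ t) (hvQ t)
  refine continuous_pi fun i => ?_
  refine Fin.cases ?_ (fun j => ?_) i
  · simpa using ha
  · simp only [Fin.cons_succ]; exact (continuous_apply j).comp hv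

/-- Two weighted families of points on which holomorphic functions of one variable have equal
integrals also have equal integrals of holomorphic functions of several variables. -/
theorem multiIntegral_congr {μ : Measure X} [IsFiniteMeasure μ] {μ' : Measure Y}
    [IsFiniteMeasure μ'] {S Q : Set ℂ} (hQ : IsCompact Q) (hQS : Q ⊆ S)
    {z : X → ℂ} {z' : Y → ℂ} (hz : Continuous z) (hz' : Continuous z')
    (hzQ : ∀ x, z x ∈ Q) (hzQ' : ∀ y, z' y ∈ Q) {w : X → ℂ} {w' : Y → ℂ}
    (hw : Integrable w μ) (hw' : Integrable w' μ')
    (hone : ∀ f : ℂ → ℂ, DifferentiableOn ℂ f S →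
      ∫ x, f (z x) * w x ∂μ = ∫ y, f (z' y) * w' y ∂μ') (m : ℕ) :
    ∀ G : (Fin m → ℂ) → ℂ, DifferentiableOn ℂ G (Set.pi univ fun _ => S) →
      ∫ x, G (fun i => z (x i)) * ∏ i, w (x i) ∂(Measure.pi fun _ => μ)
        = ∫ y, G (fun i => z' (y i)) * ∏ i, w' (y i) ∂(Measure.pi fun _ => μ') := by
  induction m with
  | zero =>
    intro G _
    simp only [Finset.univ_eq_empty, Finset.prod_empty, mul_one]
    have e : ∀ x : Fin 0 → X, (fun i => z (x i)) = (default : Fin 0 → ℂ) := fun x => by ext i; exact i.elim0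
    have e' : ∀ x : Fin 0 → Y, (fun i => z' (x i)) = (default : Fin 0 → ℂ) := fun x => by ext i; exact i.elim0
    simp only [e, e']
    simp [measureReal_def]
  | succ m ih =>
    intro G hG
    have hGc : ContinuousOn G (Set.pi univ fun _ => Q) :=
      hG.continuousOn.mono (Set.pi_mono fun _ _ => hQS)
    obtain ⟨C, hC⟩ := (isCompact_univ_pi fun _ : Fin (m + 1) => hQ).exists_bound_of_continuousOn hGc
    have hcons : ∀ a ∈ Q, ∀ v : Fin m → ℂ, (∀ i, v i ∈ Q) →
        (Fin.cons a v : Fin (m + 1) → ℂ) ∈ Set.pi univ fun _ => Q := fun a ha v hv =>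
      cons_mem_univ_pi ha hv
    have hcm : ∀ (x : X × (Fin m → X)), (fun i => z ((Fin.cons x.1 x.2 : Fin (m + 1) → X) i))
        = Fin.cons (z x.1) (fun i => z (x.2 i)) := by
      intro x; ext i; refine Fin.cases ?_ (fun j => ?_) i <;> simp
    have hcm' : ∀ (x : Y × (Fin m → Y)), (fun i => z' ((Fin.cons x.1 x.2 : Fin (m + 1) → Y) i))
        = Fin.cons (z' x.1) (fun i => z' (x.2 i)) := by
      intro x; ext i; refine Fin.cases ?_ (fun j => ?_) i <;> simp
    have hWX : Integrable (fun x : Fin m → X => ∏ i, w (x i)) (Measure.pi fun _ => μ) :=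
      Integrable.fintype_prod fun _ => hw
    have hWY : Integrable (fun x : Fin m → Y => ∏ i, w' (x i)) (Measure.pi fun _ => μ') :=
      Integrable.fintype_prod fun _ => hw'
    have i1 : Integrable (fun p : X × (Fin m → X) =>
        G (Fin.cons (z p.1) fun i => z (p.2 i)) * (w p.1 * ∏ i, w (p.2 i)))
        (μ.prod (Measure.pi fun _ => μ)) := by
      refine (Integrable.mul_prod hw hWX).bdd_mul (c := C) ?_ (Eventually.of_forall fun p =>
        hC _ (hcons _ (hzQ _) _ fun i => hzQ _))
      exact (continuous_comp_cons hGc (hz.comp continuous_fst) (continuous_pi fun i => hz.comp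
        ((continuous_apply i).comp continuous_snd)) (fun t => hzQ _)
        (fun t i => hzQ _)).aestronglyMeasurable
    have i2 : Integrable (fun p : X × (Fin m → Y) =>
        G (Fin.cons (z p.1) fun i => z' (p.2 i)) * (w p.1 * ∏ i, w' (p.2 i)))
        (μ.prod (Measure.pi fun _ => μ')) := by
      refine (Integrable.mul_prod hw hWY).bdd_mul (c := C) ?_ (Eventually.of_forall fun p =>
        hC _ (hcons _ (hzQ _) _ fun i => hzQ' _))
      exact (continuous_comp_cons hGc (hz.comp continuous_fst) (continuous_pi fun i => hz'.comp
        ((continuous_apply i).comp continuous_snd)) (fun t => hzQ _)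
        (fun t i => hzQ' _)).aestronglyMeasurable
    have i3 : Integrable (fun p : Y × (Fin m → Y) =>
        G (Fin.cons (z' p.1) fun i => z' (p.2 i)) * (w' p.1 * ∏ i, w' (p.2 i)))
        (μ'.prod (Measure.pi fun _ => μ')) := by
      refine (Integrable.mul_prod hw' hWY).bdd_mul (c := C) ?_ (Eventually.of_forall fun p =>
        hC _ (hcons _ (hzQ' _) _ fun i => hzQ' _))
      exact (continuous_comp_cons hGc (hz'.comp continuous_fst) (continuous_pi fun i => hz'.comp
        ((continuous_apply i).comp continuous_snd)) (fun t => hzQ' _)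
        (fun t i => hzQ' _)).aestronglyMeasurable
    rw [integral_pi_succ, integral_pi_succ]
    simp only [hcm, hcm', Fin.prod_univ_succ, Fin.cons_zero, Fin.cons_succ]
    rw [integral_prod _ i1, integral_prod_symm _ i3]
    -- The last m points are exchanged by the induction hypothesis with the first one fixed; after
    -- Fubini the first point is exchanged by the one-variable hypothesis.
    calc ∫ x, ∫ v : Fin m → X, G (Fin.cons (z x) fun i => z (v i)) * (w x * ∏ i, w (v i))
            ∂(Measure.pi fun _ => μ) ∂μ
        = ∫ x, ∫ v : Fin m → Y, G (Fin.cons (z x) fun i => z' (v i)) * (w x * ∏ i, w' (v i))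
            ∂(Measure.pi fun _ => μ') ∂μ := by
          refine integral_congr_ae (Eventually.of_forall fun x => ?_)
          have := ih (fun v => G (Fin.cons (z x) v)) (differentiableOn_cons hG (hQS (hzQ x)))
          simp only [mul_left_comm _ (w x)]
          rw [integral_const_mul, integral_const_mul, this]
      _ = ∫ v : Fin m → Y, ∫ x, G (Fin.cons (z x) fun i => z' (v i)) * (w x * ∏ i, w' (v i))
            ∂μ ∂(Measure.pi fun _ => μ') := integral_integral_swap i2
      _ = _ := by
          refine integral_congr_ae (Eventually.of_forall fun v => ?_)
          have := hone (fun a => G (Fin.cons a fun i => z' (v i)))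
            (differentiableOn_cons_left hG fun i => hQS (hzQ' _))
          simp only [← mul_assoc]
          rw [integral_mul_const, integral_mul_const, this]

/-- The Fredholm series of the kernel `κ(z x, z y) w(y)`. -/
noncomputable def fredholmSeries (μ : Measure X) (z w : X → ℂ) (κ : ℂ → ℂ → ℂ) : ℂ :=
  ∑' m : ℕ, ((m.factorial : ℂ))⁻¹ * ∫ x : Fin m → X,
    (Matrix.of fun i j : Fin m => κ (z (x i)) (z (x j))).det * ∏ i, w (x i) ∂(Measure.pi fun _ => μ)

lemma differentiableOn_det {m : ℕ} {S : Set ℂ} {κ : ℂ → ℂ → ℂ}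
    (hκ : DifferentiableOn ℂ (fun p : ℂ × ℂ => κ p.1 p.2) (S ×ˢ S)) :
    DifferentiableOn ℂ (fun v : Fin m → ℂ => (Matrix.of fun i j : Fin m => κ (v i) (v j)).det)
      (Set.pi univ fun _ => S) := by
  have h1 : ∀ i j : Fin m, DifferentiableOn ℂ (fun v : Fin m → ℂ => κ (v i) (v j))
      (Set.pi univ fun _ => S) := by
    intro i j
    have hd : DifferentiableOn ℂ (fun v : Fin m → ℂ => (v i, v j)) (Set.pi univ fun _ => S) := by
      fun_prop
    exact DifferentiableOn.comp (g := fun p : ℂ × ℂ => κ p.1 p.2) hκ hd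
      fun v hv => ⟨hv i (mem_univ i), hv j (mem_univ j)⟩
  simp only [Matrix.det_apply, Matrix.of_apply]
  refine DifferentiableOn.fun_sum fun σ _ => ?_
  have h2 : DifferentiableOn ℂ (fun v : Fin m → ℂ => ∏ i, κ (v (σ i)) (v i))
      (Set.pi univ fun _ => S) := fun v hv =>
    (HasFDerivWithinAt.finsetProd fun i _ =>
      (h1 (σ i) i v hv).hasFDerivWithinAt).differentiableWithinAt
  exact h2.const_smul _

/-- The determinant in each term is holomorphic in all the points together, so only the integrals of
holomorphic functions of one variable matter. This is what moves a Fredholm determinant from the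
loop to the roots, or to the segment. -/
theorem fredholmSeries_congr {μ : Measure X} [IsFiniteMeasure μ] {μ' : Measure Y}
    [IsFiniteMeasure μ'] {S Q : Set ℂ} (hQ : IsCompact Q) (hQS : Q ⊆ S)
    {z : X → ℂ} {z' : Y → ℂ} (hz : Continuous z) (hz' : Continuous z')
    (hzQ : ∀ x, z x ∈ Q) (hzQ' : ∀ y, z' y ∈ Q) {w : X → ℂ} {w' : Y → ℂ}
    (hw : Integrable w μ) (hw' : Integrable w' μ')
    (hone : ∀ f : ℂ → ℂ, DifferentiableOn ℂ f S →
      ∫ x, f (z x) * w x ∂μ = ∫ y, f (z' y) * w' y ∂μ') {κ : ℂ → ℂ → ℂ}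
    (hκ : DifferentiableOn ℂ (fun p : ℂ × ℂ => κ p.1 p.2) (S ×ˢ S)) :
    fredholmSeries μ z w κ = fredholmSeries μ' z' w' κ := by
  unfold fredholmSeries
  refine tsum_congr fun m => ?_
  congr 1
  exact multiIntegral_congr hQ hQS hz hz' hzQ hzQ' hw hw' hone m _ (differentiableOn_det hκ)

end MultiIntegral

lemma det_mul_row_of {m : ℕ} (A : Fin m → Fin m → ℂ) (v : Fin m → ℂ) :
    (Matrix.of fun i j => A i j * v j).det = (Matrix.of A).det * ∏ j, v j := by
  rw [mul_comm, ← Matrix.det_mul_row]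
  congr 1
  ext i j
  simp [mul_comm]

/-- The Fredholm series on a finite set is a determinant. -/
theorem fredholmSeries_fintype {ι : Type*} [Fintype ι] [DecidableEq ι] [MeasurableSpace ι]
    [MeasurableSingletonClass ι] (lam c : ι → ℂ) (κ : ℂ → ℂ → ℂ) :
    fredholmSeries Measure.count lam c κ
      = (1 + Matrix.of fun i j => κ (lam i) (lam j) * c j).det := by
  rw [← det_one_add_eq_sum]
  unfold fredholmSeries
  refine tsum_congr fun m => ?_
  congr 1
  rw [integral_fintype .of_finite]
  refine Finset.sum_congr rfl fun f _ => ?_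
  have h1 : (Measure.pi fun _ : Fin m => (Measure.count : Measure ι)).real {f} = 1 := by
    rw [measureReal_def, Measure.pi_singleton]
    simp
  rw [h1, one_smul, ← det_mul_row_of]
  rfl

/-- A factor depending on the second variable scales the columns, so it can be moved into the
weight. `IccExtend` makes the curve continuous on the whole line without changing it on [a, b]. -/
lemma fredholmDet_eq_fredholmSeries {z : ℝ → ℂ} {a b : ℝ} (hab : a ≤ b) (κ : ℂ → ℂ → ℂ) (ψ : ℂ → ℂ) :
    fredholmDet z a b (fun u v => κ u v * ψ v)
      = fredholmSeries (volume.restrict (Icc a b)) (IccExtend hab ((Icc a b).domRestrict z))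
          (fun t => ψ (z t) * deriv z t) κ := by
  unfold fredholmDet fredholmSeries
  refine tsum_congr fun m => ?_
  congr 1
  rw [← Measure.restrict_pi_pi]
  refine setIntegral_congr_fun (MeasurableSet.univ_pi fun _ => measurableSet_Icc) fun t ht => ?_
  have h1 : ∀ i, IccExtend hab ((Icc a b).domRestrict z) (t i) = z (t i) := fun i => by
    rw [IccExtend_of_mem hab _ (ht i (mem_univ i))]
    rfl
  simp only [h1]
  rw [det_mul_row_of, Finset.prod_mul_distrib, mul_assoc]


/-! ### Lipschitz estimates for determinants and Fredholm determinants. -/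

lemma norm_prod_sub_prod_le {ι : Type*} (s : Finset ι) {a b : ι → ℂ} {x d : ℝ} (hx : 0 ≤ x)
    (hd : 0 ≤ d) (ha : ∀ i ∈ s, ‖a i‖ ≤ x) (hb : ∀ i ∈ s, ‖b i‖ ≤ x)
    (hab : ∀ i ∈ s, ‖a i - b i‖ ≤ d * x) :
    ‖∏ i ∈ s, a i - ∏ i ∈ s, b i‖ ≤ s.card * (d * x ^ s.card) := by
  classical
  induction s using Finset.induction_on with
  | empty => simp
  | insert i s his ih =>
    have h1 := ih (fun j hj => ha j (Finset.mem_insert_of_mem hj))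
      (fun j hj => hb j (Finset.mem_insert_of_mem hj))
      (fun j hj => hab j (Finset.mem_insert_of_mem hj))
    have h2 : ‖∏ j ∈ s, b j‖ ≤ x ^ s.card := by
      rw [norm_prod, ← Finset.prod_const]
      exact Finset.prod_le_prod (fun _ _ => norm_nonneg _)
        fun j hj => hb j (Finset.mem_insert_of_mem hj)
    rw [Finset.prod_insert his, Finset.prod_insert his, Finset.card_insert_of_notMem his]
    have e : a i * ∏ j ∈ s, a j - b i * ∏ j ∈ s, b j
        = a i * (∏ j ∈ s, a j - ∏ j ∈ s, b j) + (a i - b i) * ∏ j ∈ s, b j := by ring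
    rw [e]
    calc _ ≤ ‖a i‖ * ‖∏ j ∈ s, a j - ∏ j ∈ s, b j‖ + ‖a i - b i‖ * ‖∏ j ∈ s, b j‖ := by
          refine (norm_add_le _ _).trans ?_
          rw [norm_mul, norm_mul]
      _ ≤ x * (s.card * (d * x ^ s.card)) + d * x * x ^ s.card := by
          gcongr
          · exact ha i (Finset.mem_insert_self _ _)
          · exact hab i (Finset.mem_insert_self _ _)
      _ = _ := by push_cast; ring

/-- Leibniz's formula bounded term by term. The loss of n! is harmless, since the Fredholm series
divides by it; Hadamard's inequality is not needed for small kernels. -/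
lemma norm_det_sub_det_le {n : ℕ} {A B : Matrix (Fin n) (Fin n) ℂ} {x d : ℝ} (hx : 0 ≤ x)
    (hd : 0 ≤ d) (hA : ∀ i j, ‖A i j‖ ≤ x) (hB : ∀ i j, ‖B i j‖ ≤ x)
    (hAB : ∀ i j, ‖A i j - B i j‖ ≤ d * x) :
    ‖A.det - B.det‖ ≤ n.factorial * (n * (d * x ^ n)) := by
  rw [Matrix.det_apply, Matrix.det_apply, ← Finset.sum_sub_distrib]
  refine (norm_sum_le_of_le _ (fun σ _ => ?_ :
    ∀ σ ∈ (Finset.univ : Finset (Equiv.Perm (Fin n))), _ ≤ (n * (d * x ^ n) : ℝ))).trans ?_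
  · rw [← smul_sub]
    have h := norm_prod_sub_prod_le (Finset.univ : Finset (Fin n)) hx hd
      (fun i _ => hA (σ i) i) (fun i _ => hB (σ i) i) (fun i _ => hAB (σ i) i)
    rw [Finset.card_univ, Fintype.card_fin] at h
    rcases Int.units_eq_one_or (Equiv.Perm.sign σ) with hs | hs
    · simpa [hs] using h
    · rw [norm_sub_rev] at h
      simpa [hs] using h
  · rw [Finset.sum_const, Finset.card_univ, Fintype.card_perm, Fintype.card_fin, nsmul_eq_mul]

lemma norm_det_le {n : ℕ} {A : Matrix (Fin n) (Fin n) ℂ} {x : ℝ} (hA : ∀ i j, ‖A i j‖ ≤ x) :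
    ‖A.det‖ ≤ n.factorial * x ^ n := by
  rw [Matrix.det_apply]
  refine (norm_sum_le_of_le _ (fun σ _ => ?_ :
    ∀ σ ∈ (Finset.univ : Finset (Equiv.Perm (Fin n))), _ ≤ (x ^ n : ℝ))).trans ?_
  · have h : ‖∏ i, A (σ i) i‖ ≤ x ^ n := by
      rw [norm_prod]
      refine (Finset.prod_le_prod (fun _ _ => norm_nonneg _) fun i _ => hA (σ i) i).trans ?_
      simp
    rcases Int.units_eq_one_or (Equiv.Perm.sign σ) with hs | hs <;> simpa [hs] using h
  · rw [Finset.sum_const, Finset.card_univ, Fintype.card_perm, Fintype.card_fin, nsmul_eq_mul]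

lemma fredholmDet_zero (z : ℝ → ℂ) (a b : ℝ) : fredholmDet z a b (fun _ _ => 0) = 1 := by
  unfold fredholmDet
  rw [tsum_eq_single 0]
  · simp [measureReal_def]
  · intro m hm
    obtain ⟨k, rfl⟩ := Nat.exists_eq_succ_of_ne_zero hm
    have : (Matrix.of fun _ _ : Fin (k + 1) => (0 : ℂ)).det = 0 :=
      Matrix.det_eq_zero_of_row_eq_zero 0 (by simp)
    simp [this]

namespace IsJordanLoop

variable {z : ℝ → ℂ}

/-- `fredholmDet` integrates over the closed cube, so the two arbitrary endpoint values of `deriv z`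
are included in the bound. -/
lemma exists_deriv_bound_Icc (hz : IsJordanLoop z) :
    ∃ D > 0, ∀ t ∈ Icc (0 : ℝ) 1, ‖deriv z t‖ ≤ D := by
  obtain ⟨D, hD0, hD, -⟩ := hz.exists_deriv_bound
  refine ⟨max D (max ‖deriv z 0‖ ‖deriv z 1‖), lt_max_of_lt_left hD0, fun t ht => ?_⟩
  rcases eq_or_lt_of_le ht.1 with h | h
  · subst h; exact (le_max_left _ _).trans (le_max_right _ _)
  rcases eq_or_lt_of_le ht.2 with h' | h'
  · subst h'; exact (le_max_right _ _).trans (le_max_right _ _)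
  · exact (hD t ⟨h, h'⟩).trans (le_max_left _ _)

lemma norm_fredholm_integrand_le {D : ℝ} (hD : ∀ t ∈ Icc (0 : ℝ) 1, ‖deriv z t‖ ≤ D) {m : ℕ}
    {t : Fin m → ℝ} (ht : t ∈ Set.pi univ fun _ : Fin m => Icc (0 : ℝ) 1) {a : ℂ} {b : ℝ}
    (hab : ‖a‖ ≤ b) : ‖a * ∏ i, deriv z (t i)‖ ≤ b * D ^ m := by
  rw [norm_mul, norm_prod]
  have : ∏ i, ‖deriv z (t i)‖ ≤ D ^ m := by
    refine (Finset.prod_le_prod (fun _ _ => norm_nonneg _) fun i _ => hD _ (ht i (mem_univ i))).trans ?_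
    simp
  exact mul_le_mul hab this (Finset.prod_nonneg fun _ _ => norm_nonneg _)
    ((norm_nonneg _).trans hab)

lemma volume_cube (m : ℕ) : volume (Set.pi univ fun _ : Fin m => Icc (0 : ℝ) 1) = 1 := by
  rw [volume_pi_pi]
  simp

lemma integrableOn_fredholm (hz : IsJordanLoop z) {k : ℂ → ℂ → ℂ}
    (hk : ContinuousOn (fun p : ℂ × ℂ => k p.1 p.2) (trace z ×ˢ trace z)) (m : ℕ) :
    IntegrableOn (fun t : Fin m → ℝ =>
      (Matrix.of fun i j : Fin m => k (z (t i)) (z (t j))).det * ∏ i, deriv z (t i))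
      (Set.pi univ fun _ : Fin m => Icc (0 : ℝ) 1) := by
  obtain ⟨D, -, hD⟩ := hz.exists_deriv_bound_Icc
  have hms : MeasurableSet (Set.pi univ fun _ : Fin m => Icc (0 : ℝ) 1) :=
    MeasurableSet.univ_pi fun _ => measurableSet_Icc
  have hc : ContinuousOn (fun t : Fin m → ℝ =>
      (Matrix.of fun i j : Fin m => k (z (t i)) (z (t j))).det)
      (Set.pi univ fun _ : Fin m => Icc (0 : ℝ) 1) := by
    simp only [Matrix.det_apply, Matrix.of_apply]
    refine continuousOn_finsetSum _ fun σ _ => ContinuousOn.const_smul ?_ _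
    refine continuousOn_finsetProd _ fun i _ => ?_
    have h1 : ∀ i, ContinuousOn (fun t : Fin m → ℝ => z (t i))
        (Set.pi univ fun _ : Fin m => Icc (0 : ℝ) 1) := fun i =>
      hz.continuousOn.comp (continuous_apply i).continuousOn fun t ht => ht i (mem_univ i)
    exact ContinuousOn.comp (g := fun p : ℂ × ℂ => k p.1 p.2) hk ((h1 (σ i)).prodMk (h1 i))
      fun t ht => ⟨mem_trace (ht _ (mem_univ _)), mem_trace (ht _ (mem_univ _))⟩
  obtain ⟨C, hC⟩ := (isCompact_univ_pi fun _ : Fin m => isCompact_Icc).exists_bound_of_continuousOn hc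
  have hfin : volume (Set.pi univ fun _ : Fin m => Icc (0 : ℝ) 1) < ⊤ := by
    rw [volume_cube]; exact ENNReal.one_lt_top
  have : IsFiniteMeasure ((volume : Measure (Fin m → ℝ)).restrict
      (Set.pi univ fun _ : Fin m => Icc (0 : ℝ) 1)) := ⟨by rwa [Measure.restrict_apply_univ]⟩
  refine Integrable.mono' (integrable_const (C * D ^ m)) ?_ ?_
  · refine (hc.aestronglyMeasurable hms).mul ?_
    refine Measurable.aestronglyMeasurable ?_
    exact Finset.measurable_fun_prod _ fun i _ => (measurable_deriv z).comp (measurable_pi_apply i)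
  · exact (ae_restrict_iff' hms).2 (Eventually.of_forall fun t ht =>
      norm_fredholm_integrand_le hD ht (hC t ht))

/-- The Fredholm determinant is Lipschitz with respect to small kernels. -/
theorem norm_fredholmDet_sub_le (hz : IsJordanLoop z) {D : ℝ}
    (hD : ∀ t ∈ Icc (0 : ℝ) 1, ‖deriv z t‖ ≤ D) {k k' : ℂ → ℂ → ℂ}
    (hk : ContinuousOn (fun p : ℂ × ℂ => k p.1 p.2) (trace z ×ˢ trace z))
    (hk' : ContinuousOn (fun p : ℂ × ℂ => k' p.1 p.2) (trace z ×ˢ trace z)) {x d : ℝ}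
    (hd : 0 ≤ d) (hkx : ∀ u ∈ trace z, ∀ v ∈ trace z, ‖k u v‖ ≤ x)
    (hkx' : ∀ u ∈ trace z, ∀ v ∈ trace z, ‖k' u v‖ ≤ x)
    (hkk : ∀ u ∈ trace z, ∀ v ∈ trace z, ‖k u v - k' u v‖ ≤ d * x) (hxD : x * D ≤ 1 / 4) :
    ‖fredholmDet z 0 1 k - fredholmDet z 0 1 k'‖ ≤ d / 2 := by
  have h0 : z 0 ∈ trace z := mem_trace (by simp)
  have hx : 0 ≤ x := (norm_nonneg _).trans (hkx _ h0 _ h0)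
  have hD0 : 0 ≤ D := (norm_nonneg _).trans (hD 0 (by simp))
  set y := x * D with hy
  have hy0 : 0 ≤ y := mul_nonneg hx hD0
  have hms : ∀ m, MeasurableSet (Set.pi univ fun _ : Fin m => Icc (0 : ℝ) 1) := fun m =>
    MeasurableSet.univ_pi fun _ => measurableSet_Icc
  have hmem : ∀ {m : ℕ} {t : Fin m → ℝ}, t ∈ (Set.pi univ fun _ : Fin m => Icc (0 : ℝ) 1) →
      ∀ i, z (t i) ∈ trace z := fun ht i => mem_trace (ht i (mem_univ i))
  have hreal : ∀ m, (volume : Measure (Fin m → ℝ)).real (Set.pi univ fun _ : Fin m => Icc (0 : ℝ) 1) = 1 := by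
    intro m; rw [measureReal_def, volume_cube]; simp
  have hlt : ∀ m, (volume : Measure (Fin m → ℝ)) (Set.pi univ fun _ : Fin m => Icc (0 : ℝ) 1) < ⊤ := by
    intro m; rw [volume_cube]; exact ENNReal.one_lt_top
  have hfac : ∀ m : ℕ, (0 : ℝ) < m.factorial := fun m => by exact_mod_cast m.factorial_pos
  have hterm : ∀ k : ℂ → ℂ → ℂ, (∀ u ∈ trace z, ∀ v ∈ trace z, ‖k u v‖ ≤ x) → ∀ m : ℕ,
      ‖((m.factorial : ℂ))⁻¹ * ∫ t in Set.pi univ (fun _ : Fin m => Icc (0 : ℝ) 1),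
        (Matrix.of fun i j : Fin m => k (z (t i)) (z (t j))).det * ∏ i, deriv z (t i)‖ ≤ y ^ m := by
    intro k hk m
    have h1 := norm_setIntegral_le_of_norm_le_const (hlt m) (f := fun t : Fin m → ℝ =>
      (Matrix.of fun i j : Fin m => k (z (t i)) (z (t j))).det * ∏ i, deriv z (t i))
      (C := m.factorial * x ^ m * D ^ m) fun t ht => norm_fredholm_integrand_le hD ht
        (norm_det_le fun i j => hk _ (hmem ht i) _ (hmem ht j))
    rw [hreal, mul_one] at h1
    rw [norm_mul, norm_inv, Complex.norm_natCast, inv_mul_le_iff₀ (hfac m)]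
    refine h1.trans (le_of_eq ?_)
    rw [hy, mul_pow]; ring
  have hy1 : y < 1 := by linarith
  have hsum : ∀ k : ℂ → ℂ → ℂ, (∀ u ∈ trace z, ∀ v ∈ trace z, ‖k u v‖ ≤ x) →
      Summable fun m : ℕ => ((m.factorial : ℂ))⁻¹ * ∫ t in Set.pi univ (fun _ : Fin m => Icc (0 : ℝ) 1),
        (Matrix.of fun i j : Fin m => k (z (t i)) (z (t j))).det * ∏ i, deriv z (t i) := fun k hk =>
    Summable.of_norm_bounded (summable_geometric_of_lt_one hy0 hy1) (hterm k hk)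
  unfold fredholmDet
  rw [← (hsum k hkx).tsum_sub (hsum k' hkx')]
  have hgeo : HasSum (fun m : ℕ => d * (m * y ^ m)) (d * (y / (1 - y) ^ 2)) :=
    (hasSum_coe_mul_geometric_of_norm_lt_one (by rwa [Real.norm_of_nonneg hy0])).mul_left d
  refine (tsum_of_norm_bounded hgeo fun m => ?_).trans ?_
  · rw [← mul_sub, ← integral_sub (hz.integrableOn_fredholm hk m) (hz.integrableOn_fredholm hk' m)]
    simp only [← sub_mul]
    have h1 := norm_setIntegral_le_of_norm_le_const (hlt m) (f := fun t : Fin m → ℝ =>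
      ((Matrix.of fun i j : Fin m => k (z (t i)) (z (t j))).det
        - (Matrix.of fun i j : Fin m => k' (z (t i)) (z (t j))).det) * ∏ i, deriv z (t i))
      (C := m.factorial * (m * (d * x ^ m)) * D ^ m) fun t ht => norm_fredholm_integrand_le hD ht
        (norm_det_sub_det_le hx hd (fun i j => hkx _ (hmem ht i) _ (hmem ht j))
          (fun i j => hkx' _ (hmem ht i) _ (hmem ht j))
          (fun i j => hkk _ (hmem ht i) _ (hmem ht j)))
    rw [hreal, mul_one] at h1
    rw [norm_mul, norm_inv, Complex.norm_natCast, inv_mul_le_iff₀ (hfac m)]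
    refine h1.trans (le_of_eq ?_)
    rw [hy, mul_pow]; ring
  -- For y ≤ 1/4 the quotient is at most 4/9.
  · have h2 : y / (1 - y) ^ 2 ≤ 1 / 2 := by
      rw [div_le_div_iff₀ (by nlinarith) (by norm_num)]
      nlinarith
    nlinarith

end IsJordanLoop


/-! ### The strip, and continuous functions on the segment as a Banach space. -/

lemma isOpen_strip (δ : ℝ) : IsOpen (strip δ) :=
  isOpen_lt (continuous_abs.comp Complex.continuous_im) continuous_const

lemma convex_strip (δ : ℝ) : Convex ℝ (strip δ) := by
  have : strip δ = Complex.imLm ⁻¹' Ioo (-(2 * δ)) (2 * δ) := by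
    ext z; simp [strip, abs_lt]
  rw [this]
  exact (convex_Ioo _ _).linear_preimage _

lemma ofReal_mem_strip {δ : ℝ} (hδ : 0 < δ) (t : ℝ) : (t : ℂ) ∈ strip δ := by
  simp [strip, hδ]

lemma fermiZone_subset_strip {δ : ℝ} (hδ : 0 < δ) (q : ℝ) : fermiZone q ⊆ strip δ := by
  rintro _ ⟨t, -, rfl⟩; exact ofReal_mem_strip hδ t

lemma isCompact_fermiZone (q : ℝ) : IsCompact (fermiZone q) :=
  isCompact_Icc.image Complex.continuous_ofReal

lemma ofReal_mem_fermiZone {q : ℝ} (t : Icc (-q) q) : ((t : ℝ) : ℂ) ∈ fermiZone q :=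
  mem_image_of_mem _ t.2

/-- The restriction of a function to the segment `[-q, q]`. -/
noncomputable def seg (q : ℝ) (f : ℂ → ℂ) : C(Icc (-q) q, ℂ) :=
  open Classical in
  if h : Continuous fun t : Icc (-q) q => f (t : ℝ) then ⟨_, h⟩ else 0

lemma seg_apply {q : ℝ} {f : ℂ → ℂ} (hf : ContinuousOn f (fermiZone q)) (t : Icc (-q) q) :
    seg q f t = f (t : ℝ) := by
  have h : Continuous fun t : Icc (-q) q => f (t : ℝ) :=
    hf.comp_continuous (Complex.continuous_ofReal.comp continuous_subtype_val) ofReal_mem_fermiZone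
  simp [seg, h]

lemma continuousOn_fermiZone {q : ℝ} {f : ℂ → ℂ}
    (hf : ContinuousOn (fun t : ℝ => f t) (Icc (-q) q)) : ContinuousOn f (fermiZone q) := by
  rintro _ ⟨t, ht, rfl⟩
  have h1 : ContinuousOn (fun z : ℂ => f ((z.re : ℝ) : ℂ)) (fermiZone q) :=
    hf.comp Complex.continuous_re.continuousOn (by rintro _ ⟨s, hs, rfl⟩; simpa using hs)
  refine (h1 _ (mem_image_of_mem _ ht)).congr ?_ (by simp)
  rintro _ ⟨s, hs, rfl⟩
  simp

/-- The integral over the segment. -/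
noncomputable def segIntegral {q : ℝ} (hq : 0 < q) : C(Icc (-q) q, ℂ) →L[ℂ] ℂ :=
  LinearMap.mkContinuous
    { toFun := fun f => ∫ t in (-q)..q, IccExtend (by linarith : -q ≤ q) f t
      map_add' := fun f g => by
        rw [← intervalIntegral.integral_add]
        · rfl
        · exact (f.continuous.Icc_extend').intervalIntegrable _ _
        · exact (g.continuous.Icc_extend').intervalIntegrable _ _
      map_smul' := fun a f => by
        simp only [RingHom.id_apply, smul_eq_mul]
        rw [← intervalIntegral.integral_const_mul]
        rfl } (2 * q) (fun f => by
      have := intervalIntegral.norm_integral_le_of_norm_le_const (a := -q) (b := q)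
        (f := IccExtend (by linarith : -q ≤ q) f) (C := ‖f‖) fun t _ => f.norm_coe_le_norm _
      simp only [LinearMap.coe_mk, AddHom.coe_mk]
      refine this.trans (le_of_eq ?_)
      rw [sub_neg_eq_add, abs_of_pos (by linarith)]
      ring)

lemma segIntegral_eq {q : ℝ} (hq : 0 < q) {f : C(Icc (-q) q, ℂ)} {g : ℝ → ℂ}
    (h : ∀ t : Icc (-q) q, f t = g t) : segIntegral hq f = ∫ t in (-q)..q, g t := by
  change ∫ t in (-q)..q, IccExtend (by linarith : -q ≤ q) f t = _
  refine intervalIntegral.integral_congr fun t ht => ?_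
  rw [uIcc_of_le (by linarith)] at ht
  simp only [IccExtend_of_mem _ _ ht]
  exact h ⟨t, ht⟩

lemma norm_segIntegral_le {q : ℝ} (hq : 0 < q) (f : C(Icc (-q) q, ℂ)) :
    ‖segIntegral hq f‖ ≤ 2 * q * ‖f‖ :=
  (LinearMap.mkContinuous_norm_le _ (by positivity) _ : ‖segIntegral hq‖ ≤ 2 * q) |> fun h =>
    (segIntegral hq).le_of_opNorm_le h f

lemma segIntegral_mul {q : ℝ} (hq : 0 < q) {f g : ℂ → ℂ} (hf : ContinuousOn f (fermiZone q))
    (hg : ContinuousOn g (fermiZone q)) :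
    segIntegral hq (seg q f * seg q g) = ∫ t in (-q)..q, f t * g t :=
  segIntegral_eq hq fun t => by
    rw [ContinuousMap.mul_apply, seg_apply hf, seg_apply hg]

lemma norm_seg_le {q : ℝ} {f : ℂ → ℂ} {b : ℝ} (hf : ContinuousOn f (fermiZone q)) (hb0 : 0 ≤ b)
    (hb : ∀ u ∈ fermiZone q, ‖f u‖ ≤ b) : ‖seg q f‖ ≤ b :=
  (ContinuousMap.norm_le _ hb0).2 fun t => by
    rw [seg_apply hf]; exact hb _ (ofReal_mem_fermiZone t)

/-- The integral operator whose kernel is the family `r` of functions on the segment. -/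
noncomputable def segOp {q : ℝ} (hq : 0 < q) (r : C(Icc (-q) q, C(Icc (-q) q, ℂ))) :
    C(Icc (-q) q, ℂ) →L[ℂ] C(Icc (-q) q, ℂ) :=
  LinearMap.mkContinuous
    { toFun := fun f => ⟨fun x => segIntegral hq (r x * f),
        (segIntegral hq).continuous.comp (r.continuous.mul continuous_const)⟩
      map_add' := fun f g => by ext x; simp [mul_add]
      map_smul' := fun a f => by ext x; simp [mul_smul_comm] } (2 * q * ‖r‖) (fun f => by
      refine (ContinuousMap.norm_le _ (by positivity)).2 fun x => ?_
      refine (norm_segIntegral_le hq _).trans ?_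
      rw [mul_assoc (2 * q)]
      refine mul_le_mul_of_nonneg_left ?_ (by positivity)
      refine (norm_mul_le _ _).trans ?_
      exact mul_le_mul_of_nonneg_right (r.norm_coe_le_norm x) (norm_nonneg _))

lemma segOp_apply {q : ℝ} (hq : 0 < q) (r : C(Icc (-q) q, C(Icc (-q) q, ℂ)))
    (f : C(Icc (-q) q, ℂ)) (x : Icc (-q) q) : segOp hq r f x = segIntegral hq (r x * f) := rfl

section Curry

variable {q : ℝ} {U V : Set ℂ} {Ψ : ℂ → ℂ → ℂ}

lemma continuousOn_right (hΨ : AnalyticOnNhd ℂ (fun p : ℂ × ℂ => Ψ p.1 p.2) (U ×ˢ V)) {w : ℂ}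
    (hw : w ∈ U) : ContinuousOn (Ψ w) V :=
  ContinuousOn.comp (g := fun p : ℂ × ℂ => Ψ p.1 p.2) (f := fun t => (w, t)) hΨ.continuousOn
    (by fun_prop) fun _ ht => ⟨hw, ht⟩

lemma analyticOnNhd_right (hΨ : AnalyticOnNhd ℂ (fun p : ℂ × ℂ => Ψ p.1 p.2) (U ×ˢ V)) {w : ℂ}
    (hw : w ∈ U) : AnalyticOnNhd ℂ (Ψ w) V := fun t ht =>
  AnalyticAt.fun_comp (g := fun p : ℂ × ℂ => Ψ p.1 p.2) (f := fun t => (w, t)) (hΨ (w, t) ⟨hw, ht⟩)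
    (analyticAt_const.prod analyticAt_id)

lemma analyticOnNhd_left (hΨ : AnalyticOnNhd ℂ (fun p : ℂ × ℂ => Ψ p.1 p.2) (U ×ˢ V)) {t : ℂ}
    (ht : t ∈ V) : AnalyticOnNhd ℂ (fun w => Ψ w t) U := fun w hw =>
  AnalyticAt.fun_comp (g := fun p : ℂ × ℂ => Ψ p.1 p.2) (f := fun w => (w, t)) (hΨ (w, t) ⟨hw, ht⟩)
    (analyticAt_id.prod analyticAt_const)

lemma deriv_left_eq (hΨ : AnalyticOnNhd ℂ (fun p : ℂ × ℂ => Ψ p.1 p.2) (U ×ˢ V)) {w t : ℂ}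
    (hw : w ∈ U) (ht : t ∈ V) :
    deriv (fun w => Ψ w t) w = fderiv ℂ (fun p : ℂ × ℂ => Ψ p.1 p.2) (w, t) (1, 0) := by
  have h1 := (hΨ (w, t) ⟨hw, ht⟩).differentiableAt.hasFDerivAt
  have h2 : HasDerivAt (fun w : ℂ => (w, t)) ((1 : ℂ), (0 : ℂ)) w :=
    (hasDerivAt_id w).prodMk (hasDerivAt_const w t)
  exact (h1.comp_hasDerivAt w h2).deriv

lemma deriv_right_eq (hΨ : AnalyticOnNhd ℂ (fun p : ℂ × ℂ => Ψ p.1 p.2) (U ×ˢ V)) {w t : ℂ}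
    (hw : w ∈ U) (ht : t ∈ V) :
    deriv (Ψ w) t = fderiv ℂ (fun p : ℂ × ℂ => Ψ p.1 p.2) (w, t) (0, 1) := by
  have h1 := (hΨ (w, t) ⟨hw, ht⟩).differentiableAt.hasFDerivAt
  have h2 : HasDerivAt (fun t : ℂ => (w, t)) ((0 : ℂ), (1 : ℂ)) t :=
    (hasDerivAt_const t w).prodMk (hasDerivAt_id t)
  exact (h1.comp_hasDerivAt t h2).deriv

lemma continuousOn_deriv_left (hΨ : AnalyticOnNhd ℂ (fun p : ℂ × ℂ => Ψ p.1 p.2) (U ×ˢ V)) {w : ℂ}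
    (hw : w ∈ U) : ContinuousOn (fun t => deriv (fun w => Ψ w t) w) V := by
  have h1 : ContinuousOn (fun t : ℂ => fderiv ℂ (fun p : ℂ × ℂ => Ψ p.1 p.2) (w, t) (1, 0)) V :=
    (ContinuousOn.comp (g := fderiv ℂ fun p : ℂ × ℂ => Ψ p.1 p.2) (f := fun t => (w, t))
      hΨ.fderiv.continuousOn (by fun_prop) fun _ ht => ⟨hw, ht⟩).clm_apply continuousOn_const
  exact h1.congr fun t ht => deriv_left_eq hΨ hw ht

lemma analyticOnNhd_deriv_right (hΨ : AnalyticOnNhd ℂ (fun p : ℂ × ℂ => Ψ p.1 p.2) (U ×ˢ V))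
    (hU : IsOpen U) (hV : IsOpen V) :
    AnalyticOnNhd ℂ (fun p : ℂ × ℂ => deriv (Ψ p.1) p.2) (U ×ˢ V) := by
  have h1 : AnalyticOnNhd ℂ (fun p => fderiv ℂ (fun p : ℂ × ℂ => Ψ p.1 p.2) p (0, 1)) (U ×ˢ V) :=
    fun p hp => (ContinuousLinearMap.analyticAt
      (ContinuousLinearMap.apply ℂ ℂ ((0 : ℂ), (1 : ℂ))) _).comp (hΨ.fderiv p hp)
  exact h1.congr (hU.prod hV) fun p hp => (deriv_right_eq hΨ hp.1 hp.2).symm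

/-- The second order Taylor remainder in w is uniform over the compact segment, so the derivative
exists in the sup norm. A jointly analytic family thereby becomes a holomorphic map into a Banach
space, to which bounded operators can be applied. -/
theorem hasDerivAt_seg (hU : IsOpen U) (hV : fermiZone q ⊆ V)
    (hΨ : AnalyticOnNhd ℂ (fun p : ℂ × ℂ => Ψ p.1 p.2) (U ×ˢ V)) {w : ℂ} (hw : w ∈ U) :
    HasDerivAt (fun w => seg q (Ψ w)) (seg q fun t => deriv (fun w => Ψ w t) w) w := by
  obtain ⟨r, hr, hrU⟩ := Metric.nhds_basis_closedBall.mem_iff.1 (hU.mem_nhds hw)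
  obtain ⟨b, hb⟩ := ((isCompact_closedBall w r).prod (isCompact_fermiZone q)).exists_bound_of_continuousOn
    (hΨ.continuousOn.mono (prod_mono hrU hV))
  have hcont : ∀ w ∈ U, ContinuousOn (Ψ w) (fermiZone q) := fun w hw =>
    (continuousOn_right hΨ hw).mono hV
  rw [hasDerivAt_iff_isLittleO]
  refine Asymptotics.IsBigO.trans_isLittleO (g := fun y : ℂ => ‖y - w‖ ^ 2) ?_
    (Asymptotics.isLittleO_pow_sub_sub w one_lt_two)
  refine Asymptotics.IsBigO.of_bound (4 * |b| / r ^ 2) ?_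
  filter_upwards [Metric.ball_mem_nhds w hr] with y hy
  refine (ContinuousMap.norm_le _ (by positivity)).2 fun t => ?_
  have ht := ofReal_mem_fermiZone t
  have hyU := hrU (Metric.ball_subset_closedBall hy)
  rw [ContinuousMap.sub_apply, ContinuousMap.sub_apply, ContinuousMap.smul_apply,
    seg_apply (hcont y hyU), seg_apply (hcont w hw),
    seg_apply ((continuousOn_deriv_left hΨ hw).mono hV), smul_eq_mul, mul_comm (y - w), norm_pow, norm_norm]
  exact norm_taylor_two_le hr
    ((analyticOnNhd_left hΨ (hV ht)).differentiableOn.mono (Metric.ball_subset_closedBall.trans hrU))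
    (fun u hu => (hb (u, _) ⟨Metric.ball_subset_closedBall hu, ht⟩).trans (le_abs_self b)) hy

lemma analyticOnNhd_seg (hU : IsOpen U) (hV : fermiZone q ⊆ V)
    (hΨ : AnalyticOnNhd ℂ (fun p : ℂ × ℂ => Ψ p.1 p.2) (U ×ˢ V)) :
    AnalyticOnNhd ℂ (fun w => seg q (Ψ w)) U :=
  DifferentiableOn.analyticOnNhd
    (fun _ hw => (hasDerivAt_seg hU hV hΨ hw).differentiableAt.differentiableWithinAt) hU

end Curry


/-! ### Analyticity and bounds of the bare phase and of the Lieb kernel. -/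

section Kernels

variable {c δ : ℝ}

lemma abs_im_sub_lt (hδc : δ < c / 8) {z w : ℂ} (hz : z ∈ strip δ) (hw : w ∈ strip δ) :
    |(z - w).im| < c / 2 := by
  have hz' : |z.im| < 2 * δ := hz
  have hw' : |w.im| < 2 * δ := hw
  rw [Complex.sub_im]
  have := abs_sub z.im w.im
  linarith

lemma abs_im_sub_lt' (hc : 0 < c) (hδc : δ < c / 8) {z w : ℂ} (hz : z ∈ strip δ) (hw : w ∈ strip δ) :
    |(z - w).im| < c := by
  have := abs_im_sub_lt hδc hz hw
  linarith

lemma abs_im_lt_of_mem_strip (hc : 0 < c) (hδc : δ < c / 8) {z : ℂ} (hz : z ∈ strip δ) :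
    |z.im| < c := by
  have hz' : |z.im| < 2 * δ := hz
  linarith

lemma analyticAt_barePhase {z : ℂ} (hz : |z.im| < c) : AnalyticAt ℂ (barePhase c) z := by
  have ho : IsOpen {z : ℂ | |z.im| < c} :=
    isOpen_lt (continuous_abs.comp Complex.continuous_im) continuous_const
  have hd : DifferentiableOn ℂ (barePhase c) {z : ℂ | |z.im| < c} := fun w hw =>
    (hasDerivAt_barePhase hw).differentiableAt.differentiableWithinAt
  exact hd.analyticOnNhd ho z hz

lemma analyticAt_liebKernel {z : ℂ} (hz : |z.im| < c) : AnalyticAt ℂ (liebKernel c) z := by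
  unfold liebKernel
  exact analyticAt_const.div ((analyticAt_id.pow 2).add analyticAt_const) (sq_add_sq_ne hz)

lemma analyticOnNhd_liebKernel_sub (hc : 0 < c) (hδc : δ < c / 8) :
    AnalyticOnNhd ℂ (fun p : ℂ × ℂ => liebKernel c (p.1 - p.2)) (strip δ ×ˢ strip δ) :=
  fun _ hp => AnalyticAt.fun_comp (g := liebKernel c) (f := fun p : ℂ × ℂ => p.1 - p.2)
    (analyticAt_liebKernel (abs_im_sub_lt' hc hδc hp.1 hp.2)) (analyticAt_fst.sub analyticAt_snd)

lemma analyticOnNhd_barePhase_sub (hc : 0 < c) (hδc : δ < c / 8) :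
    AnalyticOnNhd ℂ (fun p : ℂ × ℂ => barePhase c (p.1 - p.2) / (2 * Real.pi))
      (strip δ ×ˢ strip δ) :=
  fun _ hp => (AnalyticAt.fun_comp (g := barePhase c) (f := fun p : ℂ × ℂ => p.1 - p.2)
    (analyticAt_barePhase (abs_im_sub_lt' hc hδc hp.1 hp.2))
      (analyticAt_fst.sub analyticAt_snd)).div_const

/-- Both factors of z² + c² = (z + ic)(z - ic) have modulus at least c/2. -/
lemma norm_liebKernel_le_of_im (hc : 0 < c) {z : ℂ} (hz : |z.im| < c / 2) :
    ‖liebKernel c z‖ ≤ 8 / c := by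
  have h := abs_lt.1 hz
  have h1 : c / 2 ≤ ‖z + Complex.I * c‖ := by
    refine le_trans ?_ (Complex.abs_im_le_norm _)
    simp only [Complex.add_im, Complex.mul_im, Complex.I_re, Complex.ofReal_im, Complex.I_im,
      Complex.ofReal_re]
    exact le_trans (by linarith) (le_abs_self _)
  have h2 : c / 2 ≤ ‖z - Complex.I * c‖ := by
    refine le_trans ?_ (Complex.abs_im_le_norm _)
    simp only [Complex.sub_im, Complex.mul_im, Complex.I_re, Complex.ofReal_im, Complex.I_im,
      Complex.ofReal_re]
    exact le_trans (by linarith) (neg_le_abs _)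
  have e : z ^ 2 + (c : ℂ) ^ 2 = (z + Complex.I * c) * (z - Complex.I * c) := by
    ring_nf; simp
  unfold liebKernel
  rw [e, norm_div, norm_mul (z + _), div_le_div_iff₀ (by nlinarith) hc]
  have : ‖(2 * c : ℂ)‖ = 2 * c := by simp [abs_of_pos hc]
  rw [this]
  nlinarith

end Kernels

/-! ### The dressing operator, the dressed phase and the resolvent kernel. -/

section Dressing

variable {c q δ : ℝ}

lemma liebOp_eq_segOp (hq : 0 < q) (r : C(Icc (-q) q, C(Icc (-q) q, ℂ)))
    (hr : ∀ x t : Icc (-q) q, r x t = liebKernel c ((x : ℝ) - (t : ℝ) : ℂ) / (2 * Real.pi))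
    (f : C(Icc (-q) q, ℂ)) {g : ℂ → ℂ} (hg : ∀ t : Icc (-q) q, g (t : ℝ) = f t) (x : Icc (-q) q) :
    segOp hq r f x = liebOp c q g (x : ℝ) := by
  rw [segOp_apply, segIntegral_eq hq (g := fun t : ℝ => liebKernel c ((x : ℝ) - t) / (2 * Real.pi) * g t)]
  · unfold liebOp
    rw [← intervalIntegral.integral_div]
    congr 1
    ext t
    ring
  · intro t
    rw [ContinuousMap.mul_apply, hr, hg]

lemma continuousOn_dress (hc : 0 < c) (hq : 0 < q) {g : ℂ → ℂ} (hg : Continuous fun t : ℝ => g t) :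
    ContinuousOn (dress c q g) (fermiZone q) := by
  obtain ⟨k, B, hk0, hk1, hb⟩ := exists_iterate_bound hc hq hg
  exact continuousOn_fermiZone (continuousOn_tsum (fun n => (continuous_iterate hc hg n).continuousOn)
    ((summable_geometric_of_lt_one hk0 hk1).mul_right B) hb)

/-- Dressing is a bounded operator on continuous functions on the segment. -/
theorem exists_dressing (hc : 0 < c) (hq : 0 < q) :
    ∃ S : C(Icc (-q) q, ℂ) →L[ℂ] C(Icc (-q) q, ℂ), ∀ g : ℂ → ℂ, (Continuous fun t : ℝ => g t) →
      seg q (dress c q g) = S (seg q g) := by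
  obtain ⟨k, hk0, hk1, hk⟩ := exists_contraction hc hq
  -- Any width below c/8 would do; the strip only serves to see the kernel as an analytic, hence
  -- continuous, family over the segment.
  set δ := c / 16 with hδ
  have hδ0 : 0 < δ := by positivity
  have hδc : δ < c / 8 := by linarith
  have han := analyticOnNhd_liebKernel_sub hc hδc
  have hsub := fermiZone_subset_strip hδ0 q
  have hcont : Continuous fun x : Icc (-q) q =>
      (1 / (2 * Real.pi) : ℂ) • seg q (fun t => liebKernel c ((x : ℝ) - t)) := by
    have h0 : Continuous fun x : Icc (-q) q => seg q (fun t => liebKernel c ((x : ℝ) - t)) := (analyticOnNhd_seg (Ψ := fun z t => liebKernel c (z - t)) (isOpen_strip δ) hsub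
      han).continuousOn.comp_continuous (Complex.continuous_ofReal.comp continuous_subtype_val)
      fun x => ofReal_mem_strip hδ0 _
    exact h0.const_smul (1 / (2 * Real.pi) : ℂ)
  set r : C(Icc (-q) q, C(Icc (-q) q, ℂ)) := ⟨_, hcont⟩ with hr
  have hra : ∀ x t : Icc (-q) q, r x t = liebKernel c ((x : ℝ) - (t : ℝ) : ℂ) / (2 * Real.pi) := by
    intro x t
    rw [hr]
    simp only [ContinuousMap.coe_mk, ContinuousMap.smul_apply, smul_eq_mul]
    rw [seg_apply ((continuousOn_right (Ψ := fun z t => liebKernel c (z - t)) han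
      (ofReal_mem_strip hδ0 _)).mono hsub)]
    ring
  set A := segOp hq r with hA
  have hle : -q ≤ q := by linarith
  -- As k < 1, the operator 1 - A is invertible on continuous functions, and its inverse is the
  -- dressing because `dress` solves the equation on the segment.
  have hnorm : ‖A‖ ≤ k := by
    refine A.opNorm_le_bound hk0 fun f => ?_
    refine (ContinuousMap.norm_le _ (by positivity)).2 fun x => ?_
    rw [hA, liebOp_eq_segOp hq r hra f (g := fun z => IccExtend hle f z.re)
      fun t => by simp [IccExtend_of_mem hle f t.2]]
    refine (norm_liebOp_le hq (B := ‖f‖) (fun t _ => f.norm_coe_le_norm _) (by simpa using hc)).trans ?_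
    gcongr
    exact hk x x.2
  have hu : IsUnit (1 - A) := (Units.oneSub A (lt_of_le_of_lt hnorm hk1)).isUnit
  refine ⟨Ring.inverse (1 - A), fun g hg => ?_⟩
  have hgc : ContinuousOn g (fermiZone q) := continuousOn_fermiZone hg.continuousOn
  have hdc := continuousOn_dress hc hq hg
  have key : (1 - A) (seg q (dress c q g)) = seg q g := by
    ext x
    rw [sub_apply, ContinuousMap.sub_apply, hA,
      liebOp_eq_segOp hq r hra _ (g := dress c q g) fun t => (seg_apply hdc t).symm,
      one_apply_eq_self, seg_apply hdc, seg_apply hgc]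
    exact dress_eq hc hq hg (by simpa using hc)
  rw [← key, ← mul_apply_eq_comp, Ring.inverse_mul_cancel _ hu,
    one_apply_eq_self]

/-- The dressed function on the strip, in terms of the dressing operator. -/
lemma dress_eq_segIntegral (hc : 0 < c) (hq : 0 < q) (hδ : 0 < δ) (hδc : δ < c / 8)
    {S : C(Icc (-q) q, ℂ) →L[ℂ] C(Icc (-q) q, ℂ)}
    (hS : ∀ g : ℂ → ℂ, (Continuous fun t : ℝ => g t) → seg q (dress c q g) = S (seg q g))
    {g : ℂ → ℂ} (hg : Continuous fun t : ℝ => g t) {z : ℂ} (hz : z ∈ strip δ) :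
    dress c q g z = g z
      + segIntegral hq (seg q (fun t => liebKernel c (z - t)) * S (seg q g)) / (2 * Real.pi) := by
  have hk : ContinuousOn (fun t => liebKernel c (z - t)) (fermiZone q) :=
    (continuousOn_right (Ψ := fun z t => liebKernel c (z - t))
      (analyticOnNhd_liebKernel_sub hc hδc) hz).mono (fermiZone_subset_strip hδ q)
  rw [← hS g hg, segIntegral_mul hq hk (continuousOn_dress hc hq hg)]
  linear_combination dress_eq hc hq hg (abs_im_lt_of_mem_strip hc hδc hz)

variable {Ψ : ℂ → ℂ → ℂ}

lemma analyticOnNhd_swap {U V : Set ℂ}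
    (hΨ : AnalyticOnNhd ℂ (fun p : ℂ × ℂ => Ψ p.1 p.2) (U ×ˢ V)) :
    AnalyticOnNhd ℂ (fun p : ℂ × ℂ => Ψ p.2 p.1) (V ×ˢ U) := fun p hp =>
  AnalyticAt.fun_comp (g := fun p : ℂ × ℂ => Ψ p.1 p.2) (f := fun p : ℂ × ℂ => (p.2, p.1))
    (hΨ (p.2, p.1) ⟨hp.2, hp.1⟩) (analyticAt_snd.prod analyticAt_fst)

lemma continuous_ofReal_left (hδ : 0 < δ)
    (hΨ : AnalyticOnNhd ℂ (fun p : ℂ × ℂ => Ψ p.1 p.2) (strip δ ×ˢ strip δ)) {w : ℂ}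
    (hw : w ∈ strip δ) : Continuous fun t : ℝ => Ψ t w :=
  (analyticOnNhd_left hΨ hw).continuousOn.comp_continuous Complex.continuous_ofReal
    fun t => ofReal_mem_strip hδ t

/-- The dressing of a holomorphic family of holomorphic functions is jointly holomorphic. -/
theorem analyticOnNhd_dress (hc : 0 < c) (hq : 0 < q) (hδ : 0 < δ) (hδc : δ < c / 8)
    (hΨ : AnalyticOnNhd ℂ (fun p : ℂ × ℂ => Ψ p.1 p.2) (strip δ ×ˢ strip δ)) :
    AnalyticOnNhd ℂ (fun p : ℂ × ℂ => dress c q (fun v => Ψ v p.2) p.1) (strip δ ×ˢ strip δ) := by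
  obtain ⟨S, hS⟩ := exists_dressing hc hq
  have hsub := fermiZone_subset_strip hδ q
  have h1 := analyticOnNhd_seg (Ψ := fun z t => liebKernel c (z - t)) (isOpen_strip δ) hsub
    (analyticOnNhd_liebKernel_sub hc hδc)
  have h2 := analyticOnNhd_seg (Ψ := fun w t => Ψ t w) (isOpen_strip δ) hsub (analyticOnNhd_swap hΨ)
  have h3 : AnalyticOnNhd ℂ (fun p : ℂ × ℂ => Ψ p.1 p.2
      + segIntegral hq (seg q (fun t => liebKernel c (p.1 - t)) * S (seg q fun t => Ψ t p.2))
        / (2 * Real.pi)) (strip δ ×ˢ strip δ) := by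
    intro p hp
    refine (hΨ p hp).add (AnalyticAt.div_const ?_)
    refine ((segIntegral hq).analyticAt _).fun_comp (AnalyticAt.mul ?_ ?_)
    · exact AnalyticAt.fun_comp (g := fun z => seg q fun t => liebKernel c (z - t))
        (f := Prod.fst) (h1 p.1 hp.1) analyticAt_fst
    · exact (S.analyticAt _).fun_comp (AnalyticAt.fun_comp (g := fun w => seg q fun t => Ψ t w)
        (f := Prod.snd) (h2 p.2 hp.2) analyticAt_snd)
  refine h3.congr ((isOpen_strip δ).prod (isOpen_strip δ)) fun p hp => ?_
  exact (dress_eq_segIntegral (g := fun t => Ψ t p.2) hc hq hδ hδc hS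
    (continuous_ofReal_left hδ hΨ hp.2) hp.1).symm

theorem analyticOnNhd_dressedPhase (hc : 0 < c) (hq : 0 < q) (hδ : 0 < δ) (hδc : δ < c / 8) :
    AnalyticOnNhd ℂ (fun p : ℂ × ℂ => dressedPhase c q p.1 p.2) (strip δ ×ˢ strip δ) :=
  analyticOnNhd_dress (Ψ := fun v w => barePhase c (v - w) / (2 * Real.pi)) hc hq hδ hδc
    (analyticOnNhd_barePhase_sub hc hδc)

theorem analyticOnNhd_resolventKernel (hc : 0 < c) (hq : 0 < q) (hδ : 0 < δ) (hδc : δ < c / 8) :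
    AnalyticOnNhd ℂ (fun p : ℂ × ℂ => resolventKernel c q p.1 p.2) (strip δ ×ˢ strip δ) :=
  analyticOnNhd_dress (Ψ := fun v w => liebKernel c (v - w)) hc hq hδ hδc
    (analyticOnNhd_liebKernel_sub hc hδc)

/-- The bare phase satisfies ∂_w θ(z - w) = -K(z - w), and dressing is linear and bounded, so it
commutes with ∂_w and turns K into R. -/
theorem hasDerivAt_dressedPhase (hc : 0 < c) (hq : 0 < q) (hδ : 0 < δ) (hδc : δ < c / 8) {z w : ℂ}
    (hz : z ∈ strip δ) (hw : w ∈ strip δ) :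
    HasDerivAt (dressedPhase c q z) (-resolventKernel c q z w / (2 * Real.pi)) w := by
  obtain ⟨S, hS⟩ := exists_dressing hc hq
  have hsub := fermiZone_subset_strip hδ q
  have hb := analyticOnNhd_barePhase_sub (c := c) (δ := δ) hc hδc
  have hl := analyticOnNhd_liebKernel_sub (c := c) (δ := δ) hc hδc
  have hbare : ∀ v ∈ strip δ, HasDerivAt (fun w => barePhase c (v - w) / (2 * Real.pi))
      (-liebKernel c (v - w) / (2 * Real.pi)) w := fun v hv => by
    have h := (hasDerivAt_barePhase (abs_im_sub_lt' hc hδc hv hw)).comp_const_sub v w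
    exact h.div_const _
  have h1 := hasDerivAt_seg (q := q) (Ψ := fun w t => barePhase c (t - w) / (2 * Real.pi))
    (isOpen_strip δ) hsub (analyticOnNhd_swap (Ψ := fun v w => barePhase c (v - w) / (2 * Real.pi)) hb) hw
  have e1 : seg q (fun t => deriv (fun w => barePhase c (t - w) / (2 * Real.pi)) w)
      = (-1 / (2 * Real.pi) : ℂ) • seg q (fun t => liebKernel c (t - w)) := by
    ext t
    rw [seg_apply ((continuousOn_deriv_left (analyticOnNhd_swap (Ψ := fun v w => barePhase c (v - w) / (2 * Real.pi)) hb) hw).mono hsub),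
      (hbare _ (hsub (ofReal_mem_fermiZone t))).deriv, ContinuousMap.smul_apply,
      seg_apply ((analyticOnNhd_left (Ψ := fun z t => liebKernel c (z - t)) hl hw).continuousOn.mono
        hsub), smul_eq_mul]
    ring
  rw [e1] at h1
  have h2 := (hbare z hz).add (((segIntegral hq).hasFDerivAt.comp_hasDerivAt w
    ((S.hasFDerivAt.comp_hasDerivAt w h1).const_mul
      (seg q fun t => liebKernel c (z - t)))).div_const (2 * Real.pi : ℂ))
  have h3 : dressedPhase c q z =ᶠ[𝓝 w] fun w => barePhase c (z - w) / (2 * Real.pi)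
      + segIntegral hq (seg q (fun t => liebKernel c (z - t))
        * S (seg q fun t => barePhase c (t - w) / (2 * Real.pi))) / (2 * Real.pi) := by
    filter_upwards [(isOpen_strip δ).mem_nhds hw] with w hw
    exact dress_eq_segIntegral (g := fun v => barePhase c (v - w) / (2 * Real.pi)) hc hq hδ hδc hS
      (continuous_ofReal_left (Ψ := fun v w => barePhase c (v - w) / (2 * Real.pi)) hδ hb hw) hz
  refine (h2.congr_of_eventuallyEq h3).congr_deriv ?_
  have h4 : resolventKernel c q z w = _ := dress_eq_segIntegral (g := fun v => liebKernel c (v - w)) hc hq hδ hδc hS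
    (continuous_ofReal_left (Ψ := fun v w => liebKernel c (v - w)) hδ hl hw) hz
  rw [h4]
  simp only [map_smul, mul_smul_comm, smul_eq_mul]
  ring

lemma deriv_dressedPhase (hc : 0 < c) (hq : 0 < q) (hδ : 0 < δ) (hδc : δ < c / 8) {z w : ℂ}
    (hz : z ∈ strip δ) (hw : w ∈ strip δ) :
    deriv (dressedPhase c q z) w = -resolventKernel c q z w / (2 * Real.pi) :=
  (hasDerivAt_dressedPhase hc hq hδ hδc hz hw).deriv

/-- The strip is not compact, so the bound is read off from the dressing formula: for z and w in the
strip the imaginary part of z - w is below c/2, where K is at most 8/c. -/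
lemma exists_resolventKernel_bound (hc : 0 < c) (hq : 0 < q) (hδ : 0 < δ) (hδc : δ < c / 8) :
    ∃ C > 0, ∀ z ∈ strip δ, ∀ w ∈ strip δ, ‖resolventKernel c q z w‖ ≤ C := by
  obtain ⟨S, hS⟩ := exists_dressing hc hq
  have hsub := fermiZone_subset_strip hδ q
  have hl := analyticOnNhd_liebKernel_sub (c := c) (δ := δ) hc hδc
  have hp := Real.pi_pos
  have hb : ∀ z ∈ strip δ, ∀ w ∈ strip δ, ‖liebKernel c (z - w)‖ ≤ 8 / c := fun z hz w hw =>
    norm_liebKernel_le_of_im hc (abs_im_sub_lt hδc hz hw)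
  refine ⟨8 / c + 2 * q * (8 / c * (‖S‖ * (8 / c))) / (2 * Real.pi), by positivity, fun z hz w hw => ?_⟩
  have h4 : resolventKernel c q z w = _ := dress_eq_segIntegral (g := fun v => liebKernel c (v - w)) hc hq hδ hδc hS
    (continuous_ofReal_left (Ψ := fun v w => liebKernel c (v - w)) hδ hl hw) hz
  rw [h4]
  refine (norm_add_le _ _).trans (add_le_add (hb z hz w hw) ?_)
  rw [norm_div]
  have : ‖(2 * Real.pi : ℂ)‖ = 2 * Real.pi := by simp [abs_of_pos hp]
  rw [this]
  have hc1 : ContinuousOn (fun t => liebKernel c (z - t)) (fermiZone q) :=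
    (continuousOn_right (Ψ := fun z t => liebKernel c (z - t)) hl hz).mono hsub
  have hc2 : ContinuousOn (fun t => liebKernel c (t - w)) (fermiZone q) :=
    (analyticOnNhd_left (Ψ := fun z t => liebKernel c (z - t)) hl hw).continuousOn.mono hsub
  gcongr
  refine (norm_segIntegral_le hq _).trans ?_
  gcongr
  refine (norm_mul_le _ _).trans ?_
  gcongr
  · exact norm_seg_le hc1 (by positivity) fun u hu => hb _ hz _ (hsub hu)
  · refine S.le_opNorm_of_le ?_
    exact norm_seg_le hc2 (by positivity) fun u hu => hb _ (hsub hu) _ hw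

end Dressing


/-! ### The linear integral equation for small γ. -/

section Resolvent

variable {c q δ : ℝ}

lemma isUnit_one_add_smul {E : Type*} [NormedAddCommGroup E] [NormedSpace ℂ E] [CompleteSpace E]
    (A : E →L[ℂ] E) {γ : ℂ} (hγ : γ ∈ Metric.ball (0 : ℂ) (1 / (‖A‖ + 1))) :
    IsUnit (1 + γ • A) := by
  have hlt : ‖-(γ • A)‖ < 1 := by
    rw [norm_neg, norm_smul]
    rw [mem_ball_zero_iff, lt_div_iff₀ (by positivity)] at hγ
    nlinarith [norm_nonneg γ, norm_nonneg A]
  have := (Units.oneSub _ hlt).isUnit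
  rwa [Units.val_oneSub, sub_neg_eq_add] at this

lemma analyticOnNhd_inverse_one_add_smul {E : Type*} [NormedAddCommGroup E] [NormedSpace ℂ E]
    [CompleteSpace E] (A : E →L[ℂ] E) (f : E) :
    AnalyticOnNhd ℂ (fun γ : ℂ => Ring.inverse (1 + γ • A) f) (Metric.ball 0 (1 / (‖A‖ + 1))) := by
  intro γ hγ
  have h1 : AnalyticAt ℂ (fun γ : ℂ => 1 + γ • A) γ :=
    analyticAt_const.add (analyticAt_id.smul analyticAt_const)
  have h2 : AnalyticAt ℂ (fun γ : ℂ => Ring.inverse (1 + γ • A)) γ := by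
    obtain ⟨u, hu⟩ := isUnit_one_add_smul A hγ
    refine AnalyticAt.fun_comp (g := Ring.inverse) ?_ h1
    rw [← hu]
    exact analyticAt_inverse u
  exact ((ContinuousLinearMap.apply ℂ _ f).analyticAt _).fun_comp h2

/-- The linear integral equation `(I + γ R / 2π) ρ = h` for small `γ`. -/
theorem exists_resolvent_solution (hc : 0 < c) (hq : 0 < q) (hδ : 0 < δ) (hδc : δ < c / 8)
    {M : Set ℂ} (hM : M ⊆ strip δ) (hqM : fermiZone q ⊆ M) {h : ℂ → ℂ} (hh : AnalyticOnNhd ℂ h M) :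
    ∃ γ₁ > 0, ∃ ρ : ℂ → ℂ → ℂ,
      AnalyticOnNhd ℂ (fun p : ℂ × ℂ => ρ p.1 p.2) (Metric.ball 0 γ₁ ×ˢ M) ∧
      AnalyticOnNhd ℂ (fun p : ℂ × ℂ => p.1 * ∫ t in (-q)..q,
        resolventKernel c q p.2 t / (2 * Real.pi) * ρ p.1 t) (Metric.ball 0 γ₁ ×ˢ strip δ) ∧
      ∀ γ ∈ Metric.ball (0 : ℂ) γ₁,
        (∀ w ∈ M, ρ γ w + γ * (∫ t in (-q)..q, resolventKernel c q w t / (2 * Real.pi) * ρ γ t)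
          = h w) ∧
        ∀ g : ℂ → ℂ, ContinuousOn g M →
          (∀ w ∈ M, g w + γ * (∫ t in (-q)..q, resolventKernel c q w t / (2 * Real.pi) * g t)
            = h w) → EqOn g (ρ γ) M := by
  have hsub := fermiZone_subset_strip hδ q
  have hR := analyticOnNhd_resolventKernel hc hq hδ hδc
  have hR1 := analyticOnNhd_seg (isOpen_strip δ) hsub hR
  have hRc : ∀ w ∈ strip δ, ContinuousOn (resolventKernel c q w) (fermiZone q) := fun w hw =>
    (continuousOn_right hR hw).mono hsub
  have hcont0 : Continuous fun x : Icc (-q) q => seg q (resolventKernel c q ((x : ℝ) : ℂ)) :=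
    hR1.continuousOn.comp_continuous (Complex.continuous_ofReal.comp continuous_subtype_val)
      fun x => ofReal_mem_strip hδ _
  set A := (1 / (2 * Real.pi) : ℂ) • segOp hq ⟨_, hcont0⟩ with hA
  have hp : (2 * Real.pi : ℂ) ≠ 0 := by simp [Real.pi_ne_zero]
  set T : ℂ → C(Icc (-q) q, ℂ) →L[ℂ] C(Icc (-q) q, ℂ) := fun γ => 1 + γ • A with hT
  have hγ1 : (0 : ℝ) < 1 / (‖A‖ + 1) := by positivity
  have hunit : ∀ γ ∈ Metric.ball (0 : ℂ) (1 / (‖A‖ + 1)), IsUnit (T γ) := fun γ hγ =>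
    isUnit_one_add_smul A hγ
  have hhc : ContinuousOn h (fermiZone q) := hh.continuousOn.mono hqM
  set v : ℂ → C(Icc (-q) q, ℂ) := fun γ => Ring.inverse (T γ) (seg q h) with hv
  have hTv : ∀ γ ∈ Metric.ball (0 : ℂ) (1 / (‖A‖ + 1)), T γ (v γ) = seg q h := by
    intro γ hγ
    rw [hv]
    simp only
    rw [← mul_apply_eq_comp, Ring.mul_inverse_cancel _ (hunit γ hγ), one_apply_eq_self]
  have hvan : AnalyticOnNhd ℂ v (Metric.ball 0 (1 / (‖A‖ + 1))) :=
    analyticOnNhd_inverse_one_add_smul A _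
  -- The equation is solved on the segment, by inverting 1 + γA on continuous functions; off the
  -- segment the equation itself defines the solution, which also forces uniqueness on M.
  set ρ : ℂ → ℂ → ℂ := fun γ w =>
    h w - γ * (segIntegral hq (seg q (resolventKernel c q w) * v γ) / (2 * Real.pi)) with hρ
  have hρv : ∀ γ ∈ Metric.ball (0 : ℂ) (1 / (‖A‖ + 1)), ∀ t : Icc (-q) q,
      v γ t = ρ γ (t : ℝ) := by
    intro γ hγ t
    have h1 := congrArg (fun f : C(Icc (-q) q, ℂ) => f t) (hTv γ hγ)
    simp only [hT, add_apply, one_apply_eq_self, smul_apply, ContinuousMap.add_apply,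
      ContinuousMap.smul_apply, smul_eq_mul, hA, segOp_apply, ContinuousMap.coe_mk,
      seg_apply hhc] at h1
    rw [hρ]
    linear_combination h1
  have hint : ∀ w ∈ strip δ, ∀ u : C(Icc (-q) q, ℂ), ∀ g : ℂ → ℂ, (∀ t : Icc (-q) q, u t = g (t : ℝ)) →
      ∫ t in (-q)..q, resolventKernel c q w t / (2 * Real.pi) * g t
        = segIntegral hq (seg q (resolventKernel c q w) * u) / (2 * Real.pi) := by
    intro w hw u g hug
    rw [segIntegral_eq hq (g := fun t : ℝ => resolventKernel c q w t * g t),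
      ← intervalIntegral.integral_div]
    · congr 1; ext t; ring
    · intro t
      rw [ContinuousMap.mul_apply, seg_apply (hRc w hw), hug]
  have hI : AnalyticOnNhd ℂ (fun p : ℂ × ℂ => p.1 *
      (segIntegral hq (seg q (resolventKernel c q p.2) * v p.1) / (2 * Real.pi)))
      (Metric.ball 0 (1 / (‖A‖ + 1)) ×ˢ strip δ) := by
    intro p hp
    refine analyticAt_fst.mul (AnalyticAt.div_const ?_)
    refine ((segIntegral hq).analyticAt _).fun_comp (AnalyticAt.mul ?_ ?_)
    · exact AnalyticAt.fun_comp (g := fun w => seg q (resolventKernel c q w)) (f := Prod.snd)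
        (hR1 p.2 hp.2) analyticAt_snd
    · exact AnalyticAt.fun_comp (g := v) (f := Prod.fst) (hvan p.1 hp.1) analyticAt_fst
  refine ⟨_, hγ1, ρ, ?_, ?_, fun γ hγ => ⟨fun w hw => ?_, fun g hg hge w hw => ?_⟩⟩
  · intro p hp
    exact (AnalyticAt.fun_comp (g := h) (f := Prod.snd) (hh p.2 hp.2) analyticAt_snd).sub
      (hI p ⟨hp.1, hM hp.2⟩)
  · refine hI.congr (Metric.isOpen_ball.prod (isOpen_strip δ)) fun p hp => ?_
    simp only [hint p.2 hp.2 (v p.1) (ρ p.1) (hρv p.1 hp.1)]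
  · rw [hint w (hM hw) (v γ) (ρ γ) (hρv γ hγ), hρ]
    ring
  · have hgc : ContinuousOn g (fermiZone q) := hg.mono hqM
    have hgs : ∀ t : Icc (-q) q, seg q g t = g (t : ℝ) := seg_apply hgc
    have h1 : T γ (seg q g) = seg q h := by
      ext t
      have h2 := hge _ (hqM (ofReal_mem_fermiZone t))
      rw [hint _ (ofReal_mem_strip hδ _) _ g hgs] at h2
      simp only [hT, add_apply, one_apply_eq_self, smul_apply, ContinuousMap.add_apply,
        ContinuousMap.smul_apply, smul_eq_mul, hA, segOp_apply, ContinuousMap.coe_mk,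
        seg_apply hhc, hgs]
      linear_combination h2
    have h2 : seg q g = v γ := by
      rw [hv]
      simp only
      rw [← h1, ← mul_apply_eq_comp, Ring.inverse_mul_cancel _ (hunit γ hγ), one_apply_eq_self]
    have h3 := hge w hw
    rw [hint w (hM hw) _ g hgs, h2] at h3
    rw [hρ]
    linear_combination h3

end Resolvent

/-! ### Parity and reality; the counting function on the real axis. -/

section Counting

variable {c q δ : ℝ}

lemma liebKernel_neg (z : ℂ) : liebKernel c (-z) = liebKernel c z := by simp [liebKernel]

lemma barePhase_neg {z : ℂ} (hz : |z.im| < c) : barePhase c (-z) = -barePhase c z := by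
  unfold barePhase
  have e : (Complex.I * c + -z) / (Complex.I * c - -z) = ((Complex.I * c + z) / (Complex.I * c - z))⁻¹ := by
    rw [inv_div]; ring_nf
  rw [e, Complex.log_inv _ (Complex.slitPlane_arg_ne_pi (barePhase_slit hz))]
  ring

lemma liebOp_neg {g : ℂ → ℂ} (hg : ∀ z, g (-z) = g z) (z : ℂ) : liebOp c q g (-z) = liebOp c q g z := by
  unfold liebOp
  congr 1
  have := intervalIntegral.integral_comp_neg (a := -q) (b := q)
    (fun t : ℝ => liebKernel c (z - t) * g t)
  rw [neg_neg] at this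
  rw [← this]
  congr 1
  ext t
  push_cast
  rw [hg, ← liebKernel_neg]
  ring_nf

lemma dressedCharge_neg (z : ℂ) : dressedCharge c q (-z) = dressedCharge c q z := by
  unfold dressedCharge dress
  refine tsum_congr fun n => ?_
  have h : ∀ z, ((liebOp c q)^[n] fun _ => 1) (-z) = ((liebOp c q)^[n] fun _ => 1) z := by
    induction n with
    | zero => intro z; rfl
    | succ n ih => intro z; simp only [Function.iterate_succ_apply']; exact liebOp_neg ih z
  exact h z

lemma liebOp_ofReal {g : ℂ → ℂ} (hg : ∀ t : ℝ, (g t).im = 0) (x : ℝ) : (liebOp c q g x).im = 0 := by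
  have e : liebOp c q g x
      = (((∫ t in (-q)..q, 2 * c / ((x - t) ^ 2 + c ^ 2) * (g t).re) / (2 * Real.pi) : ℝ) : ℂ) := by
    unfold liebOp
    push_cast
    rw [← intervalIntegral.integral_ofReal]
    congr 2
    ext t
    have : g t = ((g t).re : ℂ) := by apply Complex.ext <;> simp [hg]
    rw [this]
    unfold liebKernel
    push_cast
    simp
  rw [e, Complex.ofReal_im]

lemma dressedCharge_im (hc : 0 < c) (hq : 0 < q) (x : ℝ) : (dressedCharge c q x).im = 0 := by
  have h : ∀ n : ℕ, ∀ x : ℝ, (((liebOp c q)^[n] fun _ => 1) (x : ℂ)).im = 0 := by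
    intro n
    induction n with
    | zero => intro x; simp
    | succ n ih => intro x; simp only [Function.iterate_succ_apply']; exact liebOp_ofReal ih x
  have hs := summable_iterate (g := fun _ => 1) hc hq continuous_const (z := (x : ℂ)) (by simpa using hc)
  unfold dressedCharge dress
  rw [Complex.im_tsum hs]
  simp [h]

lemma barePhase_im (hc : 0 < c) (x : ℝ) : (barePhase c x).im = 0 := by
  unfold barePhase
  have h1 : ‖(Complex.I * c + x) / (Complex.I * c - x)‖ = 1 := by
    have hne : ‖Complex.I * c - x‖ ≠ 0 :=
      norm_ne_zero_iff.2 (factor_ne (c := c) (z := (x : ℂ)) (by simpa using hc)).2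
    rw [norm_div, div_eq_one_iff_eq hne, ← sq_eq_sq₀ (norm_nonneg _) (norm_nonneg _),
      ← Complex.normSq_eq_norm_sq, ← Complex.normSq_eq_norm_sq]
    simp [Complex.normSq_apply]
  rw [Complex.I_mul_im, Complex.log_re, h1, Real.log_one]

lemma dressedMomentum_neg (hc : 0 < c) (x : ℝ) :
    dressedMomentum c q (-x : ℂ) = -dressedMomentum c q x := by
  unfold dressedMomentum
  have := intervalIntegral.integral_comp_neg (a := -q) (b := q)
    (fun t : ℝ => barePhase c (x - t) * dressedCharge c q t)
  rw [neg_neg] at this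
  rw [← this, neg_add, ← neg_div, ← intervalIntegral.integral_neg]
  congr 3
  ext t
  push_cast
  rw [dressedCharge_neg, ← neg_mul, ← barePhase_neg (by simpa using hc)]
  ring_nf

lemma dressedMomentum_im (hc : 0 < c) (hq : 0 < q) (x : ℝ) : (dressedMomentum c q x).im = 0 := by
  have e : dressedMomentum c q x = ((x + (∫ t in (-q)..q, (barePhase c ((x - t : ℝ) : ℂ)).re
      * (dressedCharge c q t).re) / (2 * Real.pi) : ℝ) : ℂ) := by
    unfold dressedMomentum
    push_cast
    rw [← intervalIntegral.integral_ofReal]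
    congr 3
    ext t
    have h1 : dressedCharge c q t = ((dressedCharge c q t).re : ℂ) := by
      apply Complex.ext <;> simp [dressedCharge_im hc hq]
    have h2 : barePhase c ((x : ℂ) - t) = ((barePhase c ((x - t : ℝ) : ℂ)).re : ℂ) := by
      rw [← Complex.ofReal_sub]
      apply Complex.ext <;> simp only [Complex.ofReal_re, Complex.ofReal_im, barePhase_im hc]
    rw [h1, h2]
    push_cast
    simp
  rw [e, Complex.ofReal_im]

lemma hasDerivAt_countingFunction (hc : 0 < c) (hq : 0 < q) {z : ℂ} (hz : |z.im| < c) :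
    HasDerivAt (countingFunction c q) (dressedCharge c q z / (2 * Real.pi)) z :=
  ((hasDerivAt_dressedMomentum hc hq hz).div_const _).add_const _

lemma countingFunction_ofReal (hc : 0 < c) (hq : 0 < q) (x : ℝ) :
    countingFunction c q x = ((countingFunction c q x).re : ℂ) := by
  have h : dressedMomentum c q x = ((dressedMomentum c q x).re : ℂ) := by
    apply Complex.ext <;> simp [dressedMomentum_im hc hq]
  have : countingFunction c q x
      = (((dressedMomentum c q x).re / (2 * Real.pi) + density c q / 2 : ℝ) : ℂ) := by
    unfold countingFunction
    rw [h]
    push_cast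
    simp
  rw [this, Complex.ofReal_re]

lemma countingFunction_right (hc : 0 < c) (hq : 0 < q) : countingFunction c q q = density c q := by
  have h : dressedMomentum c q q = ((dressedMomentum c q q).re : ℂ) := by
    apply Complex.ext <;> simp [dressedMomentum_im hc hq]
  unfold countingFunction density
  rw [h]
  have hp : (Real.pi : ℂ) ≠ 0 := by simp [Real.pi_ne_zero]
  push_cast
  simp only [Complex.ofReal_re]
  field_simp
  ring

lemma countingFunction_left (hc : 0 < c) (hq : 0 < q) : countingFunction c q (-q : ℂ) = 0 := by
  have h := countingFunction_right hc hq
  unfold countingFunction at h ⊢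
  rw [dressedMomentum_neg hc]
  linear_combination -h

/-- The counting function on the real axis. -/
noncomputable def realCounting (c q : ℝ) (t : ℝ) : ℝ := (countingFunction c q t).re

lemma hasDerivAt_realCounting (hc : 0 < c) (hq : 0 < q) (t : ℝ) :
    HasDerivAt (realCounting c q) ((dressedCharge c q t).re / (2 * Real.pi)) t := by
  have h := (hasDerivAt_countingFunction hc hq (z := (t : ℂ)) (by simpa using hc)).real_of_complex
  refine h.congr_deriv ?_
  have : (2 * Real.pi : ℂ) = ((2 * Real.pi : ℝ) : ℂ) := by push_cast; rfl
  rw [this, Complex.div_ofReal_re]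

lemma realCounting_left (hc : 0 < c) (hq : 0 < q) : realCounting c q (-q) = 0 := by
  unfold realCounting
  push_cast
  rw [countingFunction_left hc hq, Complex.zero_re]

lemma realCounting_right (hc : 0 < c) (hq : 0 < q) : realCounting c q q = density c q := by
  unfold realCounting
  rw [countingFunction_right hc hq, Complex.ofReal_re]

lemma continuous_realCounting (hc : 0 < c) (hq : 0 < q) : Continuous (realCounting c q) :=
  continuous_iff_continuousAt.2 fun t => (hasDerivAt_realCounting hc hq t).continuousAt

lemma density_pos (hc : 0 < c) (hq : 0 < q) (hZ : ∀ t : ℝ, 0 < (dressedCharge c q t).re) :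
    0 < density c q := by
  have hmono : StrictMono (realCounting c q) := strictMono_of_deriv_pos fun t => by
    rw [(hasDerivAt_realCounting hc hq t).deriv]
    have := hZ t
    have := Real.pi_pos
    positivity
  rw [← realCounting_right hc hq, ← realCounting_left hc hq]
  exact hmono (by linarith)

/-- On the real axis ξ is real and continuous, with ξ(-q) = 0 by oddness of p and ξ(q) = D. -/
lemma exists_countingFunction_eq (hc : 0 < c) (hq : 0 < q) {x : ℝ} (hx : x ∈ Icc 0 (density c q)) :
    ∃ t ∈ fermiZone q, countingFunction c q t = x := by
  rw [← realCounting_left hc hq, ← realCounting_right hc hq] at hx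
  obtain ⟨t, ht, htx⟩ := intermediate_value_Icc (by linarith : -q ≤ q)
    (continuous_realCounting hc hq).continuousOn hx
  refine ⟨t, mem_image_of_mem _ ht, ?_⟩
  rw [countingFunction_ofReal hc hq, ← htx]
  rfl

end Counting


/-! ### Roots of the shifted counting function, with constants independent of L. -/

lemma norm_le_supNorm {K : Set ℂ} (hK : IsCompact K) {f : ℂ → ℂ} (hf : ContinuousOn f K) {u : ℂ}
    (hu : u ∈ K) : ‖f u‖ ≤ supNorm K f :=
  le_csSup (hK.image_of_continuousOn hf.norm).bddAbove (mem_image_of_mem _ hu)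

lemma supNorm_le {K : Set ℂ} {f : ℂ → ℂ} {b : ℝ} (hb : 0 ≤ b) (h : ∀ u ∈ K, ‖f u‖ ≤ b) :
    supNorm K f ≤ b :=
  Real.sSup_le (by rintro _ ⟨u, hu, rfl⟩; exact h u hu) hb

lemma supNorm_nonneg (K : Set ℂ) (f : ℂ → ℂ) : 0 ≤ supNorm K f :=
  Real.sSup_nonneg (by rintro _ ⟨u, _, rfl⟩; exact norm_nonneg _)

/-- The shifted counting function `ξ_ν = ξ + ν / L`. -/
noncomputable def shifted (c q L : ℝ) (ν : ℂ → ℂ) (w : ℂ) : ℂ := countingFunction c q w + ν w / L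

/-- Functions which are holomorphic in the interior of `M` and bounded by `b` on `K`. -/
structure Adm (M K : Set ℂ) (b : ℝ) (ν : ℂ → ℂ) : Prop where
  analytic : AnalyticOnNhd ℂ ν (interior M)
  bound : ∀ u ∈ K, ‖ν u‖ ≤ b

/-- The geometric constants which control the roots of `ξ_ν = x` enclosed by a loop. -/
structure RootData (c q δ b : ℝ) (M K : Set ℂ) (z : ℝ → ℂ) where
  -- Here r is the width of a neighbourhood of the hull inside M, κ the expansion constant of ξ
  -- there, d₀ the width of the neighbourhood of the Fermi zone that receives the roots, d₁ its
  -- distance to the loop; Cφ and Ξ bound ∂φ and ξ, and η and L₀ are the thresholds for |N/L - D|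
  -- and L.
  (r κ d₀ d₁ Cφ Ξ η L₀ : ℝ)
  c_pos : 0 < c
  q_pos : 0 < q
  δ_pos : 0 < δ
  δ_lt : δ < c / 8
  b_pos : 0 < b
  loop : IsJordanLoop z
  isCompact_M : IsCompact M
  isCompact_K : IsCompact K
  M_subset : M ⊆ strip δ
  K_subset : K ⊆ interior M
  density_pos : 0 < density c q
  fermi_subset_K : fermiZone q ⊆ K
  r_pos : 0 < r
  thick : Metric.cthickening r (hull z) ⊆ interior M
  control : ∀ ν : ℂ → ℂ, DifferentiableOn ℂ ν (interior M) → ∀ a, (∀ u ∈ K, ‖ν u‖ ≤ a) →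
    ∀ u ∈ Metric.cthickening r (hull z), ‖ν u‖ ≤ a
  κ_pos : 0 < κ
  anti : ∀ u ∈ Metric.cthickening r (hull z), ∀ v ∈ Metric.cthickening r (hull z),
    κ ≤ ‖dslope (countingFunction c q) u v‖
  d₀_pos : 0 < d₀
  core_subset : Metric.cthickening d₀ (fermiZone q) ⊆ inside z
  d₁_pos : 0 < d₁
  sep : ∀ ζ ∈ trace z, ∀ w ∈ Metric.cthickening d₀ (fermiZone q), d₁ ≤ ‖ζ - w‖
  Cφ_pos : 0 < Cφ
  dφ_bound : ∀ u ∈ strip δ, ∀ w ∈ strip δ, ‖deriv (dressedPhase c q u) w‖ ≤ Cφ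
  ξ_bound : ∀ u ∈ Metric.cthickening r (hull z), ‖countingFunction c q u‖ ≤ Ξ
  η_pos : 0 < η
  η_le : η ≤ κ * d₀ / 16
  L₀_pos : 0 < L₀
  L₀_lip : 4 * b / (r * L₀) ≤ κ / 2
  L₀_core : b / L₀ ≤ κ * d₀ / 16

lemma differentiableOn_countingFunction {c q δ : ℝ} (hc : 0 < c) (hq : 0 < q) (hδc : δ < c / 8) :
    DifferentiableOn ℂ (countingFunction c q) (strip δ) := fun _ hz =>
  (hasDerivAt_countingFunction hc hq
    (abs_im_lt_of_mem_strip hc hδc hz)).differentiableAt.differentiableWithinAt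

/-- Injectivity of ξ comes from that of p, and ξ' = Z/2π does not vanish since Re Z > 0; compactness
does the rest. L₀ makes ν/L harmless in two ways: its Lipschitz constant is at most κ/2 and its size
at most κ d₀/16. -/
theorem exists_rootData {c q δ b : ℝ} (hc : 0 < c) (hq : 0 < q) (hδ : 0 < δ) (hδc : δ < c / 8)
    (hb : 0 < b) (hp : InjOn (dressedMomentum c q) (strip δ))
    (hZ : ∃ m > 0, ∀ w ∈ strip δ, m ≤ (dressedCharge c q w).re)
    {M K : Set ℂ} {z : ℝ → ℂ} (hM : IsCompact M) (hMc : IsConnected Mᶜ) (hMδ : M ⊆ strip δ)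
    (hK : IsCompact K) (hKM : K ⊆ interior M) (hqK : fermiZone q ⊆ interior K)
    (hz : IsJordanLoop z) (hzK : trace z ⊆ interior K) (hqz : fermiZone q ⊆ inside z) :
    Nonempty (RootData c q δ b M K z) := by
  obtain ⟨m, hm, hZm⟩ := hZ
  obtain ⟨r, hr, hthick, hctrl⟩ := hz.exists_thickening hM hMc hKM hzK
  have hzM : trace z ⊆ interior M := hzK.trans (interior_subset.trans hKM)
  have hcomp : IsCompact (Metric.cthickening r (hull z)) := (hz.isCompact_hull hM hMc hzM).cthickening
  have hsub : Metric.cthickening r (hull z) ⊆ strip δ := hthick.trans (interior_subset.trans hMδ)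
  have hdiff := differentiableOn_countingFunction (q := q) hc hq hδc
  have hpi : (2 * Real.pi : ℂ) ≠ 0 := by simp [Real.pi_ne_zero]
  have hinj : InjOn (countingFunction c q) (strip δ) := by
    intro u hu v hv huv
    refine hp hu hv ?_
    unfold countingFunction at huv
    have := add_right_cancel huv
    field_simp at this
    exact this
  have hder : ∀ u ∈ strip δ, deriv (countingFunction c q) u ≠ 0 := by
    intro u hu h0
    rw [(hasDerivAt_countingFunction hc hq (abs_im_lt_of_mem_strip hc hδc hu)).deriv,
      div_eq_zero_iff] at h0
    have h1 := h0.resolve_right hpi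
    have h2 := hZm u hu
    rw [h1, Complex.zero_re] at h2
    linarith
  obtain ⟨κ, hκ, hanti⟩ := exists_antilipschitz (isOpen_strip δ) hdiff hinj hder hcomp hsub
  obtain ⟨d₀, hd₀, hcore⟩ := (isCompact_fermiZone q).exists_cthickening_subset_open
    hz.isOpen_inside hqz
  have hdisj : Disjoint (trace z) (Metric.cthickening d₀ (fermiZone q)) :=
    disjoint_left.2 fun u hu hu' => (hcore hu').1 hu
  obtain ⟨d₁, hd₁, hsep⟩ := Metric.exists_pos_forall_lt_edist hz.isCompact_trace
    Metric.isClosed_cthickening hdisj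
  obtain ⟨CR, hCR, hR⟩ := exists_resolventKernel_bound hc hq hδ hδc
  obtain ⟨Ξ, hΞ⟩ := hcomp.exists_bound_of_continuousOn (hdiff.continuousOn.mono hsub)
  have hpp := Real.pi_pos
  refine ⟨{
    r := r, κ := κ, d₀ := d₀, d₁ := d₁, Cφ := CR / (2 * Real.pi), Ξ := Ξ, η := κ * d₀ / 16
    L₀ := max (8 * b / (r * κ)) (16 * b / (κ * d₀))
    c_pos := hc, q_pos := hq, δ_pos := hδ, δ_lt := hδc, b_pos := hb, loop := hz
    isCompact_M := hM, isCompact_K := hK, M_subset := hMδ, K_subset := hKM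
    density_pos := density_pos hc hq fun t => hm.trans_le (hZm _ (ofReal_mem_strip hδ t))
    fermi_subset_K := hqK.trans interior_subset
    r_pos := hr, thick := hthick, control := hctrl, κ_pos := hκ, anti := hanti
    d₀_pos := hd₀, core_subset := hcore, d₁_pos := NNReal.coe_pos.2 hd₁
    sep := fun ζ hζ w hw => ?_
    Cφ_pos := by positivity
    dφ_bound := fun u hu w hw => ?_
    ξ_bound := hΞ, η_pos := by positivity, η_le := le_rfl
    L₀_pos := by positivity
    L₀_lip := ?_, L₀_core := ?_ }⟩
  · have := hsep ζ hζ w hw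
    rw [edist_nndist, ENNReal.coe_lt_coe] at this
    rw [← dist_eq_norm, ← coe_nndist]
    exact_mod_cast this.le
  · rw [deriv_dressedPhase hc hq hδ hδc hu hw, norm_div, norm_neg]
    have : ‖(2 * Real.pi : ℂ)‖ = 2 * Real.pi := by simp [abs_of_pos hpp]
    rw [this]
    gcongr
    exact hR u hu w hw
  · have h1 := le_max_left (8 * b / (r * κ)) (16 * b / (κ * d₀))
    rw [div_le_iff₀ (by positivity)] at h1 ⊢
    nlinarith
  · have h1 := le_max_right (8 * b / (r * κ)) (16 * b / (κ * d₀))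
    rw [div_le_iff₀ (by positivity)] at h1 ⊢
    nlinarith

lemma Adm.mono {M K : Set ℂ} {a b : ℝ} {ν : ℂ → ℂ} (h : Adm M K a ν) (hab : a ≤ b) : Adm M K b ν :=
  ⟨h.analytic, fun u hu => (h.bound u hu).trans hab⟩

namespace RootData

variable {c q δ b : ℝ} {M K : Set ℂ} {z : ℝ → ℂ} (R : RootData c q δ b M K z)

/-- The compact neighbourhood of the hull on which estimates are made. -/
def nbhd : Set ℂ := Metric.cthickening (R.r / 2) (hull z)

/-- The compact neighbourhood of the Fermi zone which contains the roots. -/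
def core : Set ℂ := Metric.cthickening R.d₀ (fermiZone q)

/-- The open neighbourhood of the hull on which residues are computed. -/
def openNbhd : Set ℂ := Metric.thickening (R.r / 2) (hull z)

lemma nbhd_subset_thick : R.nbhd ⊆ Metric.cthickening R.r (hull z) :=
  Metric.cthickening_mono (by linarith [R.r_pos]) _

lemma hull_subset_nbhd : hull z ⊆ R.nbhd := Metric.self_subset_cthickening _

lemma inside_subset_nbhd : inside z ⊆ R.nbhd := IsJordanLoop.inside_subset_hull.trans R.hull_subset_nbhd

lemma trace_subset_nbhd : trace z ⊆ R.nbhd := IsJordanLoop.trace_subset_hull.trans R.hull_subset_nbhd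

lemma core_subset_nbhd : R.core ⊆ R.nbhd := R.core_subset.trans R.inside_subset_nbhd

lemma thick_subset_strip : Metric.cthickening R.r (hull z) ⊆ strip δ :=
  R.thick.trans (interior_subset.trans R.M_subset)

lemma nbhd_subset_strip : R.nbhd ⊆ strip δ := R.nbhd_subset_thick.trans R.thick_subset_strip

lemma nbhd_subset_interior : R.nbhd ⊆ interior M := R.nbhd_subset_thick.trans R.thick

lemma core_subset_strip : R.core ⊆ strip δ := R.core_subset_nbhd.trans R.nbhd_subset_strip

lemma isCompact_core : IsCompact R.core := (isCompact_fermiZone q).cthickening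

lemma fermi_subset_core : fermiZone q ⊆ R.core := Metric.self_subset_cthickening _

lemma openNbhd_subset_nbhd : R.openNbhd ⊆ R.nbhd := Metric.thickening_subset_cthickening _ _

lemma isOpen_openNbhd : IsOpen R.openNbhd := Metric.isOpen_thickening

lemma hull_subset_openNbhd : hull z ⊆ R.openNbhd :=
  Metric.self_subset_thickening (by linarith [R.r_pos]) _

lemma ball_subset_thick {u : ℂ} (hu : u ∈ R.nbhd) :
    Metric.ball u (R.r / 2) ⊆ Metric.cthickening R.r (hull z) := by
  have hr := R.r_pos
  have h1 := (Metric.ball_subset_closedBall.trans (Metric.closedBall_subset_cthickening hu (R.r / 2))).trans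
    (Metric.cthickening_cthickening_subset (by linarith) (by linarith) _)
  rwa [add_halves] at h1

/-- Schwarz's lemma on balls of radius r/2 centred in `nbhd`; the bound on K propagates to them by
`control`. -/
lemma lipschitz {f : ℂ → ℂ} {a : ℝ} (hf : DifferentiableOn ℂ f (interior M))
    (ha : ∀ u ∈ K, ‖f u‖ ≤ a) {u v : ℂ} (hu : u ∈ Metric.cthickening R.r (hull z)) (hv : v ∈ R.nbhd) :
    ‖f u - f v‖ ≤ 4 * a / R.r * ‖u - v‖ := by
  have hr := R.r_pos
  have h := norm_sub_le_of_bound_ball (x := v) (y := u) (r := R.r / 2) (b := a) (by linarith)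
    (hf.mono ((R.ball_subset_thick hv).trans R.thick))
    (fun w hw => R.control f hf a ha w (R.ball_subset_thick hv hw)) (R.control f hf a ha u hu)
  refine h.trans (le_of_eq ?_)
  field_simp
  ring

lemma bound {ν : ℂ → ℂ} {a : ℝ} (hν : Adm M K a ν) {u : ℂ} (hu : u ∈ R.nbhd) : ‖ν u‖ ≤ a :=
  R.control ν hν.analytic.differentiableOn a hν.bound u (R.nbhd_subset_thick hu)

variable {L : ℝ} {ν : ℂ → ℂ}

lemma L_pos (hL : R.L₀ ≤ L) : 0 < L := R.L₀_pos.trans_le hL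

/-- The shifted counting function expands distances. -/
lemma shifted_anti (hL : R.L₀ ≤ L) (hν : Adm M K b ν) {u v : ℂ}
    (hu : u ∈ R.nbhd) (hv : v ∈ R.nbhd) :
    R.κ / 2 * ‖u - v‖ ≤ ‖shifted c q L ν u - shifted c q L ν v‖ := by
  have hLp := R.L_pos hL
  have hr := R.r_pos
  have h1 := R.anti v (R.nbhd_subset_thick hv) u (R.nbhd_subset_thick hu)
  have h2 : countingFunction c q u - countingFunction c q v
      = dslope (countingFunction c q) v u * (u - v) := by
    rw [mul_comm, ← smul_eq_mul, sub_smul_dslope]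
  have h3 := R.lipschitz hν.analytic.differentiableOn hν.bound (R.nbhd_subset_thick hu) hv
  have h4 : ‖(ν u - ν v) / (L : ℂ)‖ ≤ R.κ / 2 * ‖u - v‖ := by
    rw [norm_div, Complex.norm_real, Real.norm_of_nonneg hLp.le, div_le_iff₀ hLp]
    have h5 := R.L₀_lip
    have h6 : 4 * b / R.r ≤ R.κ / 2 * L := by
      have hb := R.b_pos
      have : 4 * b / R.r ≤ R.κ / 2 * R.L₀ := by
        rw [div_le_iff₀ (mul_pos hr R.L₀_pos)] at h5
        rw [div_le_iff₀ hr]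
        linarith
      refine this.trans ?_
      have := R.κ_pos
      gcongr
    calc ‖ν u - ν v‖ ≤ 4 * b / R.r * ‖u - v‖ := h3
      _ ≤ R.κ / 2 * L * ‖u - v‖ := by gcongr
      _ = _ := by ring
  have h5 : R.κ * ‖u - v‖ ≤ ‖countingFunction c q u - countingFunction c q v‖ := by
    rw [h2, norm_mul]
    gcongr
  have e : shifted c q L ν u - shifted c q L ν v
      = (countingFunction c q u - countingFunction c q v) + (ν u - ν v) / L := by
    unfold shifted; ring
  rw [e]
  have h6 := norm_sub_le_norm_add (countingFunction c q u - countingFunction c q v) ((ν u - ν v) / L)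
  linarith

lemma shifted_inj (hL : R.L₀ ≤ L) (hν : Adm M K b ν) {u v : ℂ} (hu : u ∈ R.nbhd) (hv : v ∈ R.nbhd)
    (h : shifted c q L ν u = shifted c q L ν v) : u = v := by
  have h1 := R.shifted_anti hL hν hu hv
  rw [h, sub_self, norm_zero] at h1
  have h2 := R.κ_pos
  by_contra hne
  have : 0 < ‖u - v‖ := norm_pos_iff.2 (sub_ne_zero.2 hne)
  nlinarith

lemma differentiableOn_shifted (R : RootData c q δ b M K z) (hν : Adm M K b ν) :
    DifferentiableOn ℂ (shifted c q L ν) (interior M) :=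
  ((differentiableOn_countingFunction R.c_pos R.q_pos R.δ_lt).mono
    (interior_subset.trans R.M_subset)).add (hν.analytic.differentiableOn.div_const _)

/-- Existence of the root. -/
lemma exists_root (hL : R.L₀ ≤ L) (hν : Adm M K b ν) {x : ℝ} (hx0 : 0 ≤ x)
    (hx : x ≤ density c q + R.η) : ∃ w ∈ R.core, shifted c q L ν w = x := by
  have hLp := R.L_pos hL
  have hκ := R.κ_pos
  have hd := R.d₀_pos
  -- The value is truncated at D because j/L may exceed it by up to η; the excess is absorbed in the
  -- perturbation below.
  obtain ⟨t, ht, htx⟩ := exists_countingFunction_eq R.c_pos R.q_pos (x := min x (density c q))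
    ⟨le_min hx0 R.density_pos.le, min_le_right _ _⟩
  have hball : Metric.closedBall t R.d₀ ⊆ R.core := Metric.closedBall_subset_cthickening ht _
  have htn : t ∈ R.nbhd := R.core_subset_nbhd (R.fermi_subset_core ht)
  have hdc : DiffContOnCl ℂ (shifted c q L ν) (Metric.ball t R.d₀) := by
    refine DifferentiableOn.diffContOnCl_ball (U := interior M) (R.differentiableOn_shifted hν) ?_
    exact hball.trans (R.core_subset_nbhd.trans R.nbhd_subset_interior)
  -- Quantitative open mapping: on the circle of radius d₀ around t, ξ_ν keeps a distance κ d₀/2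
  -- from ξ_ν(t), so its image covers the ball of radius κ d₀/4. The target x is within η + b/L ≤ κ
  -- d₀/8 of the centre.
  have himg := hdc.ball_subset_image_closedBall hd (ε := R.κ / 2 * R.d₀) (fun u hu => ?_) ?_
  · obtain ⟨w, hw, hwx⟩ := himg (a := (x : ℂ)) (by
      rw [mem_ball_iff_norm]
      have e : (x : ℂ) - shifted c q L ν t = ((x - min x (density c q) : ℝ) : ℂ) - ν t / L := by
        unfold shifted; rw [htx]; push_cast; ring
      have h1 : ‖((x - min x (density c q) : ℝ) : ℂ)‖ ≤ R.η := by
        rw [Complex.norm_real, Real.norm_eq_abs, abs_le]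
        constructor
        · linarith [min_le_left x (density c q), R.η_pos]
        · rcases le_total x (density c q) with h | h
          · rw [min_eq_left h]; linarith [R.η_pos]
          · rw [min_eq_right h]; linarith
      have h2 : ‖ν t / (L : ℂ)‖ ≤ R.κ * R.d₀ / 16 := by
        rw [norm_div, Complex.norm_real, Real.norm_of_nonneg hLp.le]
        refine le_trans ?_ R.L₀_core
        have hb := R.b_pos
        have hL0 := R.L₀_pos
        have := R.bound hν htn
        gcongr
      have h3 := R.η_le
      rw [e]
      refine (norm_sub_le _ _).trans_lt ?_
      have : 0 < R.κ * R.d₀ := by positivity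
      linarith)
    exact ⟨w, hball hw, hwx⟩
  · have h1 := R.shifted_anti hL hν (R.core_subset_nbhd (hball (Metric.sphere_subset_closedBall hu))) htn
    rwa [mem_sphere_iff_norm.1 hu] at h1
  · have h1 : ∀ᶠ u in 𝓝[≠] t, shifted c q L ν u ≠ shifted c q L ν t := by
      filter_upwards [self_mem_nhdsWithin, nhdsWithin_le_nhds (Metric.closedBall_mem_nhds t hd)]
        with u hu hu' h
      exact hu (R.shifted_inj hL hν (R.core_subset_nbhd (hball hu')) htn h)
    exact h1.frequently.filter_mono nhdsWithin_le_nhds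

/-- Lipschitz dependence of the root on the shift. -/
lemma norm_root_sub_le (hL : R.L₀ ≤ L) {ν' : ℂ → ℂ} (hν : Adm M K b ν) {u u' x : ℂ}
    (hu : u ∈ R.nbhd) (hu' : u' ∈ R.nbhd) (hx : shifted c q L ν u = x)
    (hx' : shifted c q L ν' u' = x) {a : ℝ} (ha : ‖ν' u' - ν u'‖ ≤ a) :
    ‖u - u'‖ ≤ 2 / (R.κ * L) * a := by
  have hLp := R.L_pos hL
  have hκ := R.κ_pos
  have h1 := R.shifted_anti hL hν hu hu'
  have e : shifted c q L ν u - shifted c q L ν u' = (ν' u' - ν u') / L := by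
    rw [hx, ← hx']; unfold shifted; ring
  rw [e, norm_div, Complex.norm_real, Real.norm_of_nonneg hLp.le, le_div_iff₀ hLp] at h1
  rw [div_mul_eq_mul_div, le_div_iff₀ (by positivity)]
  nlinarith

lemma shifted_sub_ne (hL : R.L₀ ≤ L) (hν : Adm M K b ν) {w ζ x : ℂ} (hw : w ∈ R.core)
    (hx : shifted c q L ν w = x) (hζ : ζ ∈ R.nbhd) (hζc : ζ ∉ R.core) :
    shifted c q L ν ζ - x ≠ 0 := by
  intro h
  rw [← hx] at h
  exact hζc (R.shifted_inj hL hν hζ (R.core_subset_nbhd hw) (sub_eq_zero.1 h) ▸ hw)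

lemma trace_not_core {ζ : ℂ} (hζ : ζ ∈ trace z) : ζ ∉ R.core := fun h => (R.core_subset h).1 hζ

lemma shifted_sub_lower (hL : R.L₀ ≤ L) (hν : Adm M K b ν) {w ζ x : ℂ} (hw : w ∈ R.core)
    (hx : shifted c q L ν w = x) (hζ : ζ ∈ trace z) :
    R.κ / 2 * R.d₁ ≤ ‖shifted c q L ν ζ - x‖ := by
  rw [← hx]
  refine le_trans ?_ (R.shifted_anti hL hν (R.trace_subset_nbhd hζ) (R.core_subset_nbhd hw))
  have := R.κ_pos
  gcongr
  exact R.sep ζ hζ w hw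

/-- Off the diagonal this is `shifted_anti`; it passes to ζ = w by continuity of the divided
difference, since `nbhd` is a neighbourhood of every point of `core`. -/
lemma dslope_shifted_lower (hL : R.L₀ ≤ L) (hν : Adm M K b ν) {w ζ : ℂ} (hw : w ∈ R.core)
    (hζ : ζ ∈ R.nbhd) : R.κ / 2 ≤ ‖dslope (shifted c q L ν) w ζ‖ := by
  have hwint : w ∈ interior M := R.nbhd_subset_interior (R.core_subset_nbhd hw)
  have hne : ∀ ζ ∈ R.nbhd, ζ ≠ w → R.κ / 2 ≤ ‖dslope (shifted c q L ν) w ζ‖ := by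
    intro ζ hζ hζw
    have h1 := R.shifted_anti hL hν hζ (R.core_subset_nbhd hw)
    have hpos : 0 < ‖ζ - w‖ := norm_pos_iff.2 (sub_ne_zero.2 hζw)
    rw [dslope_of_ne _ hζw, slope_def_field, norm_div, le_div_iff₀ hpos]
    exact h1
  rcases eq_or_ne ζ w with rfl | hζw
  · have hd := (R.differentiableOn_shifted (L := L) hν).differentiableAt (isOpen_interior.mem_nhds hwint)
    have hc : ContinuousAt (dslope (shifted c q L ν) ζ) ζ := continuousAt_dslope_same.2 hd
    refine ge_of_tendsto (hc.norm.mono_left (nhdsWithin_le_nhds (s := {ζ}ᶜ))) ?_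
    have hnb : R.nbhd ∈ 𝓝 ζ := Filter.mem_of_superset
      (R.isOpen_openNbhd.mem_nhds (R.hull_subset_openNbhd (IsJordanLoop.inside_subset_hull (R.core_subset hw))))
      R.openNbhd_subset_nbhd
    filter_upwards [self_mem_nhdsWithin, nhdsWithin_le_nhds hnb] with u hu hu'
    exact hne u hu' hu
  · exact hne ζ hζ hζw

lemma deriv_shifted_lower (hL : R.L₀ ≤ L) (hν : Adm M K b ν) {w : ℂ} (hw : w ∈ R.core) :
    R.κ / 2 ≤ ‖deriv (shifted c q L ν) w‖ := by
  rw [← dslope_same]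
  exact R.dslope_shifted_lower hL hν hw (R.core_subset_nbhd hw)

/-- The residue at the root. -/
lemma contourIntegral_div_shifted (hL : R.L₀ ≤ L) (hν : Adm M K b ν) {w x : ℂ} (hw : w ∈ R.core)
    (hx : shifted c q L ν w = x) {g : ℂ → ℂ} (hg : DifferentiableOn ℂ g R.openNbhd) :
    contourIntegral z (fun u => g u / (shifted c q L ν u - x))
      = 2 * Real.pi * Complex.I * (g w / deriv (shifted c q L ν) w) := by
  have hκ := R.κ_pos
  have hin := R.core_subset hw
  have hwO : w ∈ R.openNbhd := R.hull_subset_openNbhd (IsJordanLoop.inside_subset_hull hin)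
  have hsd : DifferentiableOn ℂ (shifted c q L ν) R.openNbhd :=
    (R.differentiableOn_shifted hν).mono (R.openNbhd_subset_nbhd.trans R.nbhd_subset_interior)
  have hds : DifferentiableOn ℂ (dslope (shifted c q L ν) w) R.openNbhd :=
    (Complex.differentiableOn_dslope (R.isOpen_openNbhd.mem_nhds hwO)).2 hsd
  -- With ξ_ν(u) - x = (u - w) · dslope and a zero-free second factor, the residue is Cauchy's
  -- formula for g divided by the divided difference.
  have hne : ∀ u ∈ R.openNbhd, dslope (shifted c q L ν) w u ≠ 0 := fun u hu h => by
    have := R.dslope_shifted_lower hL hν hw (R.openNbhd_subset_nbhd hu)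
    rw [h, norm_zero] at this
    linarith
  have hbd : Bornology.IsBounded R.openNbhd :=
    R.isCompact_M.isBounded.subset ((R.openNbhd_subset_nbhd.trans R.nbhd_subset_interior).trans
      interior_subset)
  have h1 := R.loop.contourIntegral_div_sub R.isOpen_openNbhd hbd
    (IsJordanLoop.trace_subset_hull.trans R.hull_subset_openNbhd)
    (fun v hv => IsJordanLoop.windingNumber_eq_zero_of_notMem_hull fun hv' => hv (R.hull_subset_openNbhd hv'))
    (hg.div hds hne) hwO hin.1
  simp only [Pi.div_apply] at h1
  rw [hin.2, mul_one, dslope_same] at h1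
  rw [← h1]
  refine IsJordanLoop.contourIntegral_congr fun u hu => ?_
  have huw : u ≠ w := fun h => hin.1 (h ▸ hu)
  have e : shifted c q L ν u - x = (u - w) * dslope (shifted c q L ν) w u := by
    rw [← hx, ← smul_eq_mul, sub_smul_dslope]
  simp only [e]
  rw [div_div, mul_comm (u - w)]

end RootData


/-! ### Dependence of the roots and of Γ on the shift; the functional derivative. -/

open scoped ContDiff

/-- The density of the roots, `(2πiL)⁻¹ ∑_{j ∈ J} 1 / (ξ_ν(ζ) - j / L)`. -/
noncomputable def psiL (c q L : ℝ) (J : Finset ℕ) (ν : ℂ → ℂ) (ζ : ℂ) : ℂ :=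
  1 / (2 * Real.pi * Complex.I * L) * ∑ j ∈ J, 1 / (shifted c q L ν ζ - j / L)

lemma gammaLDeriv_eq (c q L : ℝ) (J : Finset ℕ) (ν : ℂ → ℂ) (μ ζ : ℂ) :
    gammaLDeriv c q L J ν μ ζ = deriv (dressedPhase c q μ) ζ * psiL c q L J ν ζ := by
  unfold gammaLDeriv psiL shifted
  ring

namespace RootData

variable {c q δ b : ℝ} {M K : Set ℂ} {z : ℝ → ℂ} (R : RootData c q δ b M K z)
variable {L : ℝ} {ν : ℂ → ℂ} {j : ℕ}

/-- `Classical.epsilon` picks some root enclosed by the loop; uniqueness in `nbhd` identifies it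
with the root constructed near the Fermi zone. -/
lemma betheRoot_spec (hL : R.L₀ ≤ L) (hν : Adm M K b ν) (hj : (j : ℝ) / L ≤ density c q + R.η) :
    betheRoot c q z L ν j ∈ R.core ∧ shifted c q L ν (betheRoot c q z L ν j) = (j : ℂ) / L := by
  have hLp := R.L_pos hL
  obtain ⟨w, hw, hwx⟩ := R.exists_root hL hν (x := (j : ℝ) / L) (by positivity) hj
  push_cast at hwx
  have hb : IsBetheRoot c q z L ν j (betheRoot c q z L ν j) :=
    Classical.epsilon_spec (p := IsBetheRoot c q z L ν j) ⟨w, R.core_subset hw, hwx⟩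
  have he : shifted c q L ν (betheRoot c q z L ν j) = (j : ℂ) / L := hb.2
  have : betheRoot c q z L ν j = w :=
    R.shifted_inj hL hν (R.inside_subset_nbhd hb.1) (R.core_subset_nbhd hw) (he.trans hwx.symm)
  exact ⟨this ▸ hw, he⟩

lemma existsUnique_betheRoot (hL : R.L₀ ≤ L) (hν : Adm M K b ν)
    (hj : (j : ℝ) / L ≤ density c q + R.η) : ∃! w, IsBetheRoot c q z L ν j w := by
  obtain ⟨h1, h2⟩ := R.betheRoot_spec hL hν hj
  refine ⟨_, ⟨R.core_subset h1, h2⟩, fun w hw => ?_⟩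
  exact R.shifted_inj hL hν (R.inside_subset_nbhd hw.1) (R.core_subset_nbhd h1)
    ((show shifted c q L ν w = _ from hw.2).trans h2.symm)

lemma betheRoot_eq (hL : R.L₀ ≤ L) (hν : Adm M K b ν) (hj : (j : ℝ) / L ≤ density c q + R.η) {w : ℂ}
    (hw : w ∈ R.nbhd) (hwx : shifted c q L ν w = (j : ℂ) / L) : betheRoot c q z L ν j = w := by
  obtain ⟨h1, h2⟩ := R.betheRoot_spec hL hν hj
  exact R.shifted_inj hL hν (R.core_subset_nbhd h1) hw (h2.trans hwx.symm)

lemma bound_sub {ν' : ℂ → ℂ} {a : ℝ} (hν : AnalyticOnNhd ℂ ν (interior M))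
    (hν' : AnalyticOnNhd ℂ ν' (interior M)) (ha : ∀ u ∈ K, ‖ν u - ν' u‖ ≤ a) {u : ℂ}
    (hu : u ∈ R.nbhd) : ‖ν u - ν' u‖ ≤ a :=
  R.control (fun u => ν u - ν' u) (hν.differentiableOn.sub hν'.differentiableOn) a ha u
    (R.nbhd_subset_thick hu)

lemma norm_betheRoot_sub_le (hL : R.L₀ ≤ L) {ν' : ℂ → ℂ} (hν : Adm M K b ν) (hν' : Adm M K b ν')
    (hj : (j : ℝ) / L ≤ density c q + R.η) {a : ℝ} (ha : ∀ u ∈ K, ‖ν' u - ν u‖ ≤ a) :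
    ‖betheRoot c q z L ν j - betheRoot c q z L ν' j‖ ≤ 2 / (R.κ * L) * a := by
  obtain ⟨h1, h2⟩ := R.betheRoot_spec hL hν hj
  obtain ⟨h3, h4⟩ := R.betheRoot_spec hL hν' hj
  exact R.norm_root_sub_le hL hν (R.core_subset_nbhd h1) (R.core_subset_nbhd h3) h2 h4
    (R.bound_sub hν'.analytic hν.analytic ha (R.core_subset_nbhd h3))

lemma analytic_dressedPhase (R : RootData c q δ b M K z) :
    AnalyticOnNhd ℂ (fun p : ℂ × ℂ => dressedPhase c q p.1 p.2) (strip δ ×ˢ strip δ) :=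
  analyticOnNhd_dressedPhase R.c_pos R.q_pos R.δ_pos R.δ_lt

lemma norm_dressedPhase_sub_le {u v w : ℂ} (hu : u ∈ strip δ) (hv : v ∈ strip δ) (hw : w ∈ strip δ) :
    ‖dressedPhase c q u v - dressedPhase c q u w‖ ≤ R.Cφ * ‖v - w‖ :=
  (convex_strip δ).norm_image_sub_le_of_norm_deriv_le
    (fun x hx => (analyticOnNhd_right R.analytic_dressedPhase hu x hx).differentiableAt)
    (fun x hx => R.dφ_bound u hu x hx) hw hv

/-- The Lipschitz constant of `Γ`. -/
noncomputable def CΓ : ℝ := (density c q + R.η) * R.Cφ * (2 / R.κ)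

lemma CΓ_pos : 0 < R.CΓ := by
  have h1 := R.density_pos
  have h2 := R.η_pos
  have h3 := R.Cφ_pos
  have h4 := R.κ_pos
  unfold CΓ
  positivity

lemma div_le_of_mem (hL : R.L₀ ≤ L) {N : ℕ} (hN : (N : ℝ) / L ≤ density c q + R.η) {J : Finset ℕ}
    (hJ : J ⊆ Finset.Icc 1 N) (hj : j ∈ J) : (j : ℝ) / L ≤ density c q + R.η := by
  have hLp := R.L_pos hL
  refine le_trans ?_ hN
  gcongr
  exact (Finset.mem_Icc.1 (hJ hj)).2

lemma gammaL_sub (J : Finset ℕ) (ρ τ : ℂ → ℂ) (μ : ℂ) :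
    gammaL c q z L J ρ μ - gammaL c q z L J τ μ
      = ∑ j ∈ J, (dressedPhase c q μ (betheRoot c q z L τ j)
          - dressedPhase c q μ (betheRoot c q z L ρ j)) := by
  unfold gammaL
  rw [← Finset.sum_sub_distrib]
  exact Finset.sum_congr rfl fun j _ => by ring

lemma gammaL_zero (J : Finset ℕ) (μ : ℂ) : gammaL c q z L J (fun _ => 0) μ = 0 := by
  unfold gammaL; simp

lemma card_div_le (hL : R.L₀ ≤ L) {N : ℕ} (hN : (N : ℝ) / L ≤ density c q + R.η) {J : Finset ℕ}
    (hJ : J ⊆ Finset.Icc 1 N) : (J.card : ℝ) / L ≤ density c q + R.η := by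
  have hLp := R.L_pos hL
  refine le_trans ?_ hN
  gcongr
  simpa using Finset.card_le_card hJ

/-- Each root moves by at most 2a/(κL), and there are at most (D + η)L of them, so the constant `CΓ`
does not depend on L. -/
lemma norm_gammaL_sub_le (hL : R.L₀ ≤ L) {N : ℕ} (hN : (N : ℝ) / L ≤ density c q + R.η)
    {J : Finset ℕ} (hJ : J ⊆ Finset.Icc 1 N) {ρ τ : ℂ → ℂ} (hρ : Adm M K b ρ) (hτ : Adm M K b τ)
    {a : ℝ} (ha : ∀ u ∈ K, ‖ρ u - τ u‖ ≤ a) {μ : ℂ} (hμ : μ ∈ strip δ) :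
    ‖gammaL c q z L J ρ μ - gammaL c q z L J τ μ‖ ≤ R.CΓ * a := by
  have hLp := R.L_pos hL
  have hκ := R.κ_pos
  have hC := R.Cφ_pos
  have ha0 : 0 ≤ a := (norm_nonneg _).trans
    (ha _ (R.fermi_subset_K (mem_image_of_mem _ (⟨by linarith [R.q_pos], by linarith [R.q_pos]⟩ :
      (0 : ℝ) ∈ Icc (-q) q))))
  rw [gammaL_sub]
  have h1 : ∀ j ∈ J, ‖dressedPhase c q μ (betheRoot c q z L τ j)
      - dressedPhase c q μ (betheRoot c q z L ρ j)‖ ≤ R.Cφ * (2 / (R.κ * L) * a) := by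
    intro j hj
    have hjD := R.div_le_of_mem hL hN hJ hj
    refine (R.norm_dressedPhase_sub_le hμ (R.core_subset_strip (R.betheRoot_spec hL hτ hjD).1)
      (R.core_subset_strip (R.betheRoot_spec hL hρ hjD).1)).trans ?_
    gcongr
    exact R.norm_betheRoot_sub_le hL hτ hρ hjD ha
  refine (norm_sum_le_of_le _ h1).trans ?_
  rw [Finset.sum_const, nsmul_eq_mul]
  have h2 := R.card_div_le hL hN hJ
  calc (J.card : ℝ) * (R.Cφ * (2 / (R.κ * L) * a)) = J.card / L * (R.Cφ * (2 / R.κ) * a) := by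
        field_simp
    _ ≤ (density c q + R.η) * (R.Cφ * (2 / R.κ) * a) := by gcongr
    _ = _ := by unfold CΓ; ring

lemma adm_zero (R : RootData c q δ b M K z) : Adm M K b fun _ => 0 :=
  ⟨analyticOnNhd_const, fun u _ => by simpa using R.b_pos.le⟩

lemma norm_gammaL_le (hL : R.L₀ ≤ L) {N : ℕ} (hN : (N : ℝ) / L ≤ density c q + R.η)
    {J : Finset ℕ} (hJ : J ⊆ Finset.Icc 1 N) {a : ℝ} (hν : Adm M K a ν) (hab : a ≤ b)
    {μ : ℂ} (hμ : μ ∈ strip δ) : ‖gammaL c q z L J ν μ‖ ≤ R.CΓ * a := by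
  have h := R.norm_gammaL_sub_le hL hN hJ (hν.mono hab) R.adm_zero (a := a)
    (fun u hu => by simpa using hν.bound u hu) hμ
  rwa [gammaL_zero, sub_zero] at h

/-- First order expansion of `φ(μ, λ)` in the shift. -/
lemma exists_phase_expansion (hL : R.L₀ ≤ L) :
    ∃ C : ℝ, 0 ≤ C ∧ ∀ ρ τ : ℂ → ℂ, Adm M K b ρ → Adm M K b τ → ∀ a : ℝ,
      (∀ u ∈ K, ‖ρ u - τ u‖ ≤ a) → 2 / (R.κ * L) * a < R.r / 2 → ∀ μ ∈ strip δ, ∀ j : ℕ,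
      (j : ℝ) / L ≤ density c q + R.η →
      ‖dressedPhase c q μ (betheRoot c q z L τ j) - dressedPhase c q μ (betheRoot c q z L ρ j)
        - deriv (dressedPhase c q μ) (betheRoot c q z L τ j)
          * (ρ (betheRoot c q z L τ j) - τ (betheRoot c q z L τ j))
          / (L * deriv (shifted c q L τ) (betheRoot c q z L τ j))‖ ≤ C * a ^ 2 := by
  have hLp := R.L_pos hL
  have hκ := R.κ_pos
  have hC := R.Cφ_pos
  have hr := R.r_pos
  have hb := R.b_pos
  set k := 2 / (R.κ * L) with hk
  have hk0 : 0 < k := by positivity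
  have hΞ0 : 0 ≤ R.Ξ := (norm_nonneg _).trans
    (R.ξ_bound _ (R.nbhd_subset_thick (R.core_subset_nbhd (R.fermi_subset_core (mem_image_of_mem _
      (⟨by linarith [R.q_pos], by linarith [R.q_pos]⟩ : (0 : ℝ) ∈ Icc (-q) q))))))
  refine ⟨4 * (R.Cφ * (R.r / 2)) / (R.r / 2) ^ 2 * k ^ 2
    + R.Cφ * (2 / R.κ * (4 * (R.Ξ + b / L) / (R.r / 2) ^ 2 * k ^ 2 + 4 / R.r * k / L)),
    by positivity, fun ρ τ hρ hτ a ha har μ hμ j hj => ?_⟩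
  have ha0 : 0 ≤ a := (norm_nonneg _).trans
    (ha _ (R.fermi_subset_K (mem_image_of_mem _ (⟨by linarith [R.q_pos], by linarith [R.q_pos]⟩ :
      (0 : ℝ) ∈ Icc (-q) q))))
  obtain ⟨hl, hle⟩ := R.betheRoot_spec hL hτ hj
  obtain ⟨hl', hle'⟩ := R.betheRoot_spec hL hρ hj
  have hd := R.norm_betheRoot_sub_le hL hτ hρ hj ha
  set l := betheRoot c q z L τ j
  set l' := betheRoot c q z L ρ j
  rw [norm_sub_rev, ← hk] at hd
  have hln := R.core_subset_nbhd hl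
  have hln' := R.core_subset_nbhd hl'
  have hball : l' ∈ Metric.ball l (R.r / 2) := by
    rw [mem_ball_iff_norm]; exact hd.trans_lt har
  have hbt := R.ball_subset_thick hln
  have hsq : ‖l' - l‖ ^ 2 ≤ k ^ 2 * a ^ 2 := by
    rw [← mul_pow]; gcongr
  set d := deriv (shifted c q L τ) l with hdd
  have hdl : R.κ / 2 ≤ ‖d‖ := R.deriv_shifted_lower hL hτ hl
  have hd0 : d ≠ 0 := norm_pos_iff.1 (by linarith)
  have t1 : ‖shifted c q L τ l' - shifted c q L τ l - d * (l' - l)‖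
      ≤ 4 * (R.Ξ + b / L) / (R.r / 2) ^ 2 * (k ^ 2 * a ^ 2) := by
    refine (norm_taylor_two_le (b := R.Ξ + b / L) (by linarith)
      ((R.differentiableOn_shifted hτ).mono (hbt.trans R.thick)) (fun u hu => ?_) hball).trans ?_
    · unfold shifted
      refine (norm_add_le _ _).trans (add_le_add (R.ξ_bound u (hbt hu)) ?_)
      rw [norm_div, Complex.norm_real, Real.norm_of_nonneg hLp.le]
      have := R.control τ hτ.analytic.differentiableOn b hτ.bound u (hbt hu)
      gcongr
    · gcongr
  -- The Lipschitz constant of ρ - τ is itself of order a, so evaluating it at l instead of l' costs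
  -- only O(a²).
  have t2 : ‖(ρ l' - τ l') - (ρ l - τ l)‖ ≤ 4 * a / R.r * (k * a) := by
    refine (R.lipschitz (f := fun u => ρ u - τ u)
      (hρ.analytic.differentiableOn.sub hτ.analytic.differentiableOn) ha
      (R.nbhd_subset_thick hln') hln).trans ?_
    gcongr
  have hLc : (L : ℂ) ≠ 0 := by exact_mod_cast hLp.ne'
  have e1 : shifted c q L τ l' - shifted c q L τ l = -(ρ l' - τ l') / L := by
    rw [hle, ← hle']; unfold shifted; ring
  -- From ξ_τ(l) = ξ_ρ(l'), with `t1` and `t2`: the displacement is -(ρ - τ)(l) / (L ξ_τ'(l)) up to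
  -- O(a²).
  have t3 : ‖(l' - l) + (ρ l - τ l) / (L * d)‖
      ≤ 2 / R.κ * (4 * (R.Ξ + b / L) / (R.r / 2) ^ 2 * (k ^ 2 * a ^ 2)
        + 4 * a / R.r * (k * a) / L) := by
    have e2 : (l' - l) + (ρ l - τ l) / (L * d)
        = -((shifted c q L τ l' - shifted c q L τ l - d * (l' - l))
          + ((ρ l' - τ l') - (ρ l - τ l)) / L) / d := by
      rw [e1]; field_simp; ring
    rw [e2, norm_div, norm_neg, div_le_iff₀ (by linarith)]
    have h5 : ‖((ρ l' - τ l') - (ρ l - τ l)) / (L : ℂ)‖ ≤ 4 * a / R.r * (k * a) / L := by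
      rw [norm_div, Complex.norm_real, Real.norm_of_nonneg hLp.le]
      gcongr
    refine (norm_add_le _ _).trans ((add_le_add t1 h5).trans ?_)
    set X := 4 * (R.Ξ + b / L) / (R.r / 2) ^ 2 * (k ^ 2 * a ^ 2) + 4 * a / R.r * (k * a) / L with hX
    have hX0 : 0 ≤ X := by positivity
    calc X = 2 / R.κ * X * (R.κ / 2) := by field_simp
      _ ≤ 2 / R.κ * X * ‖d‖ := by gcongr
  have hstrip : Metric.ball l (R.r / 2) ⊆ strip δ := hbt.trans R.thick_subset_strip
  have hls := R.core_subset_strip hl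
  have t4 : ‖dressedPhase c q μ l' - dressedPhase c q μ l - deriv (dressedPhase c q μ) l * (l' - l)‖
      ≤ 4 * (R.Cφ * (R.r / 2)) / (R.r / 2) ^ 2 * (k ^ 2 * a ^ 2) := by
    -- Subtracting the value at l bounds the function on the ball by Cφ r/2, uniformly in μ, without
    -- a bound on φ itself.
    have h := norm_taylor_two_le (f := fun w => dressedPhase c q μ w - dressedPhase c q μ l)
      (x := l) (y := l') (r := R.r / 2) (b := R.Cφ * (R.r / 2)) (by linarith)
      (((analyticOnNhd_right R.analytic_dressedPhase hμ).differentiableOn.mono hstrip).sub_const _)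
      (fun u hu => ?_) hball
    · rw [deriv_sub_const_fun] at h
      simp only [sub_self, sub_zero] at h
      refine h.trans ?_
      gcongr
    · refine (R.norm_dressedPhase_sub_le hμ (hstrip hu) hls).trans ?_
      gcongr
      exact (mem_ball_iff_norm.1 hu).le
  have e3 : dressedPhase c q μ l - dressedPhase c q μ l'
      - deriv (dressedPhase c q μ) l * (ρ l - τ l) / (L * d)
      = -(dressedPhase c q μ l' - dressedPhase c q μ l - deriv (dressedPhase c q μ) l * (l' - l))
        - deriv (dressedPhase c q μ) l * ((l' - l) + (ρ l - τ l) / (L * d)) := by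
    ring
  rw [e3]
  refine (norm_sub_le _ _).trans ?_
  rw [norm_neg, norm_mul]
  have t5 := mul_le_mul (R.dφ_bound μ hμ l hls) t3 (norm_nonneg _) hC.le
  refine (add_le_add t4 t5).trans (le_of_eq ?_)
  field_simp

/-- First order expansion of `Γ`. -/
lemma exists_gammaL_expansion (hL : R.L₀ ≤ L) {N : ℕ} (hN : (N : ℝ) / L ≤ density c q + R.η)
    {J : Finset ℕ} (hJ : J ⊆ Finset.Icc 1 N) :
    ∃ C : ℝ, 0 ≤ C ∧ ∀ ρ τ : ℂ → ℂ, Adm M K b ρ → Adm M K b τ → ∀ a : ℝ,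
      (∀ u ∈ K, ‖ρ u - τ u‖ ≤ a) → 2 / (R.κ * L) * a < R.r / 2 → ∀ μ ∈ strip δ,
      ‖gammaL c q z L J ρ μ - gammaL c q z L J τ μ
        - ∑ j ∈ J, deriv (dressedPhase c q μ) (betheRoot c q z L τ j)
          * (ρ (betheRoot c q z L τ j) - τ (betheRoot c q z L τ j))
          / (L * deriv (shifted c q L τ) (betheRoot c q z L τ j))‖ ≤ C * a ^ 2 := by
  obtain ⟨C, hC, h⟩ := R.exists_phase_expansion hL
  refine ⟨J.card * C, by positivity, fun ρ τ hρ hτ a ha har μ hμ => ?_⟩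
  rw [gammaL_sub, ← Finset.sum_sub_distrib]
  refine (norm_sum_le_of_le _ fun j hj =>
    h ρ τ hρ hτ a ha har μ hμ j (R.div_le_of_mem hL hN hJ hj)).trans (le_of_eq ?_)
  rw [Finset.sum_const, nsmul_eq_mul, mul_assoc]

lemma analyticOnNhd_deriv_dressedPhase (R : RootData c q δ b M K z) :
    AnalyticOnNhd ℂ (fun p : ℂ × ℂ => deriv (dressedPhase c q p.1) p.2) (strip δ ×ˢ strip δ) :=
  analyticOnNhd_deriv_right R.analytic_dressedPhase (isOpen_strip δ) (isOpen_strip δ)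

/-- The residue computation for the density of roots. -/
lemma contourIntegral_mul_psiL (hL : R.L₀ ≤ L) {N : ℕ}
    (hN : (N : ℝ) / L ≤ density c q + R.η) {J : Finset ℕ} (hJ : J ⊆ Finset.Icc 1 N)
    (hν : Adm M K b ν) {g : ℂ → ℂ} (hg : DifferentiableOn ℂ g R.openNbhd) :
    contourIntegral z (fun ζ => g ζ * psiL c q L J ν ζ)
      = ∑ j ∈ J, g (betheRoot c q z L ν j)
          / (L * deriv (shifted c q L ν) (betheRoot c q z L ν j)) := by
  have hpi : (2 * Real.pi * Complex.I : ℂ) ≠ 0 := by simp [Real.pi_ne_zero]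
  set G : ℂ → ℂ := fun ζ => g ζ / (2 * Real.pi * Complex.I * L) with hG
  have hGd : DifferentiableOn ℂ G R.openNbhd := hg.div_const _
  have htO : trace z ⊆ R.openNbhd := IsJordanLoop.trace_subset_hull.trans R.hull_subset_openNbhd
  have hLc : (L : ℂ) ≠ 0 := by exact_mod_cast (R.L_pos hL).ne'
  calc contourIntegral z (fun ζ => g ζ * psiL c q L J ν ζ)
      = contourIntegral z (fun ζ => ∑ j ∈ J, G ζ / (shifted c q L ν ζ - (j : ℂ) / L)) := by
        refine IsJordanLoop.contourIntegral_congr fun ζ _ => ?_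
        simp only [psiL, hG, Finset.mul_sum]
        refine Finset.sum_congr rfl fun j _ => ?_
        ring
    _ = ∑ j ∈ J, contourIntegral z (fun ζ => G ζ / (shifted c q L ν ζ - (j : ℂ) / L)) := by
        refine R.loop.contourIntegral_sum J fun j hj => ?_
        obtain ⟨h1, h2⟩ := R.betheRoot_spec hL hν (R.div_le_of_mem hL hN hJ hj)
        refine (hGd.continuousOn.mono htO).div ?_ fun ζ hζ => ?_
        · exact ((R.differentiableOn_shifted hν).continuousOn.mono
            (R.trace_subset_nbhd.trans R.nbhd_subset_interior)).sub continuousOn_const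
        · exact R.shifted_sub_ne hL hν h1 h2 (R.trace_subset_nbhd hζ) (R.trace_not_core hζ)
    _ = _ := by
        refine Finset.sum_congr rfl fun j hj => ?_
        obtain ⟨h1, h2⟩ := R.betheRoot_spec hL hν (R.div_le_of_mem hL hN hJ hj)
        rw [R.contourIntegral_div_shifted hL hν h1 h2 hGd, hG]
        simp only
        field_simp

lemma differentiableOn_deriv_dressedPhase {μ : ℂ} (hμ : μ ∈ strip δ) :
    DifferentiableOn ℂ (deriv (dressedPhase c q μ)) R.openNbhd :=
  (analyticOnNhd_right (Ψ := fun u w => deriv (dressedPhase c q u) w)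
    R.analyticOnNhd_deriv_dressedPhase hμ).differentiableOn.mono
      (R.openNbhd_subset_nbhd.trans R.nbhd_subset_strip)

/-- The residue computation for the kernel of the functional derivative. -/
lemma contourIntegral_mul_gammaLDeriv (hL : R.L₀ ≤ L) {N : ℕ}
    (hN : (N : ℝ) / L ≤ density c q + R.η) {J : Finset ℕ} (hJ : J ⊆ Finset.Icc 1 N)
    (hν : Adm M K b ν) {μ : ℂ} (hμ : μ ∈ strip δ) {g : ℂ → ℂ} (hg : DifferentiableOn ℂ g R.openNbhd) :
    contourIntegral z (fun ζ => g ζ * gammaLDeriv c q L J ν μ ζ)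
      = ∑ j ∈ J, deriv (dressedPhase c q μ) (betheRoot c q z L ν j) * g (betheRoot c q z L ν j)
          / (L * deriv (shifted c q L ν) (betheRoot c q z L ν j)) := by
  have h := R.contourIntegral_mul_psiL hL hN hJ hν ((R.differentiableOn_deriv_dressedPhase hμ).mul hg)
  simp only [Pi.mul_apply] at h
  rw [← h]
  refine IsJordanLoop.contourIntegral_congr fun ζ _ => ?_
  simp only [gammaLDeriv_eq]
  ring

lemma isOpen_openNbhd_diff : IsOpen (R.openNbhd \ R.core) :=
  R.isOpen_openNbhd.sdiff R.isCompact_core.isClosed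

lemma trace_subset_openNbhd_diff : trace z ⊆ R.openNbhd \ R.core := fun _ hζ =>
  ⟨R.hull_subset_openNbhd (IsJordanLoop.trace_subset_hull hζ), R.trace_not_core hζ⟩

lemma analyticOnNhd_gammaLDeriv (hL : R.L₀ ≤ L) {N : ℕ}
    (hN : (N : ℝ) / L ≤ density c q + R.η) {J : Finset ℕ} (hJ : J ⊆ Finset.Icc 1 N)
    (hν : Adm M K b ν) :
    AnalyticOnNhd ℂ (fun p : ℂ × ℂ => gammaLDeriv c q L J ν p.1 p.2)
      (strip δ ×ˢ (R.openNbhd \ R.core)) := by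
  rintro p ⟨hp1, hp2, hp3⟩
  have hn := R.openNbhd_subset_nbhd hp2
  refine AnalyticAt.mul ?_ ?_
  · exact (R.analyticOnNhd_deriv_dressedPhase p ⟨hp1, R.nbhd_subset_strip hn⟩).div_const
  · refine Finset.analyticAt_fun_sum _ fun j hj => ?_
    obtain ⟨h1, h2⟩ := R.betheRoot_spec hL hν (R.div_le_of_mem hL hN hJ hj)
    refine analyticAt_const.div ?_ (R.shifted_sub_ne hL hν h1 h2 hn hp3)
    have h3 : AnalyticAt ℂ (shifted c q L ν) p.2 :=
      (R.differentiableOn_shifted hν).analyticOnNhd isOpen_interior _ (R.nbhd_subset_interior hn)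
    exact (h3.fun_comp (f := Prod.snd) analyticAt_snd).sub analyticAt_const

/-- The functional derivative of `Γ`. -/
theorem isFunctionalDerivative_gammaL (hL : R.L₀ ≤ L) {N : ℕ}
    (hN : (N : ℝ) / L ≤ density c q + R.η) {J : Finset ℕ} (hJ : J ⊆ Finset.Icc 1 N)
    {B : ℝ} (hB : B + 1 ≤ b) (hν : Adm M K B ν) :
    IsFunctionalDerivative M K z (gammaL c q z L J) ν (gammaLDeriv c q L J ν) := by
  have hνb : Adm M K b ν := hν.mono (by linarith)
  refine ⟨⟨_, R.isOpen_openNbhd_diff, R.trace_subset_openNbhd_diff,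
    (R.analyticOnNhd_gammaLDeriv hL hN hJ hνb).mono (prod_mono R.M_subset Subset.rfl)⟩, fun ε hε => ?_⟩
  obtain ⟨C, hC, hexp⟩ := R.exists_gammaL_expansion hL hN hJ
  have hLp := R.L_pos hL
  have hκ := R.κ_pos
  have hr := R.r_pos
  -- The first bound keeps ρ below B + 1 ≤ b, the second keeps the displaced roots where the
  -- expansion is valid, and the third absorbs the quadratic error into ε.
  refine ⟨min 1 (min (R.r / 2 / (2 / (R.κ * L))) (ε / (C + 1))), by positivity,
    fun ρ hρ hd μ hμ => ?_⟩
  set a := supNorm K (fun u => ρ u - ν u) with ha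
  have hMs : interior M ⊆ strip δ := interior_subset.trans R.M_subset
  have hcont : ContinuousOn (fun u => ρ u - ν u) K :=
    (hρ.continuousOn.sub hν.analytic.continuousOn).mono R.K_subset
  have hab : ∀ u ∈ K, ‖ρ u - ν u‖ ≤ a := fun u hu => norm_le_supNorm R.isCompact_K hcont hu
  have ha0 : 0 ≤ a := supNorm_nonneg _ _
  have hρb : Adm M K b ρ := by
    refine ⟨hρ, fun u hu => ?_⟩
    have h1 := hab u hu
    have h2 := hν.bound u hu
    have h3 : ‖ρ u‖ ≤ ‖ρ u - ν u‖ + ‖ν u‖ := by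
      simpa using norm_add_le (ρ u - ν u) (ν u)
    have h4 := hd.le.trans (min_le_left _ _)
    linarith
  have h5 : 2 / (R.κ * L) * a < R.r / 2 := by
    have := hd.trans_le ((min_le_right _ _).trans (min_le_left _ _))
    rwa [lt_div_iff₀ (by positivity), mul_comm] at this
  have h6 := hexp ρ ν hρb hνb a hab h5 μ (R.M_subset hμ)
  rw [R.contourIntegral_mul_gammaLDeriv hL hN hJ hνb (R.M_subset hμ) (g := fun u => ρ u - ν u)
    ((hρ.differentiableOn.sub hν.analytic.differentiableOn).mono
      (R.openNbhd_subset_nbhd.trans R.nbhd_subset_interior))]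
  refine h6.trans ?_
  have h7 := hd.trans_le ((min_le_right _ _).trans (min_le_right _ _))
  rw [lt_div_iff₀ (by positivity)] at h7
  nlinarith

section Analytic

variable {E : Type*} [NormedAddCommGroup E] [NormedSpace ℂ E] [CompleteSpace E] {U : Set E}
  {Nu : E → ℂ → ℂ}

/-- The roots are holomorphic functions of the parameters. -/
theorem analyticOnNhd_betheRoot (hL : R.L₀ ≤ L) (hj : (j : ℝ) / L ≤ density c q + R.η)
    (hU : IsOpen U) (hNu : AnalyticOnNhd ℂ (fun p : E × ℂ => Nu p.1 p.2) (U ×ˢ interior M))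
    (hadm : ∀ e ∈ U, Adm M K b (Nu e)) :
    AnalyticOnNhd ℂ (fun e => betheRoot c q z L (Nu e) j) U := by
  intro e he
  obtain ⟨h1, h2⟩ := R.betheRoot_spec hL (hadm e he) hj
  set w := betheRoot c q z L (Nu e) j
  have hwi : w ∈ interior M := R.nbhd_subset_interior (R.core_subset_nbhd h1)
  set Φ : E × ℂ → ℂ := fun p => shifted c q L (Nu p.1) p.2 with hΦ
  have hξ : AnalyticAt ℂ (countingFunction c q) w :=
    (differentiableOn_countingFunction R.c_pos R.q_pos R.δ_lt).analyticOnNhd (isOpen_strip δ) w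
      (R.core_subset_strip h1)
  have hΦa : AnalyticAt ℂ Φ (e, w) :=
    (hξ.fun_comp_of_eq (f := Prod.snd) analyticAt_snd rfl).add (hNu (e, w) ⟨he, hwi⟩).div_const
  have hcd : ContDiffAt ℂ ω Φ (e, w) := hΦa.contDiffAt
  have hpd : fderiv ℂ Φ (e, w) (0, 1) = deriv (shifted c q L (Nu e)) w := by
    have h3 : HasDerivAt (fun v : ℂ => (e, v)) ((0 : E), (1 : ℂ)) w :=
      (hasDerivAt_const w e).prodMk (hasDerivAt_id w)
    exact (hΦa.differentiableAt.hasFDerivAt.comp_hasDerivAt w h3).deriv.symm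
  have hne : deriv (shifted c q L (Nu e)) w ≠ 0 := norm_pos_iff.1
    (lt_of_lt_of_le (by linarith [R.κ_pos]) (R.deriv_shifted_lower hL (hadm e he) h1))
  -- Analytic implicit function theorem for ξ_{Nu e}(w) = j/L; the partial derivative in w is
  -- bounded below. Uniqueness of the root then identifies the implicit function with `betheRoot`.
  have hinv : (fderiv ℂ Φ (e, w) ∘L .inr ℂ E ℂ).IsInvertible := by
    refine ⟨ContinuousLinearEquiv.unitsEquivAut ℂ (Units.mk0 _ hne), ?_⟩
    ext
    simp [← hpd]
  have pn : (ω : WithTop ℕ∞) ≠ 0 := by simp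
  have hψ := hcd.contDiffAt_implicitFunction pn hinv
  have hψe := hcd.eventually_apply_implicitFunction pn hinv
  have hψ0 := hcd.implicitFunction_apply_self pn hinv
  set ψ := hcd.implicitFunction pn hinv
  refine (hψ.analyticAt).congr ?_
  have hopen : ∀ᶠ x in 𝓝 e, ψ x ∈ R.openNbhd := by
    refine hψ.continuousAt.eventually_mem ?_
    rw [hψ0]
    exact R.isOpen_openNbhd.mem_nhds
      (R.hull_subset_openNbhd (IsJordanLoop.inside_subset_hull (R.core_subset h1)))
  filter_upwards [hψe, hopen, hU.mem_nhds he] with x hx hx' hxU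
  exact (R.betheRoot_eq hL (hadm x hxU) hj (R.openNbhd_subset_nbhd hx') (hx.trans h2)).symm

/-- `Γ` is holomorphic in the parameters. -/
theorem analyticOnNhd_gammaL (hL : R.L₀ ≤ L) {N : ℕ} (hN : (N : ℝ) / L ≤ density c q + R.η)
    {J : Finset ℕ} (hJ : J ⊆ Finset.Icc 1 N) (hU : IsOpen U)
    (hNu : AnalyticOnNhd ℂ (fun p : E × ℂ => Nu p.1 p.2) (U ×ˢ interior M))
    (hadm : ∀ e ∈ U, Adm M K b (Nu e)) :
    AnalyticOnNhd ℂ (fun p : E × ℂ => gammaL c q z L J (Nu p.1) p.2) (U ×ˢ strip δ) := by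
  intro p hp
  refine Finset.analyticAt_fun_sum _ fun j hj => ?_
  have hjD := R.div_le_of_mem hL hN hJ hj
  have hφ := R.analytic_dressedPhase
  refine AnalyticAt.sub ?_ ?_
  · exact AnalyticAt.fun_comp (g := fun u : ℂ × ℂ => dressedPhase c q u.1 u.2)
      (f := fun p : E × ℂ => (p.2, betheRoot c q z L (fun _ => 0) j))
      (hφ (p.2, _) ⟨hp.2, R.core_subset_strip (R.betheRoot_spec hL R.adm_zero hjD).1⟩)
      (analyticAt_snd.prod analyticAt_const)
  · exact AnalyticAt.fun_comp (g := fun u : ℂ × ℂ => dressedPhase c q u.1 u.2)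
      (f := fun p : E × ℂ => (p.2, betheRoot c q z L (Nu p.1) j))
      (hφ (p.2, _) ⟨hp.2, R.core_subset_strip (R.betheRoot_spec hL (hadm p.1 hp.1) hjD).1⟩)
      (analyticAt_snd.prod (AnalyticAt.fun_comp (f := Prod.fst)
        (g := fun e => betheRoot c q z L (Nu e) j)
        (R.analyticOnNhd_betheRoot hL hjD hU hNu hadm p.1 hp.1) analyticAt_fst))

end Analytic

end RootData


/-! ### Convergence of the density of roots as L → ∞. -/

/-- The thermodynamic limit of the density of roots. -/
noncomputable def psiLim (c q : ℝ) (ζ : ℂ) : ℂ :=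
  1 / (2 * Real.pi * Complex.I) * ∫ t in (-q)..q, deriv (countingFunction c q) t
    / (countingFunction c q ζ - countingFunction c q t)

lemma norm_inv_sub_inv_le {a b : ℂ} {m d : ℝ} (hm : 0 < m) (ha : m ≤ ‖a‖) (hb : m ≤ ‖b‖)
    (hab : ‖a - b‖ ≤ d) : ‖1 / a - 1 / b‖ ≤ d / m ^ 2 := by
  have ha0 : a ≠ 0 := norm_pos_iff.1 (hm.trans_le ha)
  have hb0 : b ≠ 0 := norm_pos_iff.1 (hm.trans_le hb)
  have hd : 0 ≤ d := (norm_nonneg _).trans hab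
  rw [div_sub_div _ _ ha0 hb0, norm_div, norm_mul, one_mul, mul_one, norm_sub_rev, sq]
  gcongr

/-- The error of a Riemann sum with step `1 / L`. -/
lemma norm_riemann_sub_le {L : ℝ} (hL : 0 < L) {f : ℝ → ℂ} {l : ℝ} (N : ℕ)
    (hf : ContinuousOn f (Icc 0 (N / L)))
    (hl : ∀ x ∈ Icc (0 : ℝ) (N / L), ∀ y ∈ Icc (0 : ℝ) (N / L), ‖f x - f y‖ ≤ l * |x - y|) :
    ‖(1 / L : ℂ) * ∑ j ∈ Finset.Icc 1 N, f (j / L) - ∫ x in (0 : ℝ)..(N / L), f x‖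
      ≤ N / L * (l / L) := by
  have hmem : ∀ k ≤ N, (k : ℝ) / L ∈ Icc (0 : ℝ) (N / L) := fun k hk => ⟨by positivity, by gcongr⟩
  have hle : ∀ k : ℕ, (k : ℝ) / L ≤ ((k + 1 : ℕ) : ℝ) / L := fun k => by gcongr; simp
  have hsub : ∀ k < N, Icc ((k : ℝ) / L) (((k + 1 : ℕ) : ℝ) / L) ⊆ Icc (0 : ℝ) (N / L) := fun k hk =>
    Icc_subset_Icc (hmem k hk.le).1 (hmem (k + 1) hk).2
  have hint : ∀ k < N, IntervalIntegrable f volume ((k : ℝ) / L) (((k + 1 : ℕ) : ℝ) / L) := fun k hk =>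
    ContinuousOn.intervalIntegrable (by rw [uIcc_of_le (hle k)]; exact hf.mono (hsub k hk))
  have h1 := intervalIntegral.sum_integral_adjacent_intervals (a := fun k : ℕ => (k : ℝ) / L) hint
  simp only [Nat.cast_zero, zero_div] at h1
  have h2 : ∑ j ∈ Finset.Icc 1 N, f (j / L) = ∑ k ∈ Finset.range N, f (((k + 1 : ℕ) : ℝ) / L) := by
    rw [Finset.range_eq_Ico, Finset.sum_Ico_add' (fun j : ℕ => f (j / L)) 0 N 1]
    rfl
  rw [← h1, h2, Finset.mul_sum, ← Finset.sum_sub_distrib]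
  have h3 : ∀ k ∈ Finset.range N, ‖(1 / L : ℂ) * f (((k + 1 : ℕ) : ℝ) / L)
      - ∫ x in ((k : ℝ) / L)..(((k + 1 : ℕ) : ℝ) / L), f x‖ ≤ l / L * (1 / L) := by
    intro k hk
    have hk' := Finset.mem_range.1 hk
    have hlen : ((k + 1 : ℕ) : ℝ) / L - (k : ℝ) / L = 1 / L := by push_cast; ring
    have e : (1 / L : ℂ) * f (((k + 1 : ℕ) : ℝ) / L)
        = ∫ _ in ((k : ℝ) / L)..(((k + 1 : ℕ) : ℝ) / L), f (((k + 1 : ℕ) : ℝ) / L) := by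
      rw [intervalIntegral.integral_const, hlen, Complex.real_smul]
      push_cast; rfl
    rw [e, ← intervalIntegral.integral_sub intervalIntegrable_const (hint k hk')]
    have h4 := intervalIntegral.norm_integral_le_of_norm_le_const (a := (k : ℝ) / L)
      (b := ((k + 1 : ℕ) : ℝ) / L) (f := fun x => f (((k + 1 : ℕ) : ℝ) / L) - f x) (C := l / L)
      (fun x hx => ?_)
    · rwa [hlen, abs_of_pos (by positivity)] at h4
    · rw [uIoc_of_le (hle k)] at hx
      refine (hl _ (hmem (k + 1) hk') x (hsub k hk' (Ioc_subset_Icc_self hx))).trans ?_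
      have h5 : |((k + 1 : ℕ) : ℝ) / L - x| ≤ 1 / L := by
        rw [abs_of_nonneg (by linarith [hx.2])]; linarith [hx.1]
      have h6 : 0 ≤ l := by
        have h7 := hl _ (hmem (k + 1) hk') _ (hmem k hk'.le)
        rw [hlen, abs_of_pos (by positivity)] at h7
        have h8 := (norm_nonneg _).trans h7
        exact le_of_mul_le_mul_right (by simpa using h8) (by positivity : (0 : ℝ) < 1 / L)
      calc l * |((k + 1 : ℕ) : ℝ) / L - x| ≤ l * (1 / L) := by gcongr
        _ = l / L := by ring
  refine (norm_sum_le_of_le _ h3).trans (le_of_eq ?_)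
  rw [Finset.sum_const, Finset.card_range, nsmul_eq_mul]
  ring

namespace RootData

variable {c q δ b : ℝ} {M K : Set ℂ} {z : ℝ → ℂ} (R : RootData c q δ b M K z)
variable {L : ℝ} {ν : ℂ → ℂ}

/-- The distance of `ξ_ν` on the loop to the relevant real values. -/
noncomputable def gap : ℝ := R.κ / 2 * R.d₁

lemma gap_pos : 0 < R.gap := by
  have := R.κ_pos
  have := R.d₁_pos
  unfold gap
  positivity

/-- Every real x in [0, D + η], not only a point j/L, is a value of ξ_ν in `core`, and the loop
stays at distance d₁ from `core`. The comparison of sums with integrals needs all these x. -/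
lemma gap_le (hL : R.L₀ ≤ L) (hν : Adm M K b ν) {ζ : ℂ} (hζ : ζ ∈ trace z) {x : ℝ} (hx0 : 0 ≤ x)
    (hx : x ≤ density c q + R.η) : R.gap ≤ ‖shifted c q L ν ζ - x‖ := by
  obtain ⟨w, hw, hwx⟩ := R.exists_root hL hν hx0 hx
  exact R.shifted_sub_lower hL hν hw hwx hζ

lemma shifted_zero (w : ℂ) : shifted c q L (fun _ => 0) w = countingFunction c q w := by
  simp [shifted]

lemma gap_le_counting {ζ : ℂ} (hζ : ζ ∈ trace z) {x : ℝ} (hx0 : 0 ≤ x)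
    (hx : x ≤ density c q + R.η) : R.gap ≤ ‖countingFunction c q ζ - x‖ := by
  have := R.gap_le le_rfl R.adm_zero hζ hx0 hx
  rwa [shifted_zero] at this

lemma deriv_countingFunction_ofReal (hc : 0 < c) (hq : 0 < q) (t : ℝ) :
    deriv (countingFunction c q) t = (((dressedCharge c q t).re / (2 * Real.pi) : ℝ) : ℂ) := by
  rw [(hasDerivAt_countingFunction hc hq (by simpa using hc)).deriv]
  have h : dressedCharge c q t = ((dressedCharge c q t).re : ℂ) := by
    apply Complex.ext <;> simp [dressedCharge_im hc hq]
  rw [h]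
  push_cast
  simp

/-- Substitution x = ξ(t), which maps [-q, q] to [0, D]: in this form the limiting density is
visibly the limit of Riemann sums over j/L. -/
lemma psiLim_eq (R : RootData c q δ b M K z) {ζ : ℂ} (hζ : ζ ∈ trace z) :
    psiLim c q ζ = 1 / (2 * Real.pi * Complex.I)
      * ∫ x in (0 : ℝ)..(density c q), 1 / (countingFunction c q ζ - (x : ℂ)) := by
  have hq := R.q_pos
  have hc := R.c_pos
  unfold psiLim
  congr 1
  have h1 := intervalIntegral.integral_deriv_smul_comp' (a := -q) (b := q) (f := realCounting c q)
    (f' := fun t => (dressedCharge c q t).re / (2 * Real.pi))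
    (g := fun x : ℝ => 1 / (countingFunction c q ζ - (x : ℂ)))
    (fun t _ => hasDerivAt_realCounting hc hq t) ?_ ?_
  · rw [realCounting_left hc hq, realCounting_right hc hq] at h1
    rw [← h1]
    refine intervalIntegral.integral_congr fun t _ => ?_
    simp only [Function.comp]
    rw [deriv_countingFunction_ofReal hc hq, Complex.real_smul, countingFunction_ofReal hc hq]
    simp only [realCounting, mul_one_div]
  · rw [uIcc_of_le (by linarith)]
    exact (Complex.continuous_re.comp_continuousOn (continuousOn_dressedCharge hc hq)).div_const _
  · refine ContinuousOn.div continuousOn_const (by fun_prop) ?_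
    rintro _ ⟨t, ht, rfl⟩
    rw [uIcc_of_le (by linarith)] at ht
    intro h0
    have h2 : countingFunction c q ζ = countingFunction c q t := by
      rw [countingFunction_ofReal hc hq t]; exact sub_eq_zero.1 h0
    have h3 : (t : ℂ) ∈ R.core := R.fermi_subset_core (mem_image_of_mem _ ht)
    have h4 := R.shifted_sub_lower le_rfl R.adm_zero h3 (shifted_zero _) hζ
    rw [shifted_zero, h2, sub_self, norm_zero] at h4
    have := R.gap_pos
    unfold gap at this
    linarith

lemma continuousOn_deriv_countingFunction :
    ContinuousOn (deriv (countingFunction c q)) R.core :=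
  ((differentiableOn_countingFunction R.c_pos R.q_pos R.δ_lt).analyticOnNhd
    (isOpen_strip δ)).deriv.continuousOn.mono R.core_subset_strip

lemma counting_sub_ne (R : RootData c q δ b M K z) {ζ : ℂ} (hζ : ζ ∈ trace z) {t : ℝ} (ht : t ∈ Icc (-q) q) :
    countingFunction c q ζ - countingFunction c q t ≠ 0 := by
  have h := R.shifted_sub_ne le_rfl R.adm_zero (R.fermi_subset_core (mem_image_of_mem _ ht))
    (shifted_zero _) (R.trace_subset_nbhd hζ) (R.trace_not_core hζ)
  rwa [shifted_zero] at h

lemma continuousOn_kernel (R : RootData c q δ b M K z) : ContinuousOn (fun p : ℂ × ℝ => deriv (countingFunction c q) p.2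
    / (countingFunction c q p.1 - countingFunction c q p.2)) (trace z ×ˢ Icc (-q) q) := by
  have hξ := (differentiableOn_countingFunction R.c_pos R.q_pos R.δ_lt).continuousOn
  refine ContinuousOn.div ?_ (ContinuousOn.sub ?_ ?_) fun p hp => R.counting_sub_ne hp.1 hp.2
  · refine R.continuousOn_deriv_countingFunction.comp (f := fun p : ℂ × ℝ => (p.2 : ℂ)) (by fun_prop) fun p hp => ?_
    exact R.fermi_subset_core (mem_image_of_mem _ hp.2)
  · exact hξ.comp continuousOn_fst fun p hp => R.nbhd_subset_strip (R.trace_subset_nbhd hp.1)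
  · exact hξ.comp (f := fun p : ℂ × ℝ => (p.2 : ℂ)) (by fun_prop) fun p _ => ofReal_mem_strip R.δ_pos _

/-- Against the limiting density, contour integrals are integrals over the Fermi zone. -/
theorem contourIntegral_mul_psiLim {g : ℂ → ℂ} (hg : DifferentiableOn ℂ g R.openNbhd) :
    contourIntegral z (fun ζ => g ζ * psiLim c q ζ) = ∫ t in (-q)..q, g t := by
  have hq := R.q_pos
  have hpi : (2 * Real.pi * Complex.I : ℂ) ≠ 0 := by simp [Real.pi_ne_zero]
  have hle : -q ≤ q := by linarith
  have htO : trace z ⊆ R.openNbhd := IsJordanLoop.trace_subset_hull.trans R.hull_subset_openNbhd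
  have hgt : ContinuousOn g (trace z) := hg.continuousOn.mono htO
  set Φ : ℝ × ℝ → ℂ := fun p => g (z p.1) * (deriv (countingFunction c q) p.2
    / (countingFunction c q (z p.1) - countingFunction c q p.2)) with hΦ
  have hΦc : ContinuousOn Φ (Icc 0 1 ×ˢ Icc (-q) q) := by
    refine ContinuousOn.mul ?_ ?_
    · exact (hgt.comp R.loop.continuousOn fun t ht => IsJordanLoop.mem_trace ht).comp continuousOn_fst
        fun p hp => hp.1
    · exact R.continuousOn_kernel.comp
        ((R.loop.continuousOn.comp continuousOn_fst fun p hp => hp.1).prodMk continuousOn_snd)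
        fun p hp => ⟨IsJordanLoop.mem_trace hp.1, hp.2⟩
  obtain ⟨C, hC⟩ := (isCompact_Icc.prod isCompact_Icc).exists_bound_of_continuousOn hΦc
  have hint : Integrable (fun p : ℝ × ℝ => Φ p * deriv z p.1)
      ((volume.restrict (Ioc (0 : ℝ) 1)).prod (volume.restrict (Ioc (-q) q))) := by
    have h1 : Integrable (fun p : ℝ × ℝ => deriv z p.1 * (1 : ℂ))
        ((volume.restrict (Ioc (0 : ℝ) 1)).prod (volume.restrict (Ioc (-q) q))) :=
      Integrable.mul_prod R.loop.integrable_deriv (integrable_const (1 : ℂ))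
    simp only [mul_one] at h1
    refine h1.bdd_mul (c := C) ?_ ?_
    · rw [Measure.prod_restrict]
      exact (hΦc.mono (prod_mono Ioc_subset_Icc_self Ioc_subset_Icc_self)).aestronglyMeasurable
        (measurableSet_Ioc.prod measurableSet_Ioc)
    · rw [Measure.prod_restrict]
      exact (ae_restrict_iff' (measurableSet_Ioc.prod measurableSet_Ioc)).2
        (Eventually.of_forall fun p hp => hC p ⟨Ioc_subset_Icc_self hp.1, Ioc_subset_Icc_self hp.2⟩)
  -- For fixed t the factor ξ'(t) cancels the derivative in the residue at t, which leaves g(t);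
  -- Fubini exchanges the loop and the segment.
  have hres : ∀ t ∈ Ioc (-q) q, ∫ s in Ioc (0 : ℝ) 1, Φ (s, t) * deriv z s
      = 2 * Real.pi * Complex.I * g t := by
    intro t ht
    have htc : (t : ℂ) ∈ R.core := R.fermi_subset_core (mem_image_of_mem _ (Ioc_subset_Icc_self ht))
    have h1 := R.contourIntegral_div_shifted le_rfl R.adm_zero htc (shifted_zero _) hg
    have hd : deriv (countingFunction c q) (t : ℂ) ≠ 0 := by
      have h2 := R.deriv_shifted_lower le_rfl R.adm_zero htc
      have e : shifted c q R.L₀ (fun _ => 0) = countingFunction c q := funext shifted_zero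
      rw [e] at h2
      exact norm_pos_iff.1 (lt_of_lt_of_le (by linarith [R.κ_pos]) h2)
    have e : shifted c q R.L₀ (fun _ => 0) = countingFunction c q := funext shifted_zero
    rw [e] at h1
    calc ∫ s in Ioc (0 : ℝ) 1, Φ (s, t) * deriv z s
        = contourIntegral z (fun u => deriv (countingFunction c q) (t : ℂ)
            * (g u / (countingFunction c q u - countingFunction c q t))) := by
          rw [IsJordanLoop.contourIntegral_eq]
          refine integral_congr_ae (Eventually.of_forall fun s => ?_)
          simp only [hΦ]
          ring
      _ = 2 * Real.pi * Complex.I * g t := by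
          rw [IsJordanLoop.contourIntegral_const_mul, h1]
          field_simp
  calc contourIntegral z (fun ζ => g ζ * psiLim c q ζ)
      = 1 / (2 * Real.pi * Complex.I) * ∫ s in Ioc (0 : ℝ) 1, ∫ t in Ioc (-q) q, Φ (s, t) * deriv z s := by
        rw [IsJordanLoop.contourIntegral_eq, ← integral_const_mul]
        refine integral_congr_ae (Eventually.of_forall fun s => ?_)
        simp only [hΦ, psiLim]
        rw [integral_mul_const, integral_const_mul, ← intervalIntegral.integral_of_le hle]
        ring
    _ = 1 / (2 * Real.pi * Complex.I) * ∫ t in Ioc (-q) q, ∫ s in Ioc (0 : ℝ) 1, Φ (s, t) * deriv z s := by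
        rw [integral_integral_swap hint]
    _ = 1 / (2 * Real.pi * Complex.I) * ∫ t in Ioc (-q) q, 2 * Real.pi * Complex.I * g t := by
        rw [setIntegral_congr_fun measurableSet_Ioc hres]
    _ = ∫ t in (-q)..q, g t := by
        rw [integral_const_mul, intervalIntegral.integral_of_le hle]
        field_simp

/-- The density of the roots is close to its thermodynamic limit. -/
theorem exists_psiL_bound (n : ℕ) : ∃ C > 0, ∀ L ≥ R.L₀, ∀ N : ℕ, |N / L - density c q| ≤ R.η →
    ∀ I ⊆ Finset.Icc 1 N, I.card ≤ n → ∀ ν, Adm M K b ν → ∀ ζ ∈ trace z,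
      ‖psiL c q L (Finset.Icc 1 N \ I) ν ζ - psiLim c q ζ‖ ≤ C * (1 / L + |N / L - density c q|) := by
  have hm := R.gap_pos
  have hD := R.density_pos
  have hη := R.η_pos
  have hb := R.b_pos
  set m := R.gap
  set X := density c q + R.η with hX
  have hX0 : 0 < X := by positivity
  refine ⟨X * (b / m ^ 2) + n / m + X * (1 / m ^ 2) + 1 / m, by positivity,
    fun L hL N hN I hI hIn ν hν ζ hζ => ?_⟩
  have hLp := R.L_pos hL
  have hLc : (L : ℂ) ≠ 0 := by exact_mod_cast hLp.ne'
  have hN' := abs_le.1 hN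
  have hNX : (N : ℝ) / L ≤ X := by linarith [hN'.2]
  set a := countingFunction c q ζ with ha
  set f : ℝ → ℂ := fun x => 1 / (a - (x : ℂ)) with hf
  have hga : ∀ x : ℝ, 0 ≤ x → x ≤ X → m ≤ ‖a - x‖ := fun x h0 h1 => R.gap_le_counting hζ h0 h1
  have hjX : ∀ j ∈ Finset.Icc 1 N, (0 : ℝ) ≤ (j : ℝ) / L ∧ (j : ℝ) / L ≤ X := fun j hj =>
    ⟨by positivity, R.div_le_of_mem hL hNX Finset.Subset.rfl hj⟩
  have hJ : Finset.Icc 1 N \ I ⊆ Finset.Icc 1 N := Finset.sdiff_subset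
  have hfb : ∀ x : ℝ, 0 ≤ x → x ≤ X → ‖f x‖ ≤ 1 / m := fun x h0 h1 => by
    rw [hf]
    simp only [norm_div, norm_one]
    exact one_div_le_one_div_of_le hm (hga x h0 h1)
  have hfl : ∀ x : ℝ, 0 ≤ x → x ≤ X → ∀ y : ℝ, 0 ≤ y → y ≤ X → ‖f x - f y‖ ≤ 1 / m ^ 2 * |x - y| := by
    intro x h0 h1 y h2 h3
    have := norm_inv_sub_inv_le hm (hga x h0 h1) (hga y h2 h3) (d := |x - y|) (by
      rw [sub_sub_sub_cancel_left, ← Complex.ofReal_sub, Complex.norm_real, Real.norm_eq_abs, abs_sub_comm])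
    rwa [one_div_mul_eq_div]
  have hfc : ∀ y, y ≤ X → ContinuousOn f (Icc 0 y) := fun y hy => by
    refine ContinuousOn.div continuousOn_const (by fun_prop) fun x hx => ?_
    exact norm_pos_iff.1 (hm.trans_le (hga x hx.1 (hx.2.trans hy)))
  have hn1 : ‖(1 / L : ℂ)‖ = 1 / L := by
    rw [norm_div, norm_one, Complex.norm_real, Real.norm_of_nonneg hLp.le]
  -- Four errors: `s1` drops ν/L, `s2` restores the at most n missing indices, `s3` replaces the sum
  -- by an integral up to N/L, and `s4` moves the endpoint to D. The first three are O(1/L), the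
  -- last one O(|N/L - D|).
  have s1 : ‖(1 / L : ℂ) * ∑ j ∈ Finset.Icc 1 N \ I, 1 / (shifted c q L ν ζ - (j : ℂ) / L)
      - (1 / L : ℂ) * ∑ j ∈ Finset.Icc 1 N \ I, f (j / L)‖ ≤ X * (b / m ^ 2) * (1 / L) := by
    rw [← mul_sub, ← Finset.sum_sub_distrib, norm_mul, hn1]
    have h1 : ∀ j ∈ Finset.Icc 1 N \ I, ‖1 / (shifted c q L ν ζ - (j : ℂ) / L) - f (j / L)‖
        ≤ b / L / m ^ 2 := by
      intro j hj
      obtain ⟨h2, h3⟩ := hjX j (hJ hj)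
      have h4 := R.gap_le hL hν hζ h2 h3
      push_cast at h4
      have h5 := hga _ h2 h3
      rw [hf]
      push_cast at h5 ⊢
      refine norm_inv_sub_inv_le hm h4 h5 ?_
      have e : shifted c q L ν ζ - (j : ℂ) / L - (a - (j : ℂ) / L) = ν ζ / L := by
        rw [ha]; unfold shifted; ring
      rw [e, norm_div, Complex.norm_real, Real.norm_of_nonneg hLp.le]
      have := R.bound hν (R.trace_subset_nbhd hζ)
      gcongr
    refine (mul_le_mul_of_nonneg_left (norm_sum_le_of_le _ h1) (by positivity)).trans ?_
    rw [Finset.sum_const, nsmul_eq_mul]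
    have h6 := R.card_div_le hL hNX hJ
    calc 1 / L * (((Finset.Icc 1 N \ I).card : ℝ) * (b / L / m ^ 2))
        = ((Finset.Icc 1 N \ I).card : ℝ) / L * (b / m ^ 2) * (1 / L) := by ring
      _ ≤ _ := by gcongr
  have s2 : ‖(1 / L : ℂ) * ∑ j ∈ Finset.Icc 1 N \ I, f (j / L)
      - (1 / L : ℂ) * ∑ j ∈ Finset.Icc 1 N, f (j / L)‖ ≤ n / m * (1 / L) := by
    rw [← Finset.sum_sdiff hI, ← mul_sub, sub_add_cancel_left, norm_mul, norm_neg, hn1]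
    have h1 : ∀ j ∈ I, ‖f (j / L)‖ ≤ 1 / m := fun j hj => hfb _ (hjX j (hI hj)).1 (hjX j (hI hj)).2
    refine (mul_le_mul_of_nonneg_left (norm_sum_le_of_le _ h1) (by positivity)).trans ?_
    rw [Finset.sum_const, nsmul_eq_mul]
    have : (I.card : ℝ) ≤ n := by exact_mod_cast hIn
    calc 1 / L * ((I.card : ℝ) * (1 / m)) ≤ 1 / L * ((n : ℝ) * (1 / m)) := by gcongr
      _ = _ := by ring
  have s3 : ‖(1 / L : ℂ) * ∑ j ∈ Finset.Icc 1 N, f (j / L) - ∫ x in (0 : ℝ)..(N / L), f x‖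
      ≤ X * (1 / m ^ 2) * (1 / L) := by
    refine (norm_riemann_sub_le hLp (l := 1 / m ^ 2) N (hfc _ hNX) fun x hx y hy =>
      hfl x hx.1 (hx.2.trans hNX) y hy.1 (hy.2.trans hNX)).trans ?_
    calc (N : ℝ) / L * (1 / m ^ 2 / L) ≤ X * (1 / m ^ 2 / L) := by gcongr
      _ = _ := by ring
  have hii : ∀ y : ℝ, 0 ≤ y → y ≤ X → IntervalIntegrable f volume 0 y := fun y h0 h1 =>
    ContinuousOn.intervalIntegrable (by rw [uIcc_of_le h0]; exact hfc y h1)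
  have hN0 : (0 : ℝ) ≤ N / L := by positivity
  have hDX : density c q ≤ X := by linarith
  have s4 : ‖(∫ x in (0 : ℝ)..(N / L), f x) - ∫ x in (0 : ℝ)..(density c q), f x‖
      ≤ 1 / m * |N / L - density c q| := by
    rw [intervalIntegral.integral_interval_sub_left (hii _ hN0 hNX) (hii _ hD.le hDX)]
    refine intervalIntegral.norm_integral_le_of_norm_le_const fun x hx => ?_
    refine hfb x ?_ ?_
    · exact le_trans (le_min hD.le hN0) hx.1.le
    · exact hx.2.trans (max_le hDX hNX)
  set ε := |N / L - density c q| with hε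
  have hε0 : 0 ≤ ε := abs_nonneg _
  have hpp : (1 : ℝ) ≤ 2 * Real.pi := by linarith [Real.pi_gt_three]
  have hfin : ‖(1 / L : ℂ) * ∑ j ∈ Finset.Icc 1 N \ I, 1 / (shifted c q L ν ζ - (j : ℂ) / L)
      - ∫ x in (0 : ℝ)..(density c q), f x‖
      ≤ X * (b / m ^ 2) * (1 / L) + n / m * (1 / L) + X * (1 / m ^ 2) * (1 / L) + 1 / m * ε := by
    refine (norm_sub_le_norm_sub_add_norm_sub _ (∫ x in (0 : ℝ)..(N / L), f x) _).trans ?_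
    refine add_le_add ?_ s4
    refine (norm_sub_le_norm_sub_add_norm_sub _ ((1 / L : ℂ) * ∑ j ∈ Finset.Icc 1 N, f (j / L)) _).trans ?_
    refine add_le_add ?_ s3
    exact (norm_sub_le_norm_sub_add_norm_sub _ _ _).trans (add_le_add s1 s2)
  have e : psiL c q L (Finset.Icc 1 N \ I) ν ζ - psiLim c q ζ
      = 1 / (2 * Real.pi * Complex.I)
        * ((1 / L : ℂ) * ∑ j ∈ Finset.Icc 1 N \ I, 1 / (shifted c q L ν ζ - (j : ℂ) / L)
          - ∫ x in (0 : ℝ)..(density c q), f x) := by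
    rw [R.psiLim_eq hζ, psiL, hf, mul_sub, ← mul_assoc]
    congr 2
    rw [one_div_mul_one_div]
  rw [e, norm_mul]
  have hn2 : ‖(1 / (2 * Real.pi * Complex.I) : ℂ)‖ ≤ 1 := by
    rw [norm_div, norm_one, norm_mul, Complex.norm_I, mul_one]
    have : ‖(2 * Real.pi : ℂ)‖ = 2 * Real.pi := by simp [abs_of_pos Real.pi_pos]
    rw [this]
    exact div_le_one_of_le₀ hpp (by linarith)
  have hL1 : 0 < 1 / L := by positivity
  calc _ ≤ 1 * _ := mul_le_mul hn2 hfin (norm_nonneg _) zero_le_one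
    _ ≤ _ := by
      have p1 : 0 ≤ X * (b / m ^ 2) * ε := by positivity
      have p2 : 0 ≤ n / m * ε := by positivity
      have p3 : 0 ≤ X * (1 / m ^ 2) * ε := by positivity
      have p4 : 0 ≤ 1 / m * (1 / L) := by positivity
      nlinarith

end RootData


/-! ### The limit of Γ as L → ∞. -/

/-- A map with a quadratic error term is differentiable. -/
lemma hasDerivWithinAt_of_sq_bound {𝕜 : Type*} [NontriviallyNormedField 𝕜] {F : Type*}
    [NormedAddCommGroup F] [NormedSpace 𝕜 F] {f : 𝕜 → F} {f' : F} {x : 𝕜} {s : Set 𝕜} {C : ℝ}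
    (h : ∀ᶠ y in 𝓝[s] x, ‖f y - f x - (y - x) • f'‖ ≤ C * ‖y - x‖ ^ 2) :
    HasDerivWithinAt f f' s x := by
  rw [hasDerivWithinAt_iff_isLittleO]
  refine Asymptotics.IsBigO.trans_isLittleO (g := fun y : 𝕜 => ‖y - x‖ ^ 2) ?_
    ((Asymptotics.isLittleO_pow_sub_sub x one_lt_two).mono nhdsWithin_le_nhds)
  refine Asymptotics.IsBigO.of_bound C ?_
  filter_upwards [h] with y hy
  rwa [norm_pow, norm_norm]

namespace RootData

variable {c q δ b : ℝ} {M K : Set ℂ} {z : ℝ → ℂ} (R : RootData c q δ b M K z)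
variable {L : ℝ} {ν : ℂ → ℂ}

lemma Adm.smul {M K : Set ℂ} {a : ℝ} (hν : Adm M K a ν) {s : ℂ} (hs : ‖s‖ ≤ 1) :
    Adm M K a fun u => s * ν u :=
  ⟨analyticOnNhd_const.mul hν.analytic, fun u hu => by
    rw [norm_mul]
    have h1 := hν.bound u hu
    have h2 := norm_nonneg (ν u)
    nlinarith⟩

/-- The second order expansion of Γ along the segment s ↦ sν, with the sum over roots written as a
contour integral by residues. -/
lemma hasDerivWithinAt_gammaL_smul (hL : R.L₀ ≤ L) {N : ℕ} (hN : (N : ℝ) / L ≤ density c q + R.η)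
    {J : Finset ℕ} (hJ : J ⊆ Finset.Icc 1 N) (hν : Adm M K b ν) {w : ℂ} (hw : w ∈ strip δ) {s : ℝ}
    (hs : s ∈ Icc (0 : ℝ) 1) :
    HasDerivWithinAt (fun s : ℝ => gammaL c q z L J (fun u => s * ν u) w)
      (contourIntegral z fun ζ => ν ζ * gammaLDeriv c q L J (fun u => s * ν u) w ζ) (Icc 0 1) s := by
  obtain ⟨C, hC, hexp⟩ := R.exists_gammaL_expansion hL hN hJ
  have hLp := R.L_pos hL
  have hκ := R.κ_pos
  have hr := R.r_pos
  have hb := R.b_pos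
  have hadm : ∀ s ∈ Icc (0 : ℝ) 1, Adm M K b fun u => (s : ℂ) * ν u := fun s hs =>
    Adm.smul hν (by rw [Complex.norm_real, Real.norm_of_nonneg hs.1]; exact hs.2)
  refine hasDerivWithinAt_of_sq_bound (C := C * b ^ 2) ?_
  have hnear : ∀ᶠ y in 𝓝[Icc 0 1] s, ‖y - s‖ < R.r / 2 / (2 / (R.κ * L) * b) := by
    refine nhdsWithin_le_nhds ?_
    have := Metric.ball_mem_nhds s (ε := R.r / 2 / (2 / (R.κ * L) * b)) (by positivity)
    filter_upwards [this] with y hy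
    rwa [mem_ball_iff_norm] at hy
  filter_upwards [self_mem_nhdsWithin, hnear] with y hy hys
  rw [lt_div_iff₀ (by positivity)] at hys
  have h1 := hexp _ _ (hadm y hy) (hadm s hs) (‖y - s‖ * b) (fun u hu => by
      rw [← sub_mul, norm_mul, ← Complex.ofReal_sub, Complex.norm_real]
      exact mul_le_mul_of_nonneg_left (hν.bound u hu) (norm_nonneg _))
    (by calc _ = ‖y - s‖ * (2 / (R.κ * L) * b) := by ring
          _ < _ := hys) w hw
  rw [R.contourIntegral_mul_gammaLDeriv hL hN hJ (hadm s hs) hw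
    (hν.analytic.differentiableOn.mono (R.openNbhd_subset_nbhd.trans R.nbhd_subset_interior)),
    Complex.real_smul, Finset.mul_sum]
  refine le_trans (le_of_eq ?_) (h1.trans (le_of_eq (by ring)))
  congr 2
  refine Finset.sum_congr rfl fun j _ => ?_
  push_cast
  ring

lemma integral_mul_deriv_dressedPhase (R : RootData c q δ b M K z) {w : ℂ} (hw : w ∈ strip δ)
    (ν : ℂ → ℂ) :
    ∫ t in (-q)..q, ν t * deriv (dressedPhase c q w) t
      = -∫ t in (-q)..q, resolventKernel c q w t / (2 * Real.pi) * ν t := by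
  rw [← intervalIntegral.integral_neg]
  refine intervalIntegral.integral_congr fun t _ => ?_
  rw [deriv_dressedPhase R.c_pos R.q_pos R.δ_pos R.δ_lt hw (ofReal_mem_strip R.δ_pos t)]
  ring

lemma continuousOn_psiLim (R : RootData c q δ b M K z) : ContinuousOn (psiLim c q) (trace z) := by
  have hle : -q ≤ q := by linarith [R.q_pos]
  have hk := R.continuousOn_kernel
  obtain ⟨C, hC⟩ := (R.loop.isCompact_trace.prod isCompact_Icc).exists_bound_of_continuousOn hk
  unfold psiLim
  refine continuousOn_const.mul fun ζ hζ => ?_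
  refine intervalIntegral.continuousWithinAt_of_dominated_interval (bound := fun _ => C) ?_ ?_
    intervalIntegrable_const ?_
  · filter_upwards [self_mem_nhdsWithin] with v hv
    rw [uIoc_of_le hle]
    refine ContinuousOn.aestronglyMeasurable ?_ measurableSet_Ioc
    exact hk.comp (f := fun t : ℝ => (v, t)) (by fun_prop) fun t ht => ⟨hv, Ioc_subset_Icc_self ht⟩
  · filter_upwards [self_mem_nhdsWithin] with v hv
    refine Eventually.of_forall fun t ht => ?_
    rw [uIoc_of_le hle] at ht
    exact hC (v, t) ⟨hv, Ioc_subset_Icc_self ht⟩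
  · refine Eventually.of_forall fun t ht => ?_
    rw [uIoc_of_le hle] at ht
    exact (hk.comp (f := fun v : ℂ => (v, t)) (by fun_prop)
      fun v hv => ⟨hv, Ioc_subset_Icc_self ht⟩) ζ hζ

lemma continuousOn_psiL (R : RootData c q δ b M K z) (hL : R.L₀ ≤ L) {N : ℕ}
    (hN : (N : ℝ) / L ≤ density c q + R.η)
    {J : Finset ℕ} (hJ : J ⊆ Finset.Icc 1 N) (hν : Adm M K b ν) :
    ContinuousOn (psiL c q L J ν) (trace z) := by
  unfold psiL
  refine continuousOn_const.mul (continuousOn_finsetSum _ fun j hj => ?_)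
  obtain ⟨h1, h2⟩ := R.betheRoot_spec hL hν (R.div_le_of_mem hL hN hJ hj)
  refine continuousOn_const.div ?_ fun ζ hζ => ?_
  · exact ((R.differentiableOn_shifted hν).continuousOn.mono
      (R.trace_subset_nbhd.trans R.nbhd_subset_interior)).sub continuousOn_const
  · exact R.shifted_sub_ne hL hν h1 h2 (R.trace_subset_nbhd hζ) (R.trace_not_core hζ)

lemma continuousOn_deriv_phase_trace (R : RootData c q δ b M K z) {w : ℂ} (hw : w ∈ strip δ) :
    ContinuousOn (deriv (dressedPhase c q w)) (trace z) :=
  (R.differentiableOn_deriv_dressedPhase hw).continuousOn.mono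
    (IsJordanLoop.trace_subset_hull.trans R.hull_subset_openNbhd)

/-- The thermodynamic limit of `Γ` is the integral operator `-R / 2π`. -/
theorem exists_gammaL_limit_bound (n : ℕ) : ∃ C > 0, ∀ L ≥ R.L₀, ∀ N : ℕ,
    |N / L - density c q| ≤ R.η → ∀ I ⊆ Finset.Icc 1 N, I.card ≤ n → ∀ ν, Adm M K b ν →
      ∀ w ∈ strip δ, ‖gammaL c q z L (Finset.Icc 1 N \ I) ν w
        + ∫ t in (-q)..q, resolventKernel c q w t / (2 * Real.pi) * ν t‖
        ≤ C * (1 / L + |N / L - density c q|) := by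
  obtain ⟨C, hC, hpsi⟩ := R.exists_psiL_bound n
  obtain ⟨D, hD0, hD, -⟩ := R.loop.exists_deriv_bound
  have hb := R.b_pos
  have hCφ := R.Cφ_pos
  refine ⟨b * (R.Cφ * C) * D, by positivity, fun L hL N hN I hI hIn ν hν w hw => ?_⟩
  have hNX : (N : ℝ) / L ≤ density c q + R.η := by linarith [(abs_le.1 hN).2]
  have hJ : Finset.Icc 1 N \ I ⊆ Finset.Icc 1 N := Finset.sdiff_subset
  set J := Finset.Icc 1 N \ I
  set ε := 1 / L + |N / L - density c q|
  have hLp := R.L_pos hL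
  have hνO : DifferentiableOn ℂ ν R.openNbhd :=
    hν.analytic.differentiableOn.mono (R.openNbhd_subset_nbhd.trans R.nbhd_subset_interior)
  have hνt : ContinuousOn ν (trace z) := hνO.continuousOn.mono
    (IsJordanLoop.trace_subset_hull.trans R.hull_subset_openNbhd)
  have hφO := R.differentiableOn_deriv_dressedPhase hw
  have hφt := R.continuousOn_deriv_phase_trace hw
  set A := ∫ t in (-q)..q, ν t * deriv (dressedPhase c q w) t with hA
  have hA' : A = contourIntegral z (fun ζ => ν ζ * deriv (dressedPhase c q w) ζ * psiLim c q ζ) := by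
    rw [R.contourIntegral_mul_psiLim (g := fun ζ => ν ζ * deriv (dressedPhase c q w) ζ) (hνO.mul hφO)]
  have hadm : ∀ s ∈ Icc (0 : ℝ) 1, Adm M K b fun u => (s : ℂ) * ν u := fun s hs =>
    Adm.smul hν (by rw [Complex.norm_real, Real.norm_of_nonneg hs.1]; exact hs.2)
  have hder : ∀ s ∈ Icc (0 : ℝ) 1, HasDerivWithinAt
      (fun s : ℝ => gammaL c q z L J (fun u => s * ν u) w - s * A)
      ((contourIntegral z fun ζ => ν ζ * gammaLDeriv c q L J (fun u => s * ν u) w ζ) - A)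
      (Icc 0 1) s := by
    intro s hs
    have h2 : HasDerivWithinAt (fun s : ℝ => (s : ℂ) * A) A (Icc 0 1) s := by
      have := ((hasDerivAt_id (s : ℂ)).comp_ofReal.mul_const A).hasDerivWithinAt (s := Icc 0 1)
      simpa using this
    exact (R.hasDerivWithinAt_gammaL_smul hL hNX hJ hν hw hs).sub h2
  -- Mean value inequality for s ↦ Γ[sν] - sA. The constant of the second order expansion is chosen
  -- after L and yields only differentiability; the uniform rate comes from the convergence of the
  -- density at every sν.
  have hmv := norm_image_sub_le_of_norm_deriv_le_segment_01' (C := b * (R.Cφ * C) * D * ε) hder ?_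
  · have e0 : gammaL c q z L J (fun u => ((0 : ℝ) : ℂ) * ν u) w = 0 := by
      simp [gammaL_zero]
    have e1 : (fun u => ((1 : ℝ) : ℂ) * ν u) = ν := by ext u; simp
    rw [e0, e1] at hmv
    rw [hA, R.integral_mul_deriv_dressedPhase hw] at hmv
    simpa using hmv
  · intro s hs
    have hs' := Ico_subset_Icc_self hs
    rw [hA', ← R.loop.contourIntegral_sub]
    · refine (IsJordanLoop.norm_contourIntegral_le hD (C := b * (R.Cφ * (C * ε))) fun ζ hζ => ?_).trans
        (le_of_eq (by ring))
      have e : ν ζ * gammaLDeriv c q L J (fun u => s * ν u) w ζ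
          - ν ζ * deriv (dressedPhase c q w) ζ * psiLim c q ζ
          = ν ζ * (deriv (dressedPhase c q w) ζ
            * (psiL c q L J (fun u => s * ν u) ζ - psiLim c q ζ)) := by
        rw [gammaLDeriv_eq]; ring
      rw [e, norm_mul, norm_mul]
      have h1 := R.bound hν (R.trace_subset_nbhd hζ)
      have h2 := R.dφ_bound w hw ζ (R.nbhd_subset_strip (R.trace_subset_nbhd hζ))
      have h3 := hpsi L hL N hN I hI hIn _ (hadm s hs') ζ hζ
      gcongr
    · simp only [gammaLDeriv_eq]
      exact hνt.mul (hφt.mul (R.continuousOn_psiL hL hNX hJ (hadm s hs')))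
    · exact (hνt.mul hφt).mul R.continuousOn_psiLim

end RootData

/-! ### Fredholm determinants on the loop, over the roots and on the Fermi zone. -/

/-- The kernel `-γ ∂_ζ φ(μ, ζ) ψ(ζ)`. -/
noncomputable def phaseKernel (c q : ℝ) (γ : ℂ) (ψ : ℂ → ℂ) (μ ζ : ℂ) : ℂ :=
  -γ * deriv (dressedPhase c q μ) ζ * ψ ζ

lemma phaseKernel_psiL (c q L : ℝ) (J : Finset ℕ) (ν : ℂ → ℂ) (γ : ℂ) :
    (fun μ ζ => -γ * gammaLDeriv c q L J ν μ ζ) = phaseKernel c q γ (psiL c q L J ν) := by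
  ext μ ζ
  rw [gammaLDeriv_eq, phaseKernel]
  ring

namespace RootData

variable {c q δ b : ℝ} {M K : Set ℂ} {z : ℝ → ℂ} (R : RootData c q δ b M K z)
variable {L : ℝ} {ν : ℂ → ℂ}

lemma continuousOn_phaseKernel (R : RootData c q δ b M K z) {ψ : ℂ → ℂ}
    (hψ : ContinuousOn ψ (trace z)) (γ : ℂ) :
    ContinuousOn (fun p : ℂ × ℂ => phaseKernel c q γ ψ p.1 p.2) (trace z ×ˢ trace z) := by
  have hts : trace z ⊆ strip δ := R.trace_subset_nbhd.trans R.nbhd_subset_strip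
  exact (continuousOn_const.mul
    (R.analyticOnNhd_deriv_dressedPhase.continuousOn.mono (prod_mono hts hts))).mul
      (hψ.comp continuousOn_snd fun p hp => hp.2)

/-- Fredholm determinants for close densities are close. -/
lemma norm_fredholmDet_phaseKernel_sub_le {D : ℝ} (hD : ∀ t ∈ Icc (0 : ℝ) 1, ‖deriv z t‖ ≤ D)
    {ψ ψ' : ℂ → ℂ} (hψ : ContinuousOn ψ (trace z)) (hψ' : ContinuousOn ψ' (trace z)) {P d : ℝ}
    (hd : 0 ≤ d) (hP : ∀ ζ ∈ trace z, ‖ψ ζ‖ ≤ P) (hP' : ∀ ζ ∈ trace z, ‖ψ' ζ‖ ≤ P)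
    (hdP : ∀ ζ ∈ trace z, ‖ψ ζ - ψ' ζ‖ ≤ d * P) {γ : ℂ} (hγ : ‖γ‖ * R.Cφ * P * D ≤ 1 / 4) :
    ‖fredholmDet z 0 1 (phaseKernel c q γ ψ) - fredholmDet z 0 1 (phaseKernel c q γ ψ')‖ ≤ d / 2 := by
  have hts : trace z ⊆ strip δ := R.trace_subset_nbhd.trans R.nbhd_subset_strip
  have hC := R.Cφ_pos
  have hφ : ∀ u ∈ trace z, ∀ v ∈ trace z, ‖-γ * deriv (dressedPhase c q u) v‖ ≤ ‖γ‖ * R.Cφ := by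
    intro u hu v hv
    rw [norm_mul, norm_neg]
    gcongr
    exact R.dφ_bound u (hts hu) v (hts hv)
  refine R.loop.norm_fredholmDet_sub_le hD (R.continuousOn_phaseKernel hψ γ)
    (R.continuousOn_phaseKernel hψ' γ) (x := ‖γ‖ * R.Cφ * P) hd ?_ ?_ ?_ hγ
  · intro u hu v hv
    rw [phaseKernel, norm_mul]
    exact mul_le_mul (hφ u hu v hv) (hP v hv) (norm_nonneg _) (by positivity)
  · intro u hu v hv
    rw [phaseKernel, norm_mul]
    exact mul_le_mul (hφ u hu v hv) (hP' v hv) (norm_nonneg _) (by positivity)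
  · intro u hu v hv
    rw [phaseKernel, phaseKernel, ← mul_sub, norm_mul]
    refine (mul_le_mul (hφ u hu v hv) (hdP v hv) (norm_nonneg _) (by positivity)).trans (le_of_eq ?_)
    ring

/-- The weighted points on the loop. -/
lemma fredholmDet_phaseKernel_eq (ψ : ℂ → ℂ) (γ : ℂ) :
    fredholmDet z 0 1 (phaseKernel c q γ ψ)
      = fredholmSeries (volume.restrict (Icc 0 1))
          (IccExtend zero_le_one ((Icc 0 1).domRestrict z)) (fun t => ψ (z t) * deriv z t)
          (fun μ ζ => -γ * deriv (dressedPhase c q μ) ζ) :=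
  fredholmDet_eq_fredholmSeries zero_le_one (fun μ ζ => -γ * deriv (dressedPhase c q μ) ζ) ψ

lemma integral_Icc_eq_contourIntegral (f ψ : ℂ → ℂ) :
    ∫ t, f (IccExtend zero_le_one ((Icc (0 : ℝ) 1).domRestrict z) t) * (ψ (z t) * deriv z t)
        ∂(volume.restrict (Icc 0 1))
      = contourIntegral z (fun ζ => f ζ * ψ ζ) := by
  rw [IsJordanLoop.contourIntegral_eq, ← integral_Icc_eq_integral_Ioc]
  refine setIntegral_congr_fun measurableSet_Icc fun t ht => ?_
  rw [IccExtend_of_mem _ _ ht, mul_assoc]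
  rfl

lemma continuous_IccExtend_loop (R : RootData c q δ b M K z) :
    Continuous (IccExtend zero_le_one ((Icc (0 : ℝ) 1).domRestrict z)) :=
  (continuousOn_iff_continuous_domRestrict.1 R.loop.continuousOn).Icc_extend'

lemma IccExtend_loop_mem (t : ℝ) :
    IccExtend zero_le_one ((Icc (0 : ℝ) 1).domRestrict z) t ∈ trace z :=
  IsJordanLoop.mem_trace (projIcc (0 : ℝ) 1 zero_le_one t).2

lemma integrable_weight (R : RootData c q δ b M K z) {ψ : ℂ → ℂ} (hψ : ContinuousOn ψ (trace z)) :
    Integrable (fun t => ψ (z t) * deriv z t) (volume.restrict (Icc (0 : ℝ) 1)) := by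
  rw [← restrict_Ioc_eq_restrict_Icc]
  exact R.loop.integrable_mul_deriv hψ

lemma trace_union_core_subset : trace z ∪ R.core ⊆ R.openNbhd :=
  union_subset (IsJordanLoop.trace_subset_hull.trans R.hull_subset_openNbhd)
    ((R.core_subset.trans IsJordanLoop.inside_subset_hull).trans R.hull_subset_openNbhd)

lemma differentiableOn_phase_prod (R : RootData c q δ b M K z) (γ : ℂ) :
    DifferentiableOn ℂ (fun p : ℂ × ℂ => -γ * deriv (dressedPhase c q p.1) p.2)
      (R.openNbhd ×ˢ R.openNbhd) := by
  have hs : R.openNbhd ⊆ strip δ := R.openNbhd_subset_nbhd.trans R.nbhd_subset_strip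
  exact (R.analyticOnNhd_deriv_dressedPhase.differentiableOn.mono (prod_mono hs hs)).const_mul _

/-- The Fredholm determinant of the functional derivative is a determinant over the roots. -/
theorem fredholmDet_psiL (hL : R.L₀ ≤ L) {N : ℕ} (hN : (N : ℝ) / L ≤ density c q + R.η)
    {J : Finset ℕ} (hJ : J ⊆ Finset.Icc 1 N) (hν : Adm M K b ν) (γ : ℂ) :
    fredholmDet z 0 1 (phaseKernel c q γ (psiL c q L J ν))
      = (1 + Matrix.of fun j k : J => -γ * deriv (dressedPhase c q (betheRoot c q z L ν j))
          (betheRoot c q z L ν k)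
          * (1 / (L * deriv (shifted c q L ν) (betheRoot c q z L ν k)))).det := by
  -- With the discrete structure and counting measure, the roots with weights 1/(L ξ_ν'(λ_k)) form a
  -- family of weighted points; the residue formula says that it integrates holomorphic functions as
  -- the loop does.
  let : TopologicalSpace J := ⊥
  have : DiscreteTopology J := ⟨rfl⟩
  let : MeasurableSpace J := ⊤
  have : BorelSpace J := ⟨by rw [borel_eq_top_of_discrete]⟩
  rw [fredholmDet_phaseKernel_eq, ← fredholmSeries_fintype
    (fun j : J => betheRoot c q z L ν j)
    (fun k : J => 1 / (L * deriv (shifted c q L ν) (betheRoot c q z L ν k)))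
    (fun μ ζ => -γ * deriv (dressedPhase c q μ) ζ)]
  refine fredholmSeries_congr (R.loop.isCompact_trace.union R.isCompact_core)
    R.trace_union_core_subset R.continuous_IccExtend_loop continuous_of_discreteTopology
    (fun t => Or.inl (IccExtend_loop_mem t))
    (fun j => Or.inr (R.betheRoot_spec hL hν (R.div_le_of_mem hL hN hJ j.2)).1)
    (R.integrable_weight (R.continuousOn_psiL hL hN hJ hν)) .of_finite (fun f hf => ?_)
    (R.differentiableOn_phase_prod γ)
  rw [integral_Icc_eq_contourIntegral, R.contourIntegral_mul_psiL hL hN hJ hν hf,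
    integral_fintype .of_finite, ← Finset.sum_coe_sort]
  refine Finset.sum_congr rfl fun j _ => ?_
  simp [div_eq_mul_inv]

/-- The limiting Fredholm determinant is the determinant on the Fermi zone. -/
theorem fredholmDet_psiLim (R : RootData c q δ b M K z) (γ : ℂ) :
    fredholmDet z 0 1 (phaseKernel c q γ (psiLim c q))
      = fredholmDet (fun t => (t : ℂ)) (-q) q
          (fun w v => γ * resolventKernel c q w v / (2 * Real.pi)) := by
  have hle : -q ≤ q := by linarith [R.q_pos]
  have e : fredholmDet (fun t => (t : ℂ)) (-q) q
      (fun w v => γ * resolventKernel c q w v / (2 * Real.pi))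
      = fredholmDet (fun t => (t : ℂ)) (-q) q (phaseKernel c q γ fun _ => 1) := by
    unfold fredholmDet
    congr 1
    ext m
    congr 3
    ext t
    congr 3
    ext i j
    simp only [phaseKernel]
    rw [deriv_dressedPhase R.c_pos R.q_pos R.δ_pos R.δ_lt (ofReal_mem_strip R.δ_pos _)
      (ofReal_mem_strip R.δ_pos _)]
    ring
  have e2 := fredholmDet_eq_fredholmSeries (z := fun t : ℝ => (t : ℂ)) hle
    (fun μ ζ => -γ * deriv (dressedPhase c q μ) ζ) (fun _ => 1)
  rw [e]
  refine Eq.trans ?_ e2.symm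
  rw [fredholmDet_phaseKernel_eq]
  have hd : ∀ t : ℝ, deriv (fun t : ℝ => (t : ℂ)) t = 1 := fun t =>
    ((hasDerivAt_id (t : ℂ)).comp_ofReal).deriv
  have hcont : Continuous (IccExtend hle ((Icc (-q) q).domRestrict fun t : ℝ => (t : ℂ))) :=
    (Complex.continuous_ofReal.comp continuous_subtype_val).Icc_extend'
  refine fredholmSeries_congr (R.loop.isCompact_trace.union R.isCompact_core)
    R.trace_union_core_subset R.continuous_IccExtend_loop hcont
    (fun t => Or.inl (IccExtend_loop_mem t))
    (fun t => Or.inr (R.fermi_subset_core (mem_image_of_mem _ (projIcc (-q) q hle t).2)))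
    (R.integrable_weight R.continuousOn_psiLim) (by simp only [hd]; exact integrable_const _)
    (fun f hf => ?_) (R.differentiableOn_phase_prod γ)
  rw [integral_Icc_eq_contourIntegral, R.contourIntegral_mul_psiLim hf,
    intervalIntegral.integral_of_le hle, ← integral_Icc_eq_integral_Ioc]
  refine setIntegral_congr_fun measurableSet_Icc fun t ht => ?_
  simp only [hd, mul_one]
  rw [IccExtend_of_mem _ _ ht]
  rfl

end RootData

/-! ### Riemann sums along the boundary curve -/

namespace IsDiscretization

variable {s : ℕ} {x : ℕ → ℝ}

lemma le_succ (hx : IsDiscretization s x) {j : ℕ} (hj : j ≤ s) : x j ≤ x (j + 1) := by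
  rcases Nat.eq_zero_or_pos j with rfl | h0
  · rw [hx.zero]; exact hx.one_nonneg
  rcases hj.eq_or_lt with rfl | h1
  · rw [hx.last]; exact hx.le_one
  · exact (hx.strictMono ⟨h0, hj⟩ ⟨by omega, h1⟩ (Nat.lt_succ_self j)).le

lemma nonneg (hx : IsDiscretization s x) {j : ℕ} (hj : j ≤ s + 1) : 0 ≤ x j := by
  induction j with
  | zero => rw [hx.zero]
  | succ j ih => exact (ih (by omega)).trans (hx.le_succ (by omega))

lemma mem_Icc (hx : IsDiscretization s x) {j : ℕ} (hj : j ≤ s + 1) : x j ∈ Icc (0 : ℝ) 1 := by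
  refine ⟨hx.nonneg hj, ?_⟩
  have : ∀ k, k ≤ s + 1 - j → x j ≤ x (j + k) := fun k => by
    induction k with
    | zero => exact fun _ => le_rfl
    | succ k ih => exact fun hk => (ih (by omega)).trans (hx.le_succ (by omega))
  have h := this (s + 1 - j) le_rfl
  rwa [Nat.add_sub_cancel' hj, hx.last] at h

end IsDiscretization

namespace IsJordanLoop

variable {z : ℝ → ℂ} {s : ℕ} {x : ℕ → ℝ}

/-- The error of the Riemann sums of a contour integral. -/
lemma norm_sum_sub_contourIntegral_le (hz : IsJordanLoop z) (hx : IsDiscretization s x) {D : ℝ}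
    (hD : ∀ t ∈ Icc (0 : ℝ) 1, ‖deriv z t‖ ≤ D) {f : ℂ → ℂ} (hf : ContinuousOn f (trace z))
    {C ε : ℝ} (hC : ∀ u ∈ trace z, ‖f u‖ ≤ C)
    (hε : ∀ t ∈ Icc (0 : ℝ) 1, ∀ t' ∈ Icc (0 : ℝ) 1, |t - t'| ≤ 2 / s → ‖f (z t) - f (z t')‖ ≤ ε) :
    ‖(∑ p : Fin s, (z (x (p + 2)) - z (x (p + 1))) * f (z (x (p + 1)))) - contourIntegral z f‖
      ≤ (ε + C * (2 / s)) * D := by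
  have hmem : ∀ j ≤ s + 1, x j ∈ Icc (0 : ℝ) 1 := fun j hj => hx.mem_Icc hj
  have hD0 : 0 ≤ D := (norm_nonneg _).trans (hD 0 (by simp))
  have hC0 : 0 ≤ C := (norm_nonneg _).trans (hC _ (mem_trace (t := 0) (by simp)))
  have hε0 : 0 ≤ ε := (norm_nonneg _).trans (hε 0 (by simp) 0 (by simp) (by simpa using by positivity))
  have hsub : ∀ a ∈ Icc (0 : ℝ) 1, ∀ b ∈ Icc (0 : ℝ) 1, a ≤ b →
      IntervalIntegrable (fun t => f (z t) * deriv z t) volume a b ∧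
      IntervalIntegrable (deriv z) volume a b := fun a ha b hb hab => by
    constructor <;> rw [intervalIntegrable_iff_integrableOn_Ioc_of_le hab]
    · exact IntegrableOn.mono_set (hz.integrable_mul_deriv hf) (Ioc_subset_Ioc ha.1 hb.2)
    · exact IntegrableOn.mono_set hz.integrable_deriv (Ioc_subset_Ioc ha.1 hb.2)
  have hsplit := intervalIntegral.sum_integral_adjacent_intervals (a := fun k => x (k + 1))
    (f := fun t => f (z t) * deriv z t) (μ := volume) (n := s)
    (fun k hk => (hsub _ (hmem _ (by omega)) _ (hmem _ (by omega)) (hx.le_succ (by omega))).1)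
  simp only [zero_add, hx.last] at hsplit
  have h01 := intervalIntegral.integral_add_adjacent_intervals
    (hsub 0 (by simp) _ (hmem 1 (by omega)) (hmem 1 (by omega)).1).1
    (hsub _ (hmem 1 (by omega)) 1 (by simp) (hmem 1 (by omega)).2).1
  -- The sum runs over the nodes x_1, ..., x_s, so it misses the arc between x_0 = 0 and x_1, whose
  -- parameter length is at most 2/s.
  have hfirst : ‖∫ t in (0 : ℝ)..x 1, f (z t) * deriv z t‖ ≤ C * (2 / s) * D := by
    have h1 := intervalIntegral.norm_integral_le_of_norm_le_const (a := 0) (b := x 1)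
      (f := fun t => f (z t) * deriv z t) (C := C * D) fun t ht => by
        rw [uIoc_of_le (hmem 1 (by omega)).1] at ht
        have ht' : t ∈ Icc (0 : ℝ) 1 := ⟨ht.1.le, ht.2.trans (hmem 1 (by omega)).2⟩
        rw [norm_mul]
        exact mul_le_mul (hC _ (mem_trace ht')) (hD t ht') (norm_nonneg _) hC0
    have h2 := hx.mesh 0 (Nat.zero_le _)
    rw [zero_add, hx.zero] at h2
    calc _ ≤ C * D * |x 1 - 0| := h1
      _ ≤ C * D * (2 / s) := by gcongr
      _ = _ := by ring
  have hpiece : ∀ k < s, ‖(z (x (k + 2)) - z (x (k + 1))) * f (z (x (k + 1)))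
      - ∫ t in x (k + 1)..x (k + 2), f (z t) * deriv z t‖ ≤ ε * D * (x (k + 2) - x (k + 1)) := by
    intro k hk
    have ha := hmem (k + 1) (by omega)
    have hb := hmem (k + 2) (by omega)
    have hab : x (k + 1) ≤ x (k + 2) := hx.le_succ (by omega)
    have hi := hsub _ ha _ hb hab
    have h1 : z (x (k + 2)) - z (x (k + 1)) = ∫ t in x (k + 1)..x (k + 2), deriv z t := by
      rw [intervalIntegral.integral_eq_sub_of_hasDerivAt_of_le hab
        (hz.continuousOn.mono (Icc_subset_Icc ha.1 hb.2))
        (fun t ht => hz.hasDerivAt ⟨ha.1.trans_lt ht.1, ht.2.trans_le hb.2⟩) hi.2]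
    rw [h1, mul_comm, ← intervalIntegral.integral_const_mul, ← intervalIntegral.integral_sub
      (hi.2.const_mul _) hi.1]
    have h2 := intervalIntegral.norm_integral_le_of_norm_le_const (a := x (k + 1)) (b := x (k + 2))
      (f := fun t => f (z (x (k + 1))) * deriv z t - f (z t) * deriv z t) (C := ε * D) fun t ht => by
        rw [uIoc_of_le hab] at ht
        have ht' : t ∈ Icc (0 : ℝ) 1 := ⟨ha.1.trans ht.1.le, ht.2.trans hb.2⟩
        rw [← sub_mul, norm_mul]
        refine mul_le_mul (hε _ ha _ ht' ?_) (hD t ht') (norm_nonneg _) hε0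
        have h3 := hx.mesh (k + 1) (by omega)
        rw [abs_of_nonneg (by linarith)] at h3
        rw [abs_sub_comm, abs_of_nonneg (by linarith [ht.1])]
        linarith [ht.2]
    rwa [abs_of_nonneg (by linarith)] at h2
  have hsum : (∑ p : Fin s, (z (x (p + 2)) - z (x (p + 1))) * f (z (x (p + 1))))
      - ∫ t in x 1..1, f (z t) * deriv z t
      = ∑ k ∈ Finset.range s, ((z (x (k + 2)) - z (x (k + 1))) * f (z (x (k + 1)))
        - ∫ t in x (k + 1)..x (k + 2), f (z t) * deriv z t) := by
    rw [Finset.sum_sub_distrib, ← hsplit,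
      Fin.sum_univ_eq_sum_range (fun k => (z (x (k + 2)) - z (x (k + 1))) * f (z (x (k + 1)))) s]
  have htel : ∑ k ∈ Finset.range s, (x (k + 2) - x (k + 1)) ≤ 1 := by
    have := Finset.sum_range_sub (fun k => x (k + 1)) s
    rw [this, hx.last]
    linarith [(hmem 1 (by omega)).1]
  have hall : ‖∑ k ∈ Finset.range s, ((z (x (k + 2)) - z (x (k + 1))) * f (z (x (k + 1)))
        - ∫ t in x (k + 1)..x (k + 2), f (z t) * deriv z t)‖ ≤ ε * D := by
    refine (norm_sum_le_of_le _ fun k hk => hpiece k (Finset.mem_range.1 hk)).trans ?_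
    rw [← Finset.mul_sum]
    exact mul_le_of_le_one_right (by positivity) htel
  unfold contourIntegral
  rw [← h01, add_comm, ← sub_sub, hsum]
  calc _ ≤ ε * D + C * (2 / s) * D := (norm_sub_le _ _).trans (add_le_add hall hfirst)
    _ = _ := by ring

end IsJordanLoop

namespace IsJordanDomain

variable {M : Set ℂ} {z : ℝ → ℂ}

lemma notMem_trace (hM : IsJordanDomain M z) {u : ℂ} (hu : u ∈ interior M) : u ∉ trace z := by
  rw [← hM.frontier_eq]
  exact disjoint_left.1 disjoint_interior_frontier hu

lemma trace_subset (hM : IsJordanDomain M z) : trace z ⊆ M := by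
  rw [← hM.frontier_eq]
  exact hM.isCompact.isClosed.frontier_subset

/-- Cauchy's formula on a Jordan domain. -/
theorem contourIntegral_div_sub (hM : IsJordanDomain M z) {Ω : Set ℂ} (hΩ : IsOpen Ω) (hMΩ : M ⊆ Ω)
    {f : ℂ → ℂ} (hf : DifferentiableOn ℂ f Ω) {u : ℂ} (hu : u ∈ interior M) :
    contourIntegral z (fun ζ => f ζ / (ζ - u)) = 2 * Real.pi * Complex.I * f u := by
  have hMt : M ⊆ Metric.thickening 1 M := Metric.self_subset_thickening one_pos M
  have h := hM.loop.contourIntegral_div_sub (hΩ.inter (Metric.isOpen_thickening (δ := 1) (E := M)))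
    (hM.isCompact.isBounded.thickening.subset inter_subset_right)
    (hM.trace_subset.trans (subset_inter hMΩ hMt)) (fun w hw => ?_) (hf.mono inter_subset_left)
    (subset_inter hMΩ hMt (interior_subset hu)) (hM.notMem_trace hu)
  · rw [h, hM.winding u hu, mul_one]
  · refine hM.loop.windingNumber_eq_zero hM.isCompact.isClosed.isOpen_compl hM.no_holes.isPreconnected
      (disjoint_left.2 fun u hu hu' => hu (hM.trace_subset hu')) (fun hb => ?_)
      (fun hwM => hw (subset_inter hMΩ hMt hwM))
    have := hM.isCompact.isBounded.union hb
    rw [union_compl_self] at this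
    exact NormedSpace.unbounded_univ ℝ ℂ this

/-- The discretized Cauchy formula converges uniformly on compact families. -/
theorem eventually_norm_sum_sub_le (hM : IsJordanDomain M z) {α : Type*} [PseudoMetricSpace α]
    {A : Set α} (hA : IsCompact A) {K : Set ℂ} (hK : IsCompact K) (hKM : K ⊆ interior M) {Ω : Set ℂ}
    (hΩ : IsOpen Ω) (hMΩ : M ⊆ Ω) {g : α → ℂ → ℂ}
    (hg : ContinuousOn (fun p : α × ℂ => g p.1 p.2) (A ×ˢ trace z))
    (hgd : ∀ a ∈ A, DifferentiableOn ℂ (g a) Ω) {ε : ℝ} (hε : 0 < ε) :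
    ∀ᶠ s : ℕ in atTop, ∀ x, IsDiscretization s x → ∀ a ∈ A, ∀ u ∈ K,
      ‖(∑ p : Fin s, (z (x (p + 2)) - z (x (p + 1)))
        / (2 * Real.pi * Complex.I * (z (x (p + 1)) - u)) * g a (z (x (p + 1)))) - g a u‖ ≤ ε := by
  obtain ⟨D, hD0, hD⟩ := hM.loop.exists_deriv_bound_Icc
  set Φ : (α × ℂ) → ℂ → ℂ := fun p ζ => g p.1 ζ / (2 * Real.pi * Complex.I * (ζ - p.2)) with hΦ
  have hπ : (2 * Real.pi * Complex.I : ℂ) ≠ 0 := Complex.two_pi_I_ne_zero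
  have hc : ContinuousOn (fun p : (α × ℂ) × ℝ => Φ p.1 (z p.2)) ((A ×ˢ K) ×ˢ Icc (0 : ℝ) 1) := by
    have hzc : ContinuousOn (fun p : (α × ℂ) × ℝ => z p.2) ((A ×ˢ K) ×ˢ Icc (0 : ℝ) 1) :=
      hM.loop.continuousOn.comp continuousOn_snd fun p hp => hp.2
    refine ContinuousOn.div ?_ ?_ fun p hp => mul_ne_zero hπ ?_
    · exact hg.comp (f := fun p : (α × ℂ) × ℝ => (p.1.1, z p.2))
        ((continuous_fst.comp continuous_fst).continuousOn.prodMk hzc)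
        fun p hp => ⟨hp.1.1, IsJordanLoop.mem_trace hp.2⟩
    · exact continuousOn_const.mul (hzc.sub (continuous_snd.comp continuous_fst).continuousOn)
    · intro h0
      rw [sub_eq_zero] at h0
      exact hM.notMem_trace (hKM hp.1.2) (h0 ▸ IsJordanLoop.mem_trace hp.2)
  have hcomp : IsCompact ((A ×ˢ K) ×ˢ Icc (0 : ℝ) 1) := (hA.prod hK).prod isCompact_Icc
  obtain ⟨C, hC⟩ := hcomp.exists_bound_of_continuousOn hc
  have hC1 : 0 < max C 1 := by positivity
  -- Uniform continuity on the compact product makes the error independent of a, of u and of the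
  -- choice of nodes; u stays off the boundary curve because K lies in the interior.
  obtain ⟨d, hd, hdu⟩ := Metric.uniformContinuousOn_iff.1
    (hcomp.uniformContinuousOn_of_continuous hc) (ε / (2 * D)) (by positivity)
  have hs0 : ∀ᶠ s : ℕ in atTop, (2 : ℝ) / s < min d (ε / (2 * D * max C 1)) :=
    (tendsto_const_div_atTop_nhds_zero_nat 2).eventually_lt_const (by positivity)
  filter_upwards [hs0] with s hs x hx a ha u hu
  have hft : ∀ ζ ∈ trace z, ‖Φ (a, u) ζ‖ ≤ max C 1 := by
    rintro _ ⟨t, ht, rfl⟩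
    exact (hC ((a, u), t) ⟨⟨ha, hu⟩, ht⟩).trans (le_max_left _ _)
  have hfc : ContinuousOn (Φ (a, u)) (trace z) := by
    refine ContinuousOn.div ?_ (by fun_prop) fun ζ hζ => mul_ne_zero hπ fun h0 => ?_
    · exact hg.comp (f := fun ζ => (a, ζ)) (by fun_prop) fun ζ hζ => ⟨ha, hζ⟩
    · rw [sub_eq_zero] at h0
      exact hM.notMem_trace (hKM hu) ((show ζ = u from h0) ▸ hζ)
  have hmain := hM.loop.norm_sum_sub_contourIntegral_le hx hD hfc hft (ε := ε / (2 * D))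
    fun t ht t' ht' htt => by
      have := hdu ((a, u), t) ⟨⟨ha, hu⟩, ht⟩ ((a, u), t') ⟨⟨ha, hu⟩, ht'⟩ (by
        rw [Prod.dist_eq, dist_self, Real.dist_eq]
        exact max_lt hd (htt.trans_lt (hs.trans_le (min_le_left _ _))))
      rw [dist_eq_norm] at this
      exact this.le
  have hcau : contourIntegral z (Φ (a, u)) = g a u := by
    have h1 := hM.contourIntegral_div_sub hΩ hMΩ (hgd a ha) (hKM hu)
    have h2 : Φ (a, u) = fun ζ => (2 * Real.pi * Complex.I : ℂ)⁻¹ * (g a ζ / (ζ - u)) := by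
      ext ζ
      simp only [hΦ, div_eq_mul_inv, mul_inv]
      ring
    rw [h2, IsJordanLoop.contourIntegral_const_mul, h1, inv_mul_cancel_left₀ hπ]
  rw [hcau] at hmain
  have e : (∑ p : Fin s, (z (x (p + 2)) - z (x (p + 1)))
        / (2 * Real.pi * Complex.I * (z (x (p + 1)) - u)) * g a (z (x (p + 1))))
      = ∑ p : Fin s, (z (x (p + 2)) - z (x (p + 1))) * Φ (a, u) (z (x (p + 1))) :=
    Finset.sum_congr rfl fun p _ => by simp only [hΦ]; ring
  rw [e]
  refine hmain.trans ?_
  have h3 : (2 : ℝ) / s ≤ ε / (2 * D * max C 1) := hs.le.trans (min_le_right _ _)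
  calc (ε / (2 * D) + max C 1 * (2 / s)) * D
      ≤ (ε / (2 * D) + max C 1 * (ε / (2 * D * max C 1))) * D := by gcongr
    _ = ε := by field_simp; ring

/-- The interpolants are uniformly bounded and Lipschitz. -/
theorem exists_interpolant_bound (hM : IsJordanDomain M z) {K : Set ℂ} (hK : IsCompact K)
    (hKM : K ⊆ interior M) {h : ℂ → ℂ} (hh : ContinuousOn h M) :
    ∃ C > 0, ∀ s x, IsDiscretization s x → ∀ u ∈ K, ∀ ς : Fin s → ℂ,
      (‖ς‖ ≤ 1 → ‖interpolant z x h s ς u‖ ≤ C) ∧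
      ∀ ς' : Fin s → ℂ, ‖interpolant z x h s ς u - interpolant z x h s ς' u‖ ≤ C * ‖ς - ς'‖ := by
  obtain ⟨D, hD0, -, hDl⟩ := hM.loop.exists_deriv_bound
  obtain ⟨H, hH⟩ := hM.loop.isCompact_trace.exists_bound_of_continuousOn (hh.mono hM.trace_subset)
  have hπ : (2 * Real.pi * Complex.I : ℂ) ≠ 0 := Complex.two_pi_I_ne_zero
  obtain ⟨A, hA⟩ := (hM.loop.isCompact_trace.prod hK).exists_bound_of_continuousOn
    (f := fun p : ℂ × ℂ => 1 / (2 * Real.pi * Complex.I * (p.1 - p.2))) (by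
      refine ContinuousOn.div continuousOn_const (by fun_prop) fun p hp => mul_ne_zero hπ fun h0 => ?_
      rw [sub_eq_zero] at h0
      exact hM.notMem_trace (hKM hp.2) (h0 ▸ hp.1))
  -- The coefficients are at most a constant times x_{p+2} - x_{p+1}, and these lengths add up to at
  -- most 1, so the bound does not depend on s.
  have key : ∀ s x, IsDiscretization s x → ∀ u ∈ K, ∀ y : Fin s → ℂ, ∀ Y, (∀ p, ‖y p‖ ≤ Y) → 0 ≤ Y →
      ‖∑ p : Fin s, (z (x (p + 2)) - z (x (p + 1)))
        / (2 * Real.pi * Complex.I * (z (x (p + 1)) - u)) * y p‖ ≤ D * max A 1 * Y := by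
    intro s x hx u hu y Y hY hY0
    have hterm : ∀ p : Fin s, ‖(z (x (p + 2)) - z (x (p + 1)))
        / (2 * Real.pi * Complex.I * (z (x (p + 1)) - u)) * y p‖
        ≤ D * max A 1 * Y * (x (p + 2) - x (p + 1)) := by
      intro p
      have hp := p.2
      have h1 := hx.mem_Icc (j := (p : ℕ) + 1) (by omega)
      have h2 := hx.mem_Icc (j := (p : ℕ) + 2) (by omega)
      have h3 := hDl _ h1 _ h2
      rw [abs_of_nonneg (by linarith [hx.le_succ (j := (p : ℕ) + 1) (by omega)])] at h3
      have h4 := hA (z (x (p + 1)), u) ⟨IsJordanLoop.mem_trace h1, hu⟩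
      rw [div_eq_mul_one_div, norm_mul, norm_mul]
      calc _ ≤ D * (x (p + 2) - x (p + 1)) * max A 1 * Y := by
            gcongr
            · exact mul_nonneg ((norm_nonneg _).trans h3) (by positivity)
            · exact (norm_nonneg _).trans h3
            · exact h4.trans (le_max_left _ _)
            · exact hY p
        _ = _ := by ring
    refine (norm_sum_le_of_le _ fun p _ => hterm p).trans ?_
    rw [← Finset.mul_sum, Fin.sum_univ_eq_sum_range (fun p => x (p + 2) - x (p + 1)) s,
      Finset.sum_range_sub (fun k => x (k + 1)) s, hx.last]
    exact mul_le_of_le_one_right (by positivity) (by linarith [(hx.mem_Icc (j := 0 + 1) (by omega)).1])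
  have hH1 : 0 < max H 1 := by positivity
  refine ⟨D * max A 1 * (1 + max H 1), by positivity, fun s x hx u hu ς => ⟨fun hς => ?_, fun ς' => ?_⟩⟩
  · refine key s x hx u hu _ _ (fun p => ?_) (by positivity)
    have hp := p.2
    exact (norm_add_le _ _).trans (add_le_add ((norm_le_pi_norm ς p).trans hς)
      ((hH _ (IsJordanLoop.mem_trace (hx.mem_Icc (by omega)))).trans (le_max_left _ _)))
  · have e : interpolant z x h s ς u - interpolant z x h s ς' u
        = ∑ p : Fin s, (z (x (p + 2)) - z (x (p + 1)))
        / (2 * Real.pi * Complex.I * (z (x (p + 1)) - u)) * (ς - ς') p := by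
      unfold interpolant
      rw [← Finset.sum_sub_distrib]
      exact Finset.sum_congr rfl fun p _ => by rw [Pi.sub_apply]; ring
    rw [e]
    refine (key s x hx u hu _ _ (fun p => norm_le_pi_norm (ς - ς') p) (norm_nonneg _)).trans ?_
    have : 1 ≤ 1 + max H 1 := by linarith
    exact mul_le_mul_of_nonneg_right (le_mul_of_one_le_right (by positivity) this) (norm_nonneg _)

lemma analyticOnNhd_interpolant (hM : IsJordanDomain M z) {s : ℕ} {x : ℕ → ℝ}
    (hx : IsDiscretization s x) (h : ℂ → ℂ) :
    AnalyticOnNhd ℂ (fun p : (Fin s → ℂ) × ℂ => interpolant z x h s p.1 p.2)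
      (univ ×ˢ interior M) := by
  intro p hp
  unfold interpolant
  refine Finset.univ.analyticAt_fun_sum fun r _ => ?_
  have hr := r.2
  refine AnalyticAt.mul (analyticAt_const.div (analyticAt_const.mul (analyticAt_const.sub analyticAt_snd))
    (mul_ne_zero Complex.two_pi_I_ne_zero fun h0 => ?_)) (AnalyticAt.add ?_ analyticAt_const)
  · rw [sub_eq_zero] at h0
    exact hM.notMem_trace hp.2 (h0 ▸ IsJordanLoop.mem_trace (hx.mem_Icc (by omega)))
  · exact ((ContinuousLinearMap.proj (R := ℂ) (φ := fun _ : Fin s => ℂ) r).comp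
      (ContinuousLinearMap.fst ℂ (Fin s → ℂ) ℂ)).analyticAt p

end IsJordanDomain

/-! ### The nonlinear integral equation -/

/-- The function `h + ∑_{j ∈ J} (φ(·, μ_j) - φ(·, Λ_j))`. -/
noncomputable def trial (c q : ℝ) (h : ℂ → ℂ) (J : Finset ℕ) (m : ℕ → ℂ) (Λ : J → ℂ) (u : ℂ) : ℂ :=
  h u + ∑ j : J, (dressedPhase c q u (m j) - dressedPhase c q u (Λ j))

lemma add_gammaL_eq_trial (c q L : ℝ) (z : ℝ → ℂ) (h : ℂ → ℂ) (J : Finset ℕ) (ν : ℂ → ℂ) (u : ℂ) :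
    h u + gammaL c q z L J ν u = trial c q h J (betheRoot c q z L fun _ => 0)
      (fun j => betheRoot c q z L ν j) u := by
  unfold gammaL trial
  rw [← Finset.sum_coe_sort]

namespace RootData

variable {c q δ b : ℝ} {M K : Set ℂ} {z : ℝ → ℂ} (R : RootData c q δ b M K z)
variable {L : ℝ} {h : ℂ → ℂ} {H B γ₁ : ℝ} {N : ℕ} {J : Finset ℕ}

lemma norm_trial_sub_le (hL : R.L₀ ≤ L) (hN : (N : ℝ) / L ≤ density c q + R.η)
    (hJ : J ⊆ Finset.Icc 1 N) {m : ℕ → ℂ} {Λ Λ' : J → ℂ} (hΛ : ∀ j, Λ j ∈ strip δ)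
    (hΛ' : ∀ j, Λ' j ∈ strip δ) {u : ℂ} (hu : u ∈ strip δ) {a : ℝ} (ha0 : 0 ≤ a)
    (ha : ∀ j, ‖Λ j - Λ' j‖ ≤ 2 / (R.κ * L) * a) :
    ‖trial c q h J m Λ u - trial c q h J m Λ' u‖ ≤ R.CΓ * a := by
  have hLp := R.L_pos hL
  have hκ := R.κ_pos
  have hC := R.Cφ_pos
  have h2 := R.card_div_le hL hN hJ
  have e : trial c q h J m Λ u - trial c q h J m Λ' u
      = ∑ j : J, (dressedPhase c q u (Λ' j) - dressedPhase c q u (Λ j)) := by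
    unfold trial
    rw [add_sub_add_left_eq_sub, ← Finset.sum_sub_distrib]
    exact Finset.sum_congr rfl fun j _ => by ring
  have h1 : ∀ j : J, ‖dressedPhase c q u (Λ' j) - dressedPhase c q u (Λ j)‖
      ≤ R.Cφ * (2 / (R.κ * L) * a) := by
    intro j
    refine (R.norm_dressedPhase_sub_le hu (hΛ' j) (hΛ j)).trans ?_
    rw [norm_sub_rev]
    gcongr
    exact ha j
  rw [e]
  refine (norm_sum_le_of_le _ fun j _ => h1 j).trans ?_
  rw [Finset.sum_const, Finset.card_univ, Fintype.card_coe, nsmul_eq_mul]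
  calc (J.card : ℝ) * (R.Cφ * (2 / (R.κ * L) * a)) = J.card / L * (R.Cφ * (2 / R.κ) * a) := by
        field_simp
    _ ≤ (density c q + R.η) * (R.Cφ * (2 / R.κ) * a) := by gcongr
    _ = _ := by unfold CΓ; ring

lemma trial_root (c q : ℝ) (h : ℂ → ℂ) (J : Finset ℕ) (m : ℕ → ℂ) (u : ℂ) :
    trial c q h J m (fun j => m j) u = h u := by
  simp [trial]

lemma analyticAt_trial (R : RootData c q δ b M K z) {E : Type*} [NormedAddCommGroup E]
    [NormedSpace ℂ E] {m : ℕ → ℂ} (hm : ∀ j ∈ J, m j ∈ strip δ) {Λ : E → J → ℂ} {p : E × ℂ}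
    (hΛ : AnalyticAt ℂ Λ p.1) (hΛs : ∀ j, Λ p.1 j ∈ strip δ) (hh : AnalyticAt ℂ h p.2)
    (hp : p.2 ∈ strip δ) : AnalyticAt ℂ (fun p : E × ℂ => trial c q h J m (Λ p.1) p.2) p := by
  have hφ := R.analytic_dressedPhase
  refine (hh.fun_comp (f := Prod.snd) analyticAt_snd).add
    (Finset.univ.analyticAt_fun_sum fun j _ => ?_)
  refine AnalyticAt.sub ?_ ?_
  · exact AnalyticAt.fun_comp (g := fun u : ℂ × ℂ => dressedPhase c q u.1 u.2)
      (f := fun p : E × ℂ => (p.2, m j)) (hφ (p.2, m j) ⟨hp, hm j j.2⟩)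
      (analyticAt_snd.prod analyticAt_const)
  · refine AnalyticAt.fun_comp (g := fun u : ℂ × ℂ => dressedPhase c q u.1 u.2)
      (f := fun p : E × ℂ => (p.2, Λ p.1 j)) (hφ (p.2, Λ p.1 j) ⟨hp, hΛs j⟩)
      (analyticAt_snd.prod ?_)
    have h1 : AnalyticAt ℂ (fun e => Λ e j) p.1 := by
      have := (analyticAt_pi_iff (𝕜 := ℂ) (f := fun j e => Λ e j)).1 hΛ j
      exact this
    exact h1.fun_comp (f := Prod.fst) analyticAt_fst

/-- The perturbed roots stay in the strip. -/
lemma mem_strip_of_near (hL : R.L₀ ≤ L) {u v : ℂ} (hu : u ∈ R.nbhd)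
    (h : ‖v - u‖ ≤ 2 / (R.κ * L) * b) : v ∈ strip δ := by
  have hLp := R.L_pos hL
  have hκ := R.κ_pos
  have hr := R.r_pos
  have hb := R.b_pos
  have hL0 := R.L₀_pos
  refine R.thick_subset_strip (R.ball_subset_thick hu (mem_ball_iff_norm.2 (h.trans_lt ?_)))
  have h1 := R.L₀_lip
  rw [div_le_iff₀ (by positivity)] at h1
  have h2 : R.κ / 2 * (R.r * R.L₀) ≤ R.κ / 2 * (R.r * L) := by gcongr
  rw [div_mul_eq_mul_div, div_lt_iff₀ (by positivity)]
  nlinarith [mul_pos hκ (mul_pos hr hLp)]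

/-- The solution of `ρ = h + Γ[γρ]` for small `γ`. -/
theorem exists_solution (hL : R.L₀ ≤ L) (hN : (N : ℝ) / L ≤ density c q + R.η)
    (hJ : J ⊆ Finset.Icc 1 N) (hh : AnalyticOnNhd ℂ h M) (hH : ∀ u ∈ M, ‖h u‖ ≤ H) (hBb : B ≤ b)
    (hγB : γ₁ * (H + R.CΓ * b) ≤ B) (hγΓ : γ₁ * R.CΓ ≤ 1 / 2) :
    ∃ ρ : ℂ → ℂ → ℂ, AnalyticOnNhd ℂ (fun p : ℂ × ℂ => ρ p.1 p.2) (Metric.ball 0 γ₁ ×ˢ M) ∧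
      ∀ γ ∈ Metric.ball (0 : ℂ) γ₁, (∀ u ∈ M, ‖ρ γ u‖ ≤ H + R.CΓ * b) ∧
        Adm M K B (fun u => γ * ρ γ u) ∧
        ∀ w, ρ γ w = h w + gammaL c q z L J (fun u => γ * ρ γ u) w := by
  have hLp := R.L_pos hL
  have hκ := R.κ_pos
  have hb := R.b_pos
  have hCΓ := R.CΓ_pos
  set k := 2 / (R.κ * L) with hk
  have hk0 : 0 < k := by positivity
  set m : ℕ → ℂ := betheRoot c q z L fun _ => 0 with hm
  have hjD : ∀ j : J, ((j : ℕ) : ℝ) / L ≤ density c q + R.η := fun j => R.div_le_of_mem hL hN hJ j.2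
  have hmc : ∀ j : J, m j ∈ R.core := fun j => (R.betheRoot_spec hL R.adm_zero (hjD j)).1
  set m' : J → ℂ := fun j => m j with hm'
  -- The unknown is the finite vector of roots, from which ρ is recovered by `trial`. The radius k b
  -- is the largest displacement that a shift of size b can cause.
  set Q : Set (J → ℂ) := Metric.closedBall m' (k * b) with hQ
  have hQj : ∀ Λ ∈ Q, ∀ j, ‖Λ j - m j‖ ≤ k * b := fun Λ hΛ j =>
    (norm_le_pi_norm (Λ - m') j).trans (mem_closedBall_iff_norm.1 hΛ)
  have hms : ∀ j : J, m j ∈ strip δ := fun j => R.core_subset_strip (hmc j)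
  have hQs : ∀ Λ ∈ Q, ∀ j, Λ j ∈ strip δ := fun Λ hΛ j =>
    R.mem_strip_of_near hL (R.core_subset_nbhd (hmc j)) (hQj Λ hΛ j)
  have hMs := R.M_subset
  have hbd : ∀ Λ ∈ Q, ∀ u ∈ M, ‖trial c q h J m Λ u‖ ≤ H + R.CΓ * b := by
    intro Λ hΛ u hu
    have h1 := R.norm_trial_sub_le (h := h) (m := m) hL hN hJ (hQs Λ hΛ) hms (hMs hu) hb.le (hQj Λ hΛ)
    rw [trial_root] at h1
    calc _ = ‖h u + (trial c q h J m Λ u - h u)‖ := by rw [add_sub_cancel]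
      _ ≤ _ := (norm_add_le _ _).trans (add_le_add (hH u hu) h1)
  have hadm : ∀ γ ∈ Metric.ball (0 : ℂ) γ₁, ∀ Λ ∈ Q, Adm M K B fun u => γ * trial c q h J m Λ u := by
    intro γ hγ Λ hΛ
    have hγ' := (mem_ball_zero_iff.1 hγ).le
    refine ⟨fun u hu => analyticAt_const.mul ?_, fun u hu => ?_⟩
    · have h1 := R.analyticAt_trial (h := h) (J := J) (m := m) (Λ := fun _ : ℂ => Λ) (p := (0, u))
        (fun j hj => hms ⟨j, hj⟩) analyticAt_const (hQs Λ hΛ) (hh u (interior_subset hu))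
        (hMs (interior_subset hu))
      exact h1.fun_comp (f := fun u : ℂ => ((0 : ℂ), u)) (analyticAt_const.prod analyticAt_id)
    · rw [norm_mul]
      refine le_trans ?_ hγB
      gcongr
      · exact (norm_nonneg _).trans hγ'
      · exact hbd Λ hΛ u (interior_subset (R.K_subset hu))
  set T : ℂ → (J → ℂ) → J → ℂ := fun γ Λ j => betheRoot c q z L (fun u => γ * trial c q h J m Λ u) j
    with hT
  have hTm : ∀ γ ∈ Metric.ball (0 : ℂ) γ₁, MapsTo (T γ) Q Q := by
    intro γ hγ Λ hΛ
    rw [hQ, mem_closedBall_iff_norm, pi_norm_le_iff_of_nonneg (by positivity)]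
    intro j
    have hA := (hadm γ hγ Λ hΛ).mono hBb
    exact R.norm_betheRoot_sub_le hL hA R.adm_zero (hjD j) (fun u hu => by simpa using hA.bound u hu)
  have hTc : ∀ γ ∈ Metric.ball (0 : ℂ) γ₁, ∀ Λ ∈ Q, ∀ Λ' ∈ Q, ‖T γ Λ - T γ Λ'‖ ≤ 1 / 2 * ‖Λ - Λ'‖ := by
    intro γ hγ Λ hΛ Λ' hΛ'
    have hγ' := (mem_ball_zero_iff.1 hγ).le
    rw [pi_norm_le_iff_of_nonneg (by positivity)]
    intro j
    -- Points that differ by k a give trial functions that differ by CΓ a, hence shifts that differ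
    -- by at most a/2 after multiplication by γ, hence roots that differ by k a/2.
    set a := ‖Λ - Λ'‖ / k with ha
    have hka : k * a = ‖Λ - Λ'‖ := by rw [ha]; field_simp
    have h1 := R.norm_betheRoot_sub_le hL ((hadm γ hγ Λ hΛ).mono hBb) ((hadm γ hγ Λ' hΛ').mono hBb)
      (hjD j) (a := 1 / 2 * a) fun u hu => by
        have hu' := hMs (interior_subset (R.K_subset hu))
        have h2 := R.norm_trial_sub_le (h := h) (m := m) hL hN hJ (hQs Λ' hΛ') (hQs Λ hΛ) hu'
          (a := a) (by positivity) fun j => by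
            rw [← hk, hka, norm_sub_rev]; exact norm_le_pi_norm (Λ - Λ') j
        rw [← mul_sub, norm_mul]
        calc _ ≤ γ₁ * (R.CΓ * a) := by
              gcongr
              exact (norm_nonneg _).trans hγ'
          _ = γ₁ * R.CΓ * a := by ring
          _ ≤ _ := by gcongr
    refine h1.trans (le_of_eq ?_)
    rw [← hka]; ring
  have hTd : ∀ Λ : ℂ → J → ℂ, DifferentiableOn ℂ Λ (Metric.ball 0 γ₁) → MapsTo Λ (Metric.ball 0 γ₁) Q →
      DifferentiableOn ℂ (fun γ => T γ (Λ γ)) (Metric.ball 0 γ₁) := by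
    intro Λ hΛd hΛ
    refine AnalyticOnNhd.differentiableOn (analyticOnNhd_pi_iff.2 fun j => ?_)
    refine R.analyticOnNhd_betheRoot hL (hjD j) Metric.isOpen_ball
      (Nu := fun γ u => γ * trial c q h J m (Λ γ) u) (fun p hp => analyticAt_fst.mul ?_)
      fun γ hγ => (hadm γ hγ _ (hΛ hγ)).mono hBb
    exact R.analyticAt_trial (fun j hj => hms ⟨j, hj⟩)
      (hΛd.analyticAt (Metric.isOpen_ball.mem_nhds hp.1)) (hQs _ (hΛ hp.1))
      (hh _ (interior_subset hp.2)) (hMs (interior_subset hp.2))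
  obtain ⟨Λ, hΛd, hΛQ, hΛT⟩ := exists_differentiableOn_fixedPoint Metric.isOpen_ball
    Metric.isClosed_closedBall Metric.isBounded_closedBall
    (w₀ := m') (Metric.mem_closedBall_self (by positivity)) hTm hTc hTd
  have hρ : ∀ γ ∈ Metric.ball (0 : ℂ) γ₁, ∀ w, trial c q h J m (Λ γ) w
      = h w + gammaL c q z L J (fun u => γ * trial c q h J m (Λ γ) u) w := by
    intro γ hγ w
    rw [add_gammaL_eq_trial]
    congr 1
    exact (hΛT γ hγ).symm
  refine ⟨fun γ u => trial c q h J m (Λ γ) u, fun p hp => ?_, fun γ hγ => ⟨hbd _ (hΛQ hγ),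
    hadm γ hγ _ (hΛQ hγ), hρ γ hγ⟩⟩
  exact R.analyticAt_trial (fun j hj => hms ⟨j, hj⟩)
    (hΛd.analyticAt (Metric.isOpen_ball.mem_nhds hp.1)) (hQs _ (hΛQ hp.1)) (hh _ hp.2) (hMs hp.2)

/-- Uniqueness of the solution. -/
theorem solution_unique (hL : R.L₀ ≤ L) (hN : (N : ℝ) / L ≤ density c q + R.η)
    (hJ : J ⊆ Finset.Icc 1 N) {γ : ℂ} (hγ : ‖γ‖ * R.CΓ ≤ 1 / 2) {ρ g : ℂ → ℂ}
    (hρ : Adm M K b fun u => γ * ρ u) (hg : Adm M K b fun u => γ * g u)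
    (hρe : ∀ w ∈ M, ρ w = h w + gammaL c q z L J (fun u => γ * ρ u) w)
    (hge : ∀ w ∈ M, g w = h w + gammaL c q z L J (fun u => γ * g u) w) : EqOn g ρ M := by
  set a := supNorm K fun u => γ * g u - γ * ρ u with ha
  have hc : ContinuousOn (fun u => γ * g u - γ * ρ u) K :=
    (hg.analytic.continuousOn.sub hρ.analytic.continuousOn).mono R.K_subset
  have ha0 : 0 ≤ a := supNorm_nonneg _ _
  have h1 : ∀ w ∈ M, ‖g w - ρ w‖ ≤ R.CΓ * a := by
    intro w hw
    rw [hge w hw, hρe w hw, add_sub_add_left_eq_sub]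
    exact R.norm_gammaL_sub_le hL hN hJ hg hρ (fun u hu => norm_le_supNorm R.isCompact_K hc hu)
      (R.M_subset hw)
  have h2 : a ≤ 1 / 2 * a := supNorm_le (by positivity) fun u hu => by
    rw [← mul_sub, norm_mul]
    calc _ ≤ ‖γ‖ * (R.CΓ * a) := by gcongr; exact h1 u (interior_subset (R.K_subset hu))
      _ = ‖γ‖ * R.CΓ * a := by ring
      _ ≤ _ := by gcongr
  have h3 : a = 0 := by linarith
  intro w hw
  have := h1 w hw
  rw [h3, mul_zero] at this
  exact sub_eq_zero.1 (norm_le_zero_iff.1 this)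

end RootData

/-! ### The thermodynamic limit -/

namespace RootData

variable {c q δ b : ℝ} {M K : Set ℂ} {z : ℝ → ℂ} (R : RootData c q δ b M K z)
variable {L : ℝ} {N : ℕ} {J : Finset ℕ}

/-- A function which solves the resolvent equation up to a small error is small. -/
lemma norm_le_of_resolvent_bound (R : RootData c q δ b M K z) {CR : ℝ}
    (hCR : ∀ w ∈ strip δ, ∀ v ∈ strip δ, ‖resolventKernel c q w v‖ ≤ CR) {γ : ℂ}
    (hγ : ‖γ‖ * (CR * q) ≤ 1 / 2) {E : ℂ → ℂ} (hE : ContinuousOn E (strip δ)) {A : ℝ}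
    (hA : ∀ w ∈ strip δ,
      ‖E w + γ * ∫ t in (-q)..q, resolventKernel c q w t / (2 * Real.pi) * E t‖ ≤ A) :
    ∀ w ∈ strip δ, ‖E w‖ ≤ 2 * A := by
  have hq := R.q_pos
  have hsub := fermiZone_subset_strip R.δ_pos q
  set e := supNorm (fermiZone q) E with he
  have hmem : ∀ t ∈ Icc (-q) q, (t : ℂ) ∈ fermiZone q := fun t ht => mem_image_of_mem _ ht
  have he0 : 0 ≤ e := supNorm_nonneg _ _
  have hCR0 : 0 ≤ CR := by
    have h0 : (0 : ℂ) ∈ strip δ := by simpa using ofReal_mem_strip R.δ_pos 0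
    exact (norm_nonneg _).trans (hCR 0 h0 0 h0)
  have hint : ∀ w ∈ strip δ,
      ‖γ * ∫ t in (-q)..q, resolventKernel c q w t / (2 * Real.pi) * E t‖ ≤ 1 / 2 * e := by
    intro w hw
    have h1 := intervalIntegral.norm_integral_le_of_norm_le_const (a := -q) (b := q)
      (f := fun t : ℝ => resolventKernel c q w t / (2 * Real.pi) * E t) (C := CR / 2 * e)
      fun t ht => by
        rw [uIoc_of_le (by linarith)] at ht
        have ht' := hmem t (Ioc_subset_Icc_self ht)
        rw [norm_mul, norm_div]
        have h2 : ‖(2 * Real.pi : ℂ)‖ = 2 * Real.pi := by simp [abs_of_pos Real.pi_pos]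
        have h3 : (2 : ℝ) ≤ 2 * Real.pi := by linarith [Real.two_le_pi]
        rw [h2]
        gcongr
        · exact hCR w hw t (hsub ht')
        · exact norm_le_supNorm (isCompact_fermiZone q) (hE.mono hsub) ht'
    rw [abs_of_nonneg (by linarith)] at h1
    rw [norm_mul]
    calc _ ≤ ‖γ‖ * (CR / 2 * e * (q - -q)) := by gcongr
      _ = ‖γ‖ * (CR * q) * e := by ring
      _ ≤ _ := by gcongr
  have hle : ∀ w ∈ strip δ, ‖E w‖ ≤ A + 1 / 2 * e := by
    intro w hw
    have := norm_sub_le (E w + γ * ∫ t in (-q)..q, resolventKernel c q w t / (2 * Real.pi) * E t)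
      (γ * ∫ t in (-q)..q, resolventKernel c q w t / (2 * Real.pi) * E t)
    rw [add_sub_cancel_right] at this
    linarith [hA w hw, hint w hw]
  have hA0 : 0 ≤ A := (norm_nonneg _).trans
    (hA (0 : ℝ) (ofReal_mem_strip R.δ_pos 0))
  have h4 : e ≤ A + 1 / 2 * e := supNorm_le (by positivity) fun u hu => hle u (hsub hu)
  intro w hw
  linarith [hle w hw]

/-- The deviation of the solution from its thermodynamic limit. -/
theorem norm_error_le (R : RootData c q δ b M K z) {CR : ℝ}
    (hCR : ∀ w ∈ strip δ, ∀ v ∈ strip δ, ‖resolventKernel c q w v‖ ≤ CR) {γ : ℂ}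
    (hγ : ‖γ‖ * (CR * q) ≤ 1 / 2) {ρL ρ G : ℂ → ℂ} (hρL : ContinuousOn ρL M)
    (hρ : ContinuousOn ρ M) {A : ℝ}
    (hG : ∀ w ∈ strip δ, ‖G w
      + ∫ t in (-q)..q, resolventKernel c q w t / (2 * Real.pi) * (γ * ρL t)‖ ≤ A)
    {E : ℂ → ℂ} (hE : ContinuousOn E (strip δ)) (hEe : ∀ w ∈ strip δ,
      E w = G w + γ * ∫ t in (-q)..q, resolventKernel c q w t / (2 * Real.pi) * ρ t)
    (hEM : ∀ w ∈ M, ρL w = ρ w + E w) : ∀ w ∈ strip δ, ‖E w‖ ≤ 2 * A := by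
  have hle : -q ≤ q := by linarith [R.q_pos]
  have hsub := fermiZone_subset_strip R.δ_pos q
  have hqM : fermiZone q ⊆ M := R.fermi_subset_K.trans (R.K_subset.trans interior_subset)
  have hmem : ∀ t ∈ Icc (-q) q, (t : ℂ) ∈ fermiZone q := fun t ht => mem_image_of_mem _ ht
  -- On the segment ρ^(L) = ρ + E, so E plus γR/2π applied to E equals G plus R/2π applied to
  -- γρ^(L), the quantity bounded by A.
  refine R.norm_le_of_resolvent_bound hCR hγ hE fun w hw => ?_
  refine le_of_eq_of_le ?_ (hG w hw)
  congr 1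
  have hint : ∀ f : ℂ → ℂ, ContinuousOn f (fermiZone q) → IntervalIntegrable
      (fun t : ℝ => resolventKernel c q w t / (2 * Real.pi) * f t) volume (-q) q := by
    intro f hf
    refine ContinuousOn.intervalIntegrable ?_
    rw [uIcc_of_le hle]
    have h1 : ContinuousOn (fun v => resolventKernel c q w v / (2 * Real.pi) * f v) (fermiZone q) :=
      (((continuousOn_right (analyticOnNhd_resolventKernel R.c_pos R.q_pos R.δ_pos R.δ_lt) hw).mono
        hsub).div_const _).mul hf
    exact h1.comp Complex.continuous_ofReal.continuousOn hmem
  have h2 : ∫ t in (-q)..q, resolventKernel c q w t / (2 * Real.pi) * E t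
      = (∫ t in (-q)..q, resolventKernel c q w t / (2 * Real.pi) * ρL t)
        - ∫ t in (-q)..q, resolventKernel c q w t / (2 * Real.pi) * ρ t := by
    rw [← intervalIntegral.integral_sub (hint _ (hρL.mono hqM)) (hint _ (hρ.mono hqM))]
    refine intervalIntegral.integral_congr fun t ht => ?_
    rw [uIcc_of_le hle] at ht
    have := hEM t (hqM (hmem t ht))
    rw [← mul_sub, this, add_sub_cancel_left]
  have h3 : ∫ t in (-q)..q, resolventKernel c q w t / (2 * Real.pi) * (γ * ρL t)
      = γ * ∫ t in (-q)..q, resolventKernel c q w t / (2 * Real.pi) * ρL t := by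
    rw [← intervalIntegral.integral_const_mul]
    exact intervalIntegral.integral_congr fun t _ => by ring
  rw [hEe w hw, h2, h3]
  ring

/-- Uniform bounds for the densities of roots on the loop. -/
theorem exists_psi_bound (n : ℕ) : ∃ P ≥ 1, ∃ C > 0,
    (∀ ζ ∈ trace z, ‖psiLim c q ζ‖ ≤ P) ∧ ∀ L ≥ R.L₀, ∀ N : ℕ, |N / L - density c q| ≤ R.η →
    ∀ I ⊆ Finset.Icc 1 N, I.card ≤ n → ∀ ν, Adm M K b ν → ∀ ζ ∈ trace z,
      ‖psiL c q L (Finset.Icc 1 N \ I) ν ζ‖ ≤ P ∧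
      ‖psiL c q L (Finset.Icc 1 N \ I) ν ζ - psiLim c q ζ‖
        ≤ C * (1 / L + |N / L - density c q|) := by
  obtain ⟨C, hC, h⟩ := R.exists_psiL_bound n
  obtain ⟨P, hP⟩ := R.loop.isCompact_trace.exists_bound_of_continuousOn R.continuousOn_psiLim
  have hL0 := R.L₀_pos
  have hη := R.η_pos
  have hadd : 0 ≤ C * (1 / R.L₀ + R.η) := by positivity
  refine ⟨max P 1 + C * (1 / R.L₀ + R.η), by linarith [le_max_right P 1], C, hC,
    fun ζ hζ => by linarith [hP ζ hζ, le_max_left P 1], fun L hL N hN I hI hIn ν hν ζ hζ => ?_⟩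
  have h1 := h L hL N hN I hI hIn ν hν ζ hζ
  refine ⟨?_, h1⟩
  have h2 : C * (1 / L + |N / L - density c q|) ≤ C * (1 / R.L₀ + R.η) := by gcongr
  have h3 := norm_add_le (psiL c q L (Finset.Icc 1 N \ I) ν ζ - psiLim c q ζ) (psiLim c q ζ)
  rw [sub_add_cancel] at h3
  linarith [hP ζ hζ, le_max_left P 1]

/-- Fredholm determinants with a small kernel are close to one. -/
lemma norm_fredholmDet_phaseKernel_sub_one_le {D : ℝ} (hD : ∀ t ∈ Icc (0 : ℝ) 1, ‖deriv z t‖ ≤ D)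
    {ψ : ℂ → ℂ} (hψ : ContinuousOn ψ (trace z)) {P : ℝ} (hP0 : 0 ≤ P)
    (hP : ∀ ζ ∈ trace z, ‖ψ ζ‖ ≤ P) {γ : ℂ} (hγ : ‖γ‖ * R.Cφ * P * D ≤ 1 / 4) :
    ‖fredholmDet z 0 1 (phaseKernel c q γ ψ) - 1‖ ≤ 1 / 2 := by
  have h := R.norm_fredholmDet_phaseKernel_sub_le hD hψ (ψ' := fun _ => 0) continuousOn_const
    zero_le_one hP (by simpa using fun _ _ => hP0) (by simpa using hP) hγ
  have e : phaseKernel c q γ (fun _ => 0) = fun _ _ => 0 := by ext; simp [phaseKernel]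
  rwa [e, fredholmDet_zero] at h

lemma half_le_norm {x : ℂ} (h : ‖x - 1‖ ≤ 1 / 2) : 1 / 2 ≤ ‖x‖ := by
  have := norm_sub_norm_le (1 : ℂ) x
  rw [norm_one, norm_sub_rev] at this
  linarith

/-- The relative error of the Fredholm determinant. -/
theorem exists_fredholmDet_error {D : ℝ} (hD : ∀ t ∈ Icc (0 : ℝ) 1, ‖deriv z t‖ ≤ D)
    {ψ : ℂ → ℂ} (hψ : ContinuousOn ψ (trace z)) {P A : ℝ} (hP1 : 1 ≤ P)
    (hP : ∀ ζ ∈ trace z, ‖ψ ζ‖ ≤ P) (hP' : ∀ ζ ∈ trace z, ‖psiLim c q ζ‖ ≤ P)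
    (hA0 : 0 ≤ A) (hA : ∀ ζ ∈ trace z, ‖ψ ζ - psiLim c q ζ‖ ≤ A) {γ : ℂ}
    (hγ : ‖γ‖ * R.Cφ * P * D ≤ 1 / 4) :
    fredholmDet z 0 1 (phaseKernel c q γ ψ) ≠ 0 ∧ ∃ e : ℂ, ‖e‖ ≤ A ∧
      fredholmDet z 0 1 (phaseKernel c q γ ψ)
        = fredholmDet (fun t => (t : ℂ)) (-q) q
            (fun w v => γ * resolventKernel c q w v / (2 * Real.pi)) * (1 + e) := by
  have hP0 : 0 ≤ P := zero_le_one.trans hP1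
  have h1 := half_le_norm (R.norm_fredholmDet_phaseKernel_sub_one_le hD hψ hP0 hP hγ)
  have h2 := half_le_norm (R.norm_fredholmDet_phaseKernel_sub_one_le hD R.continuousOn_psiLim hP0 hP' hγ)
  have h3 := R.norm_fredholmDet_phaseKernel_sub_le hD hψ R.continuousOn_psiLim (d := A) hA0 hP hP'
    (fun ζ hζ => (hA ζ hζ).trans (le_mul_of_one_le_right hA0 hP1)) hγ
  rw [R.fredholmDet_psiLim] at h2 h3
  set d := fredholmDet z 0 1 (phaseKernel c q γ ψ)
  set d' := fredholmDet (fun t => (t : ℂ)) (-q) q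
    (fun w v => γ * resolventKernel c q w v / (2 * Real.pi))
  have hd : d ≠ 0 := norm_pos_iff.1 (by linarith)
  have hd' : d' ≠ 0 := norm_pos_iff.1 (by linarith)
  refine ⟨hd, (d - d') / d', ?_, by field_simp; ring⟩
  rw [norm_div, div_le_iff₀ (by linarith)]
  nlinarith

/-- The density of roots depends continuously on the shift. -/
lemma norm_psiL_sub_le (hL : R.L₀ ≤ L) (hN : (N : ℝ) / L ≤ density c q + R.η)
    (hJ : J ⊆ Finset.Icc 1 N) {ν ν' : ℂ → ℂ} (hν : Adm M K b ν) (hν' : Adm M K b ν') {a : ℝ}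
    (ha : ∀ u ∈ K, ‖ν u - ν' u‖ ≤ a) {ζ : ℂ} (hζ : ζ ∈ trace z) :
    ‖psiL c q L J ν ζ - psiL c q L J ν' ζ‖
      ≤ ‖1 / (2 * Real.pi * Complex.I * L : ℂ)‖ * (J.card * (1 / L / (R.κ / 2 * R.d₁) ^ 2)) * a := by
  have hLp := R.L_pos hL
  have hκ := R.κ_pos
  have hd := R.d₁_pos
  have key : ∀ j ∈ J, ‖1 / (shifted c q L ν ζ - j / L) - 1 / (shifted c q L ν' ζ - j / L)‖
      ≤ 1 / L / (R.κ / 2 * R.d₁) ^ 2 * a := by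
    intro j hj
    obtain ⟨h1, h2⟩ := R.betheRoot_spec hL hν (R.div_le_of_mem hL hN hJ hj)
    obtain ⟨h3, h4⟩ := R.betheRoot_spec hL hν' (R.div_le_of_mem hL hN hJ hj)
    refine (norm_inv_sub_inv_le (by positivity) (R.shifted_sub_lower hL hν h1 h2 hζ)
      (R.shifted_sub_lower hL hν' h3 h4 hζ) (d := 1 / L * a) ?_).trans (le_of_eq (by ring))
    have e : shifted c q L ν ζ - (j : ℂ) / L - (shifted c q L ν' ζ - (j : ℂ) / L)
        = (ν ζ - ν' ζ) / L := by unfold shifted; ring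
    rw [e, norm_div, Complex.norm_real, Real.norm_of_nonneg hLp.le, one_div_mul_eq_div]
    gcongr
    exact R.bound_sub hν.analytic hν'.analytic ha (R.trace_subset_nbhd hζ)
  unfold psiL
  rw [← mul_sub, norm_mul, ← Finset.sum_sub_distrib, mul_assoc ‖_‖]
  refine mul_le_mul_of_nonneg_left ((norm_sum_le_of_le _ key).trans (le_of_eq ?_)) (norm_nonneg _)
  rw [Finset.sum_const, nsmul_eq_mul]
  ring

end RootData

/-! ### The Lagrange series of `Γ` -/

/-- A uniform bound for the interpolants on `K`. -/
def IsInterpolantBound (K : Set ℂ) (z : ℝ → ℂ) (h : ℂ → ℂ) (C : ℝ) : Prop :=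
  ∀ s x, IsDiscretization s x → ∀ u ∈ K, ∀ ς : Fin s → ℂ,
    (‖ς‖ ≤ 1 → ‖interpolant z x h s ς u‖ ≤ C) ∧
    ∀ ς' : Fin s → ℂ, ‖interpolant z x h s ς u - interpolant z x h s ς' u‖ ≤ C * ‖ς - ς'‖

/-- The coordinates of the map `ς ↦ Γ[γ f_s(ς)](t_r)`. -/
noncomputable def lagrangeMap (c q L : ℝ) (z : ℝ → ℂ) (J : Finset ℕ) (w : ℝ → ℂ) (x : ℕ → ℝ)
    (h : ℂ → ℂ) (γ : ℂ) (s : ℕ) (r : Fin s) (ς : Fin s → ℂ) : ℂ :=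
  gammaL c q z L J (fun u => γ * interpolant w x h s ς u) (w (x (r + 1)))

/-- The determinant is uniformly continuous on bounded sets of matrices. -/
lemma exists_norm_det_sub_le (ι : Type*) [Fintype ι] [DecidableEq ι] (X : ℝ) {ε : ℝ} (hε : 0 < ε) :
    ∃ d > 0, ∀ A B : Matrix ι ι ℂ, (∀ i j, ‖A i j‖ ≤ X) → (∀ i j, ‖B i j‖ ≤ X) →
      (∀ i j, ‖A i j - B i j‖ ≤ d) → ‖A.det - B.det‖ ≤ ε := by
  have hc : IsCompact (Set.pi univ fun _ : ι => Set.pi univ fun _ : ι => Metric.closedBall (0 : ℂ) X) :=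
    isCompact_univ_pi fun _ => isCompact_univ_pi fun _ => isCompact_closedBall 0 X
  have hcont : Continuous fun A : ι → ι → ℂ => (Matrix.of A).det :=
    Continuous.matrix_det (continuous_id)
  obtain ⟨d, hd, h⟩ := Metric.uniformContinuousOn_iff.1
    (hc.uniformContinuousOn_of_continuous hcont.continuousOn) ε hε
  refine ⟨d / 2, by positivity, fun A B hA hB hAB => ?_⟩
  have := h (Matrix.of.symm A) (fun i _ j _ => by simpa using hA i j) (Matrix.of.symm B) (fun i _ j _ => by simpa using hB i j) (by
    rw [dist_pi_lt_iff hd]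
    intro i
    rw [dist_pi_lt_iff hd]
    intro j
    rw [dist_eq_norm]
    exact (hAB i j).trans_lt (by linarith))
  rw [dist_eq_norm] at this
  exact this.le

namespace RootData

variable {c q δ b : ℝ} {M K : Set ℂ} {z : ℝ → ℂ} (R : RootData c q δ b M K z)
variable {L : ℝ} {N : ℕ} {J : Finset ℕ} {w : ℝ → ℂ} {h : ℂ → ℂ} {Cf : ℝ} {s : ℕ} {x : ℕ → ℝ} {γ : ℂ}

lemma adm_interpolant (hM : IsJordanDomain M w) (hCf : IsInterpolantBound K w h Cf)
    (hx : IsDiscretization s x) {ς : Fin s → ℂ} (hς : ς ∈ Metric.ball (0 : Fin s → ℂ) 1) :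
    Adm M K (‖γ‖ * Cf) fun u => γ * interpolant w x h s ς u := by
  refine ⟨fun u hu => analyticAt_const.mul ?_, fun u hu => ?_⟩
  · exact AnalyticAt.fun_comp (g := fun p : (Fin s → ℂ) × ℂ => interpolant w x h s p.1 p.2)
      (f := fun u : ℂ => (ς, u)) (hM.analyticOnNhd_interpolant hx h (ς, u) ⟨mem_univ _, hu⟩)
      (analyticAt_const.prod analyticAt_id)
  · rw [norm_mul]
    gcongr
    exact (hCf s x hx u hu ς).1 (mem_ball_zero_iff.1 hς).le

lemma bd_mem_strip (R : RootData c q δ b M K z) (hM : IsJordanDomain M w) (hx : IsDiscretization s x)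
    (r : Fin s) : w (x (r + 1)) ∈ strip δ :=
  R.M_subset (hM.trace_subset (IsJordanLoop.mem_trace (hx.mem_Icc (by have := r.2; omega))))

/-- Γ[0] = 0 and Γ is CΓ-Lipschitz, while the interpolants are bounded and Lipschitz in ς with a
constant independent of s. So one smallness condition on γ serves all orders s. -/
lemma isLagrangeMap (hL : R.L₀ ≤ L) (hN : (N : ℝ) / L ≤ density c q + R.η)
    (hJ : J ⊆ Finset.Icc 1 N) (hM : IsJordanDomain M w) (hCf : IsInterpolantBound K w h Cf)
    (hx : IsDiscretization s x) (hγb : ‖γ‖ * Cf ≤ b) (hγΓ : R.CΓ * (‖γ‖ * Cf) ≤ 1 / 8) :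
    IsLagrangeMap (lagrangeMap c q L z J w x h γ s) := by
  have hadm := fun ς (hς : ς ∈ Metric.ball (0 : Fin s → ℂ) 1) =>
    adm_interpolant (γ := γ) hM hCf hx hς
  have hC := R.CΓ_pos
  refine ⟨fun r => ?_, fun r ς hς => ?_, fun r ς hς ς' hς' => ?_⟩
  · have h1 := R.analyticOnNhd_gammaL hL hN hJ (E := Fin s → ℂ) (U := Metric.ball 0 1)
      (Nu := fun ς u => γ * interpolant w x h s ς u) Metric.isOpen_ball
      (analyticOnNhd_const.mul ((hM.analyticOnNhd_interpolant hx h).mono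
        (prod_mono (subset_univ _) Subset.rfl))) fun ς hς => (hadm ς hς).mono hγb
    intro ς hς
    exact (h1 (ς, w (x (r + 1))) ⟨hς, R.bd_mem_strip hM hx r⟩).fun_comp
      (f := fun ς : Fin s → ℂ => (ς, w (x (r + 1)))) (analyticAt_id.prod analyticAt_const)
  · exact (R.norm_gammaL_le hL hN hJ (hadm ς hς) hγb (R.bd_mem_strip hM hx r)).trans hγΓ
  · refine (R.norm_gammaL_sub_le hL hN hJ ((hadm ς hς).mono hγb) ((hadm ς' hς').mono hγb)
      (a := ‖γ‖ * (Cf * ‖ς - ς'‖)) (fun u hu => ?_) (R.bd_mem_strip hM hx r)).trans ?_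
    · rw [← mul_sub, norm_mul]
      gcongr
      exact (hCf s x hx u hu ς).2 ς'
    · calc _ = R.CΓ * (‖γ‖ * Cf) * ‖ς - ς'‖ := by ring
        _ ≤ _ := by
          gcongr
          linarith

/-- The partial derivatives of the Lagrange map. -/
lemma partialDeriv_lagrangeMap (hL : R.L₀ ≤ L) (hN : (N : ℝ) / L ≤ density c q + R.η)
    (hJ : J ⊆ Finset.Icc 1 N) (hM : IsJordanDomain M w) (hCf : IsInterpolantBound K w h Cf)
    (hCf0 : 0 < Cf)
    (hx : IsDiscretization s x) (hγb : ‖γ‖ * Cf ≤ b) {v : Fin s → ℂ}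
    (hv : v ∈ Metric.ball (0 : Fin s → ℂ) 1) (r p : Fin s) {lam : ℕ → ℂ}
    (hlam : lam = betheRoot c q z L fun u => γ * interpolant w x h s v u) :
    partialDeriv p (lagrangeMap c q L z J w x h γ s r) v
      = ∑ j : J, γ * deriv (dressedPhase c q (w (x (r + 1)))) (lam j)
        * (1 / (L * deriv (shifted c q L fun u => γ * interpolant w x h s v u) (lam j)))
        * ((w (x (p + 2)) - w (x (p + 1))) / (2 * Real.pi * Complex.I * (w (x (p + 1)) - lam j))) := by
  obtain ⟨C, hC, hexp⟩ := R.exists_gammaL_expansion hL hN hJ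
  have hLp := R.L_pos hL
  have hκ := R.κ_pos
  have hr := R.r_pos
  have hadm := fun ς (hς : ς ∈ Metric.ball (0 : Fin s → ℂ) 1) =>
    (adm_interpolant (γ := γ) hM hCf hx hς).mono hγb
  set a : ℂ → ℂ := fun u => (w (x (p + 2)) - w (x (p + 1)))
    / (2 * Real.pi * Complex.I * (w (x (p + 1)) - u)) with ha
  have hup : Continuous fun y : ℂ => Function.update v p y := continuous_const.update p continuous_id
  -- The interpolant is affine in ς, so moving one coordinate changes the shift by an exact multiple
  -- of a fixed function, and the expansion of Γ gives the derivative.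
  have hdiff : ∀ y u, γ * interpolant w x h s (Function.update v p y) u - γ * interpolant w x h s v u
      = γ * (a u * (y - v p)) := by
    intro y u
    unfold interpolant
    rw [← mul_sub, ← Finset.sum_sub_distrib, Finset.sum_eq_single p]
    · rw [Function.update_self]; simp only [ha]; ring
    · intro i _ hi
      rw [Function.update_of_ne hi, sub_self]
    · exact fun hp => absurd (Finset.mem_univ p) hp
  have hupn : ∀ y, ‖Function.update v p y - v‖ ≤ ‖y - v p‖ := by
    intro y
    rw [pi_norm_le_iff_of_nonneg (norm_nonneg _)]
    intro i
    by_cases hi : i = p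
    · subst hi; simp
    · simp [Function.update_of_ne hi]
  have hderiv : HasDerivAt (fun y => lagrangeMap c q L z J w x h γ s r (Function.update v p y))
      (∑ j ∈ J, deriv (dressedPhase c q (w (x (r + 1)))) (lam j) * (γ * a (lam j))
        / (L * deriv (shifted c q L fun u => γ * interpolant w x h s v u) (lam j))) (v p) := by
    rw [← hasDerivWithinAt_univ]
    refine hasDerivWithinAt_of_sq_bound (C := C * (‖γ‖ * Cf) ^ 2) ?_
    rw [nhdsWithin_univ]
    have h1 : ∀ᶠ y in 𝓝 (v p), Function.update v p y ∈ Metric.ball (0 : Fin s → ℂ) 1 := by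
      refine hup.continuousAt.eventually_mem ?_
      rw [Function.update_eq_self]
      exact Metric.isOpen_ball.mem_nhds hv
    have h2 : ∀ᶠ y in 𝓝 (v p), 2 / (R.κ * L) * (‖γ‖ * Cf * ‖y - v p‖) < R.r / 2 := by
      have : ContinuousAt (fun y => 2 / (R.κ * L) * (‖γ‖ * Cf * ‖y - v p‖)) (v p) := by fun_prop
      refine this.eventually_lt_const ?_
      simpa using hr
    filter_upwards [h1, h2] with y hy1 hy2
    have h3 := hexp _ _ (hadm _ hy1) (hadm v hv) (‖γ‖ * Cf * ‖y - v p‖) (fun u hu => by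
      rw [← mul_sub, norm_mul, mul_assoc]
      gcongr
      exact ((hCf s x hx u hu _).2 v).trans (by gcongr; exact hupn y)) hy2 _ (R.bd_mem_strip hM hx r)
    rw [Function.update_eq_self, smul_eq_mul, Finset.mul_sum]
    refine le_of_eq_of_le ?_ (h3.trans (le_of_eq (by ring)))
    unfold lagrangeMap
    congr 2
    refine Finset.sum_congr rfl fun j _ => ?_
    rw [hdiff, hlam]
    ring
  rw [partialDeriv, hderiv.deriv, ← Finset.sum_coe_sort]
  refine Finset.sum_congr rfl fun j _ => ?_
  simp only [ha]
  ring

/-- The Jacobian determinants converge to the Fredholm determinants. -/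
theorem eventually_norm_jacobian_sub_le (hL : R.L₀ ≤ L) (hN : (N : ℝ) / L ≤ density c q + R.η)
    (hJ : J ⊆ Finset.Icc 1 N) (hM : IsJordanDomain M w) (hCf : IsInterpolantBound K w h Cf)
    (hCf0 : 0 < Cf) {γ₀ ε : ℝ} (hε : 0 < ε) (hγb : γ₀ * Cf ≤ b) :
    ∀ᶠ s : ℕ in atTop, ∀ x, IsDiscretization s x → ∀ γ ∈ Metric.closedBall (0 : ℂ) γ₀,
      ∀ v ∈ Metric.ball (0 : Fin s → ℂ) 1,
        ‖(1 - jacobian (lagrangeMap c q L z J w x h γ s) v).det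
          - fredholmDet z 0 1
            (phaseKernel c q γ (psiL c q L J fun u => γ * interpolant w x h s v u))‖ ≤ ε := by
  have hLp := R.L_pos hL
  have hκ := R.κ_pos
  have hCφ := R.Cφ_pos
  set B : ℝ := |γ₀| * (2 / (R.κ * L)) with hB
  -- B bounds γ times the weights of the roots; the extra 1 next to Cφ leaves room for the error of
  -- the discretized Cauchy formula.
  obtain ⟨d, hd, hdet⟩ := exists_norm_det_sub_le J (1 + B * (R.Cφ + 1)) hε
  have hΩ := isOpen_strip δ
  have hev := hM.eventually_norm_sum_sub_le R.isCompact_core R.isCompact_core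
    (R.core_subset_nbhd.trans R.nbhd_subset_interior) hΩ R.M_subset
    (g := fun v ζ => deriv (dressedPhase c q ζ) v) (by
      refine R.analyticOnNhd_deriv_dressedPhase.continuousOn.comp (f := fun p : ℂ × ℂ => (p.2, p.1))
        (by fun_prop) fun p hp => ⟨R.M_subset (hM.trace_subset hp.2), R.core_subset_strip hp.1⟩)
    (fun v hv => (analyticOnNhd_left (Ψ := fun u w => deriv (dressedPhase c q u) w)
      R.analyticOnNhd_deriv_dressedPhase (R.core_subset_strip hv)).differentiableOn)
    (ε := min 1 (d / (B + 1))) (by positivity)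
  filter_upwards [hev] with s hs x hx γ hγ v hv
  have hγ' : ‖γ‖ ≤ γ₀ := mem_closedBall_zero_iff.1 hγ
  have hγb' : ‖γ‖ * Cf ≤ b := le_trans (by gcongr) hγb
  set ν : ℂ → ℂ := fun u => γ * interpolant w x h s v u with hν
  have hadm : Adm M K b ν := (adm_interpolant (γ := γ) hM hCf hx hv).mono hγb'
  set lam := betheRoot c q z L ν with hlam
  have hspec := fun j : J => R.betheRoot_spec hL hadm (R.div_le_of_mem hL hN hJ j.2)
  set wt : J → ℂ := fun k => 1 / (L * deriv (shifted c q L ν) (lam k)) with hwt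
  set aa : Fin s → ℂ → ℂ := fun p u => (w (x (p + 2)) - w (x (p + 1)))
    / (2 * Real.pi * Complex.I * (w (x (p + 1)) - u)) with haa
  -- The Jacobian factors through the roots as A A', so its s × s determinant equals the J × J
  -- determinant of 1 - A' A, of size independent of s. The entries of A' A are discretized Cauchy
  -- integrals of ∂φ(·, λ_k) evaluated at λ_j.
  set A : Matrix (Fin s) J ℂ := Matrix.of fun r j =>
    γ * deriv (dressedPhase c q (w (x (r + 1)))) (lam j) * wt j with hA
  set A' : Matrix J (Fin s) ℂ := Matrix.of fun j p => aa p (lam j) with hA'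
  have hjac : jacobian (lagrangeMap c q L z J w x h γ s) v = A * A' := by
    ext r p
    rw [jacobian, Matrix.of_apply, Matrix.mul_apply,
      R.partialDeriv_lagrangeMap hL hN hJ hM hCf hCf0 hx hγb' hv r p hlam]
    rfl
  rw [hjac, Matrix.det_one_sub_mul_comm, R.fredholmDet_psiL hL hN hJ hadm]
  have hwtn : ∀ k, ‖γ * wt k‖ ≤ B := by
    intro k
    have h1 := R.deriv_shifted_lower hL hadm (hspec k).1
    rw [norm_mul, hwt, norm_div, norm_one, norm_mul, Complex.norm_real, Real.norm_of_nonneg hLp.le]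
    have h2 : 1 / (L * ‖deriv (shifted c q L ν) (lam k)‖) ≤ 1 / (L * (R.κ / 2)) := by gcongr
    have h3 : 1 / (L * (R.κ / 2)) = 2 / (R.κ * L) := by field_simp
    rw [h3] at h2
    exact mul_le_mul (hγ'.trans (le_abs_self _)) h2 (by positivity) (abs_nonneg _)
  have hBA : ∀ j k : J, (A' * A) j k
      = γ * wt k * ∑ p : Fin s, aa p (lam j) * deriv (dressedPhase c q (w (x (p + 1)))) (lam k) := by
    intro j k
    rw [Matrix.mul_apply, Finset.mul_sum]
    refine Finset.sum_congr rfl fun p _ => ?_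
    simp only [hA, hA', Matrix.of_apply]
    ring
  have hclose := fun j k : J => hs x hx (lam k) (hspec k).1 (lam j) (hspec j).1
  have hφb := fun j k : J => R.dφ_bound (lam j) (R.core_subset_strip (hspec j).1) (lam k)
    (R.core_subset_strip (hspec k).1)
  have hB0 : 0 ≤ B := by positivity
  have hone : ∀ j k : J, ‖(1 : Matrix J J ℂ) j k‖ ≤ 1 := by
    intro j k
    rw [Matrix.one_apply]
    split_ifs <;> simp
  refine hdet _ _ (fun j k => ?_) (fun j k => ?_) fun j k => ?_
  · rw [Matrix.sub_apply, hBA]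
    refine (norm_sub_le _ _).trans (add_le_add (hone j k) ?_)
    rw [norm_mul]
    refine mul_le_mul (hwtn k) ?_ (norm_nonneg _) hB0
    have h1 := norm_add_le (∑ p : Fin s, aa p (lam j) * deriv (dressedPhase c q (w (x (p + 1)))) (lam k)
      - deriv (dressedPhase c q (lam j)) (lam k)) (deriv (dressedPhase c q (lam j)) (lam k))
    rw [sub_add_cancel] at h1
    linarith [hφb j k, (hclose j k).trans (min_le_left _ _)]
  · rw [Matrix.add_apply, Matrix.of_apply]
    refine (norm_add_le _ _).trans (add_le_add (hone j k) ?_)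
    have e : -γ * deriv (dressedPhase c q (lam j)) (lam k)
        * (1 / (L * deriv (shifted c q L ν) (lam k)))
        = -(γ * wt k * deriv (dressedPhase c q (lam j)) (lam k)) := by simp only [hwt]; ring
    rw [e, norm_neg, norm_mul]
    exact mul_le_mul (hwtn k) (by linarith [hφb j k]) (norm_nonneg _) hB0
  · rw [Matrix.sub_apply, hBA, Matrix.add_apply, Matrix.of_apply]
    have e : (1 : Matrix J J ℂ) j k - γ * wt k * (∑ p : Fin s, aa p (lam j)
          * deriv (dressedPhase c q (w (x (p + 1)))) (lam k))
        - ((1 : Matrix J J ℂ) j k + -γ * deriv (dressedPhase c q (lam j)) (lam k)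
        * (1 / (L * deriv (shifted c q L ν) (lam k))))
        = -(γ * wt k * ((∑ p : Fin s, aa p (lam j)
          * deriv (dressedPhase c q (w (x (p + 1)))) (lam k))
          - deriv (dressedPhase c q (lam j)) (lam k))) := by simp only [hwt]; ring
    rw [e, norm_neg, norm_mul]
    calc _ ≤ B * (d / (B + 1)) :=
          mul_le_mul (hwtn k) ((hclose j k).trans (min_le_right _ _)) (norm_nonneg _) hB0
      _ = d * (B / (B + 1)) := by ring
      _ ≤ d := mul_le_of_le_one_right hd.le ((div_le_one (by positivity)).2 (by linarith))

/-- The interpolants at the fixed points converge to the solution of the integral equation. -/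
theorem eventually_norm_interpolant_sub_le (hL : R.L₀ ≤ L) (hN : (N : ℝ) / L ≤ density c q + R.η)
    (hJ : J ⊆ Finset.Icc 1 N) (hM : IsJordanDomain M w) (hh : AnalyticOnNhd ℂ h M)
    (hCf : IsInterpolantBound K w h Cf) (hCf0 : 0 < Cf) {γ₀ ε : ℝ} (hε : 0 < ε)
    (hγb : γ₀ * Cf ≤ b) (hγΓ : γ₀ * R.CΓ ≤ 1 / 2) :
    ∀ᶠ s : ℕ in atTop, ∀ x, IsDiscretization s x → ∀ γ ∈ Metric.closedBall (0 : ℂ) γ₀,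
      ∀ v ∈ Metric.ball (0 : Fin s → ℂ) 1, (∀ r, lagrangeMap c q L z J w x h γ s r v = v r) →
        ∀ ρ : ℂ → ℂ, Adm M K b (fun u => γ * ρ u) →
          (∀ u, ρ u = h u + gammaL c q z L J (fun u => γ * ρ u) u) →
          ∀ u ∈ K, ‖interpolant w x h s v u - ρ u‖ ≤ ε := by
  set m : ℕ → ℂ := betheRoot c q z L fun _ => 0 with hm
  have hms : ∀ j ∈ J, m j ∈ strip δ := fun j hj =>
    R.core_subset_strip (R.betheRoot_spec hL R.adm_zero (R.div_le_of_mem hL hN hJ hj)).1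
  have hAc : IsCompact (Set.pi univ fun _ : J => R.core) := isCompact_univ_pi fun _ => R.isCompact_core
  have hΩ : IsOpen ({u | AnalyticAt ℂ h u} ∩ strip δ) := (isOpen_analyticAt ℂ h).inter (isOpen_strip δ)
  have hana : ∀ Λ ∈ Set.pi univ (fun _ : J => R.core), ∀ u ∈ {u | AnalyticAt ℂ h u} ∩ strip δ,
      AnalyticAt ℂ (fun p : (J → ℂ) × ℂ => trial c q h J m p.1 p.2) (Λ, u) := fun Λ hΛ u hu =>
    R.analyticAt_trial (E := J → ℂ) (Λ := fun Λ => Λ) hms analyticAt_id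
      (fun j => R.core_subset_strip (hΛ j (mem_univ j))) hu.1 hu.2
  have hMΩ : M ⊆ {u | AnalyticAt ℂ h u} ∩ strip δ := fun u hu => ⟨hh u hu, R.M_subset hu⟩
  have hev := hM.eventually_norm_sum_sub_le hAc R.isCompact_K R.K_subset hΩ hMΩ
    (g := fun Λ ζ => trial c q h J m Λ ζ)
    (fun p hp => (hana p.1 hp.1 p.2 (hMΩ (hM.trace_subset hp.2))).continuousAt.continuousWithinAt)
    (fun Λ hΛ u hu => ((hana Λ hΛ u hu).fun_comp (f := fun u : ℂ => (Λ, u))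
      (analyticAt_const.prod analyticAt_id)).differentiableAt.differentiableWithinAt)
    (ε := ε / 2) (by positivity)
  filter_upwards [hev] with s hs x hx γ hγ v hv hfix ρ hρ hρe
  have hγ' : ‖γ‖ ≤ γ₀ := mem_closedBall_zero_iff.1 hγ
  have hγb' : ‖γ‖ * Cf ≤ b := le_trans (by gcongr) hγb
  have hadm : Adm M K b fun u => γ * interpolant w x h s v u :=
    (adm_interpolant (γ := γ) hM hCf hx hv).mono hγb'
  have hCΓ := R.CΓ_pos
  set ν : ℂ → ℂ := fun u => γ * interpolant w x h s v u with hν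
  -- At the fixed point ς_p = Γ[ν](t_p), so the interpolant is the discretized Cauchy formula of h +
  -- Γ[ν]. That function is a trial function with all its points in `core`, hence belongs to a
  -- compact family, and convergence is uniform.
  have h1 : ∀ u ∈ K, ‖interpolant w x h s v u - (h u + gammaL c q z L J ν u)‖ ≤ ε / 2 := by
    intro u hu
    have h2 := hs x hx (fun j => betheRoot c q z L ν j)
      (fun j _ => (R.betheRoot_spec hL hadm (R.div_le_of_mem hL hN hJ j.2)).1) u hu
    simp only [hm, ← add_gammaL_eq_trial] at h2
    refine le_of_eq_of_le ?_ h2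
    congr 2
    refine Finset.sum_congr rfl fun p _ => ?_
    rw [← hfix p, add_comm (lagrangeMap c q L z J w x h γ s p v)]
    rfl
  set a := supNorm K fun u => interpolant w x h s v u - ρ u with ha
  have hKM := R.K_subset
  have ha0 : 0 ≤ a := supNorm_nonneg _ _
  have hρc : ContinuousOn ρ K := by
    intro u hu
    have hus := R.M_subset (interior_subset (hKM hu))
    have hg := R.analyticOnNhd_gammaL hL hN hJ (E := ℂ) (U := univ) (Nu := fun _ u => γ * ρ u)
      isOpen_univ (fun p hp => (hρ.analytic p.2 hp.2).fun_comp (f := Prod.snd) analyticAt_snd)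
      (fun _ _ => hρ) (0, u) ⟨mem_univ _, hus⟩
    have hg' := hg.fun_comp (f := fun u : ℂ => ((0 : ℂ), u)) (analyticAt_const.prod analyticAt_id)
    refine ContinuousAt.continuousWithinAt ?_
    rw [show ρ = fun u => h u + gammaL c q z L J (fun u => γ * ρ u) u from funext hρe]
    exact (hh u (interior_subset (hKM hu))).continuousAt.add hg'.continuousAt
  have hic : ContinuousOn (fun u => interpolant w x h s v u - ρ u) K := by
    refine ContinuousOn.sub (fun u hu => ?_) hρc
    exact ((hM.analyticOnNhd_interpolant hx h (v, u) ⟨mem_univ _, hKM hu⟩).fun_comp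
      (f := fun u : ℂ => (v, u))
      (analyticAt_const.prod analyticAt_id)).continuousAt.continuousWithinAt
  have hle : ∀ u ∈ K, ‖interpolant w x h s v u - ρ u‖ ≤ a := fun u hu =>
    norm_le_supNorm R.isCompact_K hic hu
  -- The Cauchy error ε/2 and the contraction γ₀ CΓ ≤ 1/2 together give a ≤ ε.
  have h3 : a ≤ ε / 2 + 1 / 2 * a := supNorm_le (by positivity) fun u hu => by
    have h4 := R.norm_gammaL_sub_le hL hN hJ hadm hρ (a := γ₀ * a) (fun u hu => by
      rw [← mul_sub, norm_mul]
      exact mul_le_mul hγ' (hle u hu) (norm_nonneg _) ((norm_nonneg _).trans hγ'))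
      (R.M_subset (interior_subset (hKM hu)))
    have e : interpolant w x h s v u - ρ u = (interpolant w x h s v u - (h u + gammaL c q z L J ν u))
        + (gammaL c q z L J ν u - gammaL c q z L J (fun u => γ * ρ u) u) := by
      rw [hρe u]; ring
    rw [e]
    refine (norm_add_le _ _).trans (add_le_add (h1 u hu) (h4.trans ?_))
    calc _ = γ₀ * R.CΓ * a := by ring
      _ ≤ _ := by gcongr
  intro u hu
  linarith [hle u hu]

end RootData

/-! ### Regular functionals and the limit of the Lagrange series. -/

lemma norm_div_sub_div_le {n n' d d' : ℂ} {A η : ℝ} (hA : ‖n‖ ≤ A) (hd : 1 / 2 ≤ ‖d‖)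
    (hη : η ≤ 1 / 4) (hn : ‖n' - n‖ ≤ η) (hdd : ‖d' - d‖ ≤ η) :
    ‖n / d - n' / d'‖ ≤ (8 * A + 4) * η := by
  have h1 := norm_sub_norm_le d d'
  rw [norm_sub_rev] at h1
  have hd' : 1 / 4 ≤ ‖d'‖ := by linarith
  have h0 : d ≠ 0 := norm_pos_iff.1 (by linarith)
  have h0' : d' ≠ 0 := norm_pos_iff.1 (by linarith)
  have hA0 : 0 ≤ A := (norm_nonneg _).trans hA
  have hη0 : 0 ≤ η := (norm_nonneg _).trans hn
  have e : n / d - n' / d' = (n / d) * ((d' - d) / d') - (n' - n) / d' := by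
    field_simp; ring
  have h2 : ‖n / d‖ ≤ 2 * A := by
    rw [norm_div, div_le_iff₀ (by linarith)]
    nlinarith
  have h3 : ∀ a : ℂ, ‖a‖ ≤ η → ‖a / d'‖ ≤ 4 * η := fun a ha => by
    rw [norm_div, div_le_iff₀ (by linarith)]
    nlinarith
  rw [e]
  calc _ ≤ 2 * A * (4 * η) + 4 * η := (norm_sub_le _ _).trans (add_le_add (by
        rw [norm_mul]; exact mul_le_mul h2 (h3 _ hdd) (norm_nonneg _) (by positivity)) (h3 _ hn))
    _ = _ := by ring

/-- The Lipschitz property of a regular functional. -/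
def IsLipschitzFunctional {l : ℕ} (M K : Set ℂ) (W : Set (Fin l → ℂ))
    (F : (ℂ → ℂ) → (Fin l → ℂ) → ℂ) (CF C : ℝ) : Prop :=
  ∀ f g : ℂ → ℂ, AnalyticOnNhd ℂ f (interior M) → AnalyticOnNhd ℂ g (interior M) →
    supNorm K f + supNorm K g < CF →
    ∀ z ∈ W, ‖F f z - F g z‖ ≤ C * supNorm K (fun u => f u - g u)

/-- The holomorphy property of a regular functional. -/
def IsHolomorphicFunctional {l : ℕ} (M K : Set ℂ) (W : Set (Fin l → ℂ))
    (F : (ℂ → ℂ) → (Fin l → ℂ) → ℂ) (CF : ℝ) : Prop :=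
  ∀ (m : ℕ) (Wy : Set (Fin m → ℂ)), IsOpen Wy → 0 ∈ Wy →
    ∀ ν : ℂ → (Fin m → ℂ) → ℂ,
      AnalyticOnNhd ℂ (fun p : ℂ × (Fin m → ℂ) => ν p.1 p.2) (interior M ×ˢ Wy) →
      (∃ b < CF, ∀ u ∈ K, ∀ y ∈ Wy, ‖ν u y‖ ≤ b) →
      ∃ G : (Fin m → ℂ) × (Fin l → ℂ) → ℂ, AnalyticOnNhd ℂ G (Wy ×ˢ W) ∧
        ∀ y ∈ Wy, ∀ z ∈ W, G (y, z) = F (fun u => ν u y) z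

section Functional

variable {l : ℕ} {M K : Set ℂ} {W : Set (Fin l → ℂ)} {F : (ℂ → ℂ) → (Fin l → ℂ) → ℂ} {CF C : ℝ}

lemma IsLipschitzFunctional.norm_sub_le (hF : IsLipschitzFunctional M K W F CF C) (hC : 0 ≤ C)
    {f g : ℂ → ℂ} {a b d : ℝ} (hf : Adm M K a f) (hg : Adm M K b g) (ha : 0 ≤ a) (hb : 0 ≤ b)
    (hab : a + b < CF) (hd : 0 ≤ d) (hfg : ∀ u ∈ K, ‖f u - g u‖ ≤ d) {y : Fin l → ℂ} (hy : y ∈ W) :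
    ‖F f y - F g y‖ ≤ C * d :=
  (hF f g hf.analytic hg.analytic ((add_le_add (supNorm_le ha hf.bound)
    (supNorm_le hb hg.bound)).trans_lt hab) y hy).trans
      (mul_le_mul_of_nonneg_left (supNorm_le hd hfg) hC)

/-- A regular functional is bounded on small functions. -/
lemma exists_functional_bound (hW : IsCompact W) (hC : 0 ≤ C) (hCF : 0 < CF)
    (h1 : IsLipschitzFunctional M K W F CF C) (h2 : IsHolomorphicFunctional M K W F CF) :
    ∃ A : ℝ, ∀ a, 0 ≤ a → a < CF → ∀ f, Adm M K a f → ∀ y ∈ W, ‖F f y‖ ≤ A := by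
  -- The holomorphy property without parameters, at the zero function, makes F[0] continuous on the
  -- compact W, hence bounded; the Lipschitz property covers the other functions.
  obtain ⟨G, hG, hGF⟩ := h2 0 univ isOpen_univ (mem_univ _) (fun _ _ => 0) analyticOnNhd_const
    ⟨0, hCF, fun _ _ _ _ => by simp⟩
  obtain ⟨A, hA⟩ := (isCompact_univ.prod hW).exists_bound_of_continuousOn hG.continuousOn
  refine ⟨A + C * CF, fun a ha0 ha f hf y hy => ?_⟩
  have h0 : Adm M K 0 fun _ => 0 := ⟨analyticOnNhd_const, fun _ _ => by simp⟩
  have h3 := h1.norm_sub_le hC hf h0 ha0 le_rfl (by linarith) ha0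
    (fun u hu => by simpa using hf.bound u hu) hy
  have h4 := hA (0, y) ⟨mem_univ _, hy⟩
  rw [hGF 0 (mem_univ _) y hy] at h4
  have h5 := norm_add_le (F f y - F (fun _ => 0) y) (F (fun _ => 0) y)
  rw [sub_add_cancel] at h5
  have h6 : C * a ≤ C * CF := by gcongr
  linarith

end Functional

namespace RootData

variable {c q δ b : ℝ} {M K : Set ℂ} {z : ℝ → ℂ} (R : RootData c q δ b M K z)
variable {L : ℝ} {N : ℕ} {J : Finset ℕ} {w : ℝ → ℂ} {h : ℂ → ℂ} {Cf : ℝ} {s : ℕ} {x : ℕ → ℝ} {γ : ℂ}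
variable {l : ℕ} {W : Set (Fin l → ℂ)} {F : (ℂ → ℂ) → (Fin l → ℂ) → ℂ} {CF C : ℝ}

/-- The sum of the Lagrange series of order `s`. -/
theorem hasSum_lagrangeTerm (hL : R.L₀ ≤ L) (hN : (N : ℝ) / L ≤ density c q + R.η)
    (hJ : J ⊆ Finset.Icc 1 N) (hM : IsJordanDomain M w) (hCf : IsInterpolantBound K w h Cf)
    (hCf0 : 0 < Cf) (hx : IsDiscretization s x) (hγb : ‖γ‖ * Cf ≤ b)
    (hγΓ : R.CΓ * (‖γ‖ * Cf) ≤ 1 / 8) (hC : 0 ≤ C) (h1 : IsLipschitzFunctional M K W F CF C)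
    (h2 : IsHolomorphicFunctional M K W F CF) (hCF : 2 * (‖γ‖ * Cf) < CF) {y : Fin l → ℂ}
    (hy : y ∈ W) {v : Fin s → ℂ} (hv : v ∈ Metric.ball (0 : Fin s → ℂ) 1)
    (hfix : ∀ r, lagrangeMap c q L z J w x h γ s r v = v r) :
    HasSum (lagrangeTerm w x h (gammaL c q z L J) F γ y s)
      (F (fun u => γ * interpolant w x h s v u) y
        / (1 - jacobian (lagrangeMap c q L z J w x h γ s) v).det) := by
  have hG := R.isLagrangeMap hL hN hJ hM hCf hx hγb hγΓ
  have h0 : (0 : Fin s → ℂ) ∈ Metric.ball (0 : Fin s → ℂ) 1 := Metric.mem_ball_self one_pos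
  have hadm := fun ς (hς : ς ∈ Metric.ball (0 : Fin s → ℂ) 1) => adm_interpolant (γ := γ) hM hCf hx hς
  have hpos : 0 ≤ ‖γ‖ * Cf := by positivity
  -- Here the parameters of the regular functional are the variables ς of the series.
  obtain ⟨G, hGa, hGF⟩ := h2 s (Metric.ball 0 1) Metric.isOpen_ball h0
    (fun u ς => γ * interpolant w x h s ς u) (fun p hp => analyticAt_const.mul
      ((hM.analyticOnNhd_interpolant hx h (p.2, p.1) ⟨mem_univ _, hp.1⟩).fun_comp
        (f := fun p : ℂ × (Fin s → ℂ) => (p.2, p.1)) (analyticAt_snd.prod analyticAt_fst)))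
    ⟨‖γ‖ * Cf, by linarith, fun u hu ς hς => (hadm ς hς).bound u hu⟩
  have hH : AnalyticOnNhd ℂ (fun ς => F (fun u => γ * interpolant w x h s ς u) y)
      (Metric.ball (0 : Fin s → ℂ) 1) := by
    have h3 : AnalyticOnNhd ℂ (fun ς : Fin s → ℂ => G (ς, y)) (Metric.ball 0 1) := fun ς hς =>
      (hGa (ς, y) ⟨hς, hy⟩).fun_comp (f := fun ς : Fin s → ℂ => (ς, y))
        (analyticAt_id.prod analyticAt_const)
    exact h3.congr Metric.isOpen_ball fun ς hς => hGF ς hς y hy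
  refine hG.hasSum hH (C := ‖F (fun u => γ * interpolant w x h s 0 u) y‖ + C * (‖γ‖ * Cf))
    (fun ς hς => ?_) hv hfix
  have h4 := h1.norm_sub_le hC (hadm ς hς) (hadm 0 h0) hpos hpos (by linarith) hpos (fun u hu => by
    rw [← mul_sub, norm_mul]
    gcongr
    refine ((hCf s x hx u hu ς).2 0).trans (mul_le_of_le_one_right hCf0.le ?_)
    rw [sub_zero]
    exact (mem_ball_zero_iff.1 hς).le) hy
  have h5 := norm_add_le (F (fun u => γ * interpolant w x h s ς u) y
    - F (fun u => γ * interpolant w x h s 0 u) y) (F (fun u => γ * interpolant w x h s 0 u) y)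
  rw [sub_add_cancel] at h5
  linarith

/-- The limit of the Lagrange series. -/
theorem tendstoUniformlyOn_lagrangeSeries (hL : R.L₀ ≤ L) (hN : (N : ℝ) / L ≤ density c q + R.η)
    (hJ : J ⊆ Finset.Icc 1 N) (hM : IsJordanDomain M w) (hh : AnalyticOnNhd ℂ h M)
    (hCf : IsInterpolantBound K w h Cf)
    (hCf0 : 0 < Cf) {γ₀ Hρ P D : ℝ} (hγ₀ : 0 < γ₀) (hγb : γ₀ * Cf ≤ b)
    (hγΓ : R.CΓ * (γ₀ * Cf) ≤ 1 / 8) (hγΓ' : γ₀ * R.CΓ ≤ 1 / 2) (hHρ : 0 ≤ Hρ)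
    (hW : IsCompact W) (hC : 0 < C) (h1 : IsLipschitzFunctional M K W F CF C)
    (h2 : IsHolomorphicFunctional M K W F CF) (hCF : 2 * (γ₀ * Cf) < CF)
    (hCF' : γ₀ * Cf + γ₀ * Hρ < CF)
    (hD : ∀ t ∈ Icc (0 : ℝ) 1, ‖deriv z t‖ ≤ D) (hP1 : 1 ≤ P)
    (hP : ∀ ν, Adm M K b ν → ∀ ζ ∈ trace z, ‖psiL c q L J ν ζ‖ ≤ P)
    (hγP : γ₀ * R.Cφ * P * D ≤ 1 / 4) {ρ : ℂ → ℂ → ℂ}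
    (hρ : ∀ γ ∈ Metric.closedBall (0 : ℂ) γ₀, Adm M K b (fun u => γ * ρ γ u) ∧
      (∀ u ∈ K, ‖ρ γ u‖ ≤ Hρ) ∧ ∀ u, ρ γ u = h u + gammaL c q z L J (fun u => γ * ρ γ u) u)
    {x : ℕ → ℕ → ℝ} (hx : ∀ s ≥ 1, IsDiscretization s (x s)) :
    (∀ᶠ s in atTop, ∀ γ ∈ Metric.closedBall (0 : ℂ) γ₀, ∀ y ∈ W,
      Summable (lagrangeTerm w (x s) h (gammaL c q z L J) F γ y s)) ∧
    TendstoUniformlyOn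
      (fun (s : ℕ) (p : ℂ × (Fin l → ℂ)) =>
        ∑' k : Fin s → ℕ, lagrangeTerm w (x s) h (gammaL c q z L J) F p.1 p.2 s k)
      (fun p => F (fun u => p.1 * ρ p.1 u) p.2 /
        fredholmDet z 0 1 (phaseKernel c q p.1 (psiL c q L J fun u => p.1 * ρ p.1 u)))
      atTop (Metric.closedBall 0 γ₀ ×ˢ W) := by
  have hD0 : 0 ≤ D := (norm_nonneg _).trans (hD 0 (by simp))
  have hCφ := R.Cφ_pos
  have hCΓ := R.CΓ_pos
  have hLp := R.L_pos hL
  have hnorm : ∀ γ ∈ Metric.closedBall (0 : ℂ) γ₀, ‖γ‖ ≤ γ₀ := fun γ hγ => mem_closedBall_zero_iff.1 hγ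
  have hfix : ∀ s, 1 ≤ s → ∀ γ ∈ Metric.closedBall (0 : ℂ) γ₀, ∃ v ∈ Metric.ball (0 : Fin s → ℂ) 1,
      (∀ r, lagrangeMap c q L z J w (x s) h γ s r v = v r) ∧
      ∀ y ∈ W, HasSum (lagrangeTerm w (x s) h (gammaL c q z L J) F γ y s)
        (F (fun u => γ * interpolant w (x s) h s v u) y
          / (1 - jacobian (lagrangeMap c q L z J w (x s) h γ s) v).det) := by
    intro s hs γ hγ
    have hg := hnorm γ hγ
    have hγb' : ‖γ‖ * Cf ≤ b := le_trans (by gcongr) hγb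
    have hγΓ'' : R.CΓ * (‖γ‖ * Cf) ≤ 1 / 8 := le_trans (by gcongr) hγΓ
    have hCF'' : 2 * (‖γ‖ * Cf) < CF := lt_of_le_of_lt (by gcongr) hCF
    obtain ⟨v, hv, hvf⟩ := (R.isLagrangeMap hL hN hJ hM hCf (hx s hs) hγb' hγΓ'').exists_fixedPoint
    exact ⟨v, hv, hvf, fun y hy => R.hasSum_lagrangeTerm hL hN hJ hM hCf hCf0 (hx s hs) hγb' hγΓ'' hC.le
      h1 h2 hCF'' hy hv hvf⟩
  constructor
  · filter_upwards [eventually_ge_atTop 1] with s hs γ hγ y hy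
    obtain ⟨v, -, -, hv⟩ := hfix s hs γ hγ
    exact (hv y hy).summable
  have hCF0 : 0 < CF := lt_of_le_of_lt (by positivity) hCF
  obtain ⟨A, hA⟩ := exists_functional_bound hW hC.le hCF0 h1 h2
  set C₃ : ℝ := ‖1 / (2 * Real.pi * Complex.I * L : ℂ)‖
    * (J.card * (1 / L / (R.κ / 2 * R.d₁) ^ 2)) with hC₃
  have hC₃0 : 0 ≤ C₃ := by positivity
  rw [Metric.tendstoUniformlyOn_iff]
  intro ε hε
  -- The bound 1/4 keeps the perturbed denominator away from 0, as the limiting one is at least 1/2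
  -- in modulus; the other bound makes the error of the quotient at most ε/2. Then ε₁ is chosen so
  -- that an error ε₁ in the interpolant changes both the numerator and the density by at most η.
  set η : ℝ := min (1 / 4) (ε / (2 * (8 * |A| + 4))) with hη
  have hη0 : 0 < η := by positivity
  set ε₁ : ℝ := η / ((C + C₃) * γ₀) with hε₁
  have hε₁0 : 0 < ε₁ := by positivity
  have e1 : C * (γ₀ * ε₁) ≤ η := by
    calc C * (γ₀ * ε₁) ≤ (C + C₃) * (γ₀ * ε₁) := by gcongr; linarith
      _ = η := by rw [hε₁]; field_simp
  have e2 : C₃ * (γ₀ * ε₁) ≤ η := by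
    calc C₃ * (γ₀ * ε₁) ≤ (C + C₃) * (γ₀ * ε₁) := by gcongr; linarith
      _ = η := by rw [hε₁]; field_simp
  filter_upwards [eventually_ge_atTop 1,
    R.eventually_norm_jacobian_sub_le hL hN hJ hM hCf hCf0 (ε := η / 2) (by positivity) hγb,
    R.eventually_norm_interpolant_sub_le hL hN hJ hM hh hCf hCf0 hε₁0 hγb hγΓ'] with s hs hjac hint
  rintro ⟨γ, y⟩ ⟨hγ, hy⟩
  have hg := hnorm γ hγ
  obtain ⟨v, hv, hvf, hsum⟩ := hfix s hs γ hγ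
  obtain ⟨hρa, hρb, hρe⟩ := hρ γ hγ
  have hτa : Adm M K (γ₀ * Cf) fun u => γ * interpolant w (x s) h s v u := by
    have := adm_interpolant (γ := γ) hM hCf (hx s hs) hv
    exact this.mono (by gcongr)
  have hρa' : Adm M K (γ₀ * Hρ) fun u => γ * ρ γ u := ⟨hρa.analytic, fun u hu => by
    rw [norm_mul]
    exact mul_le_mul hg (hρb u hu) (norm_nonneg _) hγ₀.le⟩
  have hdist : ∀ u ∈ K, ‖γ * interpolant w (x s) h s v u - γ * ρ γ u‖ ≤ γ₀ * ε₁ := fun u hu => by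
    rw [← mul_sub, norm_mul]
    exact mul_le_mul hg (hint (x s) (hx s hs) γ hγ v hv hvf (ρ γ) hρa hρe u hu) (norm_nonneg _) hγ₀.le
  have hnum := h1.norm_sub_le hC.le hτa hρa' (by positivity) (by positivity) hCF'
    (mul_pos hγ₀ hε₁0).le hdist hy
  have hA' := hA (γ₀ * Hρ) (by positivity) (by linarith [mul_pos hγ₀ hCf0]) _ hρa' y hy
  have hcτ := R.continuousOn_psiL hL hN hJ (hτa.mono hγb)
  have hcρ := R.continuousOn_psiL hL hN hJ hρa
  have hγP' : ‖γ‖ * R.Cφ * P * D ≤ 1 / 4 := le_trans (by gcongr) hγP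
  have hhalf := half_le_norm (R.norm_fredholmDet_phaseKernel_sub_one_le hD hcρ (by linarith)
    (hP _ hρa) hγP')
  have hfred := R.norm_fredholmDet_phaseKernel_sub_le hD hcτ hcρ (d := η) hη0.le
    (hP _ (hτa.mono hγb)) (hP _ hρa) (fun ζ hζ =>
      ((R.norm_psiL_sub_le hL hN hJ (hτa.mono hγb) hρa hdist hζ).trans e2).trans
        (le_mul_of_one_le_right hη0.le hP1)) hγP'
  have hden := norm_add_le
    ((1 - jacobian (lagrangeMap c q L z J w (x s) h γ s) v).det - fredholmDet z 0 1
      (phaseKernel c q γ (psiL c q L J fun u => γ * interpolant w (x s) h s v u)))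
    (fredholmDet z 0 1 (phaseKernel c q γ (psiL c q L J fun u => γ * interpolant w (x s) h s v u))
      - fredholmDet z 0 1 (phaseKernel c q γ (psiL c q L J fun u => γ * ρ γ u)))
  rw [sub_add_sub_cancel] at hden
  have hj := hjac (x s) (hx s hs) γ hγ v hv
  have hfin := norm_div_sub_div_le (hA'.trans (le_abs_self A)) hhalf (min_le_left _ _ : η ≤ 1 / 4)
    (hnum.trans e1) (hden.trans (by linarith))
  rw [dist_eq_norm, (hsum y hy).tsum_eq]
  refine hfin.trans_lt ?_
  calc (8 * |A| + 4) * η ≤ (8 * |A| + 4) * (ε / (2 * (8 * |A| + 4))) := by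
        gcongr; exact min_le_right _ _
    _ = ε / 2 := by field_simp
    _ < ε := by linarith

end RootData
end LiebLiniger

/-! ### Choice of the constants and assembly of the proposition. -/

namespace LiebLiniger

/-- Each smallness requirement on γ₀ holds for all small positive values, so finitely many can be
imposed at once. -/
lemma eventually_mul_lt (X : ℝ) {Y : ℝ} (hY : 0 < Y) : ∀ᶠ g : ℝ in 𝓝[>] 0, g * X < Y := by
  refine nhdsWithin_le_nhds ?_
  have : ContinuousAt (fun g : ℝ => g * X) 0 := by fun_prop
  exact this.eventually_lt_const (by simpa using hY)

lemma adm_of_supNorm_le {M K : Set ℂ} (hK : IsCompact K) (hKM : K ⊆ interior M) {ν : ℂ → ℂ} {B : ℝ}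
    (hν : AnalyticOnNhd ℂ ν (interior M)) (hB : supNorm K ν ≤ B) : Adm M K B ν :=
  ⟨hν, fun _ hu => (norm_le_supNorm hK (hν.continuousOn.mono hKM) hu).trans hB⟩

end LiebLiniger

open LiebLiniger

theorem mainTheorem10
    (c q δ : ℝ) (hc : 0 < c) (hq : 0 < q) (hδ : 0 < δ) (hδc : δ < c / 8)
    (hp : InjOn (dressedMomentum c q) (strip δ))
    (hZ : ∃ m > 0, ∀ w ∈ strip δ, m ≤ (dressedCharge c q w).re)
    (M K : Set ℂ) (bd Cq : ℝ → ℂ)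
    (hM : IsJordanDomain M bd) (hMδ : M ⊆ strip δ)
    (hK : IsCompact K) (hKM : K ⊆ interior M) (hqK : fermiZone q ⊆ interior K)
    (hCq : IsJordanLoop Cq) (hCqK : trace Cq ⊆ interior K) (hqCq : fermiZone q ⊆ inside Cq)
    (h : ℂ → ℂ) (hh : AnalyticOnNhd ℂ h M)
    (l : ℕ) (W : Set (Fin l → ℂ)) (hW : IsCompact W)
    (F : (ℂ → ℂ) → (Fin l → ℂ) → ℂ) (hF : IsRegularFunctional M K W F)
    (n : ℕ) (B : ℝ) (hB : 0 < B) :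
    ∃ γ₀ > 0, ∃ η > 0, ∃ L₀ > 0, ∃ C : ℝ, ∃ ρ : ℂ → ℂ → ℂ,
      AnalyticOnNhd ℂ (fun p : ℂ × ℂ => ρ p.1 p.2) (Metric.closedBall 0 γ₀ ×ˢ M) ∧
      (∀ γ ∈ Metric.closedBall (0 : ℂ) γ₀,
        (∀ w ∈ M, ρ γ w + γ * (∫ t in (-q)..q, resolventKernel c q w t / (2 * Real.pi) * ρ γ t)
          = h w) ∧
        ∀ g : ℂ → ℂ, ContinuousOn g M →
          (∀ w ∈ M, g w + γ * (∫ t in (-q)..q, resolventKernel c q w t / (2 * Real.pi) * g t)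
            = h w) →
          EqOn g (ρ γ) M) ∧
      ∀ L ≥ L₀, ∀ N : ℕ, |N / L - density c q| ≤ η →
      ∀ I ⊆ Finset.Icc 1 N, I.card ≤ n → ∀ J : Finset ℕ, J = Finset.Icc 1 N \ I →
        (∀ ν : ℂ → ℂ, AnalyticOnNhd ℂ ν (interior M) → supNorm K ν ≤ B →
          (∀ j ∈ Finset.Icc 1 N, ∃! w, IsBetheRoot c q Cq L ν j w) ∧
          IsFunctionalDerivative M K Cq (gammaL c q Cq L J) ν (gammaLDeriv c q L J ν)) ∧
        ∃ ρL : ℂ → ℂ → ℂ,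
          AnalyticOnNhd ℂ (fun p : ℂ × ℂ => ρL p.1 p.2) (Metric.closedBall 0 γ₀ ×ˢ M) ∧
          (∀ γ ∈ Metric.closedBall (0 : ℂ) γ₀,
            supNorm K (fun u => γ * ρL γ u) ≤ B ∧
            (∀ w ∈ M, ρL γ w = h w + gammaL c q Cq L J (fun u => γ * ρL γ u) w) ∧
            ∀ g : ℂ → ℂ, AnalyticOnNhd ℂ g M → supNorm K (fun u => γ * g u) ≤ B →
              (∀ w ∈ M, g w = h w + gammaL c q Cq L J (fun u => γ * g u) w) →
              EqOn g (ρL γ) M) ∧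
          (∃ E : ℂ × ℂ → ℂ,
            AnalyticOnNhd ℂ E (Metric.closedBall 0 γ₀ ×ˢ strip δ) ∧
            (∀ p ∈ Metric.closedBall (0 : ℂ) γ₀ ×ˢ strip δ,
              ‖E p‖ ≤ C * (1 / L + |N / L - density c q|)) ∧
            ∀ γ ∈ Metric.closedBall (0 : ℂ) γ₀, ∀ w ∈ M, ρL γ w = ρ γ w + E (γ, w)) ∧
          (∀ γ ∈ Metric.closedBall (0 : ℂ) γ₀,
            fredholmDet Cq 0 1 (fun μ ζ => -γ * gammaLDeriv c q L J (fun u => γ * ρL γ u) μ ζ) ≠ 0 ∧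
            ∃ e : ℂ, ‖e‖ ≤ C * (1 / L + |N / L - density c q|) ∧
              fredholmDet Cq 0 1 (fun μ ζ => -γ * gammaLDeriv c q L J (fun u => γ * ρL γ u) μ ζ)
                = fredholmDet (fun t => (t : ℂ)) (-q) q
                    (fun w v => γ * resolventKernel c q w v / (2 * Real.pi)) * (1 + e)) ∧
          ∀ x : ℕ → ℕ → ℝ, (∀ s ≥ 1, IsDiscretization s (x s)) →
            (∀ᶠ s in atTop, ∀ γ ∈ Metric.closedBall (0 : ℂ) γ₀, ∀ y ∈ W,
              Summable (lagrangeTerm bd (x s) h (gammaL c q Cq L J) F γ y s)) ∧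
            TendstoUniformlyOn
              (fun (s : ℕ) (p : ℂ × (Fin l → ℂ)) =>
                ∑' k : Fin s → ℕ, lagrangeTerm bd (x s) h (gammaL c q Cq L J) F p.1 p.2 s k)
              (fun p => F (fun u => p.1 * ρL p.1 u) p.2 /
                fredholmDet Cq 0 1
                  (fun μ ζ => -p.1 * gammaLDeriv c q L J (fun u => p.1 * ρL p.1 u) μ ζ))
              atTop (Metric.closedBall 0 γ₀ ×ˢ W) := by
  have hMc := hM.isCompact
  have hqM : fermiZone q ⊆ M := hqK.trans (interior_subset.trans (hKM.trans interior_subset))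
  have hKi : K ⊆ M := hKM.trans interior_subset
  -- The functional derivative at a shift of norm up to B involves nearby shifts, which must still
  -- be admissible; the root constants are therefore prepared for the bound B + 1.
  set b : ℝ := B + 1 with hb
  obtain ⟨R⟩ := exists_rootData hc hq hδ hδc (b := b) (by linarith) hp hZ hMc hM.no_holes hMδ hK hKM
    hqK hCq hCqK hqCq
  obtain ⟨γ₁, hγ₁, ρ, hρa, hρi, hρ⟩ := exists_resolvent_solution hc hq hδ hδc hMδ hqM hh
  obtain ⟨CR, hCR0, hCR⟩ := exists_resolventKernel_bound hc hq hδ hδc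
  obtain ⟨C₁, hC₁, hlim⟩ := R.exists_gammaL_limit_bound n
  obtain ⟨P, hP1, C₂, hC₂, hPlim, hP⟩ := R.exists_psi_bound n
  obtain ⟨D, hD0, hD⟩ := hCq.exists_deriv_bound_Icc
  obtain ⟨H', hH'⟩ := hMc.exists_bound_of_continuousOn hh.continuousOn
  set H : ℝ := max H' 0 with hHdef
  have hH0 : 0 ≤ H := le_max_right _ _
  have hH : ∀ u ∈ M, ‖h u‖ ≤ H := fun u hu => (hH' u hu).trans (le_max_left _ _)
  obtain ⟨Cf, hCf0, hCf⟩ := hM.exists_interpolant_bound hK hKM hh.continuousOn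
  obtain ⟨CF, hCF, ⟨C', hC', hF1⟩, hF2⟩ := hF
  have hCΓ := R.CΓ_pos
  have hCφ := R.Cφ_pos
  set Hρ : ℝ := H + R.CΓ * b with hHρ
  have hHρ0 : 0 ≤ Hρ := by positivity
  have hpos : ∀ᶠ g : ℝ in 𝓝[>] 0, 0 < g := self_mem_nhdsWithin
  -- The factors 2 in `g1`, `g2` and `g3` let the solutions be constructed on the open ball of
  -- radius 2γ₀, so that they are holomorphic in a neighbourhood of the closed ball of radius γ₀.
  -- None of these constants involves L, N or I.
  obtain ⟨γ₀, hγ₀', g1, g2, g3, g4, g5, g6, g7, g8, g9⟩ := (hpos.and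
    ((eventually_mul_lt 2 hγ₁).and ((eventually_mul_lt (2 * Hρ) hB).and
    ((eventually_mul_lt (2 * R.CΓ) (one_half_pos (α := ℝ))).and
    ((eventually_mul_lt (R.Cφ * P * D) (show (0 : ℝ) < 1 / 4 by norm_num)).and
    ((eventually_mul_lt (CR * q) (one_half_pos (α := ℝ))).and
    ((eventually_mul_lt Cf (show 0 < b by linarith)).and
    ((eventually_mul_lt (R.CΓ * Cf) (show (0 : ℝ) < 1 / 8 by norm_num)).and
    ((eventually_mul_lt (2 * Cf) hCF).and (eventually_mul_lt (Cf + Hρ) hCF)))))))))).exists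
  have hnorm : ∀ γ ∈ Metric.closedBall (0 : ℂ) γ₀, ‖γ‖ ≤ γ₀ := fun γ hγ => mem_closedBall_zero_iff.1 hγ
  have hball : Metric.closedBall (0 : ℂ) γ₀ ⊆ Metric.ball 0 (2 * γ₀) :=
    Metric.closedBall_subset_ball (by linarith)
  have hball1 : Metric.ball (0 : ℂ) (2 * γ₀) ⊆ Metric.ball 0 γ₁ := Metric.ball_subset_ball (by linarith)
  -- The summand 2C₁ serves the error of ρ^(L), and C₂ that of the determinant.
  refine ⟨γ₀, hγ₀', R.η, R.η_pos, R.L₀, R.L₀_pos, 2 * C₁ + C₂, ρ,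
    hρa.mono (prod_mono (hball.trans hball1) Subset.rfl), fun γ hγ => hρ γ (hball1 (hball hγ)), ?_⟩
  intro L hL N hNη I hI hIn J hJeq
  subst hJeq
  have hN : (N : ℝ) / L ≤ density c q + R.η := by linarith [(abs_le.1 hNη).2]
  have hJ : Finset.Icc 1 N \ I ⊆ Finset.Icc 1 N := Finset.sdiff_subset
  set J := Finset.Icc 1 N \ I
  have hLp := R.L_pos hL
  have hε0 : 0 ≤ 1 / L + |(N : ℝ) / L - density c q| := by positivity
  set ε := 1 / L + |(N : ℝ) / L - density c q|
  have hBb : B ≤ b := by linarith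
  refine ⟨fun ν hν hνB => ?_, ?_⟩
  · have hadm := adm_of_supNorm_le hK hKM hν hνB
    refine ⟨fun j hj => R.existsUnique_betheRoot hL (hadm.mono hBb)
      (R.div_le_of_mem hL hN Subset.rfl hj), R.isFunctionalDerivative_gammaL hL hN hJ le_rfl hadm⟩
  obtain ⟨ρL, hρLa, hρL⟩ := R.exists_solution (γ₁ := 2 * γ₀) hL hN hJ hh hH hBb
    (by linarith) (by linarith)
  have hadm : ∀ γ ∈ Metric.closedBall (0 : ℂ) γ₀, Adm M K b fun u => γ * ρL γ u := fun γ hγ =>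
    (hρL γ (hball hγ)).2.1.mono hBb
  have hpsi := fun ν (hν : Adm M K b ν) ζ (hζ : ζ ∈ LiebLiniger.trace Cq) =>
    hP L hL N hNη I hI hIn ν hν ζ hζ
  refine ⟨ρL, hρLa.mono (prod_mono hball Subset.rfl), fun γ hγ => ⟨?_, fun w _ =>
    (hρL γ (hball hγ)).2.2 w, fun g hg hgB hge => ?_⟩, ?_, fun γ hγ => ?_, fun x hx => ?_⟩
  · exact supNorm_le hB.le (hρL γ (hball hγ)).2.1.bound
  · refine R.solution_unique hL hN hJ ?_ (hadm γ hγ)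
      ((adm_of_supNorm_le hK hKM (analyticOnNhd_const.mul (hg.mono interior_subset)) hgB).mono hBb)
      (fun w _ => (hρL γ (hball hγ)).2.2 w) hge
    have := mul_le_mul_of_nonneg_right (hnorm γ hγ) hCΓ.le
    linarith
  -- Subtracting the two equations on M cancels h. What remains involves only φ and R in the second
  -- variable, so it is holomorphic on the whole strip although h is only given near M.
  · set E : ℂ × ℂ → ℂ := fun p => gammaL c q Cq L J (fun u => p.1 * ρL p.1 u) p.2
      + p.1 * ∫ t in (-q)..q, resolventKernel c q p.2 t / (2 * Real.pi) * ρ p.1 t with hE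
    have hEa : AnalyticOnNhd ℂ E (Metric.ball 0 (2 * γ₀) ×ˢ strip δ) := by
      refine AnalyticOnNhd.add ?_ (hρi.mono (prod_mono hball1 Subset.rfl))
      refine R.analyticOnNhd_gammaL hL hN hJ (Nu := fun γ u => γ * ρL γ u) Metric.isOpen_ball
        (fun p hp => analyticAt_fst.mul (hρLa p ⟨hp.1, interior_subset hp.2⟩))
        fun γ hγ => (hρL γ hγ).2.1.mono hBb
    have hEM : ∀ γ ∈ Metric.closedBall (0 : ℂ) γ₀, ∀ w ∈ M, ρL γ w = ρ γ w + E (γ, w) := by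
      intro γ hγ w hw
      have e1 := (hρL γ (hball hγ)).2.2 w
      have e2 := (hρ γ (hball1 (hball hγ))).1 w hw
      rw [e1, ← e2]
      simp only [hE]
      ring
    refine ⟨E, hEa.mono (prod_mono hball Subset.rfl), ?_, hEM⟩
    rintro ⟨γ, w⟩ ⟨hγ, hw⟩
    have hslice : ∀ {f : ℂ → ℂ → ℂ} {S : Set ℂ}, AnalyticOnNhd ℂ (fun p : ℂ × ℂ => f p.1 p.2)
        (Metric.ball 0 (2 * γ₀) ×ˢ S) → ContinuousOn (f γ) S := fun hf =>
      hf.continuousOn.comp (f := fun u => (γ, u)) (by fun_prop) fun u hu => ⟨hball hγ, hu⟩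
    have hγR : ‖γ‖ * (CR * q) ≤ 1 / 2 :=
      (mul_le_mul_of_nonneg_right (hnorm γ hγ) (by positivity)).trans g5.le
    have h1 := R.norm_error_le hCR hγR (ρL := ρL γ) (ρ := ρ γ)
      (G := gammaL c q Cq L J fun u => γ * ρL γ u)
      (hslice hρLa) (hslice (hρa.mono (prod_mono hball1 Subset.rfl))) (A := C₁ * ε)
      (hlim L hL N hNη I hI hIn _ (hadm γ hγ)) (E := fun w => E (γ, w))
      (hslice (f := fun γ w => E (γ, w)) hEa) (fun w _ => rfl) (hEM γ hγ) w hw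
    refine h1.trans ?_
    nlinarith [mul_nonneg hC₂.le hε0]
  · rw [phaseKernel_psiL]
    have hγP : ‖γ‖ * R.Cφ * P * D ≤ 1 / 4 := by
      have := mul_le_mul_of_nonneg_right (hnorm γ hγ) (show 0 ≤ R.Cφ * P * D by positivity)
      linarith
    obtain ⟨h1, e, he, h2⟩ := R.exists_fredholmDet_error hD (R.continuousOn_psiL hL hN hJ (hadm γ hγ)) hP1
      (fun ζ hζ => (hpsi _ (hadm γ hγ) ζ hζ).1) hPlim (A := C₂ * ε) (by positivity)
      (fun ζ hζ => (hpsi _ (hadm γ hγ) ζ hζ).2) hγP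
    refine ⟨h1, e, he.trans ?_, h2⟩
    nlinarith [mul_nonneg hC₁.le hε0]
  · simp only [phaseKernel_psiL]
    exact R.tendstoUniformlyOn_lagrangeSeries hL hN hJ hM hh hCf hCf0 hγ₀' g6.le (by linarith)
      (by linarith) hHρ0 hW hC' hF1 hF2 (by linarith) (by linarith) hD hP1
      (fun ν hν ζ hζ => (hpsi ν hν ζ hζ).1) (by linarith)
      (fun γ hγ => ⟨hadm γ hγ, fun u hu => (hρL γ (hball hγ)).1 u (hKi hu),
        (hρL γ (hball hγ)).2.2⟩) hx
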